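/- **Setting.** Let $1\le r\le d$ and $m\ge 0$ be integers. For each modality $\mathbf C\in\{\mathbf A,\mathbf B\}$ let $\mathbf C\in\mathbb R^{d\times r}$ and $\mathbf C_\xi\in\mathbb R^{d\times(d-r)}$ satisfy $\mathbf C^\top\mathbf C=\mathrm{diag}(\sigma_1^2,\dots,\sigma_r^2)$, $\mathbf C_\xi^\top\mathbf C_\xi=\sigma_\xi^2 I_{d-r}$ and $\mathbf C^\top\mathbf C_\xi=0$, where $\sigma_1,\dots,\sigma_r,\sigma_\xi>0$ do not depend on the modality. Let $z^{\pm}$ be uniform on $\{\pm1/\sqrt d\}^r$ and $\xi_{\mathbf A}^\pm,\xi_{\mathbf B}^\pm$ uniform on $\{\pm1/\sqrt d\}^{d-r}$, all independent, and put $x_{\mathbf C}^\pm=\mathbf C z^\pm+\mathbf C_\xi\xi_{\mathbf C}^\pm$. For weights $W_{\mathbf A},W_{\mathbf B}\in\mathbb R^{d\times m}$ let $f_{\mathbf C}^\pm=W_{\mathbf C}^\top x_{\mathbf C}^\pm/\sqrt{\mathbb E\|W_{\mathbf C}^\top x_{\mathbf C}\|^2}$, and for a constant $K>0$ and inverse temperature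 $\tau$ let $$S_{\mathbf A}=\frac{e^{\tau^2 f_{\mathbf A}^+\cdot f_{\mathbf B}^+}}{e^{\tau^2 f_{\mathbf A}^+\cdot f_{\mathbf B}^+}+K\,\mathbb E_{x_{\mathbf B}^-}e^{\tau^2 f_{\mathbf A}^+\cdot f_{\mathbf B}^-}},\quad S_{\mathbf B}=\frac{e^{\tau^2 f_{\mathbf A}^+\cdot f_{\mathbf B}^+}}{e^{\tau^2 f_{\mathbf A}^+\cdot f_{\mathbf B}^+}+K\,\mathbb E_{x_{\mathbf A}^-}e^{\tau^2 f_{\mathbf A}^-\cdot f_{\mathbf B}^+}},\quad \mathcal L=-\mathbb E\log S_{\mathbf A}-\mathbb E\log S_{\mathbf B}.$$ Stage 2 is the gradient flow $\dot W_{\mathbf C}=-\tau^{-2}\nabla_{W_{\mathbf C}}\mathcal L$, $t\ge0$, with $\tau=1$; time $0$ is the beginning of Stage 2. Write $\mathbf K_{\mathbf C}=W_{\mathbf C}^\top\mathbf C$, $\mathbf K_{\mathbf C,\xi}=W_{\mathbf C}^\top\mathbf C_\xi$, $[M]_p$ for the $p$-th column of $M$, and $\bar v=v/\|v\|$. Let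 $\sigma_{\max}^2,\sigma_{\min}^2$ be the maximum and minimum of $\sigma_1^2,\dots,\sigma_r^2,\sigma_\xi^2$. For $\delta_-,\delta_{N/S},\delta_{\mathbf{AB},\perp},\delta_{\xi,\perp}$ consider the conditions $$\begin{aligned} &\max\Big\{1-\langle\overline{[\mathbf K_{\mathbf A}]_p},\overline{[\mathbf K_{\mathbf B}]_p}\rangle,\ \Big|1-\tfrac{\|[\mathbf K_{\mathbf A}]_p\|^2}{\|[\mathbf K_{\mathbf B}]_p\|^2}\Big|\Big\}\le\delta_- && \forall p\in[r],\\ &\max\Big\{\Big|1-\tfrac{\|[\mathbf K_{\mathbf A,\xi}]_p\|^2}{\|[\mathbf K_{\mathbf B,\xi}]_p\|^2}\Big|,\ \Big|1-\tfrac{\|[\mathbf K_{\mathbf A,\xi}]_p\|^2}{\|[\mathbf K_{\mathbf A,\xi}]_q\|^2}\Big|\Big\}\le\delta_- && \forall p,q\in[d-r],\\ &\max_{\mathbf C,\mathbf D\in\{\mathbf A,\mathbf B\}}\ \|[\mathbf K_{\mathbf C,\xi}]_q\|/\|[\mathbf K_{\mathbf D}]_p\|\le\delta_{N/S} && \forall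 p\in[r],\,q\in[d-r],\\ &\max_{\mathbf C,\mathbf D\in\{\mathbf A,\mathbf B\}}\ |\langle\overline{[\mathbf K_{\mathbf C}]_p},\overline{[\mathbf K_{\mathbf D}]_q}\rangle|\le\delta_{\mathbf{AB},\perp} && \forall p\ne q\in[r],\\ &\max_{\mathbf C,\mathbf D\in\{\mathbf A,\mathbf B\}}\ |\langle\overline{[\mathbf K_{\mathbf C}]_p},\overline{[\mathbf K_{\mathbf D,\xi}]_q}\rangle|\le\delta_{\xi,\perp} && \forall p\in[r],\,q\in[d-r],\\ &|\langle\overline{[\mathbf K_{\mathbf A,\xi}]_s},\overline{[\mathbf K_{\mathbf B,\xi}]_q}\rangle|\le\delta_{\xi,\perp} && \forall q,s\in[d-r]. \end{aligned}\tag{$*$}$$ **Lemma (Stage 2).** Let $c>0$, $K>0$, $c_{\mathrm{Target}}>1$ and $b\in\mathbb R$ be constants. There is a constant $C$, depending only on $c,K,c_{\mathrm{Target}},b$, such that for all exponents $a_-,a_{N/S},a_{\perp},a_{\xi}\in\mathbb R$ there is a constant $a_0>0$, depending only on these constants and exponents, with the following property for all $d,r,m$ and all data as above with $$\frac{\sigma_{\max}^2}{\sigma_{\min}^2}\max\Big\{1,\frac{(d-r)\sigma_\xi^2}{r\sigma_{\min}^2}\Big\}\le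 c\log d .$$ Suppose that at time $0$ the weights are polynomially bounded, $\|W_{\mathbf A}\|_F,\|W_{\mathbf B}\|_F\le d^{\,b}$, that $\kappa_0:=\max_{p,q\in[r]}\|[\mathbf K_{\mathbf A}]_p\|/\|[\mathbf K_{\mathbf A}]_q\|\le\sqrt d$, and that $(*)$ holds with all four $\delta$'s equal to $d^{-a_0}$. Then there is an earliest time $T_1\ge0$ at which $$\frac{\|[\mathbf K_{\mathbf A}]_p\|^2}{\|[\mathbf K_{\mathbf A}]_q\|^2}\le c_{\mathrm{Target}}\qquad\text{for all }p,q\in[r],$$ it satisfies $T_1\le d^{\,C}$, and throughout Stage 2, that is, for all $t\in[0,T_1]$, condition $(*)$ holds with $\delta_-=d^{-a_-}$, $\delta_{N/S}=d^{-a_{N/S}}$, $\delta_{\mathbf{AB},\perp}=d^{-a_\perp}$, $\delta_{\xi,\perp}=d^{-a_\xi}$. -/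

import Mathlib

open scoped BigOperators Matrix

noncomputable section

/-- The two modalities. -/
inductive Modality where
  | A : Modality
  | B : Modality

/-- The linear data-generating model: `x_C = C z + C_ξ ξ_C` for each modality `C`, with `r` signal
directions and `d - r` noise directions in `ℝ^d`. The columns of `signal c` and `noise c` together
form an orthogonal system. -/
structure DataModel (d r : ℕ) where
  /-- the matrices `A`, `B` -/
  signal : Modality → Matrix (Fin d) (Fin r) ℝ
  /-- the matrices `A_ξ`, `B_ξ` -/
  noise : Modality → Matrix (Fin d) (Fin (d - r)) ℝ
  /-- signal strengths -/
  σ : Fin r → ℝ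
  /-- noise strength -/
  σξ : ℝ
  σ_pos : ∀ p, 0 < σ p
  σξ_pos : 0 < σξ
  signal_gram : ∀ c, (signal c)ᵀ * signal c = Matrix.diagonal (fun p => σ p ^ 2)
  noise_gram : ∀ c, (noise c)ᵀ * noise c = (σξ ^ 2) • (1 : Matrix (Fin (d - r)) (Fin (d - r)) ℝ)
  signal_noise : ∀ c, (signal c)ᵀ * noise c = 0

/-- A weight matrix in `ℝ^{d × m}`, with the Frobenius inner product. -/
abbrev Weights (d m : ℕ) := EuclideanSpace ℝ (Fin d × Fin m)

/-- `Wᵀ x`. -/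
def embed {d m : ℕ} (W : Weights d m) (x : Fin d → ℝ) : EuclideanSpace ℝ (Fin m) :=
  WithLp.toLp 2 (fun k => ∑ i, W (i, k) * x i)

/-- The point of `{± 1/√d}^n` with sign pattern `s`. A uniform latent vector is `latent d s` with
`s` uniform. -/
def latent (d : ℕ) {n : ℕ} (s : Fin n → Bool) : Fin n → ℝ :=
  fun i => (if s i then 1 else -1) / √(d : ℝ)

/-- `v / ‖v‖`. -/
def unitVec {m : ℕ} (v : EuclideanSpace ℝ (Fin m)) : EuclideanSpace ℝ (Fin m) := ‖v‖⁻¹ • v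

namespace DataModel

variable {d r m : ℕ} (D : DataModel d r)

/-- The maximum of `σ_1², …, σ_r², σ_ξ²`. -/
def varMax : ℝ := ⨆ i : Option (Fin r), (i.elim D.σξ D.σ) ^ 2

/-- The minimum of `σ_1², …, σ_r², σ_ξ²`. -/
def varMin : ℝ := ⨅ i : Option (Fin r), (i.elim D.σξ D.σ) ^ 2

/-- The input of modality `c` generated by the latent signal `z` and the latent noise `ξ`. -/
def input (c : Modality) (z : Fin r → ℝ) (ξ : Fin (d - r) → ℝ) : Fin d → ℝ :=
  D.signal c *ᵥ z + D.noise c *ᵥ ξ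

/-- The normalization `√(E ‖Wᵀ x_c‖²)`. -/
def normalizer (c : Modality) (W : Weights d m) : ℝ :=
  √(𝔼 s : Fin r → Bool, 𝔼 e : Fin (d - r) → Bool,
      ‖embed W (D.input c (latent d s) (latent d e))‖ ^ 2)

/-- The normalized linear feature of the input with latent signs `s` (signal) and `e` (noise). -/
def feature (c : Modality) (W : Weights d m) (s : Fin r → Bool) (e : Fin (d - r) → Bool) :
    EuclideanSpace ℝ (Fin m) :=
  (D.normalizer c W)⁻¹ • embed W (D.input c (latent d s) (latent d e))

/-- `exp (τ² f_A · f_B)` for the two given inputs. -/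
def expSim (τ : ℝ) (WA WB : Weights d m)
    (sA : Fin r → Bool) (eA : Fin (d - r) → Bool) (sB : Fin r → Bool) (eB : Fin (d - r) → Bool) :
    ℝ :=
  Real.exp (τ ^ 2 * inner ℝ (D.feature .A WA sA eA) (D.feature .B WB sB eB))

/-- `S_A(x_A⁺, x_B⁺)` for the positive pair with common latent signal `s`. -/
def softA (K τ : ℝ) (WA WB : Weights d m) (s : Fin r → Bool) (eA eB : Fin (d - r) → Bool) : ℝ :=
  D.expSim τ WA WB s eA s eB /
    (D.expSim τ WA WB s eA s eB +
      K * 𝔼 s' : Fin r → Bool, 𝔼 eB' : Fin (d - r) → Bool, D.expSim τ WA WB s eA s' eB')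

/-- `S_B(x_A⁺, x_B⁺)` for the positive pair with common latent signal `s`. -/
def softB (K τ : ℝ) (WA WB : Weights d m) (s : Fin r → Bool) (eA eB : Fin (d - r) → Bool) : ℝ :=
  D.expSim τ WA WB s eA s eB /
    (D.expSim τ WA WB s eA s eB +
      K * 𝔼 s' : Fin r → Bool, 𝔼 eA' : Fin (d - r) → Bool, D.expSim τ WA WB s' eA' s eB)

/-- The population contrastive loss `- E log S_A - E log S_B`. -/
def loss (K τ : ℝ) (WA WB : Weights d m) : ℝ :=
  - (𝔼 s : Fin r → Bool, 𝔼 eA : Fin (d - r) → Bool, 𝔼 eB : Fin (d - r) → Bool,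
      Real.log (D.softA K τ WA WB s eA eB))
  - (𝔼 s : Fin r → Bool, 𝔼 eA : Fin (d - r) → Bool, 𝔼 eB : Fin (d - r) → Bool,
      Real.log (D.softB K τ WA WB s eA eB))

/-- `W` follows, for all times `t ≥ 0`, the gradient flow of the contrastive loss with inverse
temperature `τ`, where gradients are rescaled by `τ⁻²`. -/
def IsGradientFlow (K τ : ℝ) (W : Modality → ℝ → Weights d m) : Prop :=
  ∀ t : ℝ, 0 ≤ t →
    HasDerivWithinAt (W .A)
      (-((τ ^ 2)⁻¹ • gradient (fun V => D.loss K τ V (W .B t)) (W .A t))) (Set.Ici 0) t ∧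
    HasDerivWithinAt (W .B)
      (-((τ ^ 2)⁻¹ • gradient (fun V => D.loss K τ (W .A t) V) (W .B t))) (Set.Ici 0) t

/-- The column `[K_C]_p` of `K_C = W_Cᵀ C`. -/
def sigCol (W : Modality → Weights d m) (c : Modality) (p : Fin r) : EuclideanSpace ℝ (Fin m) :=
  embed (W c) ((D.signal c).col p)

/-- The column `[K_{C,ξ}]_q` of `K_{C,ξ} = W_Cᵀ C_ξ`. -/
def noiseCol (W : Modality → Weights d m) (c : Modality) (q : Fin (d - r)) :
    EuclideanSpace ℝ (Fin m) :=
  embed (W c) ((D.noise c).col q)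

/-- The finite-width weights are close to the infinite-width limit with errors at most
`δm` (alignment and norm matching), `δNS` (noise-signal ratio), `δAB` (orthogonality between
signals) and `δξ` (orthogonality involving noises). -/
structure ErrorsWithin (W : Modality → Weights d m) (δm δNS δAB δξ : ℝ) : Prop where
  align : ∀ p, 1 - inner ℝ (unitVec (D.sigCol W .A p)) (unitVec (D.sigCol W .B p)) ≤ δm
  sig_norm : ∀ p, |1 - ‖D.sigCol W .A p‖ ^ 2 / ‖D.sigCol W .B p‖ ^ 2| ≤ δm
  noise_norm : ∀ q, |1 - ‖D.noiseCol W .A q‖ ^ 2 / ‖D.noiseCol W .B q‖ ^ 2| ≤ δm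
  noise_balance : ∀ q s, |1 - ‖D.noiseCol W .A q‖ ^ 2 / ‖D.noiseCol W .A s‖ ^ 2| ≤ δm
  noise_signal : ∀ c c' p q, ‖D.noiseCol W c q‖ / ‖D.sigCol W c' p‖ ≤ δNS
  sig_orth : ∀ c c' p q, p ≠ q →
    |inner ℝ (unitVec (D.sigCol W c p)) (unitVec (D.sigCol W c' q))| ≤ δAB
  sig_noise_orth : ∀ c c' p q,
    |inner ℝ (unitVec (D.sigCol W c p)) (unitVec (D.noiseCol W c' q))| ≤ δξ
  noise_orth : ∀ q s,
    |inner ℝ (unitVec (D.noiseCol W .A s)) (unitVec (D.noiseCol W .B q))| ≤ δξ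

end DataModel

end

/-!
The loss depends on the weights only through the columns `a i`, `b i` of `W_Aᵀ [A, A_ξ]` and
`W_Bᵀ [B, B_ξ]`, and in fact only through the normalized cross-Gram matrix `overlap a b`
(`loss_eq`). Since the columns of `[C, C_ξ]` are orthogonal, gradient flow of the weights is gradient
flow of these columns, the `i`-th one with mobility `strength D i` (`isFlow_of_isGradientFlow`).
The expectation over the latent signs is kept exact: near a diagonal overlap matrix supported on the
signals, the gradient is expanded to first order using the second and fourth moments of the
signs (`NearDiag.exists_grad_signal`, `NearDiag.exists_grad_noise`). The signal directions of the two
families attract each other; correlations between different signals, and between a noise and a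
signal, are repelled.

A number `Q`, a fixed power of `d`, dominates all constants, and `ε` is the size of the errors. On a
time interval of length `Q ^ 8`, an error may only be allowed to grow by `Q ^ k * ε ^ 2`; an
exponential bound `exp (Q t)` would be useless. So the first-order terms must have a sign:

* The correlations between sums and differences of the directions `dir (a i) ± dir (b i)` of two
  different signals satisfy a linear system in which each member is damped and attracted by its
  partner. Their maximum is therefore nonincreasing up to second order errors
  (`Near.exists_deriv_comb_signal`, `abs_le_add_mul_of_contracting`); the same holds for the
  correlations of a noise with a signal (`Near.exists_deriv_comb_noise`). The alignment of a signal
  can decrease, and the correlations among the noises can change, to second order only.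
* The differences `‖a i‖ - ‖b i‖` are not damped separately. Their `energy` grows at a rate
  proportional to the variance of the weights that drive the signals (`Near.energy_rate_le`), and
  the same variance is a lower bound for the dissipation of the potential `∑ log cosh (k²)` of the
  relative sizes `k` of the columns (`Near.potential_rate_le`). The potential lies in `[0, 1]`, so the
  energy grows by at most the factor `exp (8 L / κ)`, where `L ≤ c log d` is the ratio of the
  strengths and `κ` a lower bound of the softmax mass. This is a power of `d` (`Traj.energy_le`).
* As long as the signals are not balanced, the largest ratio of two signals decays at a rate that
  is bounded below by an inverse power of `Q` (`Near.ratio_rate_le`), so the target is reached before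
  the time `Q ^ 8`. The norms of the noises do not increase.

Up to the first time at which the signals are balanced, these estimates return the assumed error
bounds with halved constants (`Traj.near_half`), and a continuation argument gives
`Traj.exists_first_balanced`. The theorem follows by rescaling space and time so that the least
variance and the conserved mass `∑ ‖a i‖² / strength i` equal one, and by taking `ε`, and the
initial errors, to be large inverse powers of `d`.
-/

set_option linter.unusedSectionVars false

namespace Contrastive

/-! ### Scalar estimates -/

/-- A quantitative mean value theorem: if `f'` is `C`-Lipschitz, an increment of `f` is `f' w` times
the increment of the argument, up to a second-order error, for any nearby base point `w`. -/
lemma abs_sub_sub_deriv_mul_le {f f' : ℝ → ℝ} {C : ℝ} (hf : ∀ x, HasDerivAt f (f' x) x)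
    (hL : ∀ x y, |f' x - f' y| ≤ C * |x - y|) (y z w : ℝ) :
    |f y - f z - f' w * (y - z)| ≤ C * (|y - w| + |z - w|) * |y - z| := by
  have hC : 0 ≤ C := by
    have := (abs_nonneg _).trans (hL 1 0)
    simpa using this
  have key := Convex.norm_image_sub_le_of_norm_hasDerivWithin_le (s := Set.uIcc z y)
    (f := fun x => f x - f' w * x) (f' := fun x => f' x - f' w)
    (C := C * (|y - w| + |z - w|)) (x := z) (y := y)
    (fun x _ => ((hf x).sub (by simpa using (hasDerivAt_id x).const_mul (f' w))).hasDerivWithinAt)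
    (fun x hx => ?_) (convex_uIcc z y) Set.left_mem_uIcc Set.right_mem_uIcc
  · have e : f y - f' w * y - (f z - f' w * z) = f y - f z - f' w * (y - z) := by ring
    simpa only [Real.norm_eq_abs, e] using key
  · refine (hL x w).trans (mul_le_mul_of_nonneg_left ?_ hC)
    rcases Set.mem_uIcc.1 hx with h | h
    all_goals
      rw [abs_le]
      constructor <;>
        linarith [le_abs_self (y - w), neg_abs_le (y - w), le_abs_self (z - w),
          neg_abs_le (z - w), abs_nonneg (y - w), abs_nonneg (z - w)]

lemma abs_sub_le_of_deriv_le_one {f f' : ℝ → ℝ} (hf : ∀ x, HasDerivAt f (f' x) x)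
    (hL : ∀ x, |f' x| ≤ 1) (y z : ℝ) : |f y - f z| ≤ |y - z| := by
  simpa using Convex.norm_image_sub_le_of_norm_hasDerivWithin_le (s := Set.univ) (f := f)
    (f' := f') (C := 1) (x := z) (y := y) (fun x _ => (hf x).hasDerivWithinAt)
    (fun x _ => hL x) convex_univ trivial trivial

lemma hasDerivAt_tanh (x : ℝ) : HasDerivAt Real.tanh (1 - Real.tanh x ^ 2) x := by
  have h := (Real.hasDerivAt_sinh x).div (Real.hasDerivAt_cosh x) (Real.cosh_pos x).ne'
  have e : (Real.sinh / Real.cosh : ℝ → ℝ) = Real.tanh := by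
    ext y; simp [Real.tanh_eq_sinh_div_cosh]
  rw [e] at h
  refine h.congr_deriv ?_
  have := (Real.cosh_pos x).ne'
  rw [Real.tanh_eq_sinh_div_cosh]
  field_simp

lemma abs_one_sub_tanh_sq_le (x : ℝ) : |1 - Real.tanh x ^ 2| ≤ 1 := by
  have := Real.tanh_sq_lt_one x
  rw [abs_le]; constructor <;> nlinarith [sq_nonneg (Real.tanh x)]

lemma abs_tanh_sub_le (y z : ℝ) : |Real.tanh y - Real.tanh z| ≤ |y - z| :=
  abs_sub_le_of_deriv_le_one hasDerivAt_tanh abs_one_sub_tanh_sq_le y z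

lemma abs_tanh_le (y : ℝ) : |Real.tanh y| ≤ |y| := by simpa using abs_tanh_sub_le y 0

lemma tanh_nonneg {x : ℝ} (hx : 0 ≤ x) : 0 ≤ Real.tanh x := by
  rw [Real.tanh_eq_sinh_div_cosh]
  exact div_nonneg (Real.sinh_nonneg_iff.2 hx) (Real.cosh_pos x).le

lemma abs_tanh_sub_sub_le (y z w : ℝ) :
    |Real.tanh y - Real.tanh z - (1 - Real.tanh w ^ 2) * (y - z)|
      ≤ 2 * (|y - w| + |z - w|) * |y - z| := by
  refine abs_sub_sub_deriv_mul_le (f' := fun x => 1 - Real.tanh x ^ 2) hasDerivAt_tanh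
    (fun x y => ?_) y z w
  have e : 1 - Real.tanh x ^ 2 - (1 - Real.tanh y ^ 2)
      = -((Real.tanh x + Real.tanh y) * (Real.tanh x - Real.tanh y)) := by ring
  rw [e, abs_neg, abs_mul]
  refine mul_le_mul ?_ (abs_tanh_sub_le x y) (abs_nonneg _) (by norm_num)
  linarith [abs_add_le (Real.tanh x) (Real.tanh y), (Real.abs_tanh_lt_one x).le,
    (Real.abs_tanh_lt_one y).le]

/-- The logarithm of the hyperbolic cosine. -/
noncomputable def logCosh (x : ℝ) : ℝ := Real.log (Real.cosh x)

lemma hasDerivAt_logCosh (x : ℝ) : HasDerivAt logCosh (Real.tanh x) x := by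
  have h := (Real.hasDerivAt_cosh x).log (Real.cosh_pos x).ne'
  rwa [← Real.tanh_eq_sinh_div_cosh] at h

lemma logCosh_neg (x : ℝ) : logCosh (-x) = logCosh x := by simp [logCosh]

lemma logCosh_nonneg (x : ℝ) : 0 ≤ logCosh x := Real.log_nonneg (Real.one_le_cosh x)

lemma logCosh_le (x : ℝ) : logCosh x ≤ x ^ 2 / 2 := by
  rw [logCosh, Real.log_le_iff_le_exp (Real.cosh_pos x)]
  exact Real.cosh_le_exp_half_sq x

lemma abs_logCosh_sub_le (y z : ℝ) : |logCosh y - logCosh z| ≤ |y - z| :=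
  abs_sub_le_of_deriv_le_one hasDerivAt_logCosh (fun x => (Real.abs_tanh_lt_one x).le) y z

lemma abs_logCosh_sub_sub_le (y z w : ℝ) :
    |logCosh y - logCosh z - Real.tanh w * (y - z)| ≤ (|y - w| + |z - w|) * |y - z| := by
  simpa using abs_sub_sub_deriv_mul_le (C := 1) hasDerivAt_logCosh
    (fun x y => by simpa using abs_tanh_sub_le x y) y z w

/-- The logistic function `K e^y / (1 + K e^y)`: the probability mass that a contrastive softmax
puts on the negatives when their log-weight exceeds that of the positive by `y`. -/
noncomputable def logistic (K y : ℝ) : ℝ := K * Real.exp y / (1 + K * Real.exp y)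

section logistic
variable {K : ℝ} (hK : 0 < K)
include hK

lemma logistic_pos (y : ℝ) : 0 < logistic K y := by
  unfold logistic; positivity

lemma logistic_lt_one (y : ℝ) : logistic K y < 1 := by
  unfold logistic
  rw [div_lt_one (by positivity)]
  linarith

lemma abs_logistic_le_one (y : ℝ) : |logistic K y| ≤ 1 :=
  abs_le.2 ⟨by linarith [logistic_pos hK y], (logistic_lt_one hK y).le⟩

lemma hasDerivAt_logistic (y : ℝ) :
    HasDerivAt (logistic K) (logistic K y * (1 - logistic K y)) y := by
  have h1 : HasDerivAt (fun y => K * Real.exp y) (K * Real.exp y) y :=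
    (Real.hasDerivAt_exp y).const_mul K
  have hp : 1 + K * Real.exp y ≠ 0 := by positivity
  have h := h1.div (h1.const_add 1) hp
  refine h.congr_deriv ?_
  unfold logistic
  field_simp

lemma hasDerivAt_log_one_add_exp (y : ℝ) :
    HasDerivAt (fun y => Real.log (1 + K * Real.exp y)) (logistic K y) y := by
  have h1 : HasDerivAt (fun y => K * Real.exp y) (K * Real.exp y) y :=
    (Real.hasDerivAt_exp y).const_mul K
  exact (h1.const_add 1).log (by positivity)

lemma logistic_deriv_nonneg (y : ℝ) : 0 ≤ logistic K y * (1 - logistic K y) :=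
  mul_nonneg (logistic_pos hK y).le (by linarith [logistic_lt_one hK y])

lemma logistic_deriv_le_one (y : ℝ) : logistic K y * (1 - logistic K y) ≤ 1 := by
  nlinarith [logistic_pos hK y, logistic_lt_one hK y]

lemma abs_logistic_sub_le (y z : ℝ) : |logistic K y - logistic K z| ≤ |y - z| := by
  refine abs_sub_le_of_deriv_le_one (hasDerivAt_logistic hK) (fun x => ?_) y z
  rw [abs_of_nonneg (logistic_deriv_nonneg hK x)]
  exact logistic_deriv_le_one hK x

lemma abs_logistic_sub_sub_le (y z w : ℝ) :
    |logistic K y - logistic K z - logistic K w * (1 - logistic K w) * (y - z)|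
      ≤ (|y - w| + |z - w|) * |y - z| := by
  have := abs_sub_sub_deriv_mul_le (C := 1) (hasDerivAt_logistic hK)
    (fun x y => ?_) y z w
  · simpa using this
  have e : logistic K x * (1 - logistic K x) - logistic K y * (1 - logistic K y)
      = (logistic K x - logistic K y) * (1 - logistic K x - logistic K y) := by ring
  rw [e, abs_mul, one_mul]
  refine (mul_le_of_le_one_right (abs_nonneg _) ?_).trans (abs_logistic_sub_le hK x y)
  rw [abs_le]
  constructor <;>
    linarith [logistic_pos hK x, logistic_lt_one hK x, logistic_pos hK y, logistic_lt_one hK y]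

lemma logistic_mono {y z : ℝ} (h : y ≤ z) : logistic K y ≤ logistic K z := by
  have := Real.exp_le_exp.2 h
  unfold logistic
  rw [div_le_div_iff₀ (by positivity) (by positivity)]
  nlinarith

end logistic

/-! ### Uniform random signs -/

section Signs
variable {β : Type*}

/-- The random sign attached to the bit `b`. -/
def sgn (x : β → Bool) (b : β) : ℝ := if x b then 1 else -1

@[simp] lemma sgn_mul_self (x : β → Bool) (b : β) : sgn x b * sgn x b = 1 := by
  unfold sgn; split_ifs <;> norm_num

@[simp] lemma sgn_sq (x : β → Bool) (b : β) : sgn x b ^ 2 = 1 := by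
  rw [sq, sgn_mul_self]

@[simp] lemma abs_sgn (x : β → Bool) (b : β) : |sgn x b| = 1 := by
  unfold sgn; split_ifs <;> norm_num

variable [DecidableEq β]

/-- Flip the bit `b`. -/
def flip (b : β) (x : β → Bool) : β → Bool := Function.update x b (!x b)

@[simp] lemma sgn_flip_self (b : β) (x : β → Bool) : sgn (flip b x) b = -sgn x b := by
  unfold sgn flip; simp; cases x b <;> simp

lemma sgn_flip_of_ne {a b : β} (h : a ≠ b) (x : β → Bool) : sgn (flip b x) a = sgn x a := by
  unfold sgn flip; simp [Function.update_of_ne h]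

lemma flip_flip (b : β) (x : β → Bool) : flip b (flip b x) = x := by
  unfold flip; simp

variable [Fintype β]

lemma expect_flip (b : β) (F : (β → Bool) → ℝ) : 𝔼 x, F (flip b x) = 𝔼 x, F x :=
  Fintype.expect_equiv ⟨flip b, flip b, flip_flip b, flip_flip b⟩ _ _ fun _ => rfl

/-- Pairing with a sign sees only the part of `F` which is odd in that sign. -/
lemma expect_sgn_mul (b : β) (F : (β → Bool) → ℝ) :
    𝔼 x, sgn x b * F x = 𝔼 x, sgn x b * (F x - F (flip b x)) / 2 := by
  have h := expect_flip b fun x => sgn x b * F x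
  have : 𝔼 x, sgn x b * (F x - F (flip b x)) / 2
      = (𝔼 x, sgn x b * F x + 𝔼 x, sgn (flip b x) b * F (flip b x)) / 2 := by
    rw [← Finset.expect_add_distrib, Finset.expect_div]
    refine Finset.expect_congr rfl fun x _ => ?_
    rw [sgn_flip_self]; ring
  rw [this, h]; ring

lemma expect_sgn_mul_eq_zero (b : β) {F : (β → Bool) → ℝ} (hF : ∀ x, F (flip b x) = F x) :
    𝔼 x, sgn x b * F x = 0 := by
  rw [expect_sgn_mul]; simp [hF]

lemma expect_sgn_mul_sgn (a b : β) : 𝔼 x, sgn x a * sgn x b = if a = b then 1 else 0 := by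
  split_ifs with h
  · subst h; simp
  · exact expect_sgn_mul_eq_zero a fun x => sgn_flip_of_ne (Ne.symm h) x

/-- Fourth moments of random signs. -/
lemma expect_sgn_four {a b : β} (hab : a ≠ b) (c d : β) :
    𝔼 x, sgn x a * (sgn x b * (sgn x c * sgn x d))
      = (if c = a ∧ d = b then 1 else 0) + if c = b ∧ d = a then 1 else 0 := by
  by_cases hac : c = a
  · subst hac
    have e : ∀ x : β → Bool, sgn x c * (sgn x b * (sgn x c * sgn x d)) = sgn x b * sgn x d := by
      intro x
      linear_combination sgn x b * sgn x d * sgn_mul_self x c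
    simp only [e, expect_sgn_mul_sgn]
    simp [hab, eq_comm]
  by_cases hbc : c = b
  · subst hbc
    have e : ∀ x : β → Bool, sgn x a * (sgn x c * (sgn x c * sgn x d)) = sgn x a * sgn x d := by
      intro x
      linear_combination sgn x a * sgn x d * sgn_mul_self x c
    simp only [e, expect_sgn_mul_sgn]
    simp [hac, eq_comm]
  simp only [hac, hbc, false_and, if_false, add_zero]
  by_cases hcd : c = d
  · subst hcd
    simp only [sgn_mul_self, mul_one]
    rw [expect_sgn_mul_sgn, if_neg hab]
  have e : ∀ x : β → Bool, sgn x a * (sgn x b * (sgn x c * sgn x d))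
      = sgn x c * (sgn x a * (sgn x b * sgn x d)) := by intro x; ring
  simp only [e]
  refine expect_sgn_mul_eq_zero c fun x => ?_
  rw [sgn_flip_of_ne (Ne.symm hac), sgn_flip_of_ne (Ne.symm hbc), sgn_flip_of_ne (Ne.symm hcd)]

lemma abs_expect_sub_le {F H : (β → Bool) → ℝ} {C : ℝ} (h : ∀ x, |F x - H x| ≤ C) :
    |𝔼 x, F x - 𝔼 x, H x| ≤ C := by
  rw [← Finset.expect_sub_distrib, Fintype.expect_eq_sum_div_card, abs_div, Nat.abs_cast,
    div_le_iff₀ (by positivity)]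
  refine (Finset.abs_sum_le_sum_abs _ _).trans ((Finset.sum_le_sum fun x _ => h x).trans ?_)
  simp [mul_comm]

/-- The moment generating function of a vector of random signs. -/
lemma expect_exp_sum_sgn (c : β → ℝ) :
    𝔼 x : β → Bool, Real.exp (∑ b, c b * sgn x b) = ∏ b, Real.cosh (c b) := by
  have h := Finset.prod_univ_sum (fun _ : β => (Finset.univ : Finset Bool))
    fun b v => Real.exp (c b * if v then 1 else -1) / 2
  simp only [Fintype.piFinset_univ] at h
  rw [Fintype.expect_eq_sum_div_card, Finset.sum_div]
  have e1 : ∀ b, ∑ v : Bool, Real.exp (c b * if v then 1 else -1) / 2 = Real.cosh (c b) := by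
    intro b
    rw [Fintype.sum_bool, Real.cosh_eq]; simp; ring
  simp only [e1] at h
  rw [h]
  refine Finset.sum_congr rfl fun x _ => ?_
  rw [Finset.prod_div_distrib, Real.exp_sum]
  simp [sgn]

end Signs

end Contrastive

namespace Contrastive

/-! ### The loss as a function of the overlap matrix -/

section Potential
variable {S T : Type*} [Fintype S] [Fintype T] [DecidableEq S] [DecidableEq T]

/-- The bit that carries the `i`-th latent sign of the first modality: signal bits are shared by
the modalities, noise bits are not. -/
def inA : S ⊕ T → S ⊕ (T ⊕ T) := Sum.map id Sum.inl

/-- The bit that carries the `i`-th latent sign of the second modality. -/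
def inB : S ⊕ T → S ⊕ (T ⊕ T) := Sum.map id Sum.inr

lemma inA_injective : Function.Injective (inA : S ⊕ T → S ⊕ (T ⊕ T)) :=
  Function.Injective.sumMap Function.injective_id Sum.inl_injective

lemma inB_injective : Function.Injective (inB : S ⊕ T → S ⊕ (T ⊕ T)) :=
  Function.Injective.sumMap Function.injective_id Sum.inr_injective

@[simp] lemma inA_inl (s : S) : (inA (Sum.inl s) : S ⊕ (T ⊕ T)) = Sum.inl s := rfl

@[simp] lemma inB_inl (s : S) : (inB (Sum.inl s) : S ⊕ (T ⊕ T)) = Sum.inl s := rfl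

lemma inA_eq_inB_iff {i j : S ⊕ T} : inA i = inB j ↔ i = j ∧ i.isLeft := by
  rcases i with i | i <;> rcases j with j | j <;> simp [inA, inB]

/-- The sample point generated by the bits `x`, tested against the `j`-th column of `M`. -/
def field (M : S ⊕ T → S ⊕ T → ℝ) (x : S ⊕ (T ⊕ T) → Bool) (j : S ⊕ T) : ℝ :=
  ∑ i, M i j * sgn x (inA i)

/-- The similarity of the positive pair generated by the bits `x`. -/
def sim (M : S ⊕ T → S ⊕ T → ℝ) (x : S ⊕ (T ⊕ T) → Bool) : ℝ :=
  ∑ i, ∑ j, M i j * (sgn x (inA i) * sgn x (inB j))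

/-- The log-weight of the negatives of the second modality minus the similarity of the positive
pair. -/
noncomputable def gap (M : S ⊕ T → S ⊕ T → ℝ) (x : S ⊕ (T ⊕ T) → Bool) : ℝ :=
  ∑ j, logCosh (field M x j) - sim M x

/-- The half of the loss in which the negatives come from the second modality, as a function of
the overlap matrix. -/
noncomputable def pot (K : ℝ) (M : S ⊕ T → S ⊕ T → ℝ) : ℝ :=
  𝔼 x : S ⊕ (T ⊕ T) → Bool, Real.log (1 + K * Real.exp (gap M x))

/-- The partial derivatives of `pot`. -/
noncomputable def resp (K : ℝ) (M : S ⊕ T → S ⊕ T → ℝ) (i j : S ⊕ T) : ℝ :=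
  𝔼 x : S ⊕ (T ⊕ T) → Bool,
    logistic K (gap M x) * (sgn x (inA i) * (Real.tanh (field M x j) - sgn x (inB j)))

/-- The gradient of the full loss `pot K M + pot K Mᵀ` with respect to the overlap matrix. -/
noncomputable def grad (K : ℝ) (M : S ⊕ T → S ⊕ T → ℝ) (i j : S ⊕ T) : ℝ :=
  resp K M i j + resp K (fun k l => M l k) j i

lemma grad_transpose (K : ℝ) (M : S ⊕ T → S ⊕ T → ℝ) (i j : S ⊕ T) :
    grad K (fun k l => M l k) i j = grad K M j i := by
  unfold grad; rw [add_comm]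

lemma hasDerivAt_pot {K : ℝ} (hK : 0 < K) {M : ℝ → S ⊕ T → S ⊕ T → ℝ} {M' : S ⊕ T → S ⊕ T → ℝ}
    {u : ℝ} (hM : ∀ i j, HasDerivAt (fun v => M v i j) (M' i j) u) :
    HasDerivAt (fun v => pot K (M v)) (∑ i, ∑ j, resp K (M u) i j * M' i j) u := by
  have hfield : ∀ x j, HasDerivAt (fun v => field (M v) x j) (field M' x j) u := fun x j =>
    HasDerivAt.fun_sum fun i _ => (hM i j).mul_const _
  have hsim : ∀ x, HasDerivAt (fun v => sim (M v) x) (sim M' x) u := fun x =>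
    HasDerivAt.fun_sum fun i _ => HasDerivAt.fun_sum fun j _ => (hM i j).mul_const _
  have hgap : ∀ x, HasDerivAt (fun v => gap (M v) x)
      (∑ j, Real.tanh (field (M u) x j) * field M' x j - sim M' x) u := fun x =>
    (HasDerivAt.fun_sum fun j _ =>
      HasDerivAt.comp (h₂ := logCosh) (h := fun v => field (M v) x j) u
        (hasDerivAt_logCosh (field (M u) x j)) (hfield x j)).sub (hsim x)
  have hlog : ∀ x, HasDerivAt (fun v => Real.log (1 + K * Real.exp (gap (M v) x)))
      (logistic K (gap (M u) x) *
        (∑ j, Real.tanh (field (M u) x j) * field M' x j - sim M' x)) u := fun x =>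
    HasDerivAt.comp (h₂ := fun y => Real.log (1 + K * Real.exp y)) (h := fun v => gap (M v) x) u
      (hasDerivAt_log_one_add_exp hK (gap (M u) x)) (hgap x)
  have hsum := (HasDerivAt.fun_sum (u := Finset.univ) fun x _ => hlog x).div_const
    (Fintype.card (S ⊕ (T ⊕ T) → Bool) : ℝ)
  have e : ∀ N : S ⊕ T → S ⊕ T → ℝ, pot K N
      = (∑ x : S ⊕ (T ⊕ T) → Bool, Real.log (1 + K * Real.exp (gap N x)))
        / (Fintype.card (S ⊕ (T ⊕ T) → Bool) : ℝ) := fun N =>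
    Fintype.expect_eq_sum_div_card _
  simp only [e]
  refine hsum.congr_deriv ?_
  have key : ∀ x, logistic K (gap (M u) x) *
        (∑ j, Real.tanh (field (M u) x j) * field M' x j - sim M' x)
      = ∑ i, ∑ j, (logistic K (gap (M u) x) * (sgn x (inA i) *
          (Real.tanh (field (M u) x j) - sgn x (inB j)))) * M' i j := by
    intro x
    simp only [field, sim, Finset.mul_sum]
    rw [Finset.sum_comm, ← Finset.sum_sub_distrib, Finset.mul_sum]
    refine Finset.sum_congr rfl fun i _ => ?_
    rw [← Finset.sum_sub_distrib, Finset.mul_sum]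
    refine Finset.sum_congr rfl fun j _ => ?_
    ring
  simp only [key]
  rw [Finset.sum_comm, Finset.sum_div]
  refine Finset.sum_congr rfl fun i _ => ?_
  rw [Finset.sum_comm, Finset.sum_div]
  refine Finset.sum_congr rfl fun j _ => ?_
  rw [← Finset.sum_mul, resp, Fintype.expect_eq_sum_div_card]
  ring

lemma hasDerivAt_pot_add_pot {K : ℝ} (hK : 0 < K) {M : ℝ → S ⊕ T → S ⊕ T → ℝ}
    {M' : S ⊕ T → S ⊕ T → ℝ} {u : ℝ} (hM : ∀ i j, HasDerivAt (fun v => M v i j) (M' i j) u) :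
    HasDerivAt (fun v => pot K (M v) + pot K fun i j => M v j i)
      (∑ i, ∑ j, grad K (M u) i j * M' i j) u := by
  refine ((hasDerivAt_pot hK hM).add
    (hasDerivAt_pot hK (M := fun v i j => M v j i) fun i j => hM j i)).congr_deriv ?_
  rw [Finset.sum_comm (f := fun i j => resp K (fun i j => M u j i) i j * M' j i),
    ← Finset.sum_add_distrib]
  refine Finset.sum_congr rfl fun i _ => ?_
  rw [← Finset.sum_add_distrib]
  refine Finset.sum_congr rfl fun j _ => ?_
  rw [grad]; ring

/-! ### Expansion of the response around a diagonal overlap matrix -/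

/-- The signal part of the diagonal of `M`. -/
def sigDiag (M : S ⊕ T → S ⊕ T → ℝ) : S ⊕ T → ℝ := Sum.elim (fun s => M (.inl s) (.inl s)) 0

/-- What remains of `M` when the signal part of its diagonal is removed. -/
def offDiag (M : S ⊕ T → S ⊕ T → ℝ) (i j : S ⊕ T) : ℝ := M i j - if i = j then sigDiag M j else 0

/-- The value of `gap` when only the signal part of the diagonal of `M` is kept. -/
noncomputable def gapDiag (M : S ⊕ T → S ⊕ T → ℝ) : ℝ :=
  ∑ j, (logCosh (sigDiag M j) - sigDiag M j)

lemma gapDiag_transpose (M : S ⊕ T → S ⊕ T → ℝ) : gapDiag (fun k l => M l k) = gapDiag M := rfl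

/-- `M` is within `ε` of a diagonal matrix which is supported on the signals, nonnegative, and of
trace at most one. -/
structure NearDiag (M : S ⊕ T → S ⊕ T → ℝ) (ε : ℝ) : Prop where
  nonneg : ∀ s, 0 ≤ M (.inl s) (.inl s)
  sum_le : ∑ s, M (.inl s) (.inl s) ≤ 1
  off : ∀ i j, |offDiag M i j| ≤ ε

section
variable {M : S ⊕ T → S ⊕ T → ℝ} {ε : ℝ}

lemma NearDiag.transpose (h : NearDiag M ε) : NearDiag (fun k l => M l k) ε where
  nonneg := h.nonneg
  sum_le := h.sum_le
  off i j := by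
    have := h.off j i
    have e : offDiag (fun k l => M l k) i j = offDiag M j i := by
      unfold offDiag sigDiag
      by_cases hij : i = j
      · subst hij; rfl
      · rw [if_neg hij, if_neg (Ne.symm hij)]
    rwa [e]

lemma NearDiag.sigDiag_nonneg (h : NearDiag M ε) (j : S ⊕ T) : 0 ≤ sigDiag M j := by
  rcases j with s | t
  · exact h.nonneg s
  · simp [sigDiag]

lemma NearDiag.sum_sigDiag_le (h : NearDiag M ε) : ∑ j, sigDiag M j ≤ 1 := by
  simpa [sigDiag] using h.sum_le

lemma NearDiag.tanh_nonneg (h : NearDiag M ε) (j : S ⊕ T) : 0 ≤ Real.tanh (sigDiag M j) :=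
  Contrastive.tanh_nonneg (h.sigDiag_nonneg j)

lemma NearDiag.eps_nonneg (h : NearDiag M ε) (i : S ⊕ T) : 0 ≤ ε :=
  (abs_nonneg _).trans (h.off i i)

lemma NearDiag.gapDiag_ge (h : NearDiag M ε) : -1 ≤ gapDiag M := by
  unfold gapDiag
  rw [Finset.sum_sub_distrib]
  have : 0 ≤ ∑ j, logCosh (sigDiag M j) := Finset.sum_nonneg fun j _ => logCosh_nonneg _
  linarith [h.sum_sigDiag_le]

/-- The part of `field` coming from the perturbation. -/
def noiseField (M : S ⊕ T → S ⊕ T → ℝ) (x : S ⊕ (T ⊕ T) → Bool) (j : S ⊕ T) : ℝ :=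
  ∑ i, offDiag M i j * sgn x (inA i)

lemma field_eq (M : S ⊕ T → S ⊕ T → ℝ) (x : S ⊕ (T ⊕ T) → Bool) (j : S ⊕ T) :
    field M x j = sigDiag M j * sgn x (inA j) + noiseField M x j := by
  have : ∀ i, M i j * sgn x (inA i)
      = (if i = j then sigDiag M j * sgn x (inA j) else 0) + offDiag M i j * sgn x (inA i) := by
    intro i
    unfold offDiag
    split_ifs with h
    · subst h; ring
    · ring
  unfold field noiseField
  simp only [this, Finset.sum_add_distrib]
  simp

/-- The signals are shared, so on the support of the diagonal both modalities carry the same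
sign. -/
lemma sigDiag_mul_sgn (M : S ⊕ T → S ⊕ T → ℝ) (x : S ⊕ (T ⊕ T) → Bool) (j : S ⊕ T) :
    sigDiag M j * sgn x (inA j) = sigDiag M j * sgn x (inB j) := by
  rcases j with s | t <;> simp [sigDiag]

lemma tanh_sigDiag_mul_sgn (M : S ⊕ T → S ⊕ T → ℝ) (x : S ⊕ (T ⊕ T) → Bool) (j : S ⊕ T) :
    Real.tanh (sigDiag M j * sgn x (inA j)) = Real.tanh (sigDiag M j) * sgn x (inB j) := by
  rw [sigDiag_mul_sgn]
  unfold sgn; split_ifs <;> simp [Real.tanh_neg]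

lemma logCosh_mul_sgn {β : Type*} (w : ℝ) (x : β → Bool) (b : β) :
    logCosh (w * sgn x b) = logCosh w := by
  unfold sgn; split_ifs <;> simp [logCosh_neg]

lemma sim_eq (M : S ⊕ T → S ⊕ T → ℝ) (x : S ⊕ (T ⊕ T) → Bool) :
    sim M x = ∑ j, sigDiag M j + ∑ j, noiseField M x j * sgn x (inB j) := by
  have h : sim M x = ∑ j, field M x j * sgn x (inB j) := by
    unfold sim field
    rw [Finset.sum_comm]
    refine Finset.sum_congr rfl fun j _ => ?_
    rw [Finset.sum_mul]
    exact Finset.sum_congr rfl fun i _ => by ring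
  rw [h, ← Finset.sum_add_distrib]
  refine Finset.sum_congr rfl fun j _ => ?_
  rw [field_eq, sigDiag_mul_sgn]
  linear_combination sigDiag M j * sgn_mul_self x (inB j)

/-- The first-order variation of `gap`. -/
noncomputable def gapLin (M : S ⊕ T → S ⊕ T → ℝ) (x : S ⊕ (T ⊕ T) → Bool) : ℝ :=
  -∑ j, noiseField M x j * ((1 - Real.tanh (sigDiag M j)) * sgn x (inB j))

lemma NearDiag.abs_noiseField_le (h : NearDiag M ε) (x : S ⊕ (T ⊕ T) → Bool) (j : S ⊕ T) :
    |noiseField M x j| ≤ Fintype.card (S ⊕ T) * ε := by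
  unfold noiseField
  refine (Finset.abs_sum_le_sum_abs _ _).trans ?_
  refine (Finset.sum_le_card_nsmul _ _ ε fun i _ => ?_).trans (by simp)
  rw [abs_mul, abs_sgn, mul_one]
  exact h.off i j

lemma gap_sub_gapDiag (M : S ⊕ T → S ⊕ T → ℝ) (x : S ⊕ (T ⊕ T) → Bool) :
    gap M x - gapDiag M = ∑ j, (logCosh (field M x j) - logCosh (sigDiag M j * sgn x (inA j))
      - noiseField M x j * sgn x (inB j)) := by
  unfold gap gapDiag
  rw [sim_eq]
  simp only [logCosh_mul_sgn, Finset.sum_sub_distrib]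
  ring

lemma NearDiag.abs_gap_sub_le (h : NearDiag M ε) (x : S ⊕ (T ⊕ T) → Bool) :
    |gap M x - gapDiag M| ≤ 2 * (Fintype.card (S ⊕ T) : ℝ) ^ 2 * ε := by
  rw [gap_sub_gapDiag]
  refine (Finset.abs_sum_le_sum_abs _ _).trans ?_
  refine (Finset.sum_le_card_nsmul _ _ (2 * (Fintype.card (S ⊕ T) * ε)) fun j _ => ?_).trans
    (le_of_eq (by simp; ring))
  have h1 := abs_logCosh_sub_le (field M x j) (sigDiag M j * sgn x (inA j))
  rw [show field M x j - sigDiag M j * sgn x (inA j) = noiseField M x j by rw [field_eq]; ring]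
    at h1
  refine (abs_sub _ _).trans ?_
  rw [abs_mul, abs_sgn, mul_one]
  linarith [h.abs_noiseField_le x j]

lemma NearDiag.abs_gap_sub_sub_le (h : NearDiag M ε) (x : S ⊕ (T ⊕ T) → Bool) :
    |gap M x - gapDiag M - gapLin M x| ≤ (Fintype.card (S ⊕ T) : ℝ) ^ 3 * ε ^ 2 := by
  rw [gap_sub_gapDiag, gapLin, sub_neg_eq_add, ← Finset.sum_add_distrib]
  refine (Finset.abs_sum_le_sum_abs _ _).trans ?_
  refine (Finset.sum_le_card_nsmul _ _ ((Fintype.card (S ⊕ T) * ε) ^ 2) fun j _ => ?_).trans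
    (le_of_eq (by simp; ring))
  have h1 := abs_logCosh_sub_sub_le (field M x j) (sigDiag M j * sgn x (inA j))
    (sigDiag M j * sgn x (inA j))
  rw [show field M x j - sigDiag M j * sgn x (inA j) = noiseField M x j by rw [field_eq]; ring,
    tanh_sigDiag_mul_sgn, sub_self, abs_zero, add_zero] at h1
  have h2 := h.abs_noiseField_le x j
  refine le_trans (le_of_eq ?_) (h1.trans ?_)
  · congr 1; ring
  · nlinarith [abs_nonneg (noiseField M x j)]

lemma NearDiag.abs_tanh_field_sub_le (h : NearDiag M ε) (x : S ⊕ (T ⊕ T) → Bool) (j : S ⊕ T) :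
    |Real.tanh (field M x j) - Real.tanh (sigDiag M j) * sgn x (inB j)|
      ≤ Fintype.card (S ⊕ T) * ε := by
  rw [← tanh_sigDiag_mul_sgn]
  refine (abs_tanh_sub_le _ _).trans ?_
  rw [show field M x j - sigDiag M j * sgn x (inA j) = noiseField M x j by rw [field_eq]; ring]
  exact h.abs_noiseField_le x j

lemma NearDiag.abs_tanh_field_sub_sub_le (h : NearDiag M ε) (x : S ⊕ (T ⊕ T) → Bool) (j : S ⊕ T) :
    |Real.tanh (field M x j) - Real.tanh (sigDiag M j) * sgn x (inB j)
        - (1 - Real.tanh (sigDiag M j) ^ 2) * noiseField M x j|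
      ≤ 2 * (Fintype.card (S ⊕ T) * ε) ^ 2 := by
  have h1 := abs_tanh_sub_sub_le (field M x j) (sigDiag M j * sgn x (inA j))
    (sigDiag M j * sgn x (inA j))
  rw [show field M x j - sigDiag M j * sgn x (inA j) = noiseField M x j by rw [field_eq]; ring,
    tanh_sigDiag_mul_sgn, sub_self, abs_zero, add_zero, mul_pow, sgn_sq, mul_one] at h1
  have h2 := h.abs_noiseField_le x j
  refine h1.trans ?_
  nlinarith [abs_nonneg (noiseField M x j)]

lemma abs_tanh_field_sub_sgn_le (M : S ⊕ T → S ⊕ T → ℝ) (x : S ⊕ (T ⊕ T) → Bool) (j : S ⊕ T) :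
    |Real.tanh (field M x j) - sgn x (inB j)| ≤ 2 := by
  refine (abs_sub _ _).trans ?_
  rw [abs_sgn]
  linarith [(Real.abs_tanh_lt_one (field M x j)).le]

variable {K : ℝ} (hK : 0 < K)
include hK

lemma NearDiag.abs_resp_diag_le (h : NearDiag M ε) (s : S) :
    |resp K M (.inl s) (.inl s)
        + logistic K (gapDiag M) * (1 - Real.tanh (M (.inl s) (.inl s)))|
      ≤ 5 * (Fintype.card (S ⊕ T) : ℝ) ^ 2 * ε := by
  set n : ℝ := (Fintype.card (S ⊕ T) : ℝ) with hn
  have hn1 : 1 ≤ n := by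
    rw [hn]; exact_mod_cast Fintype.card_pos_iff.2 ⟨Sum.inl s⟩
  have hε := h.eps_nonneg (.inl s)
  have e : resp K M (.inl s) (.inl s)
        + logistic K (gapDiag M) * (1 - Real.tanh (M (.inl s) (.inl s)))
      = resp K M (.inl s) (.inl s) - 𝔼 _x : S ⊕ (T ⊕ T) → Bool,
        -(logistic K (gapDiag M) * (1 - Real.tanh (M (.inl s) (.inl s)))) := by
    rw [Fintype.expect_const]; ring
  rw [e, resp]
  refine abs_expect_sub_le fun x => ?_
  have h1 := (abs_logistic_sub_le hK (gap M x) (gapDiag M)).trans (h.abs_gap_sub_le x)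
  have h2 := h.abs_tanh_field_sub_le x (.inl s)
  have h3 := abs_tanh_field_sub_sgn_le M x (.inl s)
  have h4 := abs_logistic_le_one hK (gapDiag M)
  rw [show sigDiag M (.inl s) = M (.inl s) (.inl s) from rfl] at h2
  set p := logistic K (gap M x)
  set p0 := logistic K (gapDiag M)
  set τ := Real.tanh (field M x (.inl s))
  set t := Real.tanh (M (.inl s) (.inl s))
  have e2 : p * (sgn x (inA (.inl s)) * (τ - sgn x (inB (.inl s)))) - -(p0 * (1 - t))
      = sgn x (inA (.inl s)) * ((p - p0) * (τ - sgn x (inB (.inl s)))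
          + p0 * (τ - t * sgn x (inB (.inl s)))) := by
    simp only [inA_inl, inB_inl]
    linear_combination (-(p0 * (1 - t))) * sgn_mul_self x (Sum.inl s)
  rw [e2, abs_mul, abs_sgn, one_mul]
  refine (abs_add_le _ _).trans ?_
  rw [abs_mul, abs_mul]
  have := mul_le_mul h1 h3 (abs_nonneg _) (by positivity)
  have := mul_le_mul h4 h2 (abs_nonneg _) (by positivity)
  have : n * ε ≤ n ^ 2 * ε := by
    apply mul_le_mul_of_nonneg_right _ hε; nlinarith
  linarith

/-- First-order expansion of an off-diagonal entry of the response. -/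
lemma NearDiag.abs_resp_sub_le (h : NearDiag M ε) {i j : S ⊕ T} (hij : inA i ≠ inB j) :
    |resp K M i j - (logistic K (gapDiag M) * (1 - Real.tanh (sigDiag M j) ^ 2) * offDiag M i j
      + logistic K (gapDiag M) * (1 - logistic K (gapDiag M)) * (1 - Real.tanh (sigDiag M j)) *
        ((1 - Real.tanh (sigDiag M j)) * offDiag M i j
          + if i.isLeft ∧ j.isLeft then (1 - Real.tanh (sigDiag M i)) * offDiag M j i else 0))|
      ≤ 13 * (Fintype.card (S ⊕ T) : ℝ) ^ 4 * ε ^ 2 := by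
  set n : ℝ := (Fintype.card (S ⊕ T) : ℝ) with hn
  have hn1 : 1 ≤ n := by
    rw [hn]; exact_mod_cast Fintype.card_pos_iff.2 ⟨i⟩
  have hε := h.eps_nonneg i
  set p0 := logistic K (gapDiag M)
  set t := fun k => Real.tanh (sigDiag M k) with ht
  -- the first-order part of the integrand; its mean is computed from second and fourth moments
  set L : (S ⊕ (T ⊕ T) → Bool) → ℝ := fun x => sgn x (inA i) *
    (-(p0 * (1 - t j) * sgn x (inB j)) + p0 * (1 - t j ^ 2) * noiseField M x j
      - p0 * (1 - p0) * (1 - t j) * sgn x (inB j) * gapLin M x) with hL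
  have hexp : 𝔼 x, L x = p0 * (1 - t j ^ 2) * offDiag M i j
      + p0 * (1 - p0) * (1 - t j) * ((1 - t j) * offDiag M i j
          + if i.isLeft ∧ j.isLeft then (1 - t i) * offDiag M j i else 0) := by
    have e : ∀ x, L x = -(p0 * (1 - t j)) * (sgn x (inA i) * sgn x (inB j))
        + (p0 * (1 - t j ^ 2)) * (∑ k, offDiag M k j * (sgn x (inA i) * sgn x (inA k)))
        + (p0 * (1 - p0) * (1 - t j)) * (∑ l, ∑ k, ((1 - t l) * offDiag M k l) *
          (sgn x (inA i) * (sgn x (inB j) * (sgn x (inA k) * sgn x (inB l))))) := by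
      intro x
      simp only [hL, gapLin, noiseField, Finset.sum_mul, Finset.mul_sum, mul_add, mul_sub,
        ← Finset.sum_neg_distrib]
      rw [sub_eq_add_neg, ← Finset.sum_neg_distrib]
      congr 1
      · congr 1
        · ring
        · exact Finset.sum_congr rfl fun k _ => by ring
      · refine Finset.sum_congr rfl fun l _ => ?_
        rw [← Finset.sum_neg_distrib]
        refine Finset.sum_congr rfl fun k _ => ?_
        simp only [ht]; ring
    have e1 : 𝔼 x : S ⊕ (T ⊕ T) → Bool, sgn x (inA i) * sgn x (inB j) = 0 := by
      rw [expect_sgn_mul_sgn, if_neg hij]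
    have e2 : 𝔼 x : S ⊕ (T ⊕ T) → Bool,
        ∑ k, offDiag M k j * (sgn x (inA i) * sgn x (inA k)) = offDiag M i j := by
      rw [Finset.expect_sum_comm]
      simp only [← Finset.mul_expect, expect_sgn_mul_sgn, inA_injective.eq_iff]
      simp
    have e3 : 𝔼 x : S ⊕ (T ⊕ T) → Bool, ∑ l, ∑ k, ((1 - t l) * offDiag M k l) *
          (sgn x (inA i) * (sgn x (inB j) * (sgn x (inA k) * sgn x (inB l))))
        = (1 - t j) * offDiag M i j
          + if i.isLeft ∧ j.isLeft then (1 - t i) * offDiag M j i else 0 := by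
      rw [Finset.expect_sum_comm]
      simp only [Finset.expect_sum_comm, ← Finset.mul_expect, expect_sgn_four hij, mul_add,
        Finset.sum_add_distrib, inA_injective.eq_iff, inB_injective.eq_iff]
      congr 1
      · rw [Finset.sum_eq_single j, Finset.sum_eq_single i]
        · simp
        · intro b _ hb; simp [hb]
        · simp
        · intro b _ hb; simp [hb]
        · simp
      · by_cases hl : i.isLeft ∧ j.isLeft
        · rw [if_pos hl, Finset.sum_eq_single i, Finset.sum_eq_single j]
          · rw [if_pos ⟨inA_eq_inB_iff.2 ⟨rfl, hl.2⟩, (inA_eq_inB_iff.2 ⟨rfl, hl.1⟩).symm⟩,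
              mul_one]
          · intro b _ hb
            rw [if_neg, mul_zero]
            rintro ⟨h1, -⟩
            exact hb (inA_eq_inB_iff.1 h1).1
          · simp
          · intro b _ hb
            refine Finset.sum_eq_zero fun k _ => ?_
            rw [if_neg, mul_zero]
            rintro ⟨-, h1⟩
            exact hb (inA_eq_inB_iff.1 h1.symm).1.symm
          · simp
        · rw [if_neg hl]
          refine Finset.sum_eq_zero fun l _ => Finset.sum_eq_zero fun k _ => ?_
          rw [if_neg, mul_zero]
          rintro ⟨h1, h2⟩
          apply hl
          have h1' := inA_eq_inB_iff.1 h1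
          exact ⟨(inA_eq_inB_iff.1 h2.symm).2, h1'.1 ▸ h1'.2⟩
    simp only [e, Finset.expect_add_distrib, ← Finset.mul_expect, e1, e2, e3]
    ring
  rw [← hexp, resp]
  refine abs_expect_sub_le fun x => ?_
  have g1 := h.abs_gap_sub_le x
  have g2 := h.abs_gap_sub_sub_le x
  have q1 := abs_logistic_sub_sub_le hK (gap M x) (gapDiag M) (gapDiag M)
  rw [sub_self, abs_zero, add_zero] at q1
  have q2 : |gap M x - gapDiag M| * |gap M x - gapDiag M| ≤ 4 * n ^ 4 * ε ^ 2 := by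
    calc _ ≤ (2 * n ^ 2 * ε) * (2 * n ^ 2 * ε) := by gcongr
      _ = _ := by ring
  have t1 := h.abs_tanh_field_sub_le x j
  have t2 := h.abs_tanh_field_sub_sub_le x j
  have t3 := abs_tanh_field_sub_sgn_le M x j
  have p1 := abs_logistic_le_one hK (gapDiag M)
  have p2 : |p0 * (1 - p0)| ≤ 1 := by
    rw [abs_of_nonneg (logistic_deriv_nonneg hK _)]; exact logistic_deriv_le_one hK _
  have l1 : |gapLin M x| ≤ n ^ 2 * ε := by
    rw [gapLin, abs_neg]
    refine (Finset.abs_sum_le_sum_abs _ _).trans ?_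
    refine (Finset.sum_le_card_nsmul _ _ (n * ε) fun k _ => ?_).trans
      (le_of_eq (by simp [hn]; ring))
    rw [abs_mul, abs_mul, abs_sgn, mul_one]
    refine (mul_le_of_le_one_right (abs_nonneg _) ?_).trans (h.abs_noiseField_le x k)
    have := h.tanh_nonneg k
    have := Real.tanh_lt_one (sigDiag M k)
    rw [abs_le]; constructor <;> linarith
  change |Real.tanh (field M x j) - t j * sgn x (inB j)| ≤ n * ε at t1
  change |Real.tanh (field M x j) - t j * sgn x (inB j) - (1 - t j ^ 2) * noiseField M x j|
    ≤ 2 * (n * ε) ^ 2 at t2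
  set p := logistic K (gap M x)
  set τ := Real.tanh (field M x j)
  set y := gap M x
  set y0 := gapDiag M
  set xA := sgn x (inA i)
  set xB := sgn x (inB j)
  -- each summand on the right contains one second-order Taylor remainder, or a product of two
  -- first-order ones
  have e : p * (xA * (τ - xB)) - L x = xA * (p0 * (τ - t j * xB - (1 - t j ^ 2) * noiseField M x j)
      + p0 * (1 - p0) * gapLin M x * (τ - t j * xB)
      + ((p - p0 - p0 * (1 - p0) * (y - y0)) + p0 * (1 - p0) * (y - y0 - gapLin M x)) * (τ - xB))
        := by
    simp only [hL]; ring
  rw [e, abs_mul, abs_sgn, one_mul]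
  refine (abs_add_le _ _).trans ((add_le_add_left (abs_add_le _ _) _).trans ?_)
  have b1 : |p0 * (τ - t j * xB - (1 - t j ^ 2) * noiseField M x j)| ≤ 1 * (2 * (n * ε) ^ 2) := by
    rw [abs_mul]; gcongr
  have b2 : |p0 * (1 - p0) * gapLin M x * (τ - t j * xB)| ≤ 1 * (n ^ 2 * ε) * (n * ε) := by
    rw [abs_mul, abs_mul]; gcongr
  have b3 : |((p - p0 - p0 * (1 - p0) * (y - y0)) + p0 * (1 - p0) * (y - y0 - gapLin M x))
      * (τ - xB)| ≤ (4 * n ^ 4 * ε ^ 2 + 1 * (n ^ 3 * ε ^ 2)) * 2 := by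
    rw [abs_mul]
    refine mul_le_mul ((abs_add_le _ _).trans (add_le_add (q1.trans q2) ?_)) t3 (abs_nonneg _)
      (by positivity)
    rw [abs_mul]; gcongr
  refine (add_le_add (add_le_add b1 b2) b3).trans ?_
  have n2 : n ^ 2 ≤ n ^ 4 := pow_le_pow_right₀ hn1 (by norm_num)
  have n3 : n ^ 3 ≤ n ^ 4 := pow_le_pow_right₀ hn1 (by norm_num)
  have := mul_le_mul_of_nonneg_right n2 (sq_nonneg ε)
  have := mul_le_mul_of_nonneg_right n3 (sq_nonneg ε)
  nlinarith

end
end Potential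

end Contrastive

namespace Contrastive

section Potential
variable {S T : Type*} [Fintype S] [Fintype T] [DecidableEq S] [DecidableEq T]
variable {M : S ⊕ T → S ⊕ T → ℝ} {ε m : ℝ}

/-! ### Response of the noise rows and columns -/

lemma inB_ne_inA_inr (t : T) (j : S ⊕ T) : inB j ≠ inA (Sum.inr t : S ⊕ T) := fun h => by
  have := inA_eq_inB_iff.1 h.symm
  simp at this

lemma inA_ne_inB_inr (t : T) (j : S ⊕ T) : inA j ≠ inB (Sum.inr t : S ⊕ T) := fun h => by
  have := inA_eq_inB_iff.1 h
  rcases this with ⟨rfl, h2⟩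
  simp at h2

lemma field_sub_field_flip (M : S ⊕ T → S ⊕ T → ℝ) (x : S ⊕ (T ⊕ T) → Bool) (q j : S ⊕ T) :
    field M x j - field M (flip (inA q) x) j = 2 * M q j * sgn x (inA q) := by
  unfold field
  rw [← Finset.sum_sub_distrib, Finset.sum_eq_single q]
  · rw [sgn_flip_self]; ring
  · intro i _ hi
    rw [sgn_flip_of_ne (inA_injective.ne hi), sub_self]
  · simp

lemma field_flip_inB (M : S ⊕ T → S ⊕ T → ℝ) (x : S ⊕ (T ⊕ T) → Bool) (t : T) (j : S ⊕ T) :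
    field M (flip (inB (.inr t)) x) j = field M x j := by
  unfold field
  exact Finset.sum_congr rfl fun i _ => by rw [sgn_flip_of_ne (inA_ne_inB_inr t i)]

lemma sim_sub_sim_flip_inA (M : S ⊕ T → S ⊕ T → ℝ) (x : S ⊕ (T ⊕ T) → Bool) (t : T) :
    sim M x - sim M (flip (inA (.inr t)) x)
      = 2 * sgn x (inA (.inr t)) * ∑ k, M (.inr t) k * sgn x (inB k) := by
  unfold sim
  rw [← Finset.sum_sub_distrib, Finset.sum_eq_single (.inr t), ← Finset.sum_sub_distrib,
    Finset.mul_sum]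
  · refine Finset.sum_congr rfl fun k _ => ?_
    rw [sgn_flip_self, sgn_flip_of_ne (inB_ne_inA_inr t k)]; ring
  · intro i _ hi
    rw [← Finset.sum_sub_distrib]
    refine Finset.sum_eq_zero fun k _ => ?_
    rw [sgn_flip_of_ne (inB_ne_inA_inr t k), sgn_flip_of_ne (inA_injective.ne hi), sub_self]
  · simp

lemma sim_sub_sim_flip_inB (M : S ⊕ T → S ⊕ T → ℝ) (x : S ⊕ (T ⊕ T) → Bool) (t : T) :
    sim M x - sim M (flip (inB (.inr t)) x)
      = 2 * sgn x (inB (.inr t)) * field M x (.inr t) := by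
  unfold sim field
  rw [Finset.sum_comm, Finset.sum_comm (f := fun i j => M i j * (sgn (flip _ x) _ * _)),
    ← Finset.sum_sub_distrib, Finset.sum_eq_single (.inr t), ← Finset.sum_sub_distrib,
    Finset.mul_sum]
  · refine Finset.sum_congr rfl fun k _ => ?_
    rw [sgn_flip_self, sgn_flip_of_ne (inA_ne_inB_inr t k)]; ring
  · intro i _ hi
    rw [← Finset.sum_sub_distrib]
    refine Finset.sum_eq_zero fun k _ => ?_
    rw [sgn_flip_of_ne (inA_ne_inB_inr t k), sgn_flip_of_ne (inB_injective.ne hi), sub_self]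
  · simp

lemma abs_sum_mul_sgn_le {β ι : Type*} [Fintype ι] (c : ι → ℝ) (f : ι → β) (x : β → Bool)
    (hc : ∀ i, |c i| ≤ m) : |∑ i, c i * sgn x (f i)| ≤ Fintype.card ι * m := by
  refine (Finset.abs_sum_le_sum_abs _ _).trans ?_
  refine (Finset.sum_le_card_nsmul _ _ m fun i _ => ?_).trans (by simp)
  rw [abs_mul, abs_sgn, mul_one]
  exact hc i

section Row
variable {t : T} (hm : ∀ k, |M (.inr t) k| ≤ m)
include hm

lemma abs_field_sub_field_flip_le (x : S ⊕ (T ⊕ T) → Bool) (j : S ⊕ T) :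
    |field M x j - field M (flip (inA (.inr t)) x) j| ≤ 2 * m := by
  rw [field_sub_field_flip, abs_mul, abs_sgn, abs_mul, abs_two]
  linarith [hm j]

lemma abs_gap_sub_gap_flip_le (x : S ⊕ (T ⊕ T) → Bool) :
    |gap M x - gap M (flip (inA (.inr t)) x)| ≤ 4 * Fintype.card (S ⊕ T) * m := by
  unfold gap
  have e : ∀ a b c d : ℝ, a - b - (c - d) = (a - c) - (b - d) := fun a b c d => by ring
  rw [e, sim_sub_sim_flip_inA, ← Finset.sum_sub_distrib]
  refine (abs_sub _ _).trans ?_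
  have h1 : |∑ j, (logCosh (field M x j) - logCosh (field M (flip (inA (.inr t)) x) j))|
      ≤ Fintype.card (S ⊕ T) * (2 * m) := by
    refine (Finset.abs_sum_le_sum_abs _ _).trans ?_
    refine (Finset.sum_le_card_nsmul _ _ (2 * m) fun j _ => ?_).trans (by simp)
    exact (abs_logCosh_sub_le _ _).trans (abs_field_sub_field_flip_le hm x j)
  have h2 := abs_sum_mul_sgn_le (fun k => M (.inr t) k) inB x hm
  rw [abs_mul, abs_mul, abs_sgn, abs_two]
  linarith

lemma abs_resp_row_le {K : ℝ} (hK : 0 < K) (j : S ⊕ T) :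
    |resp K M (.inr t) j| ≤ 5 * Fintype.card (S ⊕ T) * m := by
  have hm0 : 0 ≤ m := (abs_nonneg _).trans (hm j)
  have hn1 : (1 : ℝ) ≤ Fintype.card (S ⊕ T) := by
    exact_mod_cast Fintype.card_pos_iff.2 ⟨j⟩
  unfold resp
  simp only [← mul_assoc]
  simp only [mul_comm (logistic K _) (sgn _ _)]
  simp only [mul_assoc]
  rw [expect_sgn_mul, ← sub_zero (𝔼 x, _), ← Fintype.expect_const (ι := S ⊕ (T ⊕ T) → Bool) (0 : ℝ)]
  refine abs_expect_sub_le fun x => ?_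
  have h1 := (abs_logistic_sub_le hK _ _).trans (abs_gap_sub_gap_flip_le hm x)
  have h2 := (abs_tanh_sub_le _ _).trans (abs_field_sub_field_flip_le hm x j)
  have h3 := abs_tanh_field_sub_sgn_le M x j
  have h4 := abs_logistic_le_one hK (gap M (flip (inA (.inr t)) x))
  rw [sgn_flip_of_ne (inB_ne_inA_inr t j)]
  set p := logistic K (gap M x)
  set p' := logistic K (gap M (flip (inA (.inr t)) x))
  set τ := Real.tanh (field M x j)
  set τ' := Real.tanh (field M (flip (inA (.inr t)) x) j)
  set xB := sgn x (inB j)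
  have e : p * (τ - xB) - p' * (τ' - xB) = (p - p') * (τ - xB) + p' * (τ - τ') := by ring
  rw [e, sub_zero, abs_div, abs_mul, abs_sgn, one_mul, abs_two]
  have b1 := mul_le_mul h1 h3 (abs_nonneg _) (by positivity)
  have b2 := mul_le_mul h4 h2 (abs_nonneg _) (by positivity)
  have b3 := abs_add_le ((p - p') * (τ - xB)) (p' * (τ - τ'))
  rw [abs_mul, abs_mul] at b3
  nlinarith

/-- The response in a noise row is, to first order, a nonnegative multiple of the overlap; the
error is small relative to that row. -/
lemma NearDiag.abs_resp_row_sub_le {K : ℝ} (hK : 0 < K) (h : NearDiag M ε) (j : S ⊕ T) :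
    |resp K M (.inr t) j - (logistic K (gapDiag M) * (1 - Real.tanh (sigDiag M j) ^ 2)
      + logistic K (gapDiag M) * (1 - logistic K (gapDiag M)) *
        (1 - Real.tanh (sigDiag M j)) ^ 2) * M (.inr t) j|
      ≤ 27 * (Fintype.card (S ⊕ T) : ℝ) ^ 3 * (ε * m) := by
  set n : ℝ := (Fintype.card (S ⊕ T) : ℝ) with hn
  have hn1 : 1 ≤ n := by
    rw [hn]; exact_mod_cast Fintype.card_pos_iff.2 ⟨j⟩
  have hm0 : 0 ≤ m := (abs_nonneg _).trans (hm j)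
  have hε := h.eps_nonneg j
  set p0 := logistic K (gapDiag M)
  set w := fun k => Real.tanh (sigDiag M k) with hw
  -- pairing with the sign of a noise bit leaves half the increment under a flip of that bit; up to
  -- sign and a factor two, `Γ` is the first-order increment of `gap`
  set Γ : (S ⊕ (T ⊕ T) → Bool) → ℝ := fun x =>
    ∑ k, ((w k - 1) * M (.inr t) k) * sgn x (inB k) with hΓ
  set L : (S ⊕ (T ⊕ T) → Bool) → ℝ := fun x =>
    p0 * (1 - p0) * (-(1 - w j)) * (sgn x (inB j) * Γ x)
      + p0 * (1 - w j ^ 2) * M (.inr t) j with hL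
  have hexp : 𝔼 x, L x = (p0 * (1 - w j ^ 2) + p0 * (1 - p0) * (1 - w j) ^ 2) * M (.inr t) j := by
    have e1 : 𝔼 x : S ⊕ (T ⊕ T) → Bool, sgn x (inB j) * Γ x = (w j - 1) * M (.inr t) j := by
      simp only [hΓ, Finset.mul_sum]
      have : ∀ (x : S ⊕ (T ⊕ T) → Bool) k,
          sgn x (inB j) * ((w k - 1) * M (.inr t) k * sgn x (inB k))
            = ((w k - 1) * M (.inr t) k) * (sgn x (inB j) * sgn x (inB k)) := fun x k => by ring
      simp only [this]
      rw [Finset.expect_sum_comm]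
      simp only [← Finset.mul_expect, expect_sgn_mul_sgn, inB_injective.eq_iff]
      simp
    simp only [hL, Finset.expect_add_distrib, ← Finset.mul_expect, e1, Fintype.expect_const]
    ring
  rw [← hexp]
  unfold resp
  simp only [← mul_assoc]
  simp only [mul_comm (logistic K _) (sgn _ _)]
  simp only [mul_assoc]
  rw [expect_sgn_mul]
  refine abs_expect_sub_le fun x => ?_
  set x' := flip (inA (.inr t)) x with hx'
  have b0 := abs_field_sub_field_flip_le hm x
  have g0 := abs_gap_sub_gap_flip_le hm x
  have f1 := h.abs_noiseField_le x
  have f2 := h.abs_noiseField_le x'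
  have hfx : ∀ k, field M x k - sigDiag M k * sgn x (inA k) = noiseField M x k := fun k => by
    rw [field_eq]; ring
  -- the diagonal part of the field does not see the flipped bit
  have hfx' : ∀ k, field M x' k - sigDiag M k * sgn x (inA k) = noiseField M x' k := fun k => by
    have : sigDiag M k * sgn x (inA k) = sigDiag M k * sgn x' (inA k) := by
      rcases k with s | t'
      · rw [hx', sgn_flip_of_ne (a := inA (Sum.inl s : S ⊕ T))]
        exact inA_injective.ne (by simp)
      · simp [sigDiag]
    rw [this, field_eq]; ring
  have hτ : |Real.tanh (field M x j) - Real.tanh (field M x' j)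
      - (1 - w j ^ 2) * (2 * M (.inr t) j * sgn x (inA (.inr t)))| ≤ 8 * n * (ε * m) := by
    have := abs_tanh_sub_sub_le (field M x j) (field M x' j) (sigDiag M j * sgn x (inA j))
    rw [hfx, hfx', tanh_sigDiag_mul_sgn, mul_pow, sgn_sq, mul_one, hx', field_sub_field_flip]
      at this
    refine this.trans ?_
    rw [← field_sub_field_flip]
    calc _ ≤ 2 * (n * ε + n * ε) * (2 * m) := by
          gcongr
          · exact f1 j
          · exact f2 j
          · exact b0 j
      _ = _ := by ring
  have hlc : ∀ k, |logCosh (field M x k) - logCosh (field M x' k)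
      - w k * sgn x (inB k) * (2 * M (.inr t) k * sgn x (inA (.inr t)))| ≤ 4 * n * (ε * m) := by
    intro k
    have := abs_logCosh_sub_sub_le (field M x k) (field M x' k) (sigDiag M k * sgn x (inA k))
    rw [hfx, hfx', tanh_sigDiag_mul_sgn, hx', field_sub_field_flip] at this
    refine this.trans ?_
    rw [← field_sub_field_flip]
    calc _ ≤ (n * ε + n * ε) * (2 * m) := by
          gcongr
          · exact f1 k
          · exact f2 k
          · exact b0 k
      _ = _ := by ring
  have hgap : |gap M x - gap M x' - 2 * sgn x (inA (.inr t)) * Γ x| ≤ 4 * n ^ 2 * (ε * m) := by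
    have e : gap M x - gap M x' - 2 * sgn x (inA (.inr t)) * Γ x
        = ∑ k, (logCosh (field M x k) - logCosh (field M x' k)
          - w k * sgn x (inB k) * (2 * M (.inr t) k * sgn x (inA (.inr t)))) := by
      have := sim_sub_sim_flip_inA M x t
      unfold gap
      simp only [Finset.sum_sub_distrib]
      have e2 : 2 * sgn x (inA (.inr t)) * Γ x
          = ∑ k, w k * sgn x (inB k) * (2 * M (.inr t) k * sgn x (inA (.inr t)))
            - 2 * sgn x (inA (.inr t)) * ∑ k, M (.inr t) k * sgn x (inB k) := by
        rw [hΓ, Finset.mul_sum, Finset.mul_sum, ← Finset.sum_sub_distrib]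
        exact Finset.sum_congr rfl fun k _ => by ring
      rw [e2]
      linarith
    rw [e]
    refine (Finset.abs_sum_le_sum_abs _ _).trans ?_
    refine (Finset.sum_le_card_nsmul _ _ _ fun k _ => hlc k).trans (le_of_eq ?_)
    simp [hn]; ring
  have hΓle : |Γ x| ≤ n * m := by
    refine abs_sum_mul_sgn_le _ _ _ fun k => ?_
    rw [abs_mul]
    refine (mul_le_of_le_one_left (abs_nonneg _) ?_).trans (hm k)
    have := h.tanh_nonneg k
    have := Real.tanh_lt_one (sigDiag M k)
    rw [abs_le]; constructor <;> simp only [hw] <;> linarith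
  have d1 := h.abs_gap_sub_le x
  have d2 := h.abs_gap_sub_le x'
  have hp := abs_logistic_sub_sub_le hK (gap M x) (gap M x') (gapDiag M)
  have p2 : |p0 * (1 - p0)| ≤ 1 := by
    rw [abs_of_nonneg (logistic_deriv_nonneg hK _)]; exact logistic_deriv_le_one hK _
  have hp' : |logistic K (gap M x) - logistic K (gap M x')
      - p0 * (1 - p0) * (2 * sgn x (inA (.inr t)) * Γ x)| ≤ 20 * n ^ 3 * (ε * m) := by
    have e : logistic K (gap M x) - logistic K (gap M x')
        - p0 * (1 - p0) * (2 * sgn x (inA (.inr t)) * Γ x)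
        = (logistic K (gap M x) - logistic K (gap M x')
            - p0 * (1 - p0) * (gap M x - gap M x'))
          + p0 * (1 - p0) * (gap M x - gap M x' - 2 * sgn x (inA (.inr t)) * Γ x) := by ring
    rw [e]
    refine (abs_add_le _ _).trans ?_
    have c1 : (|gap M x - gapDiag M| + |gap M x' - gapDiag M|) * |gap M x - gap M x'|
        ≤ (2 * n ^ 2 * ε + 2 * n ^ 2 * ε) * (4 * n * m) := by gcongr
    have c2 : |p0 * (1 - p0) * (gap M x - gap M x' - 2 * sgn x (inA (.inr t)) * Γ x)|
        ≤ 1 * (4 * n ^ 2 * (ε * m)) := by rw [abs_mul]; gcongr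
    have c3 : n ^ 2 * (ε * m) ≤ n ^ 3 * (ε * m) :=
      mul_le_mul_of_nonneg_right (pow_le_pow_right₀ hn1 (by norm_num)) (by positivity)
    refine (add_le_add (hp.trans c1) c2).trans ?_
    nlinarith
  have t1 := h.abs_tanh_field_sub_le x j
  have t3 := abs_tanh_field_sub_sgn_le M x j
  have p1 := abs_logistic_le_one hK (gapDiag M)
  have p3 := (abs_logistic_sub_le hK (gap M x') (gapDiag M)).trans d2
  have tb := (abs_tanh_sub_le _ _).trans (b0 j)
  rw [sgn_flip_of_ne (inB_ne_inA_inr t j)]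
  change |Real.tanh (field M x j) - w j * sgn x (inB j)| ≤ n * ε at t1
  set p := logistic K (gap M x)
  set p' := logistic K (gap M x')
  set τ := Real.tanh (field M x j)
  set τ' := Real.tanh (field M x' j)
  set xB := sgn x (inB j)
  set z := sgn x (inA (.inr t)) with hz
  have hzz : z * z = 1 := sgn_mul_self _ _
  have e : z * (p * (τ - xB) - p' * (τ' - xB)) / 2 - L x
      = z * ((p - p' - p0 * (1 - p0) * (2 * z * Γ x)) * (τ - xB)
          + p0 * (1 - p0) * (2 * z * Γ x) * (τ - w j * xB)
          + ((p' - p0) * (τ - τ')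
          + p0 * (τ - τ' - (1 - w j ^ 2) * (2 * M (.inr t) j * z)))) / 2 := by
    simp only [hL]
    linear_combination (p0 * (1 - p0) * (-(1 - w j)) * (xB * Γ x)
      + p0 * (1 - w j ^ 2) * M (.inr t) j) * hzz
  have habs : |z| = 1 := abs_sgn _ _
  rw [e, abs_div, abs_mul, habs, one_mul, abs_two]
  have c1 : |(p - p' - p0 * (1 - p0) * (2 * z * Γ x)) * (τ - xB)|
      ≤ 20 * n ^ 3 * (ε * m) * 2 := by rw [abs_mul]; gcongr
  have c2 : |p0 * (1 - p0) * (2 * z * Γ x) * (τ - w j * xB)|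
      ≤ 1 * (2 * 1 * (n * m)) * (n * ε) := by
    rw [abs_mul, abs_mul (p0 * (1 - p0)), abs_mul (2 * z), abs_mul 2 z, habs, abs_two]; gcongr
  have c3 : |(p' - p0) * (τ - τ')| ≤ (2 * n ^ 2 * ε) * (2 * m) := by rw [abs_mul]; gcongr
  have c4 : |p0 * (τ - τ' - (1 - w j ^ 2) * (2 * M (.inr t) j * z))|
      ≤ 1 * (8 * n * (ε * m)) := by rw [abs_mul]; gcongr
  have hem : 0 ≤ ε * m := by positivity
  have c5 : n ^ 2 * (ε * m) ≤ n ^ 3 * (ε * m) :=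
    mul_le_mul_of_nonneg_right (pow_le_pow_right₀ hn1 (by norm_num)) hem
  have c6 : n * (ε * m) ≤ n ^ 3 * (ε * m) :=
    mul_le_mul_of_nonneg_right (le_self_pow₀ hn1 (by norm_num)) hem
  have a1 := abs_add_le ((p - p' - p0 * (1 - p0) * (2 * z * Γ x)) * (τ - xB)
      + p0 * (1 - p0) * (2 * z * Γ x) * (τ - w j * xB))
    ((p' - p0) * (τ - τ') + p0 * (τ - τ' - (1 - w j ^ 2) * (2 * M (.inr t) j * z)))
  have a2 := abs_add_le ((p - p' - p0 * (1 - p0) * (2 * z * Γ x)) * (τ - xB))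
    (p0 * (1 - p0) * (2 * z * Γ x) * (τ - w j * xB))
  have a3 := abs_add_le ((p' - p0) * (τ - τ'))
    (p0 * (τ - τ' - (1 - w j ^ 2) * (2 * M (.inr t) j * z)))
  linarith

end Row

section Column
variable {t : T} (hm : ∀ k, |M k (.inr t)| ≤ m)
include hm

lemma resp_column_eq {K : ℝ} (i : S ⊕ T) :
    resp K M i (.inr t) = 𝔼 x : S ⊕ (T ⊕ T) → Bool,
      sgn x (inA i) * (logistic K (gap M x) * Real.tanh (field M x (.inr t))
        - sgn x (inB (.inr t)) *
          (logistic K (gap M x) - logistic K (gap M (flip (inB (.inr t)) x))) / 2) := by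
  have h1 : resp K M i (.inr t) = 𝔼 x : S ⊕ (T ⊕ T) → Bool,
        sgn x (inA i) * (logistic K (gap M x) * Real.tanh (field M x (.inr t)))
      - 𝔼 x : S ⊕ (T ⊕ T) → Bool,
        sgn x (inB (.inr t)) * (sgn x (inA i) * logistic K (gap M x)) := by
    rw [← Finset.expect_sub_distrib, resp]
    exact Finset.expect_congr rfl fun x _ => by ring
  rw [h1, expect_sgn_mul (inB (.inr t)), ← Finset.expect_sub_distrib]
  refine Finset.expect_congr rfl fun x _ => ?_
  rw [sgn_flip_of_ne (inA_ne_inB_inr t i)]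
  ring

lemma abs_gap_sub_gap_flip_inB_le (x : S ⊕ (T ⊕ T) → Bool) :
    |gap M x - gap M (flip (inB (.inr t)) x)| ≤ 2 * Fintype.card (S ⊕ T) * m := by
  unfold gap
  have e : ∀ a b c d : ℝ, a - b - (c - d) = (a - c) - (b - d) := fun a b c d => by ring
  simp only [field_flip_inB]
  rw [e, sim_sub_sim_flip_inB, sub_self, zero_sub, abs_neg, abs_mul, abs_mul, abs_two, abs_sgn]
  have h2 := abs_sum_mul_sgn_le (fun k => M k (.inr t)) inA x hm
  unfold field
  linarith

lemma abs_resp_column_le {K : ℝ} (hK : 0 < K) (i : S ⊕ T) :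
    |resp K M i (.inr t)| ≤ 2 * Fintype.card (S ⊕ T) * m := by
  rw [resp_column_eq hm, ← sub_zero (𝔼 x, _),
    ← Fintype.expect_const (ι := S ⊕ (T ⊕ T) → Bool) (0 : ℝ)]
  refine abs_expect_sub_le fun x => ?_
  rw [sub_zero, abs_mul, abs_sgn, one_mul]
  refine (abs_sub _ _).trans ?_
  rw [abs_mul, abs_div, abs_mul, abs_sgn, abs_two, one_mul]
  have h1 := (abs_logistic_sub_le hK _ _).trans (abs_gap_sub_gap_flip_inB_le hm x)
  have h2 := (abs_tanh_le (field M x (.inr t))).trans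
    (abs_sum_mul_sgn_le (fun k => M k (.inr t)) inA x hm)
  have h3 := mul_le_mul (abs_logistic_le_one hK (gap M x)) h2 (abs_nonneg _) zero_le_one
  linarith

lemma NearDiag.abs_resp_column_sub_le {K : ℝ} (hK : 0 < K) (h : NearDiag M ε) (i : S ⊕ T) :
    |resp K M i (.inr t) - (logistic K (gapDiag M)
      + logistic K (gapDiag M) * (1 - logistic K (gapDiag M))) * M i (.inr t)|
      ≤ 8 * (Fintype.card (S ⊕ T) : ℝ) ^ 3 * (ε * m) := by
  set n : ℝ := (Fintype.card (S ⊕ T) : ℝ) with hn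
  have hn1 : 1 ≤ n := by
    rw [hn]; exact_mod_cast Fintype.card_pos_iff.2 ⟨i⟩
  have hm0 : 0 ≤ m := (abs_nonneg _).trans (hm i)
  have hε := h.eps_nonneg i
  set p0 := logistic K (gapDiag M)
  have hexp : 𝔼 x : S ⊕ (T ⊕ T) → Bool,
      (p0 + p0 * (1 - p0)) * (sgn x (inA i) * field M x (.inr t))
        = (p0 + p0 * (1 - p0)) * M i (.inr t) := by
    rw [← Finset.mul_expect]
    congr 1
    simp only [field, Finset.mul_sum]
    have : ∀ (x : S ⊕ (T ⊕ T) → Bool) k,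
        sgn x (inA i) * (M k (.inr t) * sgn x (inA k))
          = M k (.inr t) * (sgn x (inA i) * sgn x (inA k)) := fun x k => by ring
    simp only [this]
    rw [Finset.expect_sum_comm]
    simp only [← Finset.mul_expect, expect_sgn_mul_sgn, inA_injective.eq_iff]
    simp
  rw [← hexp, resp_column_eq hm]
  refine abs_expect_sub_le fun x => ?_
  have g0 := abs_gap_sub_gap_flip_inB_le hm x
  have d1 := h.abs_gap_sub_le x
  have d2 := h.abs_gap_sub_le (flip (inB (.inr t)) x)
  have hp := abs_logistic_sub_sub_le hK (gap M x) (gap M (flip (inB (.inr t)) x)) (gapDiag M)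
  have p1 := abs_logistic_le_one hK (gapDiag M)
  have p3 := (abs_logistic_sub_le hK (gap M x) (gapDiag M)).trans d1
  have hgap : gap M x - gap M (flip (inB (.inr t)) x)
      = -(2 * sgn x (inB (.inr t)) * field M x (.inr t)) := by
    have := sim_sub_sim_flip_inB M x t
    unfold gap
    simp only [field_flip_inB]
    linarith
  have hf := abs_sum_mul_sgn_le (fun k => M k (.inr t)) inA x hm
  have hf' : |field M x (.inr t)| ≤ n * ε := by
    have := h.abs_noiseField_le x (.inr t)
    rw [show field M x (.inr t) = noiseField M x (.inr t) by rw [field_eq]; simp [sigDiag]]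
    exact this
  change |field M x (.inr t)| ≤ n * m at hf
  have ht := abs_tanh_sub_sub_le (field M x (.inr t)) 0 0
  rw [Real.tanh_zero] at ht
  simp only [sub_zero, abs_zero, add_zero, ne_eq, OfNat.ofNat_ne_zero, not_false_eq_true,
    zero_pow, one_mul] at ht
  have ht' := abs_tanh_le (field M x (.inr t))
  have c0 : (|gap M x - gapDiag M| + |gap M (flip (inB (.inr t)) x) - gapDiag M|) *
      |gap M x - gap M (flip (inB (.inr t)) x)|
      ≤ (2 * n ^ 2 * ε + 2 * n ^ 2 * ε) * (2 * n * m) := by gcongr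
  have hp := hp.trans c0
  rw [hgap] at hp
  set p := logistic K (gap M x)
  set p' := logistic K (gap M (flip (inB (.inr t)) x))
  set ρ := field M x (.inr t)
  set z := sgn x (inB (.inr t))
  have hzz : z * z = 1 := sgn_mul_self _ _
  have habs : |z| = 1 := abs_sgn _ _
  have e : sgn x (inA i) * (p * Real.tanh ρ - z * (p - p') / 2)
      - (p0 + p0 * (1 - p0)) * (sgn x (inA i) * ρ)
      = sgn x (inA i) * ((p - p0) * Real.tanh ρ + p0 * (Real.tanh ρ - ρ)
        - z * (p - p' - p0 * (1 - p0) * (-(2 * z * ρ))) / 2) := by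
    linear_combination (sgn x (inA i) * p0 * (1 - p0) * ρ) * hzz
  rw [e, abs_mul, abs_sgn, one_mul]
  refine (abs_sub _ _).trans ((add_le_add_left (abs_add_le _ _) _).trans ?_)
  rw [abs_div, abs_mul z, habs, abs_two, one_mul]
  have c1 : |(p - p0) * Real.tanh ρ| ≤ 2 * n ^ 2 * ε * (n * m) := by
    rw [abs_mul]
    exact mul_le_mul p3 (ht'.trans hf) (abs_nonneg _) (by positivity)
  have c2 : |p0 * (Real.tanh ρ - ρ)| ≤ 1 * (2 * (n * ε) * (n * m)) := by
    rw [abs_mul]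
    refine mul_le_mul p1 (ht.trans ?_) (abs_nonneg _) zero_le_one
    gcongr
  have hem : 0 ≤ ε * m := by positivity
  have c5 : n ^ 2 * (ε * m) ≤ n ^ 3 * (ε * m) :=
    mul_le_mul_of_nonneg_right (pow_le_pow_right₀ hn1 (by norm_num)) hem
  nlinarith

end Column

/-! ### Expansion of the gradient -/

section Gradient
variable {K : ℝ} (hK : 0 < K)
include hK

lemma NearDiag.abs_grad_diag_le (h : NearDiag M ε) (s : S) :
    |grad K M (.inl s) (.inl s)
        + 2 * logistic K (gapDiag M) * (1 - Real.tanh (M (.inl s) (.inl s)))|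
      ≤ 10 * (Fintype.card (S ⊕ T) : ℝ) ^ 2 * ε := by
  have h1 := h.abs_resp_diag_le hK s
  have h2 := h.transpose.abs_resp_diag_le hK s
  rw [gapDiag_transpose] at h2
  have h3 := abs_add_le _ _ |>.trans (add_le_add h1 h2)
  refine le_trans (le_of_eq ?_) (h3.trans (le_of_eq ?_))
  · unfold grad; congr 1; ring
  · ring

lemma offDiag_of_ne {i j : S ⊕ T} (hij : i ≠ j) : offDiag M i j = M i j := by
  simp [offDiag, hij]

/-- Between two different signals the gradient is, to first order, `α M i j + β M j i` with
`α ≥ β ≥ 0`: correlations between different signals are repelled. -/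
lemma NearDiag.exists_grad_signal (h : NearDiag M ε) {s s' : S} (hs : s ≠ s') :
    ∃ α β : ℝ, 0 ≤ β ∧ β ≤ α ∧ α ≤ 4 ∧
      |grad K M (.inl s) (.inl s') - (α * M (.inl s) (.inl s') + β * M (.inl s') (.inl s))|
        ≤ 26 * (Fintype.card (S ⊕ T) : ℝ) ^ 4 * ε ^ 2 ∧
      |grad K M (.inl s') (.inl s) - (α * M (.inl s') (.inl s) + β * M (.inl s) (.inl s'))|
        ≤ 26 * (Fintype.card (S ⊕ T) : ℝ) ^ 4 * ε ^ 2 := by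
  set p0 := logistic K (gapDiag M) with hp0
  set u := Real.tanh (sigDiag M (.inl s))
  set v := Real.tanh (sigDiag M (.inl s'))
  have hd := logistic_deriv_nonneg hK (gapDiag M)
  have hd1 := logistic_deriv_le_one hK (gapDiag M)
  have hp := logistic_pos hK (gapDiag M)
  have hp1 := logistic_lt_one hK (gapDiag M)
  rw [← hp0] at hd hd1 hp hp1
  have hu : 0 ≤ u := h.tanh_nonneg _
  have hv : 0 ≤ v := h.tanh_nonneg _
  have hu1 : u < 1 := Real.tanh_lt_one _
  have hv1 : v < 1 := Real.tanh_lt_one _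
  have hss : (Sum.inl s : S ⊕ T) ≠ .inl s' := by simpa using hs
  have hin : inA (Sum.inl s : S ⊕ T) ≠ inB (.inl s') := by simpa using hs
  have hin' : inA (Sum.inl s' : S ⊕ T) ≠ inB (.inl s) := by simpa using Ne.symm hs
  have e1 := h.abs_resp_sub_le hK hin
  have e2 := h.abs_resp_sub_le hK hin'
  have e3 := h.transpose.abs_resp_sub_le hK hin
  have e4 := h.transpose.abs_resp_sub_le hK hin'
  rw [gapDiag_transpose] at e3 e4
  simp only [offDiag_of_ne hK hss, offDiag_of_ne hK hss.symm, Sum.isLeft_inl, and_self,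
    if_true] at e1 e2 e3 e4
  have sd : ∀ k, sigDiag (fun k l => M l k) k = sigDiag M k := fun k => rfl
  simp only [sd] at e3 e4
  refine ⟨p0 * (1 - u ^ 2) + p0 * (1 - v ^ 2) + p0 * (1 - p0) * ((1 - u) ^ 2 + (1 - v) ^ 2),
    2 * (p0 * (1 - p0)) * ((1 - u) * (1 - v)), ?_, ?_, ?_, ?_, ?_⟩
  · have : 0 ≤ (1 - u) * (1 - v) := mul_nonneg (by linarith) (by linarith)
    positivity
  · have h1 : 0 ≤ p0 * (1 - u ^ 2) := mul_nonneg hp.le (by nlinarith)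
    have h2 : 0 ≤ p0 * (1 - v ^ 2) := mul_nonneg hp.le (by nlinarith)
    nlinarith [mul_nonneg hd (sq_nonneg (u - v))]
  · have h1 : p0 * (1 - u ^ 2) ≤ 1 := by nlinarith [sq_nonneg u]
    have h2 : p0 * (1 - v ^ 2) ≤ 1 := by nlinarith [sq_nonneg v]
    have h3 : (1 - u) ^ 2 ≤ 1 := by nlinarith
    have h4 : (1 - v) ^ 2 ≤ 1 := by nlinarith
    nlinarith
  · have := (abs_add_le _ _).trans (add_le_add e1 e4)
    refine le_trans (le_of_eq ?_) (this.trans (le_of_eq (by ring)))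
    unfold grad; congr 1; ring
  · have := (abs_add_le _ _).trans (add_le_add e2 e3)
    refine le_trans (le_of_eq ?_) (this.trans (le_of_eq (by ring)))
    unfold grad; congr 1; ring

/-- In a noise row the gradient is, to first order relative to that row, a nonnegative multiple of
the overlap: correlations between noise and signal are repelled. -/
lemma NearDiag.exists_grad_noise (h : NearDiag M ε) {t : T} (hm : ∀ k, |M (.inr t) k| ≤ m)
    (j : S ⊕ T) :
    ∃ γ : ℝ, 0 ≤ γ ∧ γ ≤ 4 ∧ |grad K M (.inr t) j - γ * M (.inr t) j|
        ≤ 35 * (Fintype.card (S ⊕ T) : ℝ) ^ 3 * (ε * m) := by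
  have e1 := h.abs_resp_row_sub_le hm hK j
  have e2 := h.transpose.abs_resp_column_sub_le (M := fun k l => M l k) hm hK j
  rw [gapDiag_transpose] at e2
  set p0 := logistic K (gapDiag M) with hp0
  set u := Real.tanh (sigDiag M j)
  have hd := logistic_deriv_nonneg hK (gapDiag M)
  have hd1 := logistic_deriv_le_one hK (gapDiag M)
  have hp := logistic_pos hK (gapDiag M)
  have hp1 := logistic_lt_one hK (gapDiag M)
  rw [← hp0] at hd hd1 hp hp1
  have hu : 0 ≤ u := h.tanh_nonneg _
  have hu1 : u < 1 := Real.tanh_lt_one _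
  refine ⟨(p0 * (1 - u ^ 2) + p0 * (1 - p0) * (1 - u) ^ 2) + (p0 + p0 * (1 - p0)), ?_, ?_, ?_⟩
  · have h1 : 0 ≤ p0 * (1 - u ^ 2) := mul_nonneg hp.le (by nlinarith)
    positivity
  · have h1 : p0 * (1 - u ^ 2) ≤ 1 := by nlinarith [sq_nonneg u]
    have h3 : (1 - u) ^ 2 ≤ 1 := by nlinarith
    nlinarith
  · have := (abs_add_le _ _).trans (add_le_add e1 e2)
    refine le_trans (le_of_eq ?_) (this.trans (le_of_eq (by ring)))
    unfold grad; congr 1; ring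

lemma abs_grad_noise_le {t : T} (hm : ∀ k, |M (.inr t) k| ≤ m) (j : S ⊕ T) :
    |grad K M (.inr t) j| ≤ 7 * Fintype.card (S ⊕ T) * m := by
  have e1 := abs_resp_row_le hm hK j
  have e2 := abs_resp_column_le (M := fun k l => M l k) hm hK j
  have := (abs_add_le _ _).trans (add_le_add e1 e2)
  refine this.trans (le_of_eq (by ring))

end Gradient

end Potential

end Contrastive

namespace Contrastive

/-! ### The gradient flow in terms of the transformed columns -/

section Flow
variable {S T : Type*} [Fintype S] [Fintype T] [DecidableEq S] [DecidableEq T]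
variable {E : Type*} [NormedAddCommGroup E] [InnerProductSpace ℝ E]

/-- The Frobenius norm of a family of vectors. -/
noncomputable def famNorm {ι : Type*} [Fintype ι] (a : ι → E) : ℝ := √(∑ i, ‖a i‖ ^ 2)

/-- The normalized cross-Gram matrix of two families of vectors. The similarity of two features is
the value of the corresponding bilinear form at the latent signs. -/
noncomputable def overlap {ι : Type*} [Fintype ι] (a b : ι → E) (i j : ι) : ℝ :=
  inner ℝ (a i) (b j) / (famNorm a * famNorm b)

/-- The pairing of the overlap matrix with the gradient of the loss. -/
noncomputable def pairing (K : ℝ) (a b : S ⊕ T → E) : ℝ :=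
  ∑ i, ∑ j, grad K (overlap a b) i j * overlap a b i j

/-- The negative gradient of the loss with respect to the `i`-th vector of the first family. -/
noncomputable def drift (K : ℝ) (a b : S ⊕ T → E) (i : S ⊕ T) : E :=
  (pairing K a b / famNorm a ^ 2) • a i
    - ∑ j, (grad K (overlap a b) i j / (famNorm a * famNorm b)) • b j

/-- The families `a` and `b` follow the gradient flow of the loss in which the `i`-th vector moves
with mobility `σ i`. Nothing is required at times at which one of the families vanishes. -/
def IsFlow (K : ℝ) (σ : S ⊕ T → ℝ) (a b : ℝ → S ⊕ T → E) : Prop :=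
  ∀ t, 0 ≤ t → famNorm (a t) ≠ 0 → famNorm (b t) ≠ 0 → ∀ i,
    HasDerivWithinAt (fun u => a u i) (σ i • drift K (a t) (b t) i) (Set.Ici 0) t ∧
    HasDerivWithinAt (fun u => b u i) (σ i • drift K (b t) (a t) i) (Set.Ici 0) t

section
variable {ι : Type*} [Fintype ι]

lemma famNorm_sq (a : ι → E) : famNorm a ^ 2 = ∑ i, ‖a i‖ ^ 2 :=
  Real.sq_sqrt (Finset.sum_nonneg fun _ _ => sq_nonneg _)

lemma famNorm_nonneg (a : ι → E) : 0 ≤ famNorm a := Real.sqrt_nonneg _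

lemma norm_le_famNorm (a : ι → E) (i : ι) : ‖a i‖ ≤ famNorm a :=
  Real.le_sqrt_of_sq_le
    (Finset.single_le_sum (f := fun i => ‖a i‖ ^ 2) (fun _ _ => sq_nonneg _) (Finset.mem_univ i))

lemma overlap_comm (a b : ι → E) (i j : ι) : overlap b a i j = overlap a b j i := by
  unfold overlap; rw [real_inner_comm, mul_comm]

lemma overlap_transpose (a b : ι → E) : (fun i j => overlap a b j i) = overlap b a := by
  ext i j; rw [overlap_comm]

lemma hasDerivAt_famNorm (a δ : ι → E) (ha : famNorm a ≠ 0) :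
    HasDerivAt (fun u : ℝ => famNorm fun k => a k + u • δ k)
      ((∑ i, inner ℝ (a i) (δ i)) / famNorm a) 0 := by
  have h1 : ∀ i, HasDerivAt (fun u : ℝ => a i + u • δ i) (δ i) 0 := fun i => by
    simpa using ((hasDerivAt_id (0 : ℝ)).smul_const (δ i)).const_add (a i)
  have h2 : HasDerivAt (fun u : ℝ => ∑ i, ‖a i + u • δ i‖ ^ 2)
      (∑ i, 2 * inner ℝ (a i) (δ i)) 0 :=
    HasDerivAt.fun_sum fun i _ => by simpa using (h1 i).norm_sq
  have h3 := h2.sqrt (by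
    simp only [zero_smul, add_zero]
    intro h0
    apply ha; unfold famNorm; rw [h0, Real.sqrt_zero])
  refine h3.congr_deriv ?_
  simp only [zero_smul, add_zero, ← Finset.mul_sum]
  change _ / (2 * famNorm a) = _
  field_simp

lemma hasDerivAt_overlap (a b δ : ι → E) (ha : famNorm a ≠ 0) (hb : famNorm b ≠ 0) (k l : ι) :
    HasDerivAt (fun u : ℝ => overlap (fun k => a k + u • δ k) b k l)
      (inner ℝ (δ k) (b l) / (famNorm a * famNorm b)
        - overlap a b k l * ((∑ i, inner ℝ (a i) (δ i)) / famNorm a ^ 2)) 0 := by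
  have h1 : HasDerivAt (fun u : ℝ => a k + u • δ k) (δ k) 0 := by
    simpa using ((hasDerivAt_id (0 : ℝ)).smul_const (δ k)).const_add (a k)
  have h2 := h1.inner ℝ (hasDerivAt_const (0 : ℝ) (b l))
  have h3 := h2.div ((hasDerivAt_famNorm a δ ha).mul_const (famNorm b)) (by simp [ha, hb])
  refine h3.congr_deriv ?_
  simp only [zero_smul, add_zero, inner_zero_right, zero_add, overlap]
  field_simp

end

/-- The loss decreases along `drift`: its derivative in a direction `δ` is minus the inner product
with `drift`. -/
lemma hasDerivAt_pot_overlap {K : ℝ} (hK : 0 < K) (a b δ : S ⊕ T → E) (ha : famNorm a ≠ 0)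
    (hb : famNorm b ≠ 0) :
    HasDerivAt (fun u : ℝ => pot K (overlap (fun k => a k + u • δ k) b)
        + pot K fun i j => overlap (fun k => a k + u • δ k) b j i)
      (-∑ i, inner ℝ (drift K a b i) (δ i)) 0 := by
  have h := hasDerivAt_pot_add_pot hK
    (M := fun u => overlap (fun k => a k + u • δ k) b) fun k l => hasDerivAt_overlap a b δ ha hb k l
  refine h.congr_deriv ?_
  have e0 : overlap (fun k => a k + (0 : ℝ) • δ k) b = overlap a b := by simp
  rw [e0]
  have e1 : ∀ i, inner ℝ (drift K a b i) (δ i)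
      = pairing K a b * (inner ℝ (a i) (δ i) / famNorm a ^ 2)
        - ∑ j, grad K (overlap a b) i j * (inner ℝ (δ i) (b j) / (famNorm a * famNorm b)) := by
    intro i
    rw [drift, inner_sub_left, real_inner_smul_left, sum_inner]
    congr 1
    · ring
    · refine Finset.sum_congr rfl fun j _ => ?_
      rw [real_inner_smul_left, real_inner_comm]; ring
  simp only [e1, Finset.sum_sub_distrib, mul_sub]
  rw [← Finset.mul_sum, ← Finset.sum_div, pairing, neg_sub]
  simp only [Finset.sum_mul, mul_assoc]

lemma differentiableAt_pot {V : Type*} [NormedAddCommGroup V] [NormedSpace ℝ V] {K : ℝ}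
    (hK : 0 < K) {M : V → S ⊕ T → S ⊕ T → ℝ} {v : V}
    (hM : ∀ i j, DifferentiableAt ℝ (fun u => M u i j) v) :
    DifferentiableAt ℝ (fun u => pot K (M u)) v := by
  have hfield : ∀ x j, DifferentiableAt ℝ (fun u => field (M u) x j) v := fun x j =>
    DifferentiableAt.fun_sum fun i _ => (hM i j).mul_const _
  have hsim : ∀ x, DifferentiableAt ℝ (fun u => sim (M u) x) v := fun x =>
    DifferentiableAt.fun_sum fun i _ => DifferentiableAt.fun_sum fun j _ => (hM i j).mul_const _
  have hgap : ∀ x, DifferentiableAt ℝ (fun u => gap (M u) x) v := fun x =>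
    (DifferentiableAt.fun_sum fun j _ => DifferentiableAt.comp (g := logCosh) v
      (hasDerivAt_logCosh _).differentiableAt (hfield x j)).sub (hsim x)
  unfold pot
  simp only [Fintype.expect_eq_sum_div_card, div_eq_mul_inv]
  refine DifferentiableAt.mul_const (DifferentiableAt.fun_sum fun x _ => ?_) _
  exact DifferentiableAt.comp (g := fun y => Real.log (1 + K * Real.exp y)) v
    (hasDerivAt_log_one_add_exp hK _).differentiableAt (hgap x)

end Flow

/-! ### From the data model to the flow of the transformed columns -/

section Model
variable {d r m : ℕ} (D : DataModel d r)

/-- The columns of `[C, C_ξ]`. -/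
def modelCol (c : Modality) : Fin r ⊕ Fin (d - r) → Fin d → ℝ :=
  Sum.elim (fun p => (D.signal c).col p) fun q => (D.noise c).col q

/-- The squared lengths of the columns of `[C, C_ξ]`. -/
def strength : Fin r ⊕ Fin (d - r) → ℝ := Sum.elim (fun p => D.σ p ^ 2) fun _ => D.σξ ^ 2

/-- The columns of `Wᵀ [C, C_ξ]`. -/
noncomputable def weightCol (c : Modality) (W : Weights d m) (i : Fin r ⊕ Fin (d - r)) :
    EuclideanSpace ℝ (Fin m) := embed W (modelCol D c i)

lemma strength_pos (i : Fin r ⊕ Fin (d - r)) : 0 < strength D i := by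
  rcases i with p | q
  · exact pow_pos (D.σ_pos p) 2
  · exact pow_pos D.σξ_pos 2

lemma modelCol_gram (c : Modality) (i j : Fin r ⊕ Fin (d - r)) :
    ∑ x, modelCol D c i x * modelCol D c j x = if i = j then strength D i else 0 := by
  have h1 := D.signal_gram c
  have h2 := D.noise_gram c
  have h3 := D.signal_noise c
  rcases i with i | i <;> rcases j with j | j
  · have := congrFun (congrFun h1 i) j
    simpa [Matrix.mul_apply, modelCol, strength, Matrix.diagonal_apply] using this
  · have := congrFun (congrFun h3 i) j
    simpa [Matrix.mul_apply, modelCol, strength] using this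
  · have := congrFun (congrFun h3 j) i
    simpa [Matrix.mul_apply, modelCol, strength, mul_comm] using this
  · have := congrFun (congrFun h2 i) j
    simpa [Matrix.mul_apply, modelCol, strength, Matrix.one_apply] using this

lemma embed_apply (W : Weights d m) (x : Fin d → ℝ) (k : Fin m) :
    embed W x k = ∑ i, W (i, k) * x i := rfl

lemma embed_add (W V : Weights d m) (x : Fin d → ℝ) :
    embed (W + V) x = embed W x + embed V x := by
  ext k; simp [embed_apply, add_mul, Finset.sum_add_distrib]

lemma embed_smul (u : ℝ) (W : Weights d m) (x : Fin d → ℝ) :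
    embed (u • W) x = u • embed W x := by
  ext k; simp [embed_apply, Finset.mul_sum, mul_assoc]

lemma embed_sum {ι : Type*} [Fintype ι] (W : Weights d m) (u : ι → ℝ) (x : ι → Fin d → ℝ) :
    embed W (fun k => ∑ i, u i * x i k) = ∑ i, u i • embed W (x i) := by
  ext k
  simp only [embed_apply, WithLp.ofLp_sum, Finset.sum_apply, WithLp.ofLp_smul, Pi.smul_apply,
    smul_eq_mul, Finset.mul_sum]
  rw [Finset.sum_comm]
  exact Finset.sum_congr rfl fun i _ => Finset.sum_congr rfl fun j _ => by ring

/-- The map `W ↦ Wᵀ x`. -/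
noncomputable def embedLin (x : Fin d → ℝ) : Weights d m →L[ℝ] EuclideanSpace ℝ (Fin m) :=
  LinearMap.toContinuousLinearMap
    { toFun := fun W => embed W x
      map_add' := fun W V => embed_add W V x
      map_smul' := fun u W => embed_smul u W x }

lemma embedLin_apply (x : Fin d → ℝ) (W : Weights d m) : embedLin x W = embed W x := rfl

/-- The weight matrix `x eᵀ`. -/
noncomputable def outer (x : Fin d → ℝ) (e : EuclideanSpace ℝ (Fin m)) : Weights d m :=
  WithLp.toLp 2 fun ik => x ik.1 * e ik.2

lemma inner_outer (W : Weights d m) (x : Fin d → ℝ) (e : EuclideanSpace ℝ (Fin m)) :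
    inner ℝ W (outer x e) = inner ℝ (embed W x) e := by
  simp only [PiLp.inner_apply, outer, embed_apply, Fintype.sum_prod_type, RCLike.inner_apply,
    conj_trivial]
  rw [Finset.sum_comm]
  refine Finset.sum_congr rfl fun k _ => ?_
  rw [Finset.mul_sum]
  exact Finset.sum_congr rfl fun i _ => by ring

lemma weightCol_outer (c : Modality) (i k : Fin r ⊕ Fin (d - r))
    (e : EuclideanSpace ℝ (Fin m)) :
    weightCol D c (outer (modelCol D c i) e) k = if k = i then strength D i • e else 0 := by
  have h := modelCol_gram D c i k
  ext l
  have : weightCol D c (outer (modelCol D c i) e) k l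
      = (∑ x, modelCol D c i x * modelCol D c k x) * e l := by
    rw [weightCol, embed_apply, Finset.sum_mul]
    exact Finset.sum_congr rfl fun x _ => by simp only [outer]; ring
  rw [this, h]
  by_cases hik : i = k
  · subst hik; simp
  · simp [hik, Ne.symm hik]

lemma embed_input (c : Modality) (W : Weights d m) (s : Fin r → Bool) (e : Fin (d - r) → Bool) :
    embed W (D.input c (latent d s) (latent d e))
      = (√(d : ℝ))⁻¹ • ∑ i, sgn (Sum.elim s e) i • weightCol D c W i := by
  have : D.input c (latent d s) (latent d e)
      = fun k => ∑ i, ((√(d : ℝ))⁻¹ * sgn (Sum.elim s e) i) * modelCol D c i k := by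
    have hlat : ∀ {n : ℕ} (v : Fin n → Bool) i, latent d v i = (√(d : ℝ))⁻¹ * sgn v i := by
      intro n v i
      unfold latent sgn
      rw [div_eq_inv_mul]
    ext k
    rw [Fintype.sum_sum_type]
    simp only [DataModel.input, Pi.add_apply, Matrix.mulVec, dotProduct, modelCol, Sum.elim_inl,
      Sum.elim_inr, Matrix.col_apply, hlat]
    congr 1 <;> exact Finset.sum_congr rfl fun i _ => mul_comm _ _
  rw [this, embed_sum, Finset.smul_sum]
  exact Finset.sum_congr rfl fun i _ => by rw [mul_smul]; rfl

lemma expect_sumElim {S T : Type*} [Fintype S] [Fintype T] [DecidableEq S] [DecidableEq T]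
    (F : (S ⊕ T → Bool) → ℝ) :
    𝔼 s : S → Bool, 𝔼 e : T → Bool, F (Sum.elim s e) = 𝔼 x, F x := by
  rw [← Finset.expect_product' Finset.univ Finset.univ
    (fun (s : S → Bool) (e : T → Bool) => F (Sum.elim s e))]
  exact Fintype.expect_equiv (Equiv.sumArrowEquivProdArrow S T Bool).symm _ _ fun _ => rfl

lemma expect_norm_sq_sum_sgn {ι : Type*} [Fintype ι] [DecidableEq ι]
    (a : ι → EuclideanSpace ℝ (Fin m)) :
    𝔼 x : ι → Bool, ‖∑ i, sgn x i • a i‖ ^ 2 = ∑ i, ‖a i‖ ^ 2 := by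
  have : ∀ x : ι → Bool, ‖∑ i, sgn x i • a i‖ ^ 2
      = ∑ i, ∑ j, inner ℝ (a i) (a j) * (sgn x i * sgn x j) := by
    intro x
    rw [← real_inner_self_eq_norm_sq, sum_inner]
    refine Finset.sum_congr rfl fun i _ => ?_
    rw [inner_sum]
    refine Finset.sum_congr rfl fun j _ => ?_
    rw [real_inner_smul_left, real_inner_smul_right]; ring
  simp only [this, Finset.expect_sum_comm, ← Finset.mul_expect, expect_sgn_mul_sgn]
  simp

lemma normalizer_eq (c : Modality) (W : Weights d m) :
    D.normalizer c W = (√(d : ℝ))⁻¹ * famNorm (weightCol D c W) := by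
  unfold DataModel.normalizer
  simp only [embed_input]
  rw [expect_sumElim (fun x => ‖(√(d : ℝ))⁻¹ • ∑ i, sgn x i • weightCol D c W i‖ ^ 2)]
  simp only [norm_smul, mul_pow]
  rw [← Finset.mul_expect, expect_norm_sq_sum_sgn, Real.sqrt_mul (by positivity),
    Real.sqrt_sq (norm_nonneg _), norm_inv, Real.norm_of_nonneg (Real.sqrt_nonneg _)]
  rfl

lemma inner_feature (hd : d ≠ 0) (c c' : Modality) (W V : Weights d m)
    (s s' : Fin r → Bool) (e e' : Fin (d - r) → Bool) :
    inner ℝ (D.feature c W s e) (D.feature c' V s' e')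
      = ∑ i, ∑ j, overlap (weightCol D c W) (weightCol D c' V) i j
          * (sgn (Sum.elim s e) i * sgn (Sum.elim s' e') j) := by
  have hd' : √(d : ℝ) ≠ 0 := (Real.sqrt_pos.2 (by positivity)).ne'
  unfold DataModel.feature
  rw [embed_input, embed_input, normalizer_eq, normalizer_eq, smul_smul, smul_smul,
    real_inner_smul_left, real_inner_smul_right, sum_inner, Finset.mul_sum, Finset.mul_sum]
  refine Finset.sum_congr rfl fun i _ => ?_
  rw [inner_sum, Finset.mul_sum, Finset.mul_sum]
  refine Finset.sum_congr rfl fun j _ => ?_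
  rw [real_inner_smul_left, real_inner_smul_right, overlap]
  field_simp

/-- Sampling the latent signs of a positive pair amounts to sampling one family of bits, in which the
signal bits are shared by the modalities. -/
lemma expect_three {S T : Type*} [Fintype S] [Fintype T] [DecidableEq S] [DecidableEq T]
    (F : (S ⊕ T → Bool) → (S ⊕ T → Bool) → ℝ) :
    𝔼 s : S → Bool, 𝔼 e : T → Bool, 𝔼 e' : T → Bool, F (Sum.elim s e) (Sum.elim s e')
      = 𝔼 x : S ⊕ (T ⊕ T) → Bool, F (x ∘ inA) (x ∘ inB) := by
  rw [← expect_sumElim]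
  refine Finset.expect_congr rfl fun s _ => ?_
  rw [← expect_sumElim (fun e => F (Sum.elim s e ∘ inA) (Sum.elim s e ∘ inB))]
  refine Finset.expect_congr rfl fun e _ => Finset.expect_congr rfl fun e' _ => ?_
  have h1 : Sum.elim s (Sum.elim e e') ∘ inA = Sum.elim s e := by
    ext i; rcases i with i | i <;> rfl
  have h2 : Sum.elim s (Sum.elim e e') ∘ inB = Sum.elim s e' := by
    ext i; rcases i with i | i <;> rfl
  rw [h1, h2]

lemma expect_three_swap {S T : Type*} [Fintype S] [Fintype T] [DecidableEq S] [DecidableEq T]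
    (F : (S ⊕ T → Bool) → (S ⊕ T → Bool) → ℝ) :
    𝔼 s : S → Bool, 𝔼 e : T → Bool, 𝔼 e' : T → Bool, F (Sum.elim s e') (Sum.elim s e)
      = 𝔼 x : S ⊕ (T ⊕ T) → Bool, F (x ∘ inA) (x ∘ inB) := by
  rw [← expect_three]
  exact Finset.expect_congr rfl fun s _ => Finset.expect_comm _ _ _

lemma log_softmax_eq {S T : Type*} [Fintype S] [Fintype T] [DecidableEq S] [DecidableEq T]
    {K : ℝ} (hK : 0 < K) (M : S ⊕ T → S ⊕ T → ℝ) (x : S ⊕ (T ⊕ T) → Bool) :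
    -Real.log (Real.exp (∑ i, ∑ j, M i j * (sgn (x ∘ inA) i * sgn (x ∘ inB) j)) /
      (Real.exp (∑ i, ∑ j, M i j * (sgn (x ∘ inA) i * sgn (x ∘ inB) j)) +
        K * 𝔼 y : S ⊕ T → Bool, Real.exp (∑ i, ∑ j, M i j * (sgn (x ∘ inA) i * sgn y j))))
      = Real.log (1 + K * Real.exp (gap M x)) := by
  have h1 : ∀ y : S ⊕ T → Bool, ∑ i, ∑ j, M i j * (sgn (x ∘ inA) i * sgn y j)
      = ∑ j, field M x j * sgn y j := by
    intro y
    rw [Finset.sum_comm]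
    refine Finset.sum_congr rfl fun j _ => ?_
    rw [field, Finset.sum_mul]
    exact Finset.sum_congr rfl fun i _ => by
      change M i j * (sgn x (inA i) * _) = _; ring
  simp only [h1, expect_exp_sum_sgn]
  have h2 : ∑ j, field M x j * sgn (x ∘ inB) j = sim M x := (h1 _).symm
  have h3 : ∏ j, Real.cosh (field M x j) = Real.exp (∑ j, logCosh (field M x j)) := by
    rw [Real.exp_sum]
    exact Finset.prod_congr rfl fun j _ => (Real.exp_log (Real.cosh_pos _)).symm
  rw [h2, h3, ← Real.log_inv, inv_div, gap, Real.exp_sub]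
  congr 1
  field_simp

/-- The loss is a function of the overlap matrix of the transformed columns. -/
lemma loss_eq (hd : d ≠ 0) {K : ℝ} (hK : 0 < K) (WA WB : Weights d m) :
    D.loss K 1 WA WB = pot K (overlap (weightCol D .A WA) (weightCol D .B WB))
      + pot K (overlap (weightCol D .B WB) (weightCol D .A WA)) := by
  unfold DataModel.loss DataModel.softA DataModel.softB DataModel.expSim
  simp only [one_pow, one_mul, inner_feature D hd]
  set M := overlap (weightCol D .A WA) (weightCol D .B WB) with hM
  have eT : ∀ x y : Fin r ⊕ Fin (d - r) → Bool, ∑ i, ∑ j, M i j * (sgn x i * sgn y j)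
      = ∑ i, ∑ j, overlap (weightCol D .B WB) (weightCol D .A WA) i j * (sgn y i * sgn x j) := by
    intro x y
    rw [Finset.sum_comm]
    refine Finset.sum_congr rfl fun i _ => Finset.sum_congr rfl fun j _ => ?_
    rw [overlap_comm]; ring
  have h1 : 𝔼 s : Fin r → Bool, 𝔼 e : Fin (d - r) → Bool, 𝔼 e' : Fin (d - r) → Bool,
      Real.log (Real.exp (∑ i, ∑ j, M i j * (sgn (Sum.elim s e) i * sgn (Sum.elim s e') j)) /
      (Real.exp (∑ i, ∑ j, M i j * (sgn (Sum.elim s e) i * sgn (Sum.elim s e') j)) +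
        K * 𝔼 s' : Fin r → Bool, 𝔼 e'' : Fin (d - r) → Bool,
          Real.exp (∑ i, ∑ j, M i j * (sgn (Sum.elim s e) i * sgn (Sum.elim s' e'') j))))
      = -pot K M := by
    have hy : ∀ x : Fin r ⊕ Fin (d - r) → Bool,
        𝔼 s' : Fin r → Bool, 𝔼 e'' : Fin (d - r) → Bool,
          Real.exp (∑ i, ∑ j, M i j * (sgn x i * sgn (Sum.elim s' e'') j))
        = 𝔼 y : Fin r ⊕ Fin (d - r) → Bool,
          Real.exp (∑ i, ∑ j, M i j * (sgn x i * sgn y j)) := fun x =>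
      expect_sumElim (S := Fin r) (T := Fin (d - r))
        (fun y => Real.exp (∑ i, ∑ j, M i j * (sgn x i * sgn y j)))
    simp only [hy]
    rw [expect_three (fun x y => Real.log (Real.exp (∑ i, ∑ j, M i j * (sgn x i * sgn y j)) /
      (Real.exp (∑ i, ∑ j, M i j * (sgn x i * sgn y j)) + K * 𝔼 y : Fin r ⊕ Fin (d - r) → Bool,
        Real.exp (∑ i, ∑ j, M i j * (sgn x i * sgn y j))))), pot, ← Finset.expect_neg_distrib]
    refine Finset.expect_congr rfl fun x _ => ?_
    rw [← log_softmax_eq hK, neg_neg]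
  have h2 : 𝔼 s : Fin r → Bool, 𝔼 e : Fin (d - r) → Bool, 𝔼 e' : Fin (d - r) → Bool,
      Real.log (Real.exp (∑ i, ∑ j, M i j * (sgn (Sum.elim s e) i * sgn (Sum.elim s e') j)) /
      (Real.exp (∑ i, ∑ j, M i j * (sgn (Sum.elim s e) i * sgn (Sum.elim s e') j)) +
        K * 𝔼 s' : Fin r → Bool, 𝔼 e'' : Fin (d - r) → Bool,
          Real.exp (∑ i, ∑ j, M i j * (sgn (Sum.elim s' e'') i * sgn (Sum.elim s e') j))))
      = -pot K (overlap (weightCol D .B WB) (weightCol D .A WA)) := by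
    simp only [eT]
    set N := overlap (weightCol D .B WB) (weightCol D .A WA)
    have hy : ∀ x : Fin r ⊕ Fin (d - r) → Bool,
        𝔼 s' : Fin r → Bool, 𝔼 e'' : Fin (d - r) → Bool,
          Real.exp (∑ i, ∑ j, N i j * (sgn x i * sgn (Sum.elim s' e'') j))
        = 𝔼 y : Fin r ⊕ Fin (d - r) → Bool,
          Real.exp (∑ i, ∑ j, N i j * (sgn x i * sgn y j)) := fun x =>
      expect_sumElim (S := Fin r) (T := Fin (d - r))
        (fun y => Real.exp (∑ i, ∑ j, N i j * (sgn x i * sgn y j)))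
    simp only [hy]
    rw [expect_three_swap (fun x y => Real.log (Real.exp (∑ i, ∑ j, N i j * (sgn x i * sgn y j)) /
      (Real.exp (∑ i, ∑ j, N i j * (sgn x i * sgn y j)) + K * 𝔼 y : Fin r ⊕ Fin (d - r) → Bool,
        Real.exp (∑ i, ∑ j, N i j * (sgn x i * sgn y j))))), pot, ← Finset.expect_neg_distrib]
    refine Finset.expect_congr rfl fun x _ => ?_
    rw [← log_softmax_eq hK, neg_neg]
  rw [h1, h2]
  ring

/-- One modality of the flow: along the gradient descent of the loss, the transformed columns move
along `drift`. -/
lemma hasDerivWithinAt_weightCol {K : ℝ} (hK : 0 < K) (c : Modality) {w : ℝ → Weights d m}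
    {b : Fin r ⊕ Fin (d - r) → EuclideanSpace ℝ (Fin m)} {L : Weights d m → ℝ} {t : ℝ}
    (hL : ∀ V, L V = pot K (overlap (weightCol D c V) b) + pot K (overlap b (weightCol D c V)))
    (hw : HasDerivWithinAt w (-gradient L (w t)) (Set.Ici 0) t)
    (ha : famNorm (weightCol D c (w t)) ≠ 0) (hb : famNorm b ≠ 0) (i : Fin r ⊕ Fin (d - r)) :
    HasDerivWithinAt (fun u => weightCol D c (w u) i)
      (strength D i • drift K (weightCol D c (w t)) b i) (Set.Ici 0) t := by
  have hL' : L = fun V => pot K (overlap (weightCol D c V) b)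
      + pot K fun i j => overlap (weightCol D c V) b j i := by
    ext V; rw [hL, overlap_transpose]
  have hcol : ∀ k, Differentiable ℝ fun V : Weights d m => weightCol D c V k := fun k =>
    (embedLin (modelCol D c k)).differentiable
  have hnorm : DifferentiableAt ℝ (fun V => famNorm (weightCol D c V)) (w t) := by
    refine DifferentiableAt.sqrt (DifferentiableAt.fun_sum fun k _ =>
      ((hcol k) (w t)).norm_sq ℝ) ?_
    intro h0; apply ha; unfold famNorm; rw [h0, Real.sqrt_zero]
  have hov : ∀ k l, DifferentiableAt ℝ (fun V => overlap (weightCol D c V) b k l) (w t) := by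
    intro k l
    unfold overlap
    have h1 : DifferentiableAt ℝ (fun V => inner ℝ (weightCol D c V k) (b l)) (w t) :=
      ((hcol k) (w t)).inner ℝ (differentiableAt_const _)
    have h2 : DifferentiableAt ℝ (fun V => famNorm (weightCol D c V) * famNorm b) (w t) :=
      hnorm.mul_const _
    have h3 : (fun V => famNorm (weightCol D c V) * famNorm b) (w t) ≠ 0 := mul_ne_zero ha hb
    simp only [div_eq_mul_inv]
    exact h1.mul (h2.fun_inv h3)
  have hdiff : DifferentiableAt ℝ L (w t) := by
    rw [hL']
    exact (differentiableAt_pot hK hov).add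
      (differentiableAt_pot hK (M := fun V i j => overlap (weightCol D c V) b j i)
        fun k l => hov l k)
  have hmain : embed (gradient L (w t)) (modelCol D c i)
      = -(strength D i • drift K (weightCol D c (w t)) b i) := by
    refine ext_inner_right ℝ fun e => ?_
    rw [← inner_outer]
    set V := outer (modelCol D c i) e with hV
    have hline : HasDerivAt (fun u : ℝ => w t + u • V) V 0 := by
      simpa using ((hasDerivAt_id (0 : ℝ)).smul_const V).const_add (w t)
    have h1 : HasDerivAt (fun u : ℝ => L (w t + u • V)) (inner ℝ (gradient L (w t)) V) 0 := by
      have hg := hdiff.hasGradientAt.hasFDerivAt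
      rw [show w t = w t + (0 : ℝ) • V by simp] at hg
      have := HasFDerivAt.comp_hasDerivAt (0 : ℝ) hg hline
      refine this.congr_deriv ?_
      simp
    have h2 := hasDerivAt_pot_overlap hK (weightCol D c (w t)) b (weightCol D c V) ha hb
    have e2 : (fun u : ℝ => L (w t + u • V)) = fun u : ℝ =>
        pot K (overlap (fun k => weightCol D c (w t) k + u • weightCol D c V k) b)
        + pot K fun i j =>
          overlap (fun k => weightCol D c (w t) k + u • weightCol D c V k) b j i := by
      ext u
      have : weightCol D c (w t + u • V)
          = fun k => weightCol D c (w t) k + u • weightCol D c V k := by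
        ext1 k; simp only [weightCol, embed_add, embed_smul]
      rw [hL']
      simp only [this]
    rw [← e2] at h2
    rw [h1.unique h2, Finset.sum_eq_single i]
    · rw [hV, weightCol_outer, if_pos rfl, inner_neg_left, real_inner_smul_left,
        real_inner_smul_right]
    · intro k _ hk
      rw [hV, weightCol_outer, if_neg hk, inner_zero_right]
    · simp
  have h := (embedLin (m := m) (modelCol D c i)).hasFDerivAt.comp_hasDerivWithinAt t hw
  refine h.congr_deriv ?_
  rw [map_neg, embedLin_apply, hmain, neg_neg]

lemma isFlow_of_isGradientFlow (hd : d ≠ 0) {K : ℝ} (hK : 0 < K)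
    {W : Modality → ℝ → Weights d m} (hW : D.IsGradientFlow K 1 W) :
    IsFlow K (strength D) (fun t => weightCol D .A (W .A t)) fun t => weightCol D .B (W .B t) := by
  intro t ht ha hb i
  obtain ⟨hA, hB⟩ := hW t ht
  simp only [one_pow, inv_one, one_smul] at hA hB
  exact ⟨hasDerivWithinAt_weightCol D hK .A (fun V => loss_eq D hd hK V (W .B t)) hA ha hb i,
    hasDerivWithinAt_weightCol D hK .B
      (fun V => (loss_eq D hd hK (W .A t) V).trans (add_comm _ _)) hB hb ha i⟩

end Model

end Contrastive

namespace Contrastive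

/-! ### Directions and relative sizes -/

section Dir
variable {E : Type*} [NormedAddCommGroup E] [InnerProductSpace ℝ E]

/-- The direction `v / ‖v‖` of a vector. -/
noncomputable def dir (v : E) : E := ‖v‖⁻¹ • v

lemma norm_dir {v : E} (hv : v ≠ 0) : ‖dir v‖ = 1 := by
  unfold dir; rw [norm_smul, norm_inv, norm_norm, inv_mul_cancel₀ (norm_ne_zero_iff.2 hv)]

lemma norm_dir_le (v : E) : ‖dir v‖ ≤ 1 := by
  by_cases hv : v = 0
  · simp [hv, dir]
  · exact (norm_dir hv).le

lemma norm_smul_dir (v : E) : ‖v‖ • dir v = v := by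
  by_cases hv : v = 0
  · simp [hv]
  · unfold dir; rw [smul_smul, mul_inv_cancel₀ (norm_ne_zero_iff.2 hv), one_smul]

lemma inner_dir_self {v : E} (hv : v ≠ 0) : inner ℝ (dir v) (dir v) = 1 := by
  rw [real_inner_self_eq_norm_sq, norm_dir hv, one_pow]

lemma inner_dir_dir (u v : E) : inner ℝ (dir u) (dir v) = inner ℝ u v / (‖u‖ * ‖v‖) := by
  unfold dir; rw [real_inner_smul_left, real_inner_smul_right]; field_simp

lemma inner_eq_mul_inner_dir (u v : E) : inner ℝ u v = ‖u‖ * ‖v‖ * inner ℝ (dir u) (dir v) := by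
  conv_lhs => rw [← norm_smul_dir u, ← norm_smul_dir v]
  rw [real_inner_smul_left, real_inner_smul_right]; ring

lemma abs_inner_dir_le (u v : E) : |inner ℝ (dir u) (dir v)| ≤ 1 :=
  (abs_real_inner_le_norm _ _).trans
    (mul_le_one₀ (norm_dir_le u) (norm_nonneg _) (norm_dir_le v))

lemma inner_dir_le (u v : E) : inner ℝ (dir u) (dir v) ≤ 1 :=
  (le_abs_self _).trans (abs_inner_dir_le u v)

variable {ι : Type*} [Fintype ι]

/-- The size of `a i` relative to the Frobenius norm of the family. -/
noncomputable def rel (a : ι → E) (i : ι) : ℝ := ‖a i‖ / famNorm a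

lemma rel_nonneg (a : ι → E) (i : ι) : 0 ≤ rel a i := div_nonneg (norm_nonneg _) (famNorm_nonneg a)

lemma rel_le_one (a : ι → E) (i : ι) : rel a i ≤ 1 :=
  div_le_one_of_le₀ (norm_le_famNorm a i) (famNorm_nonneg a)

lemma sum_rel_sq {a : ι → E} (ha : famNorm a ≠ 0) : ∑ i, rel a i ^ 2 = 1 := by
  simp only [rel, div_pow]
  rw [← Finset.sum_div, ← famNorm_sq, div_self (pow_ne_zero 2 ha)]

lemma overlap_eq (a b : ι → E) (i j : ι) :
    overlap a b i j = rel a i * rel b j * inner ℝ (dir (a i)) (dir (b j)) := by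
  unfold overlap rel
  rw [inner_eq_mul_inner_dir]
  field_simp

/-- The reverse triangle inequality for the Frobenius norm. -/
lemma sq_famNorm_sub_le (a b : ι → E) :
    (famNorm a - famNorm b) ^ 2 ≤ ∑ i, (‖a i‖ - ‖b i‖) ^ 2 := by
  have h1 : famNorm a ^ 2 = ∑ i, ‖a i‖ ^ 2 := famNorm_sq a
  have h2 : famNorm b ^ 2 = ∑ i, ‖b i‖ ^ 2 := famNorm_sq b
  have h3 : ∑ i, ‖a i‖ * ‖b i‖ ≤ famNorm a * famNorm b := by
    refine abs_le_of_sq_le_sq' ?_ (mul_nonneg (famNorm_nonneg a) (famNorm_nonneg b)) |>.2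
    rw [mul_pow, h1, h2]
    exact Finset.sum_mul_sq_le_sq_mul_sq _ _ _
  have h4 : ∑ i, (‖a i‖ - ‖b i‖) ^ 2
      = ∑ i, ‖a i‖ ^ 2 - 2 * ∑ i, ‖a i‖ * ‖b i‖ + ∑ i, ‖b i‖ ^ 2 := by
    rw [Finset.mul_sum, ← Finset.sum_sub_distrib, ← Finset.sum_add_distrib]
    exact Finset.sum_congr rfl fun i _ => by ring
  rw [h4, ← h1, ← h2]
  nlinarith

end Dir

section State
variable {S T : Type*} [Fintype S] [Fintype T] [DecidableEq S] [DecidableEq T]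
variable {E : Type*} [NormedAddCommGroup E] [InnerProductSpace ℝ E]

/-- The coefficient with which the direction of `b j` acts on the direction of `a i`. -/
noncomputable def couple (K : ℝ) (a b : S ⊕ T → E) (i j : S ⊕ T) : ℝ :=
  grad K (overlap a b) i j * (rel b j / rel a i)

/-- The logarithmic derivative of `‖a i‖` in units of `σ i / famNorm a ^ 2`. -/
noncomputable def rateLog (K : ℝ) (a b : S ⊕ T → E) (i : S ⊕ T) : ℝ :=
  pairing K a b - ∑ j, couple K a b i j * inner ℝ (dir (b j)) (dir (a i))

/-- The velocity of the direction of `a i` in units of `σ i / famNorm a ^ 2`. -/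
noncomputable def rateDir (K : ℝ) (a b : S ⊕ T → E) (i : S ⊕ T) : E :=
  -∑ j, couple K a b i j •
    (dir (b j) - inner ℝ (dir (b j)) (dir (a i)) • dir (a i))

lemma drift_eq (K : ℝ) {a b : S ⊕ T → E} (ha : famNorm a ≠ 0) (hb : famNorm b ≠ 0) (i : S ⊕ T)
    (hi : a i ≠ 0) :
    drift K a b i = (‖a i‖ / famNorm a ^ 2) •
      (rateLog K a b i • dir (a i) + rateDir K a b i) := by
  have h0 : ‖a i‖ ≠ 0 := norm_ne_zero_iff.2 hi
  have h1 : rateLog K a b i • dir (a i) + rateDir K a b i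
      = pairing K a b • dir (a i) - ∑ j, couple K a b i j • dir (b j) := by
    simp only [rateLog, rateDir, sub_smul, Finset.sum_smul, smul_sub, Finset.sum_sub_distrib,
      smul_smul]
    abel
  rw [h1, smul_sub, Finset.smul_sum, drift]
  congr 1
  · conv_lhs => rw [← norm_smul_dir (a i)]
    rw [smul_smul, smul_smul]; congr 1; ring
  · refine Finset.sum_congr rfl fun j _ => ?_
    conv_lhs => rw [← norm_smul_dir (b j)]
    rw [smul_smul, smul_smul, couple, rel, rel]
    congr 1
    field_simp

/-! ### The regime of small errors -/

/-- One half of the condition `Near`, in a form that is preserved under limits. -/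
structure HalfNear (a b : S ⊕ T → E) (Q ε : ℝ) : Prop where
  low : ∀ s, famNorm a ≤ Q * ‖a (.inl s)‖
  noise : ∀ t, ‖a (.inr t)‖ ≤ ε * famNorm a
  close : ∀ s, |‖a (.inl s)‖ - ‖b (.inl s)‖| ≤ ε * ‖a (.inl s)‖
  align : ∀ s, (1 - ε) * (‖a (.inl s)‖ * ‖b (.inl s)‖) ≤ inner ℝ (a (.inl s)) (b (.inl s))
  same : ∀ i s, i ≠ .inl s → |inner ℝ (a i) (a (.inl s))| ≤ ε * (‖a i‖ * ‖a (.inl s)‖)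
  cross : ∀ i s, i ≠ .inl s → |inner ℝ (a i) (b (.inl s))| ≤ ε * (‖a i‖ * ‖b (.inl s)‖)

/-- The families `a` and `b` are, up to relative errors `ε`, equal on the signals, orthogonal, and
negligible on the noises; the sizes of the signals differ by at most a factor `Q`. -/
structure Near (a b : S ⊕ T → E) (Q ε : ℝ) : Prop where
  ne_left : ∀ i, a i ≠ 0
  ne_right : ∀ i, b i ≠ 0
  left : HalfNear a b Q ε
  right : HalfNear b a Q ε

lemma Near.symm {a b : S ⊕ T → E} {Q ε : ℝ} (h : Near a b Q ε) : Near b a Q ε :=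
  ⟨h.ne_right, h.ne_left, h.right, h.left⟩

/-- `Q` dominates the number of vectors and all absolute constants, and `ε` is much smaller than
any power of `1 / Q` that occurs. -/
structure Params (S T : Type*) [Fintype S] [Fintype T] (Q ε : ℝ) : Prop where
  hQ : 100 ≤ Q
  card_le : (Fintype.card (S ⊕ T) : ℝ) ≤ Q
  eps_nonneg : 0 ≤ ε
  eps_le : Q ^ 40 * ε ≤ 1

namespace Params
variable {Q ε : ℝ} (P : Params S T Q ε)
include P

lemma one_le : 1 ≤ Q := by linarith [P.hQ]

lemma pos : 0 < Q := by linarith [P.hQ]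

lemma pow_eps_le {k : ℕ} (hk : k ≤ 40) : Q ^ k * ε ≤ 1 :=
  (mul_le_mul_of_nonneg_right (pow_le_pow_right₀ P.one_le hk) P.eps_nonneg).trans P.eps_le

lemma eps_le_one : ε ≤ 1 := by simpa using P.pow_eps_le (k := 0) (by norm_num)

lemma eps_small : 100 * ε ≤ 1 := by
  have := P.pow_eps_le (k := 1) (by norm_num)
  nlinarith [P.hQ, P.eps_nonneg]

lemma step (k : ℕ) (x : ℝ) (hx : 0 ≤ x) : 100 * (Q ^ k * x) ≤ Q ^ (k + 1) * x := by
  have : 0 ≤ Q ^ k * x := mul_nonneg (pow_nonneg P.pos.le _) hx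
  rw [pow_succ]; nlinarith [P.hQ]

lemma mono {k l : ℕ} (h : k ≤ l) {x : ℝ} (hx : 0 ≤ x) : Q ^ k * x ≤ Q ^ l * x :=
  mul_le_mul_of_nonneg_right (pow_le_pow_right₀ P.one_le h) hx

lemma absorb {k : ℕ} (hk : k ≤ 40) : Q ^ k * ε ^ 2 ≤ ε := by
  have := mul_le_mul_of_nonneg_right (P.pow_eps_le hk) P.eps_nonneg
  nlinarith

/-- A sum over all vectors of terms of size at most `x`. -/
lemma abs_sum_le {f : S ⊕ T → ℝ} {x : ℝ} (hx : 0 ≤ x) (h : ∀ i, |f i| ≤ x) :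
    |∑ i, f i| ≤ Q * x := by
  refine (Finset.abs_sum_le_sum_abs _ _).trans ?_
  refine (Finset.sum_le_card_nsmul _ _ x fun i _ => h i).trans ?_
  simpa using mul_le_mul_of_nonneg_right P.card_le hx

end Params

section NearLemmas
variable {a b : S ⊕ T → E} {Q ε : ℝ} (P : Params S T Q ε) (h : Near a b Q ε)

section
include h

lemma Near.norm_pos (i : S ⊕ T) : 0 < ‖a i‖ := norm_pos_iff.2 (h.ne_left i)

lemma Near.famNorm_pos (i : S ⊕ T) : 0 < famNorm a :=
  (h.norm_pos i).trans_le (norm_le_famNorm a i)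

lemma Near.rel_pos (i : S ⊕ T) : 0 < rel a i := div_pos (h.norm_pos i) (h.famNorm_pos i)

lemma Near.one_le_mul_rel (s : S) : 1 ≤ Q * rel a (.inl s) := by
  unfold rel
  rw [← mul_div_assoc, one_le_div (h.famNorm_pos (.inl s))]
  exact h.left.low s

lemma Near.rel_noise_le (t : T) : rel a (.inr t) ≤ ε := by
  unfold rel
  rw [div_le_iff₀ (h.famNorm_pos (.inr t))]
  exact h.left.noise t

lemma Near.le_align (s : S) : 1 - ε ≤ inner ℝ (dir (a (.inl s))) (dir (b (.inl s))) := by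
  rw [inner_dir_dir, le_div_iff₀ (mul_pos (h.norm_pos _) (h.symm.norm_pos _))]
  exact h.left.align s

lemma Near.abs_same_le {i : S ⊕ T} {s : S} (hi : i ≠ .inl s) :
    |inner ℝ (dir (a i)) (dir (a (.inl s)))| ≤ ε := by
  rw [inner_dir_dir, abs_div, div_le_iff₀ (by
    rw [abs_pos]; exact (mul_pos (h.norm_pos _) (h.norm_pos _)).ne'),
    abs_of_pos (mul_pos (h.norm_pos _) (h.norm_pos _))]
  exact h.left.same i s hi

lemma Near.abs_cross_le {i : S ⊕ T} {s : S} (hi : i ≠ .inl s) :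
    |inner ℝ (dir (a i)) (dir (b (.inl s)))| ≤ ε := by
  rw [inner_dir_dir, abs_div, div_le_iff₀ (by
    rw [abs_pos]; exact (mul_pos (h.norm_pos _) (h.symm.norm_pos _)).ne'),
    abs_of_pos (mul_pos (h.norm_pos _) (h.symm.norm_pos _))]
  exact h.left.cross i s hi

end

include P h

lemma Near.abs_famNorm_sub_le (i : S ⊕ T) :
    |famNorm a - famNorm b| ≤ 6 * Q * ε * famNorm a := by
  have hA := h.famNorm_pos i
  have hB := h.symm.famNorm_pos i
  have hε := P.eps_nonneg
  have hQ := P.hQ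
  have hQε : Q * ε ≤ 1 / 100 := by
    have := P.pow_eps_le (k := 2) (by norm_num)
    nlinarith [mul_nonneg P.pos.le hε]
  have hsq := sq_famNorm_sub_le a b
  set x := |famNorm a - famNorm b|
  have hx : 0 ≤ x := abs_nonneg _
  have hBx : famNorm b ≤ famNorm a + x := by
    have := neg_abs_le (famNorm a - famNorm b); linarith
  have hterm : ∀ j, (‖a j‖ - ‖b j‖) ^ 2 ≤ (ε * (famNorm a + x)) ^ 2 := by
    intro j
    rw [sq_le_sq, abs_of_nonneg (a := ε * _) (by positivity)]
    rcases j with s | t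
    · refine (h.left.close s).trans (mul_le_mul_of_nonneg_left ?_ hε)
      linarith [norm_le_famNorm a (.inl s)]
    · have h1 := h.left.noise t
      have h2 := h.right.noise t
      have h3 := norm_nonneg (a (.inr t))
      have h4 := norm_nonneg (b (.inr t))
      have h5 := mul_le_mul_of_nonneg_left hBx hε
      have h6 := mul_nonneg hε hx
      rw [abs_le]; constructor <;> linarith
  have hsum : ∑ j, (‖a j‖ - ‖b j‖) ^ 2 ≤ Q * (ε * (famNorm a + x)) ^ 2 := by
    refine (Finset.sum_le_card_nsmul _ _ _ fun j _ => hterm j).trans ?_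
    simpa using mul_le_mul_of_nonneg_right P.card_le (sq_nonneg (ε * (famNorm a + x)))
  have hx2 : x ^ 2 ≤ (Q * ε * (famNorm a + x)) ^ 2 := by
    have e : x ^ 2 = (famNorm a - famNorm b) ^ 2 := sq_abs _
    rw [e]
    refine hsq.trans (hsum.trans ?_)
    have : (Q * ε * (famNorm a + x)) ^ 2 = Q * (Q * (ε * (famNorm a + x)) ^ 2) := by ring
    rw [this]
    exact le_mul_of_one_le_left (by have := P.pos; positivity) P.one_le
  have hx3 := abs_le_of_sq_le_sq' hx2 (by have := P.pos; positivity) |>.2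
  have : 0 ≤ Q * ε := mul_nonneg P.pos.le hε
  nlinarith

lemma Near.abs_rel_sub_le (s : S) : |rel a (.inl s) - rel b (.inl s)| ≤ 7 * Q * ε := by
  have hA := h.famNorm_pos (.inl s)
  have hB := h.symm.famNorm_pos (.inl s)
  have e : rel a (.inl s) - rel b (.inl s)
      = (‖a (.inl s)‖ - ‖b (.inl s)‖) / famNorm a
        + rel b (.inl s) * ((famNorm b - famNorm a) / famNorm a) := by
    unfold rel; field_simp; ring
  rw [e]
  refine (abs_add_le _ _).trans ?_
  have h1 : |(‖a (.inl s)‖ - ‖b (.inl s)‖) / famNorm a| ≤ ε := by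
    rw [abs_div, abs_of_pos hA, div_le_iff₀ hA]
    exact (h.left.close s).trans
      (mul_le_mul_of_nonneg_left (norm_le_famNorm a _) P.eps_nonneg)
  have h2 : |(famNorm b - famNorm a) / famNorm a| ≤ 6 * Q * ε := by
    rw [abs_div, abs_of_pos hA, div_le_iff₀ hA, abs_sub_comm]
    exact h.abs_famNorm_sub_le P (.inl s)
  have h3 : |rel b (.inl s)| ≤ 1 := by
    rw [abs_of_nonneg (rel_nonneg _ _)]; exact rel_le_one _ _
  rw [abs_mul]
  have := mul_le_mul h3 h2 (abs_nonneg _) zero_le_one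
  have := P.one_le
  nlinarith [P.eps_nonneg]

lemma Near.abs_ratio_sub_one_le (s : S) :
    |rel b (.inl s) / rel a (.inl s) - 1| ≤ 7 * Q ^ 2 * ε := by
  have hk := h.rel_pos (.inl s)
  have h1 := h.one_le_mul_rel s
  rw [div_sub_one hk.ne', abs_div, abs_of_pos hk, div_le_iff₀ hk, abs_sub_comm]
  refine (h.abs_rel_sub_le P s).trans ?_
  have : 0 ≤ 7 * Q * ε := by have := P.pos; have := P.eps_nonneg; positivity
  nlinarith

lemma Near.ratio_le (s : S) (j : S ⊕ T) : rel b j / rel a (.inl s) ≤ Q * rel b j := by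
  have hk := h.rel_pos (.inl s)
  rw [div_le_iff₀ hk]
  nlinarith [h.one_le_mul_rel s, rel_nonneg b j]

lemma Near.align_nonneg (s : S) : 0 ≤ inner ℝ (dir (a (.inl s))) (dir (b (.inl s))) := by
  linarith [h.le_align s, P.eps_le_one]

lemma Near.sum_rel_mul_le_one : ∑ i, rel a i * rel b i ≤ 1 := by
  by_cases hne : Nonempty (S ⊕ T)
  · obtain ⟨i⟩ := hne
    have h1 := sum_rel_sq (h.famNorm_pos i).ne'
    have h2 := sum_rel_sq (h.symm.famNorm_pos i).ne'
    have : ∀ j, rel a j * rel b j ≤ (rel a j ^ 2 + rel b j ^ 2) / 2 := fun j => by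
      nlinarith [sq_nonneg (rel a j - rel b j)]
    refine (Finset.sum_le_sum fun j _ => this j).trans ?_
    rw [← Finset.sum_div, Finset.sum_add_distrib, h1, h2]; norm_num
  · rw [not_nonempty_iff] at hne
    simp

lemma Near.abs_overlap_le {i j : S ⊕ T} (hij : i ≠ j ∨ i.isRight) :
    |overlap a b i j| ≤ rel a i * ε := by
  have hk := rel_nonneg a i
  have hl := rel_nonneg b j
  rw [overlap_eq, abs_mul, abs_mul, abs_of_nonneg hk, abs_of_nonneg hl, mul_assoc]
  refine mul_le_mul_of_nonneg_left ?_ hk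
  rcases j with s | t
  · have hi : i ≠ .inl s := by
      rcases hij with h1 | h1
      · exact h1
      · rintro rfl; simp at h1
    exact (mul_le_of_le_one_left (abs_nonneg _) (rel_le_one b _)).trans (h.abs_cross_le hi)
  · exact (mul_le_of_le_one_right hl (abs_inner_dir_le _ _)).trans (h.symm.rel_noise_le t)

lemma Near.nearDiag : NearDiag (overlap a b) ε where
  nonneg s := by
    rw [overlap_eq]
    exact mul_nonneg (mul_nonneg (rel_nonneg _ _) (rel_nonneg _ _)) (h.align_nonneg P s)
  sum_le := by
    refine le_trans ?_ (h.sum_rel_mul_le_one P)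
    rw [Fintype.sum_sum_type (fun i => rel a i * rel b i)]
    refine le_trans (Finset.sum_le_sum fun s _ => ?_)
      (le_add_of_nonneg_right (Finset.sum_nonneg fun t _ =>
        mul_nonneg (rel_nonneg _ _) (rel_nonneg _ _)))
    rw [overlap_eq]
    exact mul_le_of_le_one_right (mul_nonneg (rel_nonneg _ _) (rel_nonneg _ _))
      (inner_dir_le _ _)
  off i j := by
    by_cases hij : i ≠ j ∨ i.isRight
    · have e : offDiag (overlap a b) i j = overlap a b i j := by
        unfold offDiag
        rcases hij with h1 | h1
        · simp [h1]
        · rcases i with i | i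
          · simp at h1
          · split_ifs with h2
            · subst h2; simp [sigDiag]
            · simp
      rw [e]
      exact (h.abs_overlap_le P hij).trans
        (mul_le_of_le_one_left P.eps_nonneg (rel_le_one a i))
    · push Not at hij
      obtain ⟨rfl, h1⟩ := hij
      rcases i with i | i
      · simp [offDiag, sigDiag, P.eps_nonneg]
      · simp at h1

/-! ### Size of the gradient -/

variable {K : ℝ} (hK : 0 < K)

section
include hK

lemma abs_resp_le_two (M : S ⊕ T → S ⊕ T → ℝ) (i j : S ⊕ T) : |resp K M i j| ≤ 2 := by
  rw [resp, ← sub_zero (𝔼 x, _), ← Fintype.expect_const (ι := S ⊕ (T ⊕ T) → Bool) (0 : ℝ)]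
  refine abs_expect_sub_le fun x => ?_
  rw [sub_zero, abs_mul, abs_mul, abs_sgn, one_mul]
  have := mul_le_mul (abs_logistic_le_one hK (gap M x)) (abs_tanh_field_sub_sgn_le M x j)
    (abs_nonneg _) zero_le_one
  linarith

lemma abs_grad_le_four (M : S ⊕ T → S ⊕ T → ℝ) (i j : S ⊕ T) : |grad K M i j| ≤ 4 := by
  refine (abs_add_le _ _).trans ?_
  linarith [abs_resp_le_two P h hK M i j, abs_resp_le_two P h hK (fun k l => M l k) j i]

lemma Near.abs_grad_diag_le (s : S) :
    |grad K (overlap a b) (.inl s) (.inl s) + 2 * logistic K (gapDiag (overlap a b)) *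
      (1 - Real.tanh (rel a (.inl s) ^ 2))| ≤ Q ^ 3 * ε := by
  have h1 := (h.nearDiag P).abs_grad_diag_le hK s
  have hQ := P.hQ
  have hε := P.eps_nonneg
  set p := logistic K (gapDiag (overlap a b))
  have hp : |p| ≤ 1 := abs_logistic_le_one hK _
  have h2 : |Real.tanh (rel a (.inl s) ^ 2) - Real.tanh (overlap a b (.inl s) (.inl s))|
      ≤ 8 * Q * ε := by
    refine (abs_tanh_sub_le _ _).trans ?_
    rw [overlap_eq]
    set k := rel a (.inl s)
    set l := rel b (.inl s)
    set ψ := inner ℝ (dir (a (.inl s))) (dir (b (.inl s)))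
    have hk : |k| ≤ 1 := by rw [abs_of_nonneg (rel_nonneg _ _)]; exact rel_le_one _ _
    have hl : |l| ≤ 1 := by rw [abs_of_nonneg (rel_nonneg _ _)]; exact rel_le_one _ _
    have hψ : |1 - ψ| ≤ ε := by
      have h3 : ψ ≤ 1 := inner_dir_le _ _
      rw [abs_of_nonneg (by linarith)]; linarith [h.le_align s]
    have e : k ^ 2 - k * l * ψ = k * ((k - l) + l * (1 - ψ)) := by ring
    rw [e, abs_mul]
    refine (mul_le_of_le_one_left (abs_nonneg _) hk).trans ((abs_add_le _ _).trans ?_)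
    rw [abs_mul]
    have := h.abs_rel_sub_le P s
    have := mul_le_mul hl hψ (abs_nonneg _) zero_le_one
    nlinarith
  have e : grad K (overlap a b) (.inl s) (.inl s)
      + 2 * p * (1 - Real.tanh (rel a (.inl s) ^ 2))
      = (grad K (overlap a b) (.inl s) (.inl s)
        + 2 * p * (1 - Real.tanh (overlap a b (.inl s) (.inl s))))
        - 2 * p * (Real.tanh (rel a (.inl s) ^ 2)
          - Real.tanh (overlap a b (.inl s) (.inl s))) := by ring
  rw [e]
  refine (abs_sub _ _).trans ?_
  have h3 : |2 * p * (Real.tanh (rel a (.inl s) ^ 2)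
          - Real.tanh (overlap a b (.inl s) (.inl s)))| ≤ 2 * 1 * (8 * Q * ε) := by
    rw [abs_mul, abs_mul, abs_two]; gcongr
  have h4 : 10 * (Fintype.card (S ⊕ T) : ℝ) ^ 2 * ε ≤ 10 * Q ^ 2 * ε := by
    have := P.card_le; gcongr
  have s1 := P.step 1 ε hε
  have s2 := P.step 2 ε hε
  have : 0 ≤ Q ^ 2 * ε := by positivity
  simp only [pow_one, Nat.reduceAdd] at s1 s2
  linarith

lemma Near.abs_grad_noise_le (t : T) (j : S ⊕ T) :
    |grad K (overlap a b) (.inr t) j| ≤ Q ^ 2 * ε * rel a (.inr t) := by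
  have h1 := Contrastive.abs_grad_noise_le hK
    (fun k => h.abs_overlap_le P (i := .inr t) (j := k) (Or.inr rfl)) j
  refine h1.trans ?_
  have hk := rel_nonneg a (.inr t)
  have hε := P.eps_nonneg
  have : 7 * (Fintype.card (S ⊕ T) : ℝ) ≤ Q ^ 2 := by nlinarith [P.card_le, P.hQ]
  calc _ ≤ Q ^ 2 * (rel a (.inr t) * ε) := mul_le_mul_of_nonneg_right this (by positivity)
    _ = _ := by ring

lemma Near.abs_grad_noise_le' (t : T) (j : S ⊕ T) :
    |grad K (overlap a b) j (.inr t)| ≤ Q ^ 2 * ε * rel b (.inr t) := by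
  have := h.symm.abs_grad_noise_le P hK t j
  rwa [← overlap_transpose, grad_transpose] at this

lemma Near.exists_grad_noise (t : T) (s : S) :
    ∃ γ : ℝ, 0 ≤ γ ∧ γ ≤ 4 ∧
      |grad K (overlap a b) (.inr t) (.inl s) - γ * overlap a b (.inr t) (.inl s)|
        ≤ Q ^ 4 * ε ^ 2 * rel a (.inr t) := by
  obtain ⟨γ, h1, h2, h3⟩ := (h.nearDiag P).exists_grad_noise hK
    (fun k => h.abs_overlap_le P (i := .inr t) (j := k) (Or.inr rfl)) (.inl s)
  refine ⟨γ, h1, h2, h3.trans ?_⟩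
  have hk := rel_nonneg a (.inr t)
  have hε := P.eps_nonneg
  have : 35 * (Fintype.card (S ⊕ T) : ℝ) ^ 3 ≤ Q ^ 4 := by
    have h5 : (Fintype.card (S ⊕ T) : ℝ) ^ 3 ≤ Q ^ 3 := by
      have := P.card_le; gcongr
    have := P.step 3 1 zero_le_one
    have : 0 ≤ Q ^ 3 := pow_nonneg P.pos.le _
    norm_num at *
    linarith
  calc _ ≤ Q ^ 4 * (ε * (rel a (.inr t) * ε)) := mul_le_mul_of_nonneg_right this (by positivity)
    _ = _ := by ring

lemma Near.exists_grad_signal {s s' : S} (hs : s ≠ s') :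
    ∃ α β : ℝ, 0 ≤ β ∧ β ≤ α ∧ α ≤ 4 ∧
      |grad K (overlap a b) (.inl s) (.inl s') - (α * overlap a b (.inl s) (.inl s')
        + β * overlap a b (.inl s') (.inl s))| ≤ Q ^ 5 * ε ^ 2 ∧
      |grad K (overlap a b) (.inl s') (.inl s) - (α * overlap a b (.inl s') (.inl s)
        + β * overlap a b (.inl s) (.inl s'))| ≤ Q ^ 5 * ε ^ 2 := by
  obtain ⟨α, β, h1, h2, h3, h4, h5⟩ := (h.nearDiag P).exists_grad_signal hK hs
  have : 26 * (Fintype.card (S ⊕ T) : ℝ) ^ 4 * ε ^ 2 ≤ Q ^ 5 * ε ^ 2 := by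
    refine mul_le_mul_of_nonneg_right ?_ (sq_nonneg ε)
    have h5 : (Fintype.card (S ⊕ T) : ℝ) ^ 4 ≤ Q ^ 4 := by
      have := P.card_le; gcongr
    have := P.step 4 1 zero_le_one
    have : 0 ≤ Q ^ 4 := pow_nonneg P.pos.le _
    norm_num at *
    linarith
  exact ⟨α, β, h1, h2, h3, h4.trans this, h5.trans this⟩

lemma Near.abs_grad_signal_le {s s' : S} (hs : s ≠ s') :
    |grad K (overlap a b) (.inl s) (.inl s')| ≤ Q * ε := by
  obtain ⟨α, β, h1, h2, h3, h4, -⟩ := h.exists_grad_signal P hK hs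
  have hne : (Sum.inl s : S ⊕ T) ≠ .inl s' := by simpa using hs
  have e1 : |overlap a b (.inl s) (.inl s')| ≤ ε := (h.abs_overlap_le P (Or.inl hne)).trans
    (mul_le_of_le_one_left P.eps_nonneg (rel_le_one a _))
  have e2 : |overlap a b (.inl s') (.inl s)| ≤ ε := (h.abs_overlap_le P (Or.inl hne.symm)).trans
    (mul_le_of_le_one_left P.eps_nonneg (rel_le_one a _))
  have e3 := P.absorb (k := 5) (by norm_num)
  rw [abs_le] at *
  have hα : 0 ≤ α := h1.trans h2
  have m1 := mul_le_mul_of_nonneg_left e1.1 hα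
  have m2 := mul_le_mul_of_nonneg_left e1.2 hα
  have m3 := mul_le_mul_of_nonneg_left e2.1 h1
  have m4 := mul_le_mul_of_nonneg_left e2.2 h1
  have hε := P.eps_nonneg
  have m5 : α * ε ≤ 4 * ε := mul_le_mul_of_nonneg_right h3 hε
  have m6 : β * ε ≤ 4 * ε := mul_le_mul_of_nonneg_right (h2.trans h3) hε
  have m7 : 100 * ε ≤ Q * ε := mul_le_mul_of_nonneg_right P.hQ hε
  constructor <;> linarith [h4.1, h4.2]

/-- To second order, the pairing sees only the diagonal. -/
lemma Near.abs_pairing_sub_le :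
    |pairing K a b - ∑ s, grad K (overlap a b) (.inl s) (.inl s) *
      overlap a b (.inl s) (.inl s)| ≤ Q ^ 4 * ε ^ 2 := by
  have hε := P.eps_nonneg
  have hQ0 := P.pos.le
  set D : S ⊕ T → ℝ := Sum.elim (fun s => grad K (overlap a b) (.inl s) (.inl s) *
      overlap a b (.inl s) (.inl s)) 0 with hD
  have e0 : ∑ s, grad K (overlap a b) (.inl s) (.inl s) * overlap a b (.inl s) (.inl s)
      = ∑ i, D i := by rw [Fintype.sum_sum_type]; simp [hD]
  have e1 : ∑ i, D i = ∑ i, ∑ j, if i = j then D i else 0 := by simp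
  rw [e0, e1, pairing, ← Finset.sum_sub_distrib]
  have key : ∀ i j, |grad K (overlap a b) i j * overlap a b i j - if i = j then D i else 0|
      ≤ Q ^ 2 * ε ^ 2 := by
    intro i j
    have hk := rel_le_one a i
    have hk0 := rel_nonneg a i
    by_cases hij : i ≠ j ∨ i.isRight
    · have e2 : (if i = j then D i else 0) = 0 := by
        split_ifs with h1
        · rcases i with i | i
          · rcases hij with h2 | h2
            · exact absurd h1 h2
            · simp at h2
          · rfl
        · rfl
      rw [e2, sub_zero, abs_mul]
      have h1 := (h.abs_overlap_le P hij).trans (mul_le_of_le_one_left hε hk)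
      have h2 : |grad K (overlap a b) i j| ≤ Q ^ 2 * ε := by
        rcases i with s | t
        · rcases j with s' | t'
          · have hs : s ≠ s' := by
              rcases hij with h2 | h2
              · simpa using h2
              · simp at h2
            refine (h.abs_grad_signal_le P hK hs).trans ?_
            nlinarith [P.hQ, mul_nonneg hQ0 hε]
          · refine (h.abs_grad_noise_le' P hK t' _).trans ?_
            exact mul_le_of_le_one_right (by positivity) (rel_le_one b _)
        · refine (h.abs_grad_noise_le P hK t _).trans ?_
          exact mul_le_of_le_one_right (by positivity) hk
      calc _ ≤ (Q ^ 2 * ε) * ε := mul_le_mul h2 h1 (abs_nonneg _) (by positivity)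
        _ = _ := by ring
    · push Not at hij
      obtain ⟨rfl, h1⟩ := hij
      rcases i with i | i
      · simp [hD]; positivity
      · simp at h1
  have hrow : ∀ i, |∑ j, grad K (overlap a b) i j * overlap a b i j
      - ∑ j, (if i = j then D i else 0)| ≤ Q * (Q ^ 2 * ε ^ 2) := by
    intro i
    rw [← Finset.sum_sub_distrib]
    exact P.abs_sum_le (by positivity) (key i)
  refine (P.abs_sum_le (by positivity) hrow).trans (le_of_eq (by ring))

/-! ### Size of the couplings -/

lemma Near.abs_couple_diag_sub_le (s : S) :
    |couple K a b (.inl s) (.inl s) - grad K (overlap a b) (.inl s) (.inl s)| ≤ Q ^ 3 * ε := by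
  have e : couple K a b (.inl s) (.inl s) - grad K (overlap a b) (.inl s) (.inl s)
      = grad K (overlap a b) (.inl s) (.inl s) * (rel b (.inl s) / rel a (.inl s) - 1) := by
    unfold couple; ring
  rw [e, abs_mul]
  have := mul_le_mul (abs_grad_le_four P h hK (overlap a b) (.inl s) (.inl s))
    (h.abs_ratio_sub_one_le P s) (abs_nonneg _) (by norm_num)
  have s2 := P.step 2 ε P.eps_nonneg
  have : 0 ≤ Q ^ 2 * ε := mul_nonneg (pow_nonneg P.pos.le _) P.eps_nonneg
  simp only [Nat.reduceAdd] at s2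
  linarith

lemma Near.abs_couple_signal_le {s s' : S} (hs : s ≠ s') :
    |couple K a b (.inl s) (.inl s')| ≤ Q ^ 2 * ε := by
  unfold couple
  rw [abs_mul, abs_of_nonneg (div_nonneg (rel_nonneg _ _) (rel_nonneg _ _))]
  have h1 := h.abs_grad_signal_le P hK hs
  have h2 : rel b (.inl s') / rel a (.inl s) ≤ Q :=
    (h.ratio_le P s _).trans (mul_le_of_le_one_right P.pos.le (rel_le_one _ _))
  have hε := P.eps_nonneg
  have hQ := P.pos.le
  calc _ ≤ Q * ε * Q := mul_le_mul h1 h2 (div_nonneg (rel_nonneg _ _) (rel_nonneg _ _))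
        (by positivity)
    _ = _ := by ring

lemma Near.abs_couple_signal_noise_le (s : S) (t : T) :
    |couple K a b (.inl s) (.inr t)| ≤ Q ^ 3 * ε ^ 2 := by
  unfold couple
  have hl := rel_nonneg b (.inr t)
  have hl1 := h.symm.rel_noise_le t
  have hl2 := rel_le_one b (.inr t)
  rw [abs_mul, abs_of_nonneg (div_nonneg hl (rel_nonneg _ _))]
  have h1 := h.abs_grad_noise_le' P hK t (.inl s)
  have h2 := h.ratio_le P s (.inr t)
  have hε := P.eps_nonneg
  have hQ := P.pos.le
  calc _ ≤ (Q ^ 2 * ε * rel b (.inr t)) * (Q * rel b (.inr t)) :=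
        mul_le_mul h1 h2 (div_nonneg hl (rel_nonneg _ _)) (by positivity)
    _ ≤ (Q ^ 2 * ε * ε) * (Q * 1) := by gcongr
    _ = _ := by ring

lemma Near.abs_couple_noise_le (t : T) (j : S ⊕ T) :
    |couple K a b (.inr t) j| ≤ Q ^ 2 * ε * rel b j := by
  unfold couple
  have hk := h.rel_pos (.inr t)
  have hl := rel_nonneg b j
  rw [abs_mul, abs_of_nonneg (div_nonneg hl hk.le)]
  refine (mul_le_mul_of_nonneg_right (h.abs_grad_noise_le P hK t j)
    (div_nonneg hl hk.le)).trans (le_of_eq ?_)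
  field_simp

lemma Near.abs_couple_noise_signal_le (t : T) (s : S) :
    |couple K a b (.inr t) (.inl s)| ≤ Q ^ 2 * ε :=
  (h.abs_couple_noise_le P hK t _).trans (mul_le_of_le_one_right
    (mul_nonneg (pow_nonneg P.pos.le _) P.eps_nonneg) (rel_le_one _ _))

lemma Near.abs_couple_noise_noise_le (t t' : T) :
    |couple K a b (.inr t) (.inr t')| ≤ Q ^ 2 * ε ^ 2 := by
  refine (h.abs_couple_noise_le P hK t _).trans ?_
  have := mul_le_mul_of_nonneg_left (h.symm.rel_noise_le t')
    (mul_nonneg (pow_nonneg P.pos.le 2) P.eps_nonneg)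
  refine this.trans (le_of_eq (by ring))

end

end NearLemmas
end State

end Contrastive

namespace Contrastive

section State
variable {S T : Type*} [Fintype S] [Fintype T] [DecidableEq S] [DecidableEq T]
variable {E : Type*} [NormedAddCommGroup E] [InnerProductSpace ℝ E]
variable {a b : S ⊕ T → E} {Q ε : ℝ} (P : Params S T Q ε) (h : Near a b Q ε)
variable {K : ℝ} (hK : 0 < K)

include P

lemma Params.abs_mul_mul_le {x c : ℝ} (hx : |x| ≤ ε) (hc0 : 0 ≤ c) (hc : c ≤ 4)
    {y : ℝ} (hy : |y| ≤ 7 * Q ^ 2 * ε) : |c * x * y| ≤ Q ^ 3 * ε ^ 2 := by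
  rw [abs_mul, abs_mul, abs_of_nonneg hc0]
  have hε := P.eps_nonneg
  have hQ := P.pos
  calc c * |x| * |y| ≤ 4 * ε * (7 * Q ^ 2 * ε) := by gcongr
    _ ≤ Q ^ 3 * ε ^ 2 := by
      have := P.step 2 (ε ^ 2) (sq_nonneg ε)
      simp only [Nat.reduceAdd] at this
      have : 0 ≤ Q ^ 2 * ε ^ 2 := by positivity
      nlinarith

include h

/-- The coupling between two signals, from the expansion of the gradient. -/
lemma Near.abs_couple_sub_le {s s' : S} (hs : s ≠ s') {α β : ℝ} (hα : 0 ≤ α) (hα4 : α ≤ 4)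
    (hβ : 0 ≤ β) (hβ4 : β ≤ 4)
    (hG : |grad K (overlap a b) (.inl s) (.inl s') - (α * overlap a b (.inl s) (.inl s')
        + β * overlap a b (.inl s') (.inl s))| ≤ Q ^ 5 * ε ^ 2) :
    |couple K a b (.inl s) (.inl s') - rel a (.inl s') * rel b (.inl s') *
      (α * inner ℝ (dir (a (.inl s))) (dir (b (.inl s')))
        + β * inner ℝ (dir (a (.inl s'))) (dir (b (.inl s))))| ≤ Q ^ 7 * ε ^ 2 := by
  have hne : (Sum.inl s : S ⊕ T) ≠ .inl s' := by simpa using hs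
  have hX := h.abs_cross_le (i := .inl s) (s := s') hne
  have hY := h.abs_cross_le (i := .inl s') (s := s) hne.symm
  have hr := h.abs_ratio_sub_one_le P s
  have hr' := h.abs_rel_sub_le P s'
  have hrat : rel b (.inl s') / rel a (.inl s) ≤ Q :=
    (h.ratio_le P s _).trans (mul_le_of_le_one_right P.pos.le (rel_le_one _ _))
  rw [overlap_eq, overlap_eq] at hG
  unfold couple
  have hk := h.rel_pos (.inl s)
  have hk' := rel_le_one a (.inl s')
  have hk0' := rel_nonneg a (.inl s')
  have hl' := rel_le_one b (.inl s')
  have hl0' := rel_nonneg b (.inl s')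
  set k := rel a (.inl s)
  set k' := rel a (.inl s')
  set l := rel b (.inl s)
  set l' := rel b (.inl s')
  set X := inner ℝ (dir (a (.inl s))) (dir (b (.inl s')))
  set Y := inner ℝ (dir (a (.inl s'))) (dir (b (.inl s)))
  set G := grad K (overlap a b) (.inl s) (.inl s')
  have hQ := P.pos
  have hε := P.eps_nonneg
  have e : G * (l' / k) - k' * l' * (α * X + β * Y)
      = (G - (α * (k * l' * X) + β * (k' * l * Y))) * (l' / k)
        + (α * X * (l' * (l' - k')) + β * Y * (k' * l' * (l / k - 1))) := by
    field_simp; ring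
  rw [e]
  have b1 : |(G - (α * (k * l' * X) + β * (k' * l * Y))) * (l' / k)| ≤ Q ^ 6 * ε ^ 2 := by
    rw [abs_mul, abs_of_nonneg (div_nonneg hl0' hk.le)]
    calc _ ≤ (Q ^ 5 * ε ^ 2) * Q := mul_le_mul hG hrat (div_nonneg hl0' hk.le) (by positivity)
      _ = _ := by ring
  have b2 : |α * X * (l' * (l' - k'))| ≤ Q ^ 3 * ε ^ 2 := by
    refine P.abs_mul_mul_le hX hα hα4 ?_
    rw [abs_mul, abs_of_nonneg hl0', abs_sub_comm]
    refine (mul_le_of_le_one_left (abs_nonneg _) hl').trans (hr'.trans ?_)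
    nlinarith [P.hQ, mul_nonneg hQ.le hε]
  have b3 : |β * Y * (k' * l' * (l / k - 1))| ≤ Q ^ 3 * ε ^ 2 := by
    refine P.abs_mul_mul_le hY hβ hβ4 ?_
    rw [abs_mul, abs_of_nonneg (mul_nonneg hk0' hl0')]
    exact (mul_le_of_le_one_left (abs_nonneg _) (mul_le_one₀ hk' hl0' hl')).trans hr
  have s1 := P.mono (k := 3) (l := 6) (by norm_num) (sq_nonneg ε)
  have s2 := P.step 6 (ε ^ 2) (sq_nonneg ε)
  have : 0 ≤ Q ^ 6 * ε ^ 2 := by positivity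
  simp only [Nat.reduceAdd] at s2
  have t1 := abs_add_le ((G - (α * (k * l' * X) + β * (k' * l * Y))) * (l' / k))
    (α * X * (l' * (l' - k')) + β * Y * (k' * l' * (l / k - 1)))
  have t2 := abs_add_le (α * X * (l' * (l' - k'))) (β * Y * (k' * l' * (l / k - 1)))
  linarith

include hK

/-- The couplings of one signal to another, in both families, share two nonnegative coefficients. -/
lemma Near.exists_couple_signal {s s' : S} (hs : s ≠ s') :
    ∃ α β : ℝ, 0 ≤ β ∧ β ≤ α ∧ α ≤ 4 ∧
      |couple K a b (.inl s) (.inl s') - rel a (.inl s') * rel b (.inl s') *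
        (α * inner ℝ (dir (a (.inl s))) (dir (b (.inl s')))
        + β * inner ℝ (dir (a (.inl s'))) (dir (b (.inl s))))| ≤ Q ^ 7 * ε ^ 2 ∧
      |couple K b a (.inl s) (.inl s') - rel a (.inl s') * rel b (.inl s') *
        (α * inner ℝ (dir (a (.inl s'))) (dir (b (.inl s)))
        + β * inner ℝ (dir (a (.inl s))) (dir (b (.inl s'))))| ≤ Q ^ 7 * ε ^ 2 := by
  obtain ⟨α, β, hβ, hβα, hα, h1, h2⟩ := h.exists_grad_signal P hK hs
  have hα0 := hβ.trans hβα
  have hβ4 := hβα.trans hα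
  refine ⟨α, β, hβ, hβα, hα, h.abs_couple_sub_le P hs hα0 hα hβ hβ4 h1, ?_⟩
  have := h.symm.abs_couple_sub_le P (K := K) hs hα0 hα hβ hβ4 (by
    rw [← overlap_transpose, grad_transpose]
    exact h2)
  rw [real_inner_comm _ (dir (b (.inl s))), real_inner_comm _ (dir (b (.inl s'))),
    mul_comm (rel b (.inl s'))] at this
  exact this

/-- The coupling of a noise to a signal is a nonnegative multiple of their correlation. -/
lemma Near.exists_couple_noise (t : T) (s : S) :
    ∃ c : ℝ, 0 ≤ c ∧ |couple K a b (.inr t) (.inl s)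
      - c * inner ℝ (dir (a (.inr t))) (dir (b (.inl s)))| ≤ Q ^ 4 * ε ^ 2 := by
  obtain ⟨γ, h0, -, h1⟩ := h.exists_grad_noise P hK t s
  refine ⟨γ * rel b (.inl s) ^ 2, by positivity, ?_⟩
  have hk := h.rel_pos (.inr t)
  have hl := rel_nonneg b (.inl s)
  have hl1 := rel_le_one b (.inl s)
  rw [overlap_eq] at h1
  unfold couple
  have e : ∀ G X : ℝ, G * (rel b (.inl s) / rel a (.inr t)) - γ * rel b (.inl s) ^ 2 * X
      = (G - γ * (rel a (.inr t) * rel b (.inl s) * X)) * (rel b (.inl s) / rel a (.inr t)) := by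
    intro G X; field_simp
  rw [e, abs_mul, abs_of_nonneg (div_nonneg hl hk.le)]
  calc _ ≤ (Q ^ 4 * ε ^ 2 * rel a (.inr t)) * (1 / rel a (.inr t)) := by
        have := P.pos; gcongr
    _ = _ := by field_simp

/-! ### Testing the velocity of directions -/

/-- The velocity of the direction of a signal, tested against a vector that is nearly orthogonal to
all vectors except possibly those with index `j`. -/
lemma Near.abs_inner_rateDir_signal_le {s : S} {j : S ⊕ T} (hj : j ≠ .inl s) {z : E}
    (hz : ‖z‖ ≤ 1) (hA : |inner ℝ (dir (a (.inl s))) z| ≤ ε)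
    (hB : ∀ s' : S, .inl s' ≠ j → |inner ℝ (dir (b (.inl s'))) z| ≤ ε) :
    |inner ℝ (rateDir K a b (.inl s)) z
      - (-grad K (overlap a b) (.inl s) (.inl s) *
          (inner ℝ (dir (b (.inl s))) z - inner ℝ (dir (a (.inl s))) z)
        - couple K a b (.inl s) j * inner ℝ (dir (b j)) z)| ≤ Q ^ 5 * ε ^ 2 := by
  have hε := P.eps_nonneg
  have hε1 := P.eps_le_one
  have hQ := P.pos
  have hQ1 := P.hQ
  set x := inner ℝ (dir (a (.inl s))) z
  set g := grad K (overlap a b) (.inl s) (.inl s)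
  have expand : inner ℝ (rateDir K a b (.inl s)) z = -∑ i, couple K a b (.inl s) i *
      (inner ℝ (dir (b i)) z - inner ℝ (dir (b i)) (dir (a (.inl s))) * x) := by
    rw [rateDir, inner_neg_left, sum_inner]
    simp only [real_inner_smul_left, inner_sub_left, x]
  have e2 : g * (inner ℝ (dir (b (.inl s))) z - x) + couple K a b (.inl s) j * inner ℝ (dir (b j)) z
      = ∑ i, ((if i = .inl s then g * (inner ℝ (dir (b (.inl s))) z - x) else 0)
        + (if i = j then couple K a b (.inl s) j * inner ℝ (dir (b j)) z else 0)) := by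
    rw [Finset.sum_add_distrib]; simp
  have e3 : inner ℝ (rateDir K a b (.inl s)) z
      - (-g * (inner ℝ (dir (b (.inl s))) z - x) - couple K a b (.inl s) j * inner ℝ (dir (b j)) z)
      = -∑ i, (couple K a b (.inl s) i *
          (inner ℝ (dir (b i)) z - inner ℝ (dir (b i)) (dir (a (.inl s))) * x)
        - ((if i = .inl s then g * (inner ℝ (dir (b (.inl s))) z - x) else 0)
        + (if i = j then couple K a b (.inl s) j * inner ℝ (dir (b j)) z else 0))) := by
    rw [Finset.sum_sub_distrib, ← e2, expand]; ring
  rw [e3, abs_neg]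
  have hzb : ∀ i, |inner ℝ (dir (b i)) z| ≤ 1 := fun i =>
    (abs_real_inner_le_norm _ _).trans (mul_le_one₀ (norm_dir_le _) (norm_nonneg _) hz)
  have hba : ∀ i, |inner ℝ (dir (b i)) (dir (a (.inl s)))| ≤ 1 := fun i => abs_inner_dir_le _ _
  have s3 := P.step 3 (ε ^ 2) (sq_nonneg ε)
  have s30 : 0 ≤ Q ^ 3 * ε ^ 2 := by positivity
  simp only [Nat.reduceAdd] at s3
  have m23 := P.mono (k := 2) (l := 3) (by norm_num) (sq_nonneg ε)
  have m03 := P.mono (k := 0) (l := 3) (by norm_num) (sq_nonneg ε)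
  rw [pow_zero, one_mul] at m03
  refine (P.abs_sum_le (x := Q ^ 4 * ε ^ 2) (by positivity) fun i => ?_).trans
    (le_of_eq (by ring))
  have hzz := hzb i
  have hbb := hba i
  rcases i with s' | t
  · by_cases hs : s' = s
    · subst hs
      rw [if_pos rfl, if_neg hj.symm, add_zero]
      have hd := h.abs_couple_diag_sub_le P hK s'
      have hg := abs_grad_le_four P h hK (overlap a b) (.inl s') (.inl s')
      have hψ : |1 - inner ℝ (dir (b (.inl s'))) (dir (a (.inl s')))| ≤ ε := by
        have h3 : inner ℝ (dir (b (.inl s'))) (dir (a (.inl s'))) ≤ 1 := inner_dir_le _ _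
        rw [abs_of_nonneg (by linarith)]; linarith [h.symm.le_align s']
      have hy := hB s' hj.symm
      set y := inner ℝ (dir (b (.inl s'))) z
      set ψ := inner ℝ (dir (b (.inl s'))) (dir (a (.inl s')))
      set ω := couple K a b (.inl s') (.inl s')
      have e4 : ω * (y - ψ * x) - g * (y - x) = (ω - g) * (y - ψ * x) + g * ((1 - ψ) * x) := by
        ring
      rw [e4]
      refine (abs_add_le _ _).trans ?_
      rw [abs_mul, abs_mul g, abs_mul (1 - ψ)]
      have h1 : |y - ψ * x| ≤ 2 * ε := by
        refine (abs_sub _ _).trans ?_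
        rw [abs_mul]
        have := mul_le_mul hbb hA (abs_nonneg _) zero_le_one
        linarith
      have h2 := mul_le_mul hd h1 (abs_nonneg _) (by positivity)
      have h3 := mul_le_mul hg (mul_le_mul hψ hA (abs_nonneg _) hε) (by positivity) (by norm_num)
      nlinarith
    · have hne : (Sum.inl s' : S ⊕ T) ≠ .inl s := by simpa using hs
      rw [if_neg hne, zero_add]
      have hw := h.abs_couple_signal_le P hK (Ne.symm hs)
      have hc := h.symm.abs_cross_le hne
      have h1 := mul_le_mul hc hA (abs_nonneg _) hε
      rw [← abs_mul] at h1
      split_ifs with h2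
      · subst h2
        rw [mul_sub, sub_sub_cancel_left, abs_neg, abs_mul]
        have := mul_le_mul hw h1 (abs_nonneg _) (by positivity)
        have : Q ^ 2 * ε * (ε * ε) ≤ Q ^ 2 * ε * (ε * 1) := by gcongr
        nlinarith
      · rw [sub_zero, abs_mul]
        have hy := hB s' h2
        have h3 : |inner ℝ (dir (b (.inl s'))) z
            - inner ℝ (dir (b (.inl s'))) (dir (a (.inl s))) * x| ≤ 2 * ε := by
          refine (abs_sub _ _).trans ?_
          have : ε * ε ≤ ε * 1 := by gcongr
          linarith
        have := mul_le_mul hw h3 (abs_nonneg _) (by positivity)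
        nlinarith
  · rw [if_neg (by simp), zero_add]
    have hw := h.abs_couple_signal_noise_le P hK s t
    have h1 := mul_le_mul hbb hA (abs_nonneg _) zero_le_one
    rw [← abs_mul, one_mul] at h1
    split_ifs with h2
    · subst h2
      rw [mul_sub, sub_sub_cancel_left, abs_neg, abs_mul]
      have := mul_le_mul hw (h1.trans hε1) (abs_nonneg _) (by positivity)
      linarith
    · rw [sub_zero, abs_mul]
      have h3 : |inner ℝ (dir (b (.inr t))) z
          - inner ℝ (dir (b (.inr t))) (dir (a (.inl s))) * x| ≤ 2 := by
        refine (abs_sub _ _).trans ?_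
        linarith
      have := mul_le_mul hw h3 (abs_nonneg _) (by positivity)
      linarith

/-- The velocity of the direction of a noise, tested against a vector that is nearly orthogonal to
all signals except possibly the one with index `j`. -/
lemma Near.abs_inner_rateDir_noise_le {t : T} (j : S ⊕ T) {z : E} (hz : ‖z‖ ≤ 1)
    (hB : ∀ s' : S, .inl s' ≠ j → |inner ℝ (dir (b (.inl s'))) z| ≤ ε) :
    |inner ℝ (rateDir K a b (.inr t)) z
      + couple K a b (.inr t) j * inner ℝ (dir (b j)) z| ≤ Q ^ 4 * ε ^ 2 := by
  have hε := P.eps_nonneg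
  have hε1 := P.eps_le_one
  have hQ := P.pos
  have hQ1 := P.hQ
  set x := inner ℝ (dir (a (.inr t))) z
  have hx : |x| ≤ 1 :=
    (abs_real_inner_le_norm _ _).trans (mul_le_one₀ (norm_dir_le _) (norm_nonneg _) hz)
  have e3 : inner ℝ (rateDir K a b (.inr t)) z + couple K a b (.inr t) j * inner ℝ (dir (b j)) z
      = -∑ i, (couple K a b (.inr t) i *
          (inner ℝ (dir (b i)) z - inner ℝ (dir (b i)) (dir (a (.inr t))) * x)
        - (if i = j then couple K a b (.inr t) j * inner ℝ (dir (b j)) z else 0)) := by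
    rw [Finset.sum_sub_distrib, rateDir, inner_neg_left, sum_inner]
    simp only [real_inner_smul_left, inner_sub_left, x, Finset.sum_ite_eq', Finset.mem_univ,
      if_true]
    ring
  rw [e3, abs_neg]
  have hzb : ∀ i, |inner ℝ (dir (b i)) z| ≤ 1 := fun i =>
    (abs_real_inner_le_norm _ _).trans (mul_le_one₀ (norm_dir_le _) (norm_nonneg _) hz)
  have hba : ∀ i, |inner ℝ (dir (b i)) (dir (a (.inr t)))| ≤ 1 := fun i => abs_inner_dir_le _ _
  have s2 := P.step 2 (ε ^ 2) (sq_nonneg ε)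
  have s20 : 0 ≤ Q ^ 2 * ε ^ 2 := by positivity
  simp only [Nat.reduceAdd] at s2
  refine (P.abs_sum_le (x := Q ^ 3 * ε ^ 2) (by positivity) fun i => ?_).trans
    (le_of_eq (by ring))
  have hzz := hzb i
  have hbb := hba i
  rcases i with s' | t'
  · have hw := h.abs_couple_noise_signal_le P hK t s'
    have hc : |inner ℝ (dir (b (.inl s'))) (dir (a (.inr t)))| ≤ ε := by
      rw [real_inner_comm]; exact h.abs_cross_le (by simp)
    have h1 := mul_le_mul hc hx (abs_nonneg _) hε
    rw [← abs_mul, mul_one] at h1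
    split_ifs with h2
    · subst h2
      rw [mul_sub, sub_sub_cancel_left, abs_neg, abs_mul]
      have := mul_le_mul hw h1 (abs_nonneg _) (by positivity)
      nlinarith
    · rw [sub_zero, abs_mul]
      have hy := hB s' h2
      have h3 : |inner ℝ (dir (b (.inl s'))) z
          - inner ℝ (dir (b (.inl s'))) (dir (a (.inr t))) * x| ≤ 2 * ε := by
        refine (abs_sub _ _).trans ?_
        linarith
      have := mul_le_mul hw h3 (abs_nonneg _) (by positivity)
      nlinarith
  · have hw := h.abs_couple_noise_noise_le P hK t t'
    have h1 := mul_le_mul hbb hx (abs_nonneg _) zero_le_one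
    rw [← abs_mul, one_mul] at h1
    split_ifs with h2
    · subst h2
      rw [mul_sub, sub_sub_cancel_left, abs_neg, abs_mul]
      have := mul_le_mul hw h1 (abs_nonneg _) (by positivity)
      linarith
    · rw [sub_zero, abs_mul]
      have h3 : |inner ℝ (dir (b (.inr t'))) z
          - inner ℝ (dir (b (.inr t'))) (dir (a (.inr t))) * x| ≤ 2 := by
        refine (abs_sub _ _).trans ?_
        linarith
      have := mul_le_mul hw h3 (abs_nonneg _) (by positivity)
      linarith

/-! ### Logarithmic derivatives of the norms -/

lemma Near.abs_rateLog_signal_le (s : S) :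
    |rateLog K a b (.inl s) - (pairing K a b - grad K (overlap a b) (.inl s) (.inl s) *
      inner ℝ (dir (a (.inl s))) (dir (b (.inl s))) * (rel b (.inl s) / rel a (.inl s)))|
      ≤ Q ^ 4 * ε ^ 2 := by
  have hε := P.eps_nonneg
  have hε1 := P.eps_le_one
  have hQ := P.pos
  have hQ1 := P.hQ
  have e : rateLog K a b (.inl s) - (pairing K a b - grad K (overlap a b) (.inl s) (.inl s) *
      inner ℝ (dir (a (.inl s))) (dir (b (.inl s))) * (rel b (.inl s) / rel a (.inl s)))
      = -∑ i, (if i = .inl s then 0 else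
        couple K a b (.inl s) i * inner ℝ (dir (b i)) (dir (a (.inl s)))) := by
    have e1 : ∀ i, (if i = .inl s then 0 else
        couple K a b (.inl s) i * inner ℝ (dir (b i)) (dir (a (.inl s))))
        = couple K a b (.inl s) i * inner ℝ (dir (b i)) (dir (a (.inl s)))
          - if i = .inl s then
            couple K a b (.inl s) i * inner ℝ (dir (b i)) (dir (a (.inl s))) else 0 := by
      intro i; split_ifs <;> ring
    simp only [e1, Finset.sum_sub_distrib, Finset.sum_ite_eq', Finset.mem_univ, if_true]
    rw [rateLog, couple, real_inner_comm (dir (b (.inl s)))]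
    ring
  rw [e, abs_neg]
  refine (P.abs_sum_le (x := Q ^ 3 * ε ^ 2) (by positivity) fun i => ?_).trans
    (le_of_eq (by ring))
  split_ifs with h1
  · rw [abs_zero]; positivity
  · rw [abs_mul]
    rcases i with s' | t
    · have hw := h.abs_couple_signal_le P hK (s := s) (s' := s') (by rintro rfl; exact h1 rfl)
      have := mul_le_mul hw (h.symm.abs_cross_le h1) (abs_nonneg _) (by positivity)
      have m := P.mono (k := 2) (l := 3) (by norm_num) (sq_nonneg ε)
      nlinarith
    · have hw := h.abs_couple_signal_noise_le P hK s t
      have := mul_le_mul hw (abs_inner_dir_le (b (.inr t)) (a (.inl s))) (abs_nonneg _)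
        (by positivity)
      linarith

lemma Near.abs_rateLog_noise_le (t : T) :
    |rateLog K a b (.inr t) - pairing K a b| ≤ Q ^ 3 * ε ^ 2 := by
  have hε := P.eps_nonneg
  have hQ := P.pos
  rw [rateLog, sub_sub_cancel_left, abs_neg]
  refine (P.abs_sum_le (x := Q ^ 2 * ε ^ 2) (by positivity) fun i => ?_).trans
    (le_of_eq (by ring))
  rw [abs_mul]
  rcases i with s' | t'
  · have hw := h.abs_couple_noise_signal_le P hK t s'
    have hc : |inner ℝ (dir (b (.inl s'))) (dir (a (.inr t)))| ≤ ε := by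
      rw [real_inner_comm]; exact h.abs_cross_le (by simp)
    have := mul_le_mul hw hc (abs_nonneg _) (by positivity)
    nlinarith
  · have hw := h.abs_couple_noise_noise_le P hK t t'
    have := mul_le_mul hw (abs_inner_dir_le (b (.inr t')) (a (.inr t))) (abs_nonneg _)
      (by positivity)
    linarith

end State
end Contrastive

namespace Contrastive

/-! ### Contraction of the correlations -/

section State
variable {S T : Type*} [Fintype S] [Fintype T] [DecidableEq S] [DecidableEq T]
variable {E : Type*} [NormedAddCommGroup E] [InnerProductSpace ℝ E]

/-- The strengths lie in `[1, L]` and the two families are not small. -/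
structure Scaled (σ : S ⊕ T → ℝ) (a b : S ⊕ T → E) (L : ℝ) : Prop where
  one_le : ∀ i, 1 ≤ σ i
  le : ∀ i, σ i ≤ L
  left : 1 ≤ 2 * famNorm a
  right : 1 ≤ 2 * famNorm b

/-- The velocity of the direction of `a i`. -/
noncomputable def velDir (K : ℝ) (σ : S ⊕ T → ℝ) (a b : S ⊕ T → E) (i : S ⊕ T) : E :=
  (σ i / famNorm a ^ 2) • rateDir K a b i

/-- A time scale for the vectors with index `i` that is symmetric in the two families. -/
noncomputable def speed (σ : S ⊕ T → ℝ) (a b : S ⊕ T → E) (i : S ⊕ T) : ℝ :=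
  σ i / (famNorm a * famNorm b)

lemma speed_comm (σ : S ⊕ T → ℝ) (a b : S ⊕ T → E) (i : S ⊕ T) :
    speed σ b a i = speed σ a b i := by
  unfold speed; rw [mul_comm]

lemma grad_overlap_comm (K : ℝ) (a b : S ⊕ T → E) (i : S ⊕ T) :
    grad K (overlap b a) i i = grad K (overlap a b) i i := by
  rw [← overlap_transpose, grad_transpose]

/-- The signs `1` and `-1`. -/
def boolSign (η : Bool) : ℝ := if η then 1 else -1

/-- The sum (for `true`) or difference (for `false`) of the two directions with index `i`. -/
noncomputable def comb (a b : S ⊕ T → E) (η : Bool) (i : S ⊕ T) : E :=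
  dir (a i) + boolSign η • dir (b i)

/-- The velocity of `comb`. -/
noncomputable def velComb (K : ℝ) (σ : S ⊕ T → ℝ) (a b : S ⊕ T → E) (η : Bool) (i : S ⊕ T) : E :=
  velDir K σ a b i + boolSign η • velDir K σ b a i

namespace Scaled
variable {σ : S ⊕ T → ℝ} {a b : S ⊕ T → E} {L : ℝ} (Sc : Scaled σ a b L)
include Sc

lemma symm : Scaled σ b a L := ⟨Sc.one_le, Sc.le, Sc.right, Sc.left⟩

lemma L_pos (i : S ⊕ T) : 0 < L := zero_lt_one.trans_le ((Sc.one_le i).trans (Sc.le i))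

lemma pos_left : 0 < famNorm a := by linarith [Sc.left]

lemma speed_pos (i : S ⊕ T) : 0 < speed σ a b i :=
  div_pos (zero_lt_one.trans_le (Sc.one_le i)) (mul_pos Sc.pos_left Sc.symm.pos_left)

lemma div_sq_le (i : S ⊕ T) : σ i / famNorm a ^ 2 ≤ 4 * L := by
  rw [div_le_iff₀ (pow_pos Sc.pos_left 2)]
  have := Sc.le i
  have := Sc.L_pos i
  have : 1 ≤ (2 * famNorm a) ^ 2 := one_le_pow₀ Sc.left
  nlinarith

lemma div_sq_pos (i : S ⊕ T) : 0 < σ i / famNorm a ^ 2 :=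
  div_pos (zero_lt_one.trans_le (Sc.one_le i)) (pow_pos Sc.pos_left 2)

lemma speed_le (i : S ⊕ T) : speed σ a b i ≤ 4 * L := by
  unfold speed
  rw [div_le_iff₀ (mul_pos Sc.pos_left Sc.symm.pos_left)]
  have := Sc.le i
  have := Sc.L_pos i
  have : 1 ≤ (2 * famNorm a) * (2 * famNorm b) := one_le_mul_of_one_le_of_one_le Sc.left Sc.right
  nlinarith

end Scaled

variable {a b : S ⊕ T → E} {Q ε : ℝ} (P : Params S T Q ε) (h : Near a b Q ε)
variable {K : ℝ} (hK : 0 < K) {σ : S ⊕ T → ℝ} {L : ℝ} (Sc : Scaled σ a b L) (hL : L ≤ Q)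
  (hκ : 1 ≤ Q * logistic K (-1))

lemma tanh_sub_tanh (x y : ℝ) :
    Real.tanh x - Real.tanh y = Real.sinh (x - y) / (Real.cosh x * Real.cosh y) := by
  have := (Real.cosh_pos x).ne'
  have := (Real.cosh_pos y).ne'
  rw [Real.tanh_eq_sinh_div_cosh, Real.tanh_eq_sinh_div_cosh, Real.sinh_sub]
  field_simp

lemma tanh_mono {x y : ℝ} (hxy : x ≤ y) : Real.tanh x ≤ Real.tanh y := by
  rw [← sub_nonneg, tanh_sub_tanh]
  exact div_nonneg (Real.sinh_nonneg_iff.2 (sub_nonneg.2 hxy))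
    (mul_pos (Real.cosh_pos y) (Real.cosh_pos x)).le

lemma cosh_one_le : Real.cosh 1 ≤ 8 / 5 := by
  rw [Real.cosh_eq]
  have e1 : Real.exp 1 * Real.exp (-1) = 1 := by rw [← Real.exp_add]; simp
  have e2 := Real.exp_one_lt_d9
  have e5 := Real.exp_one_gt_d9
  have e4 := Real.exp_pos (-1)
  nlinarith

lemma le_tanh_sub_tanh {x y : ℝ} (hy : 0 ≤ y) (hxy : y ≤ x) (hx : x ≤ 1) :
    (x - y) / 3 ≤ Real.tanh x - Real.tanh y := by
  rw [tanh_sub_tanh]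
  have h1 : ∀ z, 0 ≤ z → z ≤ 1 → Real.cosh z ≤ 8 / 5 := fun z h0 h1 =>
    (Real.cosh_le_cosh.2 (by rwa [abs_of_nonneg h0, abs_one])).trans cosh_one_le
  have h2 : Real.cosh x * Real.cosh y ≤ 3 :=
    (mul_le_mul (h1 x (hy.trans hxy) hx) (h1 y hy (hxy.trans hx)) (Real.cosh_pos y).le
      (by norm_num)).trans (by norm_num)
  exact div_le_div₀ (Real.sinh_nonneg_iff.2 (sub_nonneg.2 hxy))
    (Real.self_le_sinh_iff.2 (sub_nonneg.2 hxy)) (mul_pos (Real.cosh_pos x) (Real.cosh_pos y)) h2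

lemma one_sub_tanh_ge {x : ℝ} (hx : x ≤ 1) : 1 / 5 ≤ 1 - Real.tanh x := by
  have h1 : Real.tanh x ≤ Real.tanh 1 := tanh_mono hx
  have h2 : Real.tanh 1 ≤ 4 / 5 := by
    rw [Real.tanh_eq_sinh_div_cosh, div_le_div_iff₀ (Real.cosh_pos 1) (by norm_num),
      Real.sinh_eq, Real.cosh_eq]
    have e1 : Real.exp 1 * Real.exp (-1) = 1 := by rw [← Real.exp_add]; simp
    have e2 := Real.exp_one_lt_d9
    have e3 := Real.exp_pos 1
    have e4 := Real.exp_pos (-1)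
    nlinarith
  linarith

section
include P h

/-- The gradient on the diagonal is negative, uniformly. -/
lemma Near.le_neg_grad (hK : 0 < K) (hκ : 1 ≤ Q * logistic K (-1)) (s : S) :
    3 / 10 * logistic K (-1) ≤ -grad K (overlap a b) (.inl s) (.inl s) := by
  have h1 := abs_le.1 (h.abs_grad_diag_le P hK s)
  have h2 : logistic K (-1) ≤ logistic K (gapDiag (overlap a b)) :=
    logistic_mono hK (h.nearDiag P).gapDiag_ge
  have h3 := one_sub_tanh_ge (x := rel a (.inl s) ^ 2)
    (pow_le_one₀ (rel_nonneg _ _) (rel_le_one _ _))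
  have h4 := logistic_pos hK (-1)
  have h5 := mul_le_mul h2 h3 (by norm_num) (h4.le.trans h2)
  have h6 := P.pow_eps_le (k := 5) (by norm_num)
  have h7 := P.step 3 ε P.eps_nonneg
  have h8 : Q ^ 4 * ε ≤ logistic K (-1) := by
    have e : Q ^ 5 * ε = Q * (Q ^ 4 * ε) := by ring
    rw [e] at h6
    exact le_of_mul_le_mul_left (h6.trans hκ) P.pos
  simp only [Nat.reduceAdd] at h7
  linarith [h1.2]

end

include P h Sc hL

/-- Passing from tested rates to tested velocities. -/
lemma Near.abs_inner_velDir_sub_le {i : S ⊕ T} {z : E} {m : ℝ}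
    (h1 : |inner ℝ (rateDir K a b i) z - m| ≤ Q ^ 8 * ε ^ 2) (h2 : |m| ≤ Q ^ 3 * ε) :
    |inner ℝ (velDir K σ a b i) z - speed σ a b i * m| ≤ Q ^ 10 * ε ^ 2 := by
  have hn := Sc.pos_left
  have hN := Sc.symm.pos_left
  have hρ := Sc.speed_le i
  have hρ0 := Sc.speed_pos i
  have hQ := P.pos
  have hε := P.eps_nonneg
  have hr := h.abs_famNorm_sub_le P i
  have hr' : |famNorm b / famNorm a - 1| ≤ 6 * Q * ε := by
    rw [div_sub_one hn.ne', abs_div, abs_of_pos hn, div_le_iff₀ hn, abs_sub_comm]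
    exact hr
  set w := inner ℝ (rateDir K a b i) z
  have e : inner ℝ (velDir K σ a b i) z - speed σ a b i * m
      = speed σ a b i * ((w - m) + (famNorm b / famNorm a - 1) * w) := by
    unfold velDir speed
    rw [real_inner_smul_left]
    field_simp
    ring
  have hw : |w| ≤ 2 * (Q ^ 3 * ε) := by
    have e1 : Q ^ 8 * ε ^ 2 = (Q ^ 8 * ε) * ε := by ring
    have e2 := mul_le_mul_of_nonneg_right (P.pow_eps_le (k := 8) (by norm_num)) hε
    have e3 := P.mono (k := 0) (l := 3) (by norm_num) hε
    have : |w| ≤ |w - m| + |m| := by simpa using abs_add_le (w - m) m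
    rw [pow_zero] at e3
    linarith
  rw [e, abs_mul, abs_of_pos hρ0]
  have s8 := P.step 8 (ε ^ 2) (sq_nonneg ε)
  have s9 := P.step 4 (ε ^ 2) (sq_nonneg ε)
  have m9 := P.mono (k := 5) (l := 8) (by norm_num) (sq_nonneg ε)
  have p8 : 0 ≤ Q ^ 8 * ε ^ 2 := by positivity
  simp only [Nat.reduceAdd] at s8 s9
  have h3 : |(w - m) + (famNorm b / famNorm a - 1) * w| ≤ 2 * (Q ^ 8 * ε ^ 2) := by
    refine (abs_add_le _ _).trans ?_
    rw [abs_mul]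
    have := mul_le_mul hr' hw (abs_nonneg _) (by positivity)
    nlinarith
  calc speed σ a b i * |(w - m) + (famNorm b / famNorm a - 1) * w|
      ≤ (4 * Q) * (2 * (Q ^ 8 * ε ^ 2)) := by gcongr; linarith
    _ ≤ Q ^ 10 * ε ^ 2 := by
      have s9 := P.step 9 (ε ^ 2) (sq_nonneg ε)
      simp only [Nat.reduceAdd] at s9
      have e4 : (4 * Q) * (2 * (Q ^ 8 * ε ^ 2)) = 8 * (Q ^ 9 * ε ^ 2) := by ring
      have p8 : 0 ≤ Q ^ 9 * ε ^ 2 := by positivity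
      linarith

include hK

/-- The velocity of a signal tested against a direction with index `s'` in either family. -/
lemma Near.abs_inner_velDir_signal_le {s s' : S} (hs : s ≠ s') {z : E} (hz : ‖z‖ ≤ 1)
    (hA : |inner ℝ (dir (a (.inl s))) z| ≤ ε)
    (hB : ∀ s'' : S, s'' ≠ s' → |inner ℝ (dir (b (.inl s''))) z| ≤ ε)
    (hz1 : |inner ℝ (dir (b (.inl s'))) z - 1| ≤ ε) {c : ℝ} (hc : |c| ≤ 8 * ε)
    (hω : |couple K a b (.inl s) (.inl s') - c| ≤ Q ^ 7 * ε ^ 2) :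
    |inner ℝ (velDir K σ a b (.inl s)) z - speed σ a b (.inl s) *
      (-grad K (overlap a b) (.inl s) (.inl s) *
          (inner ℝ (dir (b (.inl s))) z - inner ℝ (dir (a (.inl s))) z) - c)|
      ≤ Q ^ 10 * ε ^ 2 := by
  have hε := P.eps_nonneg
  have hQ := P.pos
  have hg := abs_grad_le_four P h hK (overlap a b) (.inl s) (.inl s)
  have hy := hB s hs
  refine h.abs_inner_velDir_sub_le P Sc hL ?_ ?_
  · have h1 := h.abs_inner_rateDir_signal_le P hK (s := s) (j := .inl s')
      (by simpa using hs.symm) hz hA (fun s'' h'' => hB s'' (by simpa using h''))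
    have h2 := h.abs_couple_signal_le P hK hs
    have h3 := mul_le_mul h2 hz1 (abs_nonneg _) (by positivity)
    rw [← abs_mul] at h3
    set w := inner ℝ (rateDir K a b (.inl s)) z
    set ω := couple K a b (.inl s) (.inl s')
    set t := inner ℝ (dir (b (.inl s'))) z
    set v := -grad K (overlap a b) (.inl s) (.inl s) *
          (inner ℝ (dir (b (.inl s))) z - inner ℝ (dir (a (.inl s))) z)
    have e : w - (v - c) = (w - (v - ω * t)) - (ω * (t - 1)) - (ω - c) := by ring
    rw [e]
    have t1 := abs_sub (w - (v - ω * t) - (ω * (t - 1))) (ω - c)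
    have t2 := abs_sub (w - (v - ω * t)) (ω * (t - 1))
    have m1 := P.mono (k := 5) (l := 7) (by norm_num) (sq_nonneg ε)
    have m2 := P.mono (k := 2) (l := 7) (by norm_num) (sq_nonneg ε)
    have s7 := P.step 7 (ε ^ 2) (sq_nonneg ε)
    have p7 : 0 ≤ Q ^ 7 * ε ^ 2 := by positivity
    simp only [Nat.reduceAdd] at s7
    nlinarith
  · refine (abs_sub _ _).trans ?_
    rw [abs_mul, abs_neg]
    have h1 : |inner ℝ (dir (b (.inl s))) z - inner ℝ (dir (a (.inl s))) z| ≤ 2 * ε := by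
      refine (abs_sub _ _).trans ?_; linarith
    have h2 := mul_le_mul hg h1 (abs_nonneg _) (by norm_num)
    have s0 := P.step 0 ε hε
    have m := P.mono (k := 1) (l := 3) (by norm_num) hε
    simp only [zero_add, pow_zero, one_mul] at s0
    linarith

include hκ

/-- The correlations of sums and differences of directions of two different signals decay, up to
second order errors, towards their partners with sums and differences interchanged: one of the
two contributions to the derivative. -/
lemma Near.exists_inner_velComb_signal {s s' : S} (hs : s ≠ s') (η ζ : Bool) :
    ∃ c₁ c₂ : ℝ, 0 ≤ c₁ ∧ 0 ≤ c₂ ∧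
      |inner ℝ (velComb K σ a b η (.inl s)) (comb a b ζ (.inl s'))
        + c₁ * inner ℝ (comb a b η (.inl s)) (comb a b ζ (.inl s'))
        + c₂ * (inner ℝ (comb a b η (.inl s)) (comb a b ζ (.inl s'))
          - inner ℝ (comb a b (!η) (.inl s)) (comb a b (!ζ) (.inl s')))|
      ≤ 4 * (Q ^ 10 * ε ^ 2) := by
  obtain ⟨α, β, hβ, hβα, hα, w1, w2⟩ := h.exists_couple_signal P hK hs
  have hne : (Sum.inl s : S ⊕ T) ≠ .inl s' := by simpa using hs
  have hε := P.eps_nonneg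
  have hg : 0 ≤ -grad K (overlap a b) (.inl s) (.inl s) :=
    le_trans (by have := logistic_pos hK (-1); positivity) (h.le_neg_grad P hK hκ s)
  have hX := h.abs_cross_le hne
  have hY := h.abs_cross_le hne.symm
  have hx := h.abs_same_le hne
  have hy := h.symm.abs_same_le hne
  have hθ0 : 0 ≤ rel a (.inl s') * rel b (.inl s') := mul_nonneg (rel_nonneg _ _) (rel_nonneg _ _)
  have hθ1 : rel a (.inl s') * rel b (.inl s') ≤ 1 :=
    mul_le_one₀ (rel_le_one _ _) (rel_nonneg _ _) (rel_le_one _ _)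
  have hψ : |inner ℝ (dir (b (.inl s'))) (dir (a (.inl s'))) - 1| ≤ ε := by
    have h3 : inner ℝ (dir (b (.inl s'))) (dir (a (.inl s'))) ≤ 1 := inner_dir_le _ _
    rw [abs_sub_comm, abs_of_nonneg (by linarith)]; linarith [h.symm.le_align s']
  have hb1 : |inner ℝ (dir (b (.inl s'))) (dir (b (.inl s'))) - 1| ≤ ε := by
    rw [inner_dir_self (h.ne_right _), sub_self, abs_zero]; exact hε
  have ha1 : |inner ℝ (dir (a (.inl s'))) (dir (a (.inl s'))) - 1| ≤ ε := by
    rw [inner_dir_self (h.ne_left _), sub_self, abs_zero]; exact hε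
  have bound : ∀ x y θ : ℝ, 0 ≤ θ → θ ≤ 1 → |x| ≤ ε → |y| ≤ ε → |θ * (α * x + β * y)| ≤ 8 * ε := by
    intro x y θ h0 h1 hx hy
    rw [abs_mul, abs_of_nonneg h0]
    refine (mul_le_of_le_one_left (abs_nonneg _) h1).trans ((abs_add_le _ _).trans ?_)
    rw [abs_mul, abs_mul, abs_of_nonneg hβ, abs_of_nonneg (hβ.trans hβα)]
    have := mul_le_mul hα hx (abs_nonneg _) (by norm_num)
    have := mul_le_mul (hβα.trans hα) hy (abs_nonneg _) (by norm_num)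
    linarith
  have v1 := h.abs_inner_velDir_signal_le P hK Sc hL hs (norm_dir_le (a (.inl s'))) hx
    (fun s'' h'' => h.symm.abs_cross_le (by simpa using h'')) hψ (bound _ _ _ hθ0 hθ1 hX hY) w1
  have v2 := h.abs_inner_velDir_signal_le P hK Sc hL hs (norm_dir_le (b (.inl s'))) hX
    (fun s'' h'' => h.symm.abs_same_le (by simpa using h'')) hb1 (bound _ _ _ hθ0 hθ1 hX hY) w1
  have v3 := h.symm.abs_inner_velDir_signal_le P hK Sc.symm hL hs (norm_dir_le (b (.inl s'))) hy
    (fun s'' h'' => h.abs_cross_le (by simpa using h''))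
    (by rw [real_inner_comm]; exact hψ) (bound _ _ _ hθ0 hθ1 hY hX) w2
  have v4 := h.symm.abs_inner_velDir_signal_le P hK Sc.symm hL hs (norm_dir_le (a (.inl s')))
    (by rw [real_inner_comm]; exact hY)
    (fun s'' h'' => h.abs_same_le (by simpa using h'')) ha1 (bound _ _ _ hθ0 hθ1 hY hX) w2
  rw [speed_comm, grad_overlap_comm] at v3 v4
  have hρ := (Sc.speed_pos (.inl s)).le
  set ρ := speed σ a b (.inl s)
  set g := -grad K (overlap a b) (.inl s) (.inl s)
  set θ := rel a (.inl s') * rel b (.inl s')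
  refine ⟨if η then 0 else 2 * ρ * g,
    if ζ then ρ * θ * (α + boolSign η * β) else 0, ?_, ?_, ?_⟩
  · split_ifs <;> positivity
  · split_ifs
    · refine mul_nonneg (mul_nonneg hρ hθ0) ?_
      cases η <;> simp [boolSign] <;> linarith
    · exact le_rfl
  rw [real_inner_comm (dir (a (.inl s'))) (dir (b (.inl s)))] at v1
  simp only [velComb, comb, inner_add_left, inner_add_right, real_inner_smul_left,
    real_inner_smul_right]
  rw [real_inner_comm (dir (a (.inl s'))) (dir (b (.inl s)))]
  rw [real_inner_comm (dir (a (.inl s'))) (dir (b (.inl s)))] at v4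
  set x := inner ℝ (dir (a (.inl s))) (dir (a (.inl s')))
  set y := inner ℝ (dir (b (.inl s))) (dir (b (.inl s')))
  set X := inner ℝ (dir (a (.inl s))) (dir (b (.inl s')))
  set Y := inner ℝ (dir (a (.inl s'))) (dir (b (.inl s)))
  rw [abs_le] at v1 v2 v3 v4 ⊢
  cases η <;> cases ζ <;> simp only [boolSign, Bool.not_true, Bool.not_false, if_true, if_false,
    Bool.false_eq_true] <;> constructor <;> linarith
/-- The correlations of sums and differences of directions of two different signals decay, up to
second order errors, towards their partners with sums and differences interchanged. -/
lemma Near.exists_deriv_comb_signal {s s' : S} (hs : s ≠ s') (η ζ : Bool) :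
    ∃ c₁ c₂ : ℝ, 0 ≤ c₁ ∧ 0 ≤ c₂ ∧
      |inner ℝ (comb a b η (.inl s)) (velComb K σ a b ζ (.inl s'))
        + inner ℝ (velComb K σ a b η (.inl s)) (comb a b ζ (.inl s'))
        + c₁ * inner ℝ (comb a b η (.inl s)) (comb a b ζ (.inl s'))
        + c₂ * (inner ℝ (comb a b η (.inl s)) (comb a b ζ (.inl s'))
          - inner ℝ (comb a b (!η) (.inl s)) (comb a b (!ζ) (.inl s')))|
      ≤ Q ^ 11 * ε ^ 2 := by
  obtain ⟨c₁, c₂, h1, h2, h3⟩ := h.exists_inner_velComb_signal P hK Sc hL hκ hs η ζ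
  obtain ⟨d₁, d₂, k1, k2, k3⟩ := h.exists_inner_velComb_signal P hK Sc hL hκ hs.symm ζ η
  refine ⟨c₁ + d₁, c₂ + d₂, add_nonneg h1 k1, add_nonneg h2 k2, ?_⟩
  rw [real_inner_comm _ (velComb K σ a b ζ (.inl s')), real_inner_comm _ (comb a b ζ (.inl s')),
    real_inner_comm _ (comb a b (!ζ) (.inl s'))] at k3
  have s10 := P.step 10 (ε ^ 2) (sq_nonneg ε)
  have : 0 ≤ Q ^ 10 * ε ^ 2 := mul_nonneg (pow_nonneg P.pos.le _) (sq_nonneg ε)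
  simp only [Nat.reduceAdd] at s10
  rw [abs_le] at *
  constructor <;> linarith

/-- The correlation of a noise with the sum or difference of the directions of a signal decays, up
to second order errors, towards its partner. -/
lemma Near.exists_deriv_comb_noise (t : T) (s : S) (ζ : Bool) :
    ∃ c₁ c₂ : ℝ, 0 ≤ c₁ ∧ 0 ≤ c₂ ∧
      |inner ℝ (dir (a (.inr t))) (velComb K σ a b ζ (.inl s))
        + inner ℝ (velDir K σ a b (.inr t)) (comb a b ζ (.inl s))
        + c₁ * inner ℝ (dir (a (.inr t))) (comb a b ζ (.inl s))
        + c₂ * (inner ℝ (dir (a (.inr t))) (comb a b ζ (.inl s))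
          - inner ℝ (dir (a (.inr t))) (comb a b (!ζ) (.inl s)))|
      ≤ Q ^ 11 * ε ^ 2 := by
  obtain ⟨c, hc, w⟩ := h.exists_couple_noise P hK t s
  have hε := P.eps_nonneg
  have hQ := P.pos
  have hg : 0 ≤ -grad K (overlap a b) (.inl s) (.inl s) :=
    le_trans (by have := logistic_pos hK (-1); positivity) (h.le_neg_grad P hK hκ s)
  have hne : (Sum.inr t : S ⊕ T) ≠ .inl s := by simp
  have hX := h.abs_cross_le hne
  have hx := h.abs_same_le hne
  have hX' : |inner ℝ (dir (b (.inl s))) (dir (a (.inr t)))| ≤ ε := by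
    rw [real_inner_comm]; exact hX
  have hx' : |inner ℝ (dir (a (.inl s))) (dir (a (.inr t)))| ≤ ε := by
    rw [real_inner_comm]; exact hx
  -- the motion of the noise
  have noise : ∀ z : E, ‖z‖ ≤ 1 → |inner ℝ (dir (b (.inl s))) z - 1| ≤ ε →
      (∀ s' : S, s' ≠ s → |inner ℝ (dir (b (.inl s'))) z| ≤ ε) →
      |inner ℝ (velDir K σ a b (.inr t)) z + σ (.inr t) / famNorm a ^ 2 *
        (c * inner ℝ (dir (a (.inr t))) (dir (b (.inl s))))| ≤ Q ^ 10 * ε ^ 2 := by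
    intro z hz h1 h2
    have h3 := h.abs_inner_rateDir_noise_le P hK (t := t) (.inl s) hz
      (fun s' h' => h2 s' (by simpa using h'))
    have h4 := mul_le_mul (h.abs_couple_noise_signal_le P hK t s) h1 (abs_nonneg _) (by positivity)
    rw [← abs_mul] at h4
    rw [velDir, real_inner_smul_left, ← mul_add, abs_mul, abs_of_pos (Sc.div_sq_pos _)]
    set w' := inner ℝ (rateDir K a b (.inr t)) z
    set ω := couple K a b (.inr t) (.inl s)
    set x := inner ℝ (dir (b (.inl s))) z
    set X := inner ℝ (dir (a (.inr t))) (dir (b (.inl s)))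
    have e : w' + c * X = (w' + ω * x) - (ω * (x - 1)) - (ω - c * X) := by ring
    have h5 : |w' + c * X| ≤ 3 * (Q ^ 4 * ε ^ 2) := by
      rw [e]
      have t1 := abs_sub (w' + ω * x - (ω * (x - 1))) (ω - c * X)
      have t2 := abs_sub (w' + ω * x) (ω * (x - 1))
      have m2 := P.mono (k := 2) (l := 4) (by norm_num) (sq_nonneg ε)
      nlinarith
    have h6 := Sc.div_sq_le (.inr t)
    have h7 : σ (.inr t) / famNorm a ^ 2 ≤ 4 * Q := h6.trans (by linarith)
    have h8 := mul_le_mul h7 h5 (abs_nonneg _) (by positivity)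
    have s5 := P.step 5 (ε ^ 2) (sq_nonneg ε)
    have m6 := P.mono (k := 6) (l := 10) (by norm_num) (sq_nonneg ε)
    have p5 : 0 ≤ Q ^ 5 * ε ^ 2 := by positivity
    simp only [Nat.reduceAdd] at s5
    have e5 : 4 * Q * (3 * (Q ^ 4 * ε ^ 2)) = 12 * (Q ^ 5 * ε ^ 2) := by ring
    linarith
  have n1 := noise (dir (a (.inl s))) (norm_dir_le _) (by
      have h3 : inner ℝ (dir (b (.inl s))) (dir (a (.inl s))) ≤ 1 := inner_dir_le _ _
      rw [abs_sub_comm, abs_of_nonneg (by linarith)]; linarith [h.symm.le_align s])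
    (fun s' h' => h.symm.abs_cross_le (by simpa using h'))
  have n2 := noise (dir (b (.inl s))) (norm_dir_le _) (by
      rw [inner_dir_self (h.ne_right _), sub_self, abs_zero]; exact hε)
    (fun s' h' => h.symm.abs_same_le (by simpa using h'))
  -- the motion of the signal
  have small : ∀ x y : ℝ, |x| ≤ ε → |y| ≤ ε →
      |-grad K (overlap a b) (.inl s) (.inl s) * (x - y)| ≤ Q ^ 3 * ε := by
    intro x y h1 h2
    rw [abs_mul, abs_neg]
    have h3 := abs_sub x y
    have h4 := mul_le_mul (abs_grad_le_four P h hK (overlap a b) (.inl s) (.inl s))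
      (h3.trans (add_le_add h1 h2)) (abs_nonneg _) (by norm_num)
    have s0 := P.step 0 ε hε
    have m := P.mono (k := 1) (l := 3) (by norm_num) hε
    simp only [zero_add, pow_zero, one_mul] at s0
    linarith
  have up : ∀ w v ω y : ℝ, |w - (v - ω * y)| ≤ Q ^ 5 * ε ^ 2 → |ω| ≤ Q ^ 3 * ε ^ 2 → |y| ≤ 1 →
      |w - v| ≤ Q ^ 8 * ε ^ 2 := by
    intro w v ω y h1 h2 h3
    have h4 := mul_le_mul h2 h3 (abs_nonneg _) (by positivity)
    rw [← abs_mul] at h4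
    have e : w - v = (w - (v - ω * y)) - ω * y := by ring
    have t1 := abs_sub (w - (v - ω * y)) (ω * y)
    rw [e]
    have m1 := P.mono (k := 3) (l := 5) (by norm_num) (sq_nonneg ε)
    have m2 := P.mono (k := 6) (l := 8) (by norm_num) (sq_nonneg ε)
    have s5 := P.step 5 (ε ^ 2) (sq_nonneg ε)
    have p5 : 0 ≤ Q ^ 5 * ε ^ 2 := by positivity
    simp only [Nat.reduceAdd] at s5
    linarith
  have r1 := h.abs_inner_rateDir_signal_le P hK (s := s) (j := .inr t) hne (norm_dir_le _) hx'
    (fun s' _ => by rw [real_inner_comm]; exact h.abs_cross_le (by simp))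
  have r2 := h.symm.abs_inner_rateDir_signal_le P hK (s := s) (j := .inr t) hne
    (norm_dir_le (a (.inr t))) hX'
    (fun s' _ => by rw [real_inner_comm]; exact h.abs_same_le (by simp))
  have v1 := h.abs_inner_velDir_sub_le P Sc hL
    (up _ _ _ _ r1 (h.abs_couple_signal_noise_le P hK s t) (abs_inner_dir_le _ _)) (small _ _ hX' hx')
  have v2 := h.symm.abs_inner_velDir_sub_le P Sc.symm hL
    (up _ _ _ _ r2 (h.symm.abs_couple_signal_noise_le P hK s t) (abs_inner_dir_le _ _))
    (by rw [grad_overlap_comm]; exact small _ _ hx' hX')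
  rw [speed_comm, grad_overlap_comm] at v2
  have hρ := (Sc.speed_pos (.inl s)).le
  have hρ' := (Sc.div_sq_pos (.inr t)).le
  set ρ := speed σ a b (.inl s)
  set ρ' := σ (.inr t) / famNorm a ^ 2
  set g := -grad K (overlap a b) (.inl s) (.inl s)
  refine ⟨if ζ then 0 else 2 * ρ * g, if ζ then ρ' * c else 0, by split_ifs <;> positivity,
    by split_ifs <;> positivity, ?_⟩
  simp only [velComb, comb, inner_add_right, real_inner_smul_right]
  rw [real_inner_comm (velDir K σ a b (.inl s)), real_inner_comm (velDir K σ b a (.inl s))]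
  rw [real_inner_comm (dir (a (.inr t))) (dir (a (.inl s))),
    real_inner_comm (dir (a (.inr t))) (dir (b (.inl s)))] at v1 v2
  set x := inner ℝ (dir (a (.inr t))) (dir (a (.inl s)))
  set X := inner ℝ (dir (a (.inr t))) (dir (b (.inl s)))
  have s10 := P.step 10 (ε ^ 2) (sq_nonneg ε)
  have p10 : 0 ≤ Q ^ 10 * ε ^ 2 := by positivity
  simp only [Nat.reduceAdd] at s10
  rw [abs_le] at v1 v2 n1 n2 ⊢
  cases ζ <;> simp only [boolSign, Bool.not_true, Bool.not_false, if_true, if_false,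
    Bool.false_eq_true] <;> constructor <;> linarith

/-- The alignment of the two directions of a signal does not decrease, up to second order. -/
lemma Near.deriv_align_ge (s : S) :
    -(Q ^ 8 * ε ^ 2) ≤ inner ℝ (dir (a (.inl s))) (velDir K σ b a (.inl s))
      + inner ℝ (velDir K σ a b (.inl s)) (dir (b (.inl s))) := by
  have hQ := P.pos
  have hε := P.eps_nonneg
  -- one of the two contributions, for either order of the families
  have half : ∀ a b : S ⊕ T → E, Near a b Q ε → Scaled σ a b L →
      -(4 * (Q ^ 6 * ε ^ 2)) ≤ inner ℝ (velDir K σ a b (.inl s)) (dir (b (.inl s))) := by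
    intro a b h Sc
    have hle := h.le_neg_grad P hK hκ s
    have hκ0 := logistic_pos hK (-1)
    have e : inner ℝ (rateDir K a b (.inl s)) (dir (b (.inl s)))
        = -∑ i, couple K a b (.inl s) i * (inner ℝ (dir (b i)) (dir (b (.inl s)))
          - inner ℝ (dir (b i)) (dir (a (.inl s)))
            * inner ℝ (dir (a (.inl s))) (dir (b (.inl s)))) := by
      rw [rateDir, inner_neg_left, sum_inner]
      simp only [real_inner_smul_left, inner_sub_left]
    have hsum : ∑ i, couple K a b (.inl s) i * (inner ℝ (dir (b i)) (dir (b (.inl s)))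
          - inner ℝ (dir (b i)) (dir (a (.inl s)))
            * inner ℝ (dir (a (.inl s))) (dir (b (.inl s)))) ≤ Q * (2 * Q ^ 3 * ε ^ 2) := by
      refine (Finset.sum_le_card_nsmul _ _ (2 * Q ^ 3 * ε ^ 2) fun i _ => ?_).trans ?_
      · have hψ := abs_inner_dir_le (a (.inl s)) (b (.inl s))
        by_cases hi : i = .inl s
        · subst hi
          refine le_trans (mul_nonpos_of_nonpos_of_nonneg ?_ ?_) (by positivity)
          · unfold couple
            exact mul_nonpos_of_nonpos_of_nonneg (by linarith)
              (div_nonneg (rel_nonneg _ _) (rel_nonneg _ _))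
          · rw [inner_dir_self (h.ne_right _), real_inner_comm, ← sq, sub_nonneg]
            rw [sq_le_one_iff_abs_le_one]
            exact hψ
        · refine (le_abs_self _).trans ?_
          rw [abs_mul]
          rcases i with s' | t
          · have h1 := h.symm.abs_same_le hi
            have h2 := h.symm.abs_cross_le hi
            have h3 := mul_le_mul h2 hψ (abs_nonneg _) hε
            rw [← abs_mul] at h3
            have h4 := (abs_sub _ _).trans (add_le_add h1 h3)
            have h5 := mul_le_mul (h.abs_couple_signal_le P hK (s := s) (s' := s')
              (by rintro rfl; exact hi rfl)) h4 (abs_nonneg _) (by positivity)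
            have := P.mono (k := 2) (l := 3) (by norm_num) (sq_nonneg ε)
            nlinarith
          · have h3 := mul_le_mul (abs_inner_dir_le (b (.inr t)) (a (.inl s))) hψ (abs_nonneg _)
              zero_le_one
            rw [← abs_mul] at h3
            have h4 := (abs_sub _ _).trans (add_le_add (abs_inner_dir_le (b (.inr t)) (b (.inl s)))
              h3)
            have h5 := mul_le_mul (h.abs_couple_signal_noise_le P hK s t) h4 (abs_nonneg _)
              (by positivity)
            linarith
      · rw [Finset.card_univ, nsmul_eq_mul]
        exact mul_le_mul_of_nonneg_right P.card_le (by positivity)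
    rw [velDir, real_inner_smul_left]
    have h6 : σ (.inl s) / famNorm a ^ 2 ≤ 4 * Q := (Sc.div_sq_le _).trans (by linarith)
    have h7 := (Sc.div_sq_pos (.inl s)).le
    have h8 : -(Q * (2 * Q ^ 3 * ε ^ 2)) ≤ inner ℝ (rateDir K a b (.inl s)) (dir (b (.inl s))) := by
      rw [e]; exact neg_le_neg hsum
    have h9 : 0 ≤ Q * (2 * Q ^ 3 * ε ^ 2) := by positivity
    have h10 := mul_le_mul_of_nonneg_left h8 h7
    have h11 := mul_le_mul_of_nonneg_right h6 h9
    have e2 : 4 * Q * (Q * (2 * Q ^ 3 * ε ^ 2)) = 8 * (Q ^ 5 * ε ^ 2) := by ring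
    have s5 := P.step 5 (ε ^ 2) (sq_nonneg ε)
    have p5 : 0 ≤ Q ^ 5 * ε ^ 2 := by positivity
    simp only [Nat.reduceAdd] at s5
    linarith
  have h1 := half a b h Sc
  have h2 := half b a h.symm Sc.symm
  rw [real_inner_comm] at h2
  have m := P.mono (k := 7) (l := 8) (by norm_num) (sq_nonneg ε)
  have s6 := P.step 6 (ε ^ 2) (sq_nonneg ε)
  have p5 : 0 ≤ Q ^ 6 * ε ^ 2 := by positivity
  simp only [Nat.reduceAdd] at s6
  linarith

omit hκ in
/-- The correlations between noises of different families move only to second order. -/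
lemma Near.abs_deriv_noise_le (t t' : T) :
    |inner ℝ (dir (a (.inr t))) (velDir K σ b a (.inr t'))
      + inner ℝ (velDir K σ a b (.inr t)) (dir (b (.inr t')))| ≤ Q ^ 7 * ε ^ 2 := by
  have hQ := P.pos
  have hε := P.eps_nonneg
  have half : ∀ a b : S ⊕ T → E, Near a b Q ε → Scaled σ a b L → ∀ t t' : T,
      |inner ℝ (velDir K σ a b (.inr t)) (dir (b (.inr t')))| ≤ Q ^ 6 * ε ^ 2 := by
    intro a b h Sc t t'
    have h1 := h.abs_inner_rateDir_noise_le P hK (t := t) (.inr t') (norm_dir_le (b (.inr t')))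
      (fun s' _ => by rw [real_inner_comm]; exact h.symm.abs_same_le (by simp))
    have h2 := mul_le_mul (h.abs_couple_noise_noise_le P hK t t')
      (abs_inner_dir_le (b (.inr t')) (b (.inr t'))) (abs_nonneg _) (by positivity)
    rw [← abs_mul] at h2
    set w := inner ℝ (rateDir K a b (.inr t)) (dir (b (.inr t')))
    set v := couple K a b (.inr t) (.inr t') * inner ℝ (dir (b (.inr t'))) (dir (b (.inr t')))
    have h3 : |w| ≤ 2 * (Q ^ 4 * ε ^ 2) := by
      have := abs_sub (w + v) v
      rw [add_sub_cancel_right] at this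
      have := P.mono (k := 2) (l := 4) (by norm_num) (sq_nonneg ε)
      linarith
    rw [velDir, real_inner_smul_left, abs_mul, abs_of_pos (Sc.div_sq_pos _)]
    have h6 : σ (.inr t) / famNorm a ^ 2 ≤ 4 * Q := (Sc.div_sq_le _).trans (by linarith)
    have h7 := mul_le_mul h6 h3 (abs_nonneg _) (by positivity)
    have e2 : 4 * Q * (2 * (Q ^ 4 * ε ^ 2)) = 8 * (Q ^ 5 * ε ^ 2) := by ring
    have s5 := P.step 5 (ε ^ 2) (sq_nonneg ε)
    have p5 : 0 ≤ Q ^ 5 * ε ^ 2 := by positivity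
    simp only [Nat.reduceAdd] at s5
    linarith
  have h1 := half a b h Sc t t'
  have h2 := half b a h.symm Sc.symm t' t
  rw [real_inner_comm] at h2
  have t1 := abs_add_le (inner ℝ (dir (a (.inr t))) (velDir K σ b a (.inr t')))
    (inner ℝ (velDir K σ a b (.inr t)) (dir (b (.inr t'))))
  have s6 := P.step 6 (ε ^ 2) (sq_nonneg ε)
  have p5 : 0 ≤ Q ^ 6 * ε ^ 2 := by positivity
  simp only [Nat.reduceAdd] at s6
  linarith

end State
end Contrastive

namespace Contrastive

/-! ### Sizes of the vectors -/

section Sums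
variable {ι : Type*} [Fintype ι]

/-- The quadratic form that drives the differences between the norms of two families. Here `k` and
`l` are the relative sizes, `n` and `N` the Frobenius norms, and `H` is the mean of the weights `w`;
up to third order terms only the variance of the weights enters. -/
lemma sum_sub_mul_le {k l w : ι → ℝ} {n N H : ℝ} (hn : 0 < n) (hN : 0 < N) (hH : 0 < H)
    (hk : ∑ i, k i ^ 2 = 1) (hl : ∑ i, l i ^ 2 = 1) (hw : ∀ i, 0 ≤ w i)
    (hm : ∑ i, w i * (k i * l i) = H) :
    ∑ i, (n * k i - N * l i) * (-H * (k i / n - l i / N) + w i * (l i / n - k i / N))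
      ≤ (N / n - 1) ^ 2 / H * ∑ i, (w i - H) ^ 2 * k i ^ 2
        + |N / n - 1| * H * ∑ i, (l i - k i) ^ 2
        + (N / n - 1) ^ 2 * (n / N) * |∑ i, w i * (l i - k i) * k i| := by
  set ζ := N / n with hζ
  have hζ0 : 0 < ζ := div_pos hN hn
  have hiv : n / N = ζ⁻¹ := by rw [hζ, inv_div]
  set C := ∑ i, k i * l i
  set R := ∑ i, w i * k i ^ 2
  set S := ∑ i, w i * l i ^ 2
  set V := ∑ i, (w i - H) ^ 2 * k i ^ 2
  have eX : ∑ i, (n * k i - N * l i) * (-H * (k i / n - l i / N) + w i * (l i / n - k i / N))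
      = H * (ζ + ζ⁻¹) * C - ζ⁻¹ * R - ζ * S := by
    have e : ∀ i, (n * k i - N * l i) * (-H * (k i / n - l i / N) + w i * (l i / n - k i / N))
        = -H * k i ^ 2 + -H * l i ^ 2 + H * (ζ + ζ⁻¹) * (k i * l i)
          + 2 * (w i * (k i * l i)) - ζ⁻¹ * (w i * k i ^ 2) - ζ * (w i * l i ^ 2) := by
      intro i
      rw [← hiv, hζ]
      field_simp
      ring
    simp only [e, Finset.sum_add_distrib, Finset.sum_sub_distrib, ← Finset.mul_sum]
    rw [hk, hl, hm]; ring
  have eD : ∑ i, (l i - k i) ^ 2 = 2 - 2 * C := by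
    have e : ∀ i, (l i - k i) ^ 2 = l i ^ 2 + k i ^ 2 - 2 * (k i * l i) := fun i => by ring
    simp only [e, Finset.sum_add_distrib, Finset.sum_sub_distrib, ← Finset.mul_sum]
    rw [hk, hl]; ring
  have eB : ∑ i, w i * (l i - k i) * k i = H - R := by
    have e : ∀ i, w i * (l i - k i) * k i = w i * (k i * l i) - w i * k i ^ 2 := fun i => by ring
    simp only [e, Finset.sum_sub_distrib]
    rw [hm]
  have eW : ∑ i, w i * (l i - k i) ^ 2 = S - 2 * H + R := by
    have e : ∀ i, w i * (l i - k i) ^ 2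
        = w i * l i ^ 2 - 2 * (w i * (k i * l i)) + w i * k i ^ 2 := fun i => by ring
    simp only [e, Finset.sum_sub_distrib, Finset.sum_add_distrib, ← Finset.mul_sum]
    rw [hm]
  have hW : 0 ≤ S - 2 * H + R := by
    rw [← eW]; exact Finset.sum_nonneg fun i _ => mul_nonneg (hw i) (sq_nonneg _)
  have hD : 0 ≤ 2 - 2 * C := by
    rw [← eD]; exact Finset.sum_nonneg fun i _ => sq_nonneg _
  -- the square `(H (l - k) + (ζ - 1) (w - H) k) ^ 2 / H`, summed
  have hsq : 0 ≤ H * (2 - 2 * C) + 2 * (ζ - 1) * (H - R - H * C + H) + (ζ - 1) ^ 2 / H * V := by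
    have e : ∀ i, (H * (l i - k i) + (ζ - 1) * (w i - H) * k i) ^ 2 / H
        = H * (l i - k i) ^ 2 + 2 * (ζ - 1) * (w i * (l i - k i) * k i - H * (k i * l i)
          + H * k i ^ 2) + (ζ - 1) ^ 2 / H * ((w i - H) ^ 2 * k i ^ 2) := by
      intro i; field_simp; ring
    have h0 : 0 ≤ ∑ i, (H * (l i - k i) + (ζ - 1) * (w i - H) * k i) ^ 2 / H :=
      Finset.sum_nonneg fun i _ => div_nonneg (sq_nonneg _) hH.le
    simp only [e, Finset.sum_add_distrib, Finset.sum_sub_distrib, ← Finset.mul_sum] at h0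
    rw [eD, eB, hk] at h0
    linarith
  rw [eX, eD, eB, hiv]
  have h1 : (ζ - 1) * (H * (2 - 2 * C)) ≤ |ζ - 1| * H * (2 - 2 * C) := by
    rw [mul_assoc]
    exact mul_le_mul_of_nonneg_right (le_abs_self _) (mul_nonneg hH.le hD)
  have h2 : (ζ - 1) ^ 2 * ζ⁻¹ * (H - R) ≤ (ζ - 1) ^ 2 * ζ⁻¹ * |H - R| :=
    mul_le_mul_of_nonneg_left (le_abs_self _) (by positivity)
  have h3 : 0 ≤ ζ * (S - 2 * H + R) := mul_nonneg hζ0.le hW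
  have hi : ζ * ζ⁻¹ = 1 := mul_inv_cancel₀ hζ0.ne'
  have h4 : 0 ≤ (ζ - 1) ^ 2 * ζ⁻¹ * (H * (1 - C)) := by
    have : 0 ≤ 1 - C := by linarith
    positivity
  have e5 : (ζ - 1) ^ 2 * ζ⁻¹ = ζ - 2 + ζ⁻¹ := by
    field_simp; ring
  rw [e5] at h2 h4 ⊢
  linarith

/-- The weighted mean value `∑ σ k² (τ - T) y` is negative when `y` is, up to small errors, a
negative multiple of `τ - T`. -/
lemma sum_mul_sub_mul_le {k σ τ y : ι → ℝ} {T p η L : ℝ}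
    (hp0 : 0 < p) (hp1 : p ≤ 1) (hk0 : ∀ i, 0 ≤ k i) (hk1 : ∀ i, k i ≤ 1)
    (hσ : ∀ i, 1 ≤ σ i) (hσL : ∀ i, σ i ≤ L) (hτ : ∀ i, |τ i - T| ≤ 1) (hη1 : η ≤ 1)
    (hη : ∀ i, k i * |y i + 2 * p * (τ i - T)| ≤ η) :
    ∑ i, σ i * (k i ^ 2 * ((τ i - T) * y i))
      ≤ -(∑ i, y i ^ 2 * k i ^ 2) / 2 + Fintype.card ι * (2 * (L * η)) := by
  have key : ∀ i, σ i * (k i ^ 2 * ((τ i - T) * y i)) ≤ -(y i ^ 2 * k i ^ 2) / 2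
      + 2 * (L * η) := by
    intro i
    have h1 := hη i
    have h2 := hτ i
    have h3 := hk0 i
    have h4 := hk1 i
    set x := τ i - T
    set e := y i + 2 * p * x with he
    have h0 : 0 ≤ η := (mul_nonneg h3 (abs_nonneg _)).trans h1
    have hy : y i = e - 2 * p * x := by rw [he]; ring
    have h5 : k i ^ 2 * (x * y i) ≤ -(y i ^ 2 * k i ^ 2) / 2 + 2 * η := by
      have e1 : k i ^ 2 * (x * y i) + y i ^ 2 * k i ^ 2 / 2
          = -(2 * (p * (1 - p) * (k i * x) ^ 2)) + (1 - 2 * p) * (k i * x) * (k i * e)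
            + (k i * e) ^ 2 / 2 := by
        rw [hy]; ring
      have e2 : 0 ≤ p * (1 - p) * (k i * x) ^ 2 :=
        mul_nonneg (mul_nonneg hp0.le (by linarith)) (sq_nonneg _)
      have e3 : |k i * e| ≤ η := by rw [abs_mul, abs_of_nonneg h3]; exact h1
      have e4 : |(1 - 2 * p) * (k i * x)| ≤ 1 := by
        rw [abs_mul, abs_mul, abs_of_nonneg h3]
        exact mul_le_one₀ (by rw [abs_le]; constructor <;> linarith)
          (mul_nonneg h3 (abs_nonneg _)) (mul_le_one₀ h4 (abs_nonneg _) h2)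
      have e5 : (1 - 2 * p) * (k i * x) * (k i * e) ≤ η := by
        refine (le_abs_self _).trans ?_
        rw [abs_mul]
        exact (mul_le_of_le_one_left (abs_nonneg _) e4).trans e3
      have e6 : (k i * e) ^ 2 ≤ η := by
        rw [← sq_abs]; nlinarith [abs_nonneg (k i * e)]
      linarith
    have h6 : 0 ≤ y i ^ 2 * k i ^ 2 / 2 := by positivity
    have h7 := hσ i
    have h8 := hσL i
    have h9 := mul_le_mul_of_nonneg_left h5 (zero_le_one.trans h7)
    have h10 := mul_le_mul_of_nonneg_right h8 h0
    have h11 := mul_le_mul_of_nonneg_right h7 h6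
    linarith
  refine (Finset.sum_le_sum fun i _ => key i).trans (le_of_eq ?_)
  rw [Finset.sum_add_distrib, ← Finset.sum_div, Finset.sum_neg_distrib]
  simp

end Sums

section State
variable {S T : Type*} [Fintype S] [Fintype T] [DecidableEq S] [DecidableEq T]
variable {E : Type*} [NormedAddCommGroup E] [InnerProductSpace ℝ E]

omit [DecidableEq S] [DecidableEq T] in
lemma norm_eq_famNorm_mul_rel {a : S ⊕ T → E} (ha : famNorm a ≠ 0) (i : S ⊕ T) :
    ‖a i‖ = famNorm a * rel a i := by
  rw [rel, mul_div_cancel₀ _ ha]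

/-- The weight with which a signal is enforced; noises have weight zero. -/
noncomputable def weight (K : ℝ) (a b : S ⊕ T → E) : S ⊕ T → ℝ :=
  Sum.elim (fun s => -grad K (overlap a b) (.inl s) (.inl s) *
    inner ℝ (dir (a (.inl s))) (dir (b (.inl s)))) 0

/-- The mean of the weights. -/
noncomputable def meanWeight (K : ℝ) (a b : S ⊕ T → E) : ℝ :=
  ∑ i, weight K a b i * (rel a i * rel b i)

/-- The variance of the weights. -/
noncomputable def weightVar (K : ℝ) (a b : S ⊕ T → E) : ℝ :=
  ∑ i, (weight K a b i - meanWeight K a b) ^ 2 * rel a i ^ 2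

/-- The energy of the differences of the norms. -/
noncomputable def energy (σ : S ⊕ T → ℝ) (a b : S ⊕ T → E) : ℝ :=
  ∑ i, (‖a i‖ - ‖b i‖) ^ 2 / σ i

lemma weight_comm (K : ℝ) (a b : S ⊕ T → E) (i : S ⊕ T) : weight K b a i = weight K a b i := by
  rcases i with s | t
  · simp only [weight, Sum.elim_inl]
    rw [grad_overlap_comm, real_inner_comm]
  · simp only [weight, Sum.elim_inr]

lemma meanWeight_comm (K : ℝ) (a b : S ⊕ T → E) : meanWeight K b a = meanWeight K a b := by
  unfold meanWeight
  exact Finset.sum_congr rfl fun i _ => by rw [weight_comm, mul_comm (rel b i)]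

variable {a b : S ⊕ T → E} {Q ε : ℝ} (P : Params S T Q ε) (h : Near a b Q ε)
variable {K : ℝ} (hK : 0 < K) {σ : S ⊕ T → ℝ} {L : ℝ} (Sc : Scaled σ a b L) (hL : L ≤ Q)
  (hκ : 1 ≤ Q * logistic K (-1))

include P h

lemma Near.abs_rel_sub_le_all (i : S ⊕ T) : |rel a i - rel b i| ≤ 7 * Q * ε := by
  rcases i with s | t
  · exact h.abs_rel_sub_le P s
  · have h1 := h.rel_noise_le t
    have h2 := h.symm.rel_noise_le t
    have h3 := rel_nonneg a (.inr t)
    have h4 := rel_nonneg b (.inr t)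
    have h5 := P.hQ
    have h6 := P.eps_nonneg
    rw [abs_le]; constructor <;> nlinarith

include hK

lemma Near.abs_pairing_add_meanWeight_le : |pairing K a b + meanWeight K a b| ≤ Q ^ 4 * ε ^ 2 := by
  have h1 := h.abs_pairing_sub_le P hK
  have e : meanWeight K a b = -∑ s, grad K (overlap a b) (.inl s) (.inl s) *
      overlap a b (.inl s) (.inl s) := by
    unfold meanWeight
    rw [Fintype.sum_sum_type, ← Finset.sum_neg_distrib]
    simp only [weight, Sum.elim_inl, Sum.elim_inr, Pi.zero_apply, zero_mul, Finset.sum_const_zero,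
      add_zero]
    exact Finset.sum_congr rfl fun s _ => by rw [overlap_eq]; ring
  rw [e, ← sub_eq_add_neg]
  exact h1

lemma Near.abs_rateLog_sub_le (i : S ⊕ T) :
    |rateLog K a b i - (weight K a b i * (rel b i / rel a i) - meanWeight K a b)|
      ≤ Q ^ 5 * ε ^ 2 := by
  have h1 := h.abs_pairing_add_meanWeight_le P hK
  have s4 := P.step 4 (ε ^ 2) (sq_nonneg ε)
  have p4 : 0 ≤ Q ^ 4 * ε ^ 2 := mul_nonneg (pow_nonneg P.pos.le _) (sq_nonneg ε)
  simp only [Nat.reduceAdd] at s4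
  rcases i with s | t
  · have h2 := h.abs_rateLog_signal_le P hK s
    simp only [weight, Sum.elim_inl]
    rw [abs_le] at *
    constructor <;> linarith
  · have h2 := h.abs_rateLog_noise_le P hK t
    have m := P.mono (k := 3) (l := 4) (by norm_num) (sq_nonneg ε)
    simp only [weight, Sum.elim_inr, Pi.zero_apply]
    rw [abs_le] at *
    constructor <;> linarith

lemma Near.weight_nonneg (hκ : 1 ≤ Q * logistic K (-1)) (i : S ⊕ T) : 0 ≤ weight K a b i := by
  rcases i with s | t
  · exact mul_nonneg (le_trans (by have := logistic_pos hK (-1); positivity)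
      (h.le_neg_grad P hK hκ s)) (h.align_nonneg P s)
  · exact le_rfl

lemma Near.abs_weight_le (i : S ⊕ T) : |weight K a b i| ≤ 4 := by
  rcases i with s | t
  · simp only [weight, Sum.elim_inl]
    rw [abs_mul, abs_neg]
    exact (mul_le_of_le_one_right (abs_nonneg _) (abs_inner_dir_le _ _)).trans
      (abs_grad_le_four P h hK _ _ _)
  · simp [weight]

/-- The weight of a signal as a function of its relative size. -/
lemma Near.abs_weight_sub_le (s : S) :
    |weight K a b (.inl s) - 2 * logistic K (gapDiag (overlap a b)) *
      (1 - Real.tanh (rel a (.inl s) ^ 2))| ≤ Q ^ 4 * ε := by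
  have h1 := h.abs_grad_diag_le P hK s
  have h2 := abs_grad_le_four P h hK (overlap a b) (.inl s) (.inl s)
  have hψ : |1 - inner ℝ (dir (a (.inl s))) (dir (b (.inl s)))| ≤ ε := by
    have h3 : inner ℝ (dir (a (.inl s))) (dir (b (.inl s))) ≤ 1 := inner_dir_le _ _
    rw [abs_of_nonneg (by linarith)]; linarith [h.le_align s]
  simp only [weight, Sum.elim_inl]
  set ψ := inner ℝ (dir (a (.inl s))) (dir (b (.inl s)))
  set G := grad K (overlap a b) (.inl s) (.inl s)
  have h3 := mul_le_mul h2 hψ (abs_nonneg _) (by norm_num)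
  rw [← abs_mul] at h3
  have s3 := P.step 3 ε P.eps_nonneg
  have m := P.mono (k := 0) (l := 3) (by norm_num) P.eps_nonneg
  simp only [Nat.reduceAdd, pow_zero, one_mul] at s3 m
  rw [abs_le] at *
  constructor <;> linarith [P.eps_nonneg]

lemma Near.abs_meanWeight_sub_le :
    |meanWeight K a b - ∑ i, weight K a b i * rel a i ^ 2| ≤ Q ^ 3 * ε := by
  have hε := P.eps_nonneg
  have hQ := P.pos
  unfold meanWeight
  rw [← Finset.sum_sub_distrib]
  refine (P.abs_sum_le (x := 28 * Q * ε) (by positivity) fun i => ?_).trans ?_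
  · have e : weight K a b i * (rel a i * rel b i) - weight K a b i * rel a i ^ 2
        = weight K a b i * (rel a i * (rel b i - rel a i)) := by ring
    have h1 := h.abs_rel_sub_le_all P i
    have h2 := h.abs_weight_le P hK i
    rw [abs_sub_comm] at h1
    rw [e, abs_mul, abs_mul, abs_of_nonneg (rel_nonneg a i)]
    have h3 := (mul_le_of_le_one_left (abs_nonneg (rel b i - rel a i)) (rel_le_one a i)).trans h1
    have := mul_le_mul h2 h3 (mul_nonneg (rel_nonneg a i) (abs_nonneg _)) (by norm_num)
    linarith
  · have s2 := P.step 2 ε hε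
    have p2 : 0 ≤ Q ^ 2 * ε := by positivity
    simp only [Nat.reduceAdd] at s2
    linarith

include hκ

lemma Near.le_weight (s : S) : 29 / 100 * logistic K (-1) ≤ weight K a b (.inl s) := by
  have h1 := h.le_neg_grad P hK hκ s
  have h2 := h.le_align s
  have h3 := P.eps_small
  have h4 := logistic_pos hK (-1)
  simp only [weight, Sum.elim_inl]
  have h5 : (99 / 100 : ℝ) ≤ inner ℝ (dir (a (.inl s))) (dir (b (.inl s))) := by linarith
  have := mul_le_mul h1 h5 (by norm_num) (by linarith)
  linarith

/-- A lower bound of the weights of the signals is, up to small errors, a lower bound of their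
mean. -/
lemma Near.le_meanWeight (i₀ : S ⊕ T) {c : ℝ} (hc : c ≤ 4)
    (hw : ∀ s, c ≤ weight K a b (.inl s)) : c - Q ^ 4 * ε ≤ meanWeight K a b := by
  have h1 := abs_le.1 (h.abs_meanWeight_sub_le P hK)
  have hε := P.eps_nonneg
  have hQ := P.pos
  have h2 := sum_rel_sq (h.famNorm_pos i₀).ne'
  have h3 : ∀ i, c * rel a i ^ 2 - weight K a b i * rel a i ^ 2 ≤ 4 * ε ^ 2 := by
    intro i
    rcases i with s | t
    · have := mul_le_mul_of_nonneg_right (hw s) (sq_nonneg (rel a (.inl s)))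
      have := sq_nonneg ε
      linarith
    · have h4 := h.rel_noise_le t
      have h5 := rel_nonneg a (.inr t)
      have h6 : rel a (.inr t) ^ 2 ≤ ε ^ 2 := pow_le_pow_left₀ h5 h4 2
      have h7 := mul_le_mul hc h6 (sq_nonneg _) (by norm_num)
      simp only [weight, Sum.elim_inr, Pi.zero_apply]
      linarith
  have h8 : ∑ i, (c * rel a i ^ 2 - weight K a b i * rel a i ^ 2) ≤ Q * (4 * ε ^ 2) := by
    refine (Finset.sum_le_card_nsmul _ _ _ fun i _ => h3 i).trans ?_
    rw [Finset.card_univ, nsmul_eq_mul]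
    exact mul_le_mul_of_nonneg_right P.card_le (by positivity)
  rw [Finset.sum_sub_distrib, ← Finset.mul_sum, h2, mul_one] at h8
  have s3 := P.step 3 ε hε
  have s1 := P.mono (k := 1) (l := 3) (by norm_num) hε
  have p3 : 0 ≤ Q ^ 3 * ε := by positivity
  have h9 : Q * (4 * ε ^ 2) ≤ 4 * (Q ^ 1 * ε) := by
    have := P.eps_le_one
    nlinarith [mul_nonneg hQ.le hε]
  simp only [Nat.reduceAdd] at s3
  linarith [h1.1]

lemma Near.meanWeight_le {c : ℝ} (hc0 : 0 ≤ c)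
    (hw : ∀ s, weight K a b (.inl s) ≤ c) : meanWeight K a b ≤ c := by
  unfold meanWeight
  have h1 := h.sum_rel_mul_le_one P
  calc ∑ i, weight K a b i * (rel a i * rel b i) ≤ ∑ i, c * (rel a i * rel b i) := by
        refine Finset.sum_le_sum fun i _ => mul_le_mul_of_nonneg_right ?_
          (mul_nonneg (rel_nonneg _ _) (rel_nonneg _ _))
        rcases i with s | t
        · exact hw s
        · exact hc0
    _ ≤ c := by rw [← Finset.mul_sum]; exact mul_le_of_le_one_right hc0 h1

lemma Near.meanWeight_le_four : meanWeight K a b ≤ 4 :=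
  h.meanWeight_le P hK hκ (by norm_num) fun s => (le_abs_self _).trans (h.abs_weight_le P hK _)

lemma Near.logistic_le_meanWeight (i₀ : S ⊕ T) : logistic K (-1) / 4 ≤ meanWeight K a b := by
  have h4 := logistic_pos hK (-1)
  have h5 := abs_le.1 (abs_logistic_le_one hK (-1))
  have h1 := h.le_meanWeight P hK hκ i₀ (c := 29 / 100 * logistic K (-1))
    (by linarith [h5.2]) (h.le_weight P hK hκ)
  have h6 := P.pow_eps_le (k := 6) (by norm_num)
  have h8 : Q ^ 5 * ε ≤ logistic K (-1) := by
    have e : Q ^ 6 * ε = Q * (Q ^ 5 * ε) := by ring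
    rw [e] at h6
    exact le_of_mul_le_mul_left (h6.trans hκ) P.pos
  have h7 := P.step 4 ε P.eps_nonneg
  simp only [Nat.reduceAdd] at h7
  linarith

/-! ### The energy of the norm differences and its dissipation -/

omit hK hκ in
lemma Near.abs_norm_sub_le (i : S ⊕ T) : |‖a i‖ - ‖b i‖| ≤ 2 * ε * famNorm a := by
  have hε := P.eps_nonneg
  have hn := h.famNorm_pos i
  rcases i with s | t
  · refine (h.left.close s).trans ?_
    have := mul_le_mul_of_nonneg_left (norm_le_famNorm a (.inl s)) hε
    have := mul_nonneg hε hn.le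
    linarith
  · have h1 := h.left.noise t
    have h2 := h.right.noise t
    have h3 := abs_le.1 (h.abs_famNorm_sub_le P (.inr t))
    have h4 : 6 * (Q * ε) ≤ 1 := by
      have := P.step 1 ε hε
      have := P.pow_eps_le (k := 2) (by norm_num)
      simp only [Nat.reduceAdd, pow_one] at *
      linarith [mul_nonneg P.pos.le hε]
    have h5 : famNorm b ≤ 2 * famNorm a := by nlinarith
    have h6 := mul_le_mul_of_nonneg_left h5 hε
    have h7 := norm_nonneg (a (.inr t))
    have h8 := norm_nonneg (b (.inr t))
    have := mul_nonneg hε hn.le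
    rw [abs_le]; constructor <;> linarith

include Sc

omit h hK hκ P in
lemma Scaled.sq_famNorm_sub_le : (famNorm b - famNorm a) ^ 2 ≤ L * energy σ a b := by
  have h1 := Contrastive.sq_famNorm_sub_le b a
  refine h1.trans ?_
  unfold energy
  rw [Finset.mul_sum]
  refine Finset.sum_le_sum fun i _ => ?_
  have h2 := Sc.one_le i
  have h3 := Sc.le i
  rw [← mul_div_assoc, le_div_iff₀ (by linarith), ← neg_sub ‖b i‖, neg_sq, mul_comm]
  exact mul_le_mul_of_nonneg_right h3 (sq_nonneg _)

/-- The derivative of the energy is controlled by the variance of the weights. -/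
lemma Near.energy_rate_le (i₀ : S ⊕ T) :
    ∑ i, 2 * (‖a i‖ - ‖b i‖) * (‖a i‖ / famNorm a ^ 2 * rateLog K a b i
        - ‖b i‖ / famNorm b ^ 2 * rateLog K b a i)
      ≤ 8 * L / logistic K (-1) * energy σ a b * (weightVar K a b / famNorm a ^ 2)
        + Q ^ 7 * ε ^ 3 := by
  have hε := P.eps_nonneg
  have hQ := P.pos
  have hn := h.famNorm_pos i₀
  have hN := h.symm.famNorm_pos i₀
  have hκ0 := logistic_pos hK (-1)
  have hH := h.logistic_le_meanWeight P hK hκ i₀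
  have hH4 := h.meanWeight_le_four P hK hκ
  have hH0 : 0 < meanWeight K a b := by linarith
  have hz : |famNorm b / famNorm a - 1| ≤ 6 * Q * ε := by
    rw [div_sub_one hn.ne', abs_div, abs_of_pos hn, div_le_iff₀ hn, abs_sub_comm]
    exact h.abs_famNorm_sub_le P i₀
  have hnN : famNorm a ≤ 2 * famNorm b := by
    have h3 := abs_le.1 (h.symm.abs_famNorm_sub_le P i₀)
    have h4 : 6 * (Q * ε) ≤ 1 := by
      have := P.step 1 ε hε
      have := P.pow_eps_le (k := 2) (by norm_num)
      simp only [Nat.reduceAdd, pow_one] at *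
      linarith [mul_nonneg P.pos.le hε]
    nlinarith
  have main := sum_sub_mul_le (k := rel a) (l := rel b) (w := weight K a b) hn hN hH0
    (sum_rel_sq hn.ne') (sum_rel_sq hN.ne') (h.weight_nonneg P hK hκ) rfl
  set n := famNorm a
  set N := famNorm b
  set H := meanWeight K a b
  have hΔ : ∑ i, (rel b i - rel a i) ^ 2 ≤ Q * (49 * (Q ^ 2 * ε ^ 2)) := by
    refine (le_abs_self _).trans (P.abs_sum_le (by positivity) fun i => ?_)
    have h1 := h.abs_rel_sub_le_all P i
    rw [abs_sub_comm] at h1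
    rw [abs_pow]
    refine (pow_le_pow_left₀ (abs_nonneg _) h1 2).trans (le_of_eq (by ring))
  have hB : |∑ i, weight K a b i * (rel b i - rel a i) * rel a i| ≤ Q * (28 * (Q * ε)) := by
    refine P.abs_sum_le (by positivity) fun i => ?_
    have h1 := h.abs_rel_sub_le_all P i
    rw [abs_sub_comm] at h1
    rw [abs_mul, abs_mul]
    have h2 := mul_le_mul (h.abs_weight_le P hK i) h1 (abs_nonneg _) (by norm_num)
    have h3 : |rel a i| ≤ 1 := by rw [abs_of_nonneg (rel_nonneg _ _)]; exact rel_le_one _ _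
    refine (mul_le_of_le_one_right (by positivity) h3).trans (h2.trans (le_of_eq (by ring)))
  have hz2 : (N / n - 1) ^ 2 ≤ 36 * (Q ^ 2 * ε ^ 2) := by
    rw [← sq_abs]
    exact (pow_le_pow_left₀ (abs_nonneg _) hz 2).trans (le_of_eq (by ring))
  have hΔ0 : 0 ≤ ∑ i, (rel b i - rel a i) ^ 2 := Finset.sum_nonneg fun i _ => sq_nonneg _
  -- two of the three terms of `main` are of third order
  have c1 : |N / n - 1| * H * ∑ i, (rel b i - rel a i) ^ 2 ≤ Q ^ 6 * ε ^ 3 := by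
    calc _ ≤ (6 * Q * ε) * 4 * (Q * (49 * (Q ^ 2 * ε ^ 2))) := by gcongr
      _ = 1176 * (Q ^ 4 * ε ^ 3) := by ring
      _ ≤ Q ^ 6 * ε ^ 3 := by
        have := P.step 4 (ε ^ 3) (by positivity)
        have := P.step 5 (ε ^ 3) (by positivity)
        have : 0 ≤ Q ^ 4 * ε ^ 3 := by positivity
        simp only [Nat.reduceAdd] at *
        linarith
  have c2 : (N / n - 1) ^ 2 * (n / N) * |∑ i, weight K a b i * (rel b i - rel a i) * rel a i|
      ≤ Q ^ 6 * ε ^ 3 := by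
    have h2 : n / N ≤ 2 := by rw [div_le_iff₀ hN]; exact hnN
    calc _ ≤ (36 * (Q ^ 2 * ε ^ 2)) * 2 * (Q * (28 * (Q * ε))) := by gcongr
      _ = 2016 * (Q ^ 4 * ε ^ 3) := by ring
      _ ≤ Q ^ 6 * ε ^ 3 := by
        have := P.step 4 (ε ^ 3) (by positivity)
        have := P.step 5 (ε ^ 3) (by positivity)
        have : 0 ≤ Q ^ 4 * ε ^ 3 := by positivity
        simp only [Nat.reduceAdd] at *
        linarith
  have hV : 0 ≤ weightVar K a b :=
    Finset.sum_nonneg fun i _ => mul_nonneg (sq_nonneg _) (sq_nonneg _)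
  -- the remaining term carries the variance
  have c3 : (N / n - 1) ^ 2 / H * weightVar K a b
      ≤ 4 * L / logistic K (-1) * energy σ a b * (weightVar K a b / n ^ 2) := by
    have h1 : (N / n - 1) ^ 2 ≤ L * energy σ a b / n ^ 2 := by
      rw [div_sub_one hn.ne', div_pow]
      exact div_le_div_of_nonneg_right Sc.sq_famNorm_sub_le (by positivity)
    have h2 : 1 / H ≤ 4 / logistic K (-1) := by
      rw [div_le_div_iff₀ hH0 hκ0]; linarith
    have h3 := mul_le_mul h1 h2 (by positivity) ((sq_nonneg _).trans h1)
    have h4 := mul_le_mul_of_nonneg_right h3 hV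
    calc _ = (N / n - 1) ^ 2 * (1 / H) * weightVar K a b := by ring
      _ ≤ _ := h4
      _ = _ := by ring
  -- the terms beyond the model for the logarithmic derivatives
  have hrem : |∑ i, (‖a i‖ - ‖b i‖) * (‖a i‖ / n ^ 2 * rateLog K a b i
        - ‖b i‖ / N ^ 2 * rateLog K b a i)
      - ∑ i, (n * rel a i - N * rel b i) * (-H * (rel a i / n - rel b i / N)
        + weight K a b i * (rel b i / n - rel a i / N))| ≤ Q * (6 * (Q ^ 5 * ε ^ 3)) := by
    rw [← Finset.sum_sub_distrib]
    refine P.abs_sum_le (by positivity) fun i => ?_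
    have ha := h.rel_pos i
    have hb := h.symm.rel_pos i
    have h1 := h.abs_rateLog_sub_le P hK i
    have h2 := h.symm.abs_rateLog_sub_le P hK i
    rw [weight_comm, meanWeight_comm] at h2
    have h3 := h.abs_norm_sub_le P i
    have ea : ‖a i‖ = n * rel a i := norm_eq_famNorm_mul_rel hn.ne' i
    have eb : ‖b i‖ = N * rel b i := norm_eq_famNorm_mul_rel hN.ne' i
    rw [ea, eb] at h3 ⊢
    set k := rel a i
    set l := rel b i
    set w := weight K a b i
    set ra := rateLog K a b i
    set rb := rateLog K b a i
    have e : (n * k - N * l) * (n * k / n ^ 2 * ra - N * l / N ^ 2 * rb)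
        - (n * k - N * l) * (-H * (k / n - l / N) + w * (l / n - k / N))
        = (n * k - N * l) * (k / n * (ra - (w * (l / k) - H)) - l / N * (rb - (w * (k / l) - H)))
        := by
      field_simp
      ring
    rw [e, abs_mul]
    have h4 : |k / n * (ra - (w * (l / k) - H)) - l / N * (rb - (w * (k / l) - H))|
        ≤ 3 / n * (Q ^ 5 * ε ^ 2) := by
      refine (abs_sub _ _).trans ?_
      rw [abs_mul, abs_mul, abs_of_pos (div_pos ha hn), abs_of_pos (div_pos hb hN)]
      have h5 : k / n ≤ 1 / n := div_le_div_of_nonneg_right (rel_le_one a i) hn.le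
      have h6 : l / N ≤ 2 / n := by
        rw [div_le_div_iff₀ hN hn]
        have := rel_le_one b i
        nlinarith
      have h7 := mul_le_mul h5 h1 (abs_nonneg _) (by positivity)
      have h8 := mul_le_mul h6 h2 (abs_nonneg _) (by positivity)
      refine (add_le_add h7 h8).trans (le_of_eq (by ring))
    refine (mul_le_mul h3 h4 (abs_nonneg _) (by positivity)).trans (le_of_eq ?_)
    field_simp
    ring
  have e2 : ∑ i, 2 * (‖a i‖ - ‖b i‖) * (‖a i‖ / n ^ 2 * rateLog K a b i
        - ‖b i‖ / N ^ 2 * rateLog K b a i)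
      = 2 * ∑ i, (‖a i‖ - ‖b i‖) * (‖a i‖ / n ^ 2 * rateLog K a b i
        - ‖b i‖ / N ^ 2 * rateLog K b a i) := by
    rw [Finset.mul_sum]; exact Finset.sum_congr rfl fun i _ => by ring
  rw [e2]
  have h6 := (abs_le.1 hrem).2
  have s6 := P.step 6 (ε ^ 3) (by positivity)
  have p6 : 0 ≤ Q ^ 6 * ε ^ 3 := by positivity
  have e3 : Q * (6 * (Q ^ 5 * ε ^ 3)) = 6 * (Q ^ 6 * ε ^ 3) := by ring
  have e4 : 8 * L / logistic K (-1) * energy σ a b * (weightVar K a b / n ^ 2)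
      = 2 * (4 * L / logistic K (-1) * energy σ a b * (weightVar K a b / n ^ 2)) := by ring
  have e5 : (N / n - 1) ^ 2 / H * ∑ i, (weight K a b i - H) ^ 2 * rel a i ^ 2
      = (N / n - 1) ^ 2 / H * weightVar K a b := rfl
  simp only [Nat.reduceAdd] at s6
  rw [e4]
  linarith

include hL

omit Sc hL in
/-- How far the weights are from an affine function of `tanh (rel a i ^ 2)`. -/
lemma Near.rel_mul_abs_weight_sub_le (i₀ i : S ⊕ T) :
    rel a i * |weight K a b i - meanWeight K a b + 2 * logistic K (gapDiag (overlap a b)) *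
      (Real.tanh (rel a i ^ 2) - ∑ j, Real.tanh (rel a j ^ 2) * rel a j ^ 2)| ≤ Q ^ 6 * ε := by
  have hε := P.eps_nonneg
  have hQ := P.pos
  have hn := h.famNorm_pos i₀
  have hp0 := logistic_pos hK (gapDiag (overlap a b))
  have hp1 := (logistic_lt_one hK (gapDiag (overlap a b))).le
  set p := logistic K (gapDiag (overlap a b)) with hp
  set X := ∑ j, Real.tanh (rel a j ^ 2) * rel a j ^ 2
  have s3 := P.step 3 ε hε
  have s4 := P.step 4 ε hε
  have s5 := P.step 5 ε hε
  have m := P.mono (k := 0) (l := 3) (by norm_num) hε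
  have p3 : 0 ≤ Q ^ 3 * ε := by positivity
  simp only [Nat.reduceAdd, pow_zero, one_mul] at s3 s4 s5 m
  have h1 : ∀ i, rel a i * |weight K a b i - 2 * p * (1 - Real.tanh (rel a i ^ 2))| ≤ Q ^ 4 * ε := by
    intro i
    rcases i with s | t
    · exact (mul_le_of_le_one_left (abs_nonneg _) (rel_le_one _ _)).trans
        (h.abs_weight_sub_le P hK s)
    · have h2 := h.rel_noise_le t
      have h3 := tanh_nonneg (sq_nonneg (rel a (.inr t)))
      have h4 := one_sub_tanh_ge (x := rel a (.inr t) ^ 2)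
        (pow_le_one₀ (rel_nonneg _ _) (rel_le_one _ _))
      have h5 : |weight K a b (.inr t) - 2 * p * (1 - Real.tanh (rel a (.inr t) ^ 2))| ≤ 2 := by
        simp only [weight, Sum.elim_inr, Pi.zero_apply]
        rw [zero_sub, abs_neg, abs_of_nonneg (by positivity)]
        nlinarith
      have := mul_le_mul h2 h5 (abs_nonneg _) hε
      linarith
  have h2 : |∑ i, weight K a b i * rel a i ^ 2 - 2 * p * (1 - X)| ≤ Q * (Q ^ 4 * ε) := by
    have e : ∑ i, weight K a b i * rel a i ^ 2 - 2 * p * (1 - X)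
        = ∑ i, (weight K a b i - 2 * p * (1 - Real.tanh (rel a i ^ 2))) * rel a i ^ 2 := by
      have e1 : ∀ i, (weight K a b i - 2 * p * (1 - Real.tanh (rel a i ^ 2))) * rel a i ^ 2
          = weight K a b i * rel a i ^ 2 - 2 * p * (rel a i ^ 2
            - Real.tanh (rel a i ^ 2) * rel a i ^ 2) := fun i => by ring
      simp only [e1, Finset.sum_sub_distrib, ← Finset.mul_sum]
      rw [sum_rel_sq hn.ne']
    rw [e]
    refine P.abs_sum_le (by positivity) fun i => ?_
    rw [abs_mul, abs_of_nonneg (sq_nonneg (rel a i))]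
    calc _ = rel a i * (rel a i
          * |weight K a b i - 2 * p * (1 - Real.tanh (rel a i ^ 2))|) := by ring
      _ ≤ _ := (mul_le_of_le_one_left (mul_nonneg (rel_nonneg _ _) (abs_nonneg _))
        (rel_le_one _ _)).trans (h1 i)
  have h3 := h.abs_meanWeight_sub_le P hK
  have e : weight K a b i - meanWeight K a b + 2 * p * (Real.tanh (rel a i ^ 2) - X)
      = (weight K a b i - 2 * p * (1 - Real.tanh (rel a i ^ 2)))
        - (∑ i, weight K a b i * rel a i ^ 2 - 2 * p * (1 - X))
        - (meanWeight K a b - ∑ i, weight K a b i * rel a i ^ 2) := by ring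
  rw [e]
  have t1 := abs_sub ((weight K a b i - 2 * p * (1 - Real.tanh (rel a i ^ 2)))
        - (∑ i, weight K a b i * rel a i ^ 2 - 2 * p * (1 - X)))
        (meanWeight K a b - ∑ i, weight K a b i * rel a i ^ 2)
  have t2 := abs_sub (weight K a b i - 2 * p * (1 - Real.tanh (rel a i ^ 2)))
        (∑ i, weight K a b i * rel a i ^ 2 - 2 * p * (1 - X))
  have hk0 := rel_nonneg a i
  have hk1 := rel_le_one a i
  have t3 := mul_le_mul_of_nonneg_left (t1.trans (add_le_add t2 le_rfl)) hk0
  have t4 := mul_le_of_le_one_left (abs_nonneg (∑ i, weight K a b i * rel a i ^ 2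
    - 2 * p * (1 - X))) hk1
  have t5 := mul_le_of_le_one_left (abs_nonneg (meanWeight K a b
    - ∑ i, weight K a b i * rel a i ^ 2)) hk1
  have t6 := h1 i
  have e6 : Q * (Q ^ 4 * ε) = Q ^ 5 * ε := by ring
  rw [mul_add, mul_add] at t3
  linarith

/-- The potential `∑ log cosh (k²)` of the relative sizes `k` dissipates the variance of the
weights. -/
lemma Near.potential_rate_le (i₀ : S ⊕ T) :
    ∑ i, Real.tanh (rel a i ^ 2) * (2 * rel a i ^ 2 * (σ i * rateLog K a b i
        - ∑ j, σ j * rel a j ^ 2 * rateLog K a b j) / famNorm a ^ 2)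
      ≤ -(weightVar K a b / famNorm a ^ 2) + Q ^ 10 * ε := by
  have hε := P.eps_nonneg
  have hQ := P.pos
  have hn := h.famNorm_pos i₀
  have hL0 := Sc.L_pos i₀
  set X := ∑ j, Real.tanh (rel a j ^ 2) * rel a j ^ 2 with hX
  set n := famNorm a
  have hτ0 : ∀ i, 0 ≤ Real.tanh (rel a i ^ 2) := fun i => tanh_nonneg (sq_nonneg _)
  have hτ1 : ∀ i, Real.tanh (rel a i ^ 2) ≤ 1 := fun i => by
    linarith [one_sub_tanh_ge (x := rel a i ^ 2) (pow_le_one₀ (rel_nonneg _ _) (rel_le_one _ _))]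
  have hX0 : 0 ≤ X := Finset.sum_nonneg fun i _ => mul_nonneg (hτ0 i) (sq_nonneg _)
  have hX1 : X ≤ 1 := by
    rw [← sum_rel_sq hn.ne']
    exact Finset.sum_le_sum fun i _ => mul_le_of_le_one_left (sq_nonneg _) (hτ1 i)
  have hτX : ∀ i, |Real.tanh (rel a i ^ 2) - X| ≤ 1 := fun i => by
    rw [abs_le]; constructor <;> linarith [hτ0 i, hτ1 i]
  -- the change of `famNorm a` replaces `tanh (rel a i ^ 2)` by its deviation from the mean `X`
  have e1 : ∑ i, Real.tanh (rel a i ^ 2) * (2 * rel a i ^ 2 * (σ i * rateLog K a b i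
        - ∑ j, σ j * rel a j ^ 2 * rateLog K a b j) / n ^ 2)
      = 2 / n ^ 2 * ∑ i, σ i * (rel a i ^ 2 * ((Real.tanh (rel a i ^ 2) - X)
        * rateLog K a b i)) := by
    set R := ∑ j, σ j * rel a j ^ 2 * rateLog K a b j with hR
    have e2 : ∀ i, σ i * (rel a i ^ 2 * ((Real.tanh (rel a i ^ 2) - X) * rateLog K a b i))
        = Real.tanh (rel a i ^ 2) * (rel a i ^ 2 * σ i * rateLog K a b i)
          - X * (σ i * rel a i ^ 2 * rateLog K a b i) := fun i => by ring
    have e3 : ∀ i, Real.tanh (rel a i ^ 2) * (2 * rel a i ^ 2 * (σ i * rateLog K a b i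
        - R) / n ^ 2) = 2 / n ^ 2 * (Real.tanh (rel a i ^ 2) * (rel a i ^ 2 * σ i * rateLog K a b i)
          - Real.tanh (rel a i ^ 2) * rel a i ^ 2 * R) := fun i => by ring
    simp only [e2, e3, Finset.sum_sub_distrib, ← Finset.mul_sum, ← Finset.sum_mul]
    rfl
  have hη1 : Q ^ 6 * ε ≤ 1 := P.pow_eps_le (by norm_num)
  have main := sum_mul_sub_mul_le (k := rel a) (σ := σ) (τ := fun i => Real.tanh (rel a i ^ 2))
    (y := fun i => weight K a b i - meanWeight K a b) (T := X)
    (p := logistic K (gapDiag (overlap a b))) (η := Q ^ 6 * ε) (L := L)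
    (logistic_pos hK _) (logistic_lt_one hK _).le (rel_nonneg a) (rel_le_one a) Sc.one_le Sc.le
    hτX hη1 (fun i => h.rel_mul_abs_weight_sub_le P hK hκ i₀ i)
  have hrem : |∑ i, σ i * (rel a i ^ 2 * ((Real.tanh (rel a i ^ 2) - X) * rateLog K a b i))
      - ∑ i, σ i * (rel a i ^ 2 * ((Real.tanh (rel a i ^ 2) - X)
        * (weight K a b i - meanWeight K a b)))| ≤ Q * (Q * (Q ^ 2 * ε)) := by
    rw [← Finset.sum_sub_distrib]
    refine P.abs_sum_le (by positivity) fun i => ?_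
    have hk := h.rel_pos i
    have hk1 := rel_le_one a i
    have h1 := h.abs_rateLog_sub_le P hK i
    have h2 := h.abs_rel_sub_le_all P i
    rw [abs_sub_comm] at h2
    have h3 := h.abs_weight_le P hK i
    set k := rel a i
    set l := rel b i
    set w := weight K a b i
    set ra := rateLog K a b i
    set H := meanWeight K a b
    set τ := Real.tanh (k ^ 2)
    have e : σ i * (k ^ 2 * ((τ - X) * ra)) - σ i * (k ^ 2 * ((τ - X) * (w - H)))
        = σ i * ((τ - X) * (k ^ 2 * (ra - (w * (l / k) - H)) + k * (w * (l - k)))) := by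
      field_simp
      ring
    have hσ0 : 0 ≤ σ i := zero_le_one.trans (Sc.one_le i)
    rw [e, abs_mul, abs_mul, abs_of_nonneg hσ0]
    have h4 : |k ^ 2 * (ra - (w * (l / k) - H)) + k * (w * (l - k))| ≤ Q ^ 2 * ε := by
      refine (abs_add_le _ _).trans ?_
      rw [abs_mul, abs_mul, abs_mul, abs_of_pos hk, abs_of_pos (pow_pos hk 2)]
      have h5 := (mul_le_of_le_one_left (abs_nonneg (ra - (w * (l / k) - H)))
        (pow_le_one₀ (n := 2) hk.le hk1)).trans h1
      have h6 := mul_le_mul h3 h2 (abs_nonneg _) (by norm_num)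
      have h7 := (mul_le_of_le_one_left (mul_nonneg (abs_nonneg w) (abs_nonneg (l - k)))
        hk1).trans h6
      have h8 := P.absorb (k := 5) (by norm_num)
      have h9 := P.step 1 ε hε
      have h10 := P.step 0 ε hε
      simp only [Nat.reduceAdd, pow_one, zero_add, pow_zero, one_mul] at h9 h10
      linarith
    have h5 := mul_le_mul (hτX i) h4 (abs_nonneg _) zero_le_one
    rw [one_mul] at h5
    exact mul_le_mul ((Sc.le i).trans hL) h5 (by positivity) hQ.le
  have h1 := (abs_le.1 hrem).2
  have hn2 : 2 / n ^ 2 ≤ 8 := by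
    rw [div_le_iff₀ (pow_pos hn 2)]
    have := one_le_pow₀ (n := 2) Sc.left
    nlinarith
  have hcard : (Fintype.card (S ⊕ T) : ℝ) * (2 * (L * (Q ^ 6 * ε))) ≤ Q * (2 * (Q * (Q ^ 6 * ε))) := by
    have := P.card_le
    gcongr
  have h2 : ∑ i, σ i * (rel a i ^ 2 * ((Real.tanh (rel a i ^ 2) - X) * rateLog K a b i))
      ≤ -(weightVar K a b) / 2 + 3 * (Q ^ 8 * ε) := by
    have e2 : Q * (2 * (Q * (Q ^ 6 * ε))) = 2 * (Q ^ 8 * ε) := by ring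
    have e3 : Q * (Q * (Q ^ 2 * ε)) = Q ^ 4 * ε := by ring
    have m := P.mono (k := 4) (l := 8) (by norm_num) hε
    have e4 : weightVar K a b = ∑ i, (weight K a b i - meanWeight K a b) ^ 2 * rel a i ^ 2 := rfl
    rw [e4]
    linarith
  rw [e1]
  have h3 := mul_le_mul_of_nonneg_left h2 (by positivity : 0 ≤ 2 / n ^ 2)
  have p8 : 0 ≤ 3 * (Q ^ 8 * ε) := by positivity
  have h4 := mul_le_mul_of_nonneg_right hn2 p8
  have s8 := P.step 8 ε hε
  have m := P.mono (k := 9) (l := 10) (by norm_num) hε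
  simp only [Nat.reduceAdd] at s8
  have e5 : 2 / n ^ 2 * (-(weightVar K a b) / 2 + 3 * (Q ^ 8 * ε))
      = -(weightVar K a b / n ^ 2) + 2 / n ^ 2 * (3 * (Q ^ 8 * ε)) := by ring
  linarith

/-! ### Balancing of the signals -/

omit Sc hL hκ in
lemma Near.abs_rateLog_sub_le' (i : S ⊕ T) (hi : 1 ≤ Q * rel a i ∨ weight K a b i = 0) :
    |rateLog K a b i - (weight K a b i - meanWeight K a b)| ≤ Q ^ 3 * ε := by
  have h1 := h.abs_rateLog_sub_le P hK i
  have hε := P.eps_nonneg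
  have hQ := P.pos
  have h2 : |weight K a b i * (rel b i / rel a i - 1)| ≤ 28 * (Q ^ 2 * ε) := by
    rcases hi with hi | hi
    · have hk := h.rel_pos i
      have h3 := h.abs_rel_sub_le_all P i
      rw [abs_sub_comm] at h3
      have h4 : |rel b i / rel a i - 1| ≤ 7 * (Q ^ 2 * ε) := by
        rw [div_sub_one hk.ne', abs_div, abs_of_pos hk, div_le_iff₀ hk]
        have : 0 ≤ 7 * Q * ε := by positivity
        nlinarith
      rw [abs_mul]
      have := mul_le_mul (h.abs_weight_le P hK i) h4 (abs_nonneg _) (by norm_num)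
      linarith
    · rw [hi, zero_mul, abs_zero]; positivity
  have e : rateLog K a b i - (weight K a b i - meanWeight K a b)
      = (rateLog K a b i - (weight K a b i * (rel b i / rel a i) - meanWeight K a b))
        + weight K a b i * (rel b i / rel a i - 1) := by ring
  rw [e]
  have t := abs_add_le (rateLog K a b i - (weight K a b i * (rel b i / rel a i)
    - meanWeight K a b)) (weight K a b i * (rel b i / rel a i - 1))
  have h8 := P.absorb (k := 5) (by norm_num)
  have h9 := P.step 2 ε hε
  have m := P.mono (k := 0) (l := 2) (by norm_num) hε
  have p2 : 0 ≤ Q ^ 2 * ε := by positivity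
  simp only [Nat.reduceAdd, pow_zero, one_mul] at h9 m
  linarith

/-- As long as they are not balanced, the ratio of the largest to the smallest signal decays at a
rate bounded below. -/
lemma Near.ratio_rate_le {cT : ℝ} (hcT : cT ≤ Q * (cT - 1)) (hcT1 : 1 < cT) {p q : S}
    (hp : ∀ s, ‖a (.inl s)‖ ≤ ‖a (.inl p)‖) (hq : ∀ s, ‖a (.inl q)‖ ≤ ‖a (.inl s)‖)
    (hpq : cT * ‖a (.inl q)‖ ^ 2 ≤ ‖a (.inl p)‖ ^ 2) (hn2 : famNorm a ^ 2 ≤ Q) :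
    σ (.inl p) / famNorm a ^ 2 * rateLog K a b (.inl p)
      - σ (.inl q) / famNorm a ^ 2 * rateLog K a b (.inl q) ≤ -(1 / Q ^ 7) := by
  have hε := P.eps_nonneg
  have hQ := P.pos
  have hn := h.famNorm_pos (.inl p)
  have hrel : ∀ s s', ‖a (.inl s)‖ ≤ ‖a (.inl s')‖ → rel a (.inl s) ≤ rel a (.inl s') :=
    fun s s' hs => div_le_div_of_nonneg_right hs hn.le
  have hsq : ∀ s s', ‖a (.inl s)‖ ≤ ‖a (.inl s')‖ → Real.tanh (rel a (.inl s) ^ 2)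
      ≤ Real.tanh (rel a (.inl s') ^ 2) := fun s s' hs =>
    tanh_mono (pow_le_pow_left₀ (rel_nonneg _ _) (hrel s s' hs) 2)
  set P0 := logistic K (gapDiag (overlap a b)) with hP0
  have hP0κ : logistic K (-1) ≤ P0 := logistic_mono hK (h.nearDiag P).gapDiag_ge
  have hκ0 := logistic_pos hK (-1)
  have hP0pos : 0 < P0 := hκ0.trans_le hP0κ
  have hw := fun s => abs_le.1 (h.abs_weight_sub_le P hK s)
  have h4 := P.step 4 ε hε
  have h5 := P.step 5 ε hε
  have h6 := P.step 6 ε hε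
  have p4 : 0 ≤ Q ^ 4 * ε := by positivity
  have m3 := P.mono (k := 3) (l := 4) (by norm_num) hε
  simp only [Nat.reduceAdd] at h4 h5 h6
  have wp : ∀ s, weight K a b (.inl p) - 2 * (Q ^ 4 * ε) ≤ weight K a b (.inl s) := fun s => by
    have := mul_le_mul_of_nonneg_left (hsq s p (hp s)) (by positivity : 0 ≤ 2 * P0)
    linarith [(hw s).1, (hw p).2]
  have wq : ∀ s, weight K a b (.inl s) ≤ weight K a b (.inl q) + 2 * (Q ^ 4 * ε) := fun s => by
    have := mul_le_mul_of_nonneg_left (hsq q s (hq s)) (by positivity : 0 ≤ 2 * P0)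
    linarith [(hw q).1, (hw s).2]
  have hp4 := (abs_le.1 (h.abs_weight_le P hK (.inl p))).2
  have Hp := h.le_meanWeight P hK hκ (.inl p) (c := weight K a b (.inl p) - 2 * (Q ^ 4 * ε))
    (by linarith) wp
  have Hq := h.meanWeight_le P hK hκ (c := weight K a b (.inl q) + 2 * (Q ^ 4 * ε))
    (add_nonneg (h.weight_nonneg P hK hκ _) (by positivity)) wq
  -- the gap between the extreme weights
  have hk : 1 / Q ^ 3 ≤ rel a (.inl p) ^ 2 - rel a (.inl q) ^ 2 := by
    have h1 := h.one_le_mul_rel p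
    have h2 : cT * rel a (.inl q) ^ 2 ≤ rel a (.inl p) ^ 2 := by
      simp only [rel, div_pow]
      rw [← mul_div_assoc]
      exact div_le_div_of_nonneg_right hpq (by positivity)
    have h3 : 1 ≤ Q ^ 2 * rel a (.inl p) ^ 2 := by rw [← mul_pow]; exact one_le_pow₀ h1
    rw [div_le_iff₀ (by positivity)]
    have h7 : rel a (.inl p) ^ 2 ≤ Q * (rel a (.inl p) ^ 2 - rel a (.inl q) ^ 2) := by
      have hc0 : 0 < cT := by linarith
      have h8 : (cT - 1) * rel a (.inl p) ^ 2
          ≤ cT * (rel a (.inl p) ^ 2 - rel a (.inl q) ^ 2) := by linarith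
      have hd0 : 0 ≤ rel a (.inl p) ^ 2 - rel a (.inl q) ^ 2 := by
        have : rel a (.inl q) ≤ rel a (.inl p) := hrel q p (hp q)
        have := pow_le_pow_left₀ (rel_nonneg _ _) this 2
        linarith
      have h9 := mul_le_mul_of_nonneg_right hcT hd0
      have h10 := h8.trans h9
      rw [mul_comm Q, mul_assoc] at h10
      exact le_of_mul_le_mul_left h10 (by linarith)
    calc 1 ≤ Q ^ 2 * rel a (.inl p) ^ 2 := h3
      _ ≤ Q ^ 2 * (Q * (rel a (.inl p) ^ 2 - rel a (.inl q) ^ 2)) := by gcongr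
      _ = _ := by ring
  have ht := le_tanh_sub_tanh (sq_nonneg (rel a (.inl q)))
    (pow_le_pow_left₀ (rel_nonneg _ _) (hrel q p (hp q)) 2)
    (pow_le_one₀ (rel_nonneg a (.inl p)) (rel_le_one a _))
  have hP01 : 1 / Q ≤ P0 := by
    rw [div_le_iff₀ hQ]; rw [mul_comm] at hκ; exact hκ.trans (by gcongr)
  have hgap : 2 / 3 * (1 / Q ^ 4) - 2 * (Q ^ 4 * ε)
      ≤ weight K a b (.inl q) - weight K a b (.inl p) := by
    have h1 : 1 / Q * (1 / Q ^ 3 / 3) ≤ P0 * (Real.tanh (rel a (.inl p) ^ 2)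
        - Real.tanh (rel a (.inl q) ^ 2)) := by
      refine mul_le_mul hP01 (le_trans ?_ ht) (by positivity) (le_trans (by positivity) hP01)
      gcongr
    have e : 1 / Q * (1 / Q ^ 3 / 3) = 1 / 3 * (1 / Q ^ 4) := by field_simp
    rw [e] at h1
    linarith [(hw p).2, (hw q).1]
  have hrp := abs_le.1 (h.abs_rateLog_sub_le' P hK (.inl p) (Or.inl (h.one_le_mul_rel p)))
  have hrq := abs_le.1 (h.abs_rateLog_sub_le' P hK (.inl q) (Or.inl (h.one_le_mul_rel q)))
  have up : rateLog K a b (.inl p) ≤ weight K a b (.inl p) - meanWeight K a b + Q ^ 4 * ε := by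
    linarith
  have uq : weight K a b (.inl q) - meanWeight K a b - Q ^ 4 * ε ≤ rateLog K a b (.inl q) := by
    linarith
  -- multiplication by a strength in `[1, L]` costs little when the sign is nearly right
  have s1 : σ (.inl p) * rateLog K a b (.inl p)
      ≤ weight K a b (.inl p) - meanWeight K a b + Q * (5 * (Q ^ 4 * ε)) := by
    have a1 := Sc.one_le (.inl p)
    have a2 := (Sc.le (.inl p)).trans hL
    have a3 := mul_le_mul_of_nonneg_left up (zero_le_one.trans a1)
    have a4 : 0 ≤ (σ (.inl p) - 1) *
        (4 * (Q ^ 4 * ε) - (weight K a b (.inl p) - meanWeight K a b)) :=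
      mul_nonneg (by linarith) (by linarith)
    have a5 := mul_le_mul_of_nonneg_right a2 p4
    linarith
  have s2 : weight K a b (.inl q) - meanWeight K a b - Q * (5 * (Q ^ 4 * ε))
      ≤ σ (.inl q) * rateLog K a b (.inl q) := by
    have a1 := Sc.one_le (.inl q)
    have a2 := (Sc.le (.inl q)).trans hL
    have a3 := mul_le_mul_of_nonneg_left uq (zero_le_one.trans a1)
    have a4 : 0 ≤ (σ (.inl q) - 1) *
        (4 * (Q ^ 4 * ε) + (weight K a b (.inl q) - meanWeight K a b)) :=
      mul_nonneg (by linarith) (by linarith)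
    have a5 := mul_le_mul_of_nonneg_right a2 p4
    linarith
  have e5 : Q * (5 * (Q ^ 4 * ε)) = 5 * (Q ^ 5 * ε) := by ring
  have h12 : Q ^ 6 * ε ≤ 1 / 100 * (1 / Q ^ 4) := by
    have h11 := P.pow_eps_le (k := 11) (by norm_num)
    have : 100 * (Q ^ 10 * ε) ≤ Q ^ 11 * ε := P.step 10 ε hε
    rw [← mul_le_mul_iff_left₀ (by positivity : 0 < Q ^ 4)]
    have e6 : 1 / 100 * (1 / Q ^ 4) * Q ^ 4 = 1 / 100 := by field_simp
    rw [e6]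
    linarith
  have h13 : σ (.inl p) * rateLog K a b (.inl p) - σ (.inl q) * rateLog K a b (.inl q)
      ≤ -(1 / 2 * (1 / Q ^ 4)) := by
    have : 0 < 1 / Q ^ 4 := by positivity
    linarith
  have e7 : σ (.inl p) / famNorm a ^ 2 * rateLog K a b (.inl p)
      - σ (.inl q) / famNorm a ^ 2 * rateLog K a b (.inl q)
      = (σ (.inl p) * rateLog K a b (.inl p) - σ (.inl q) * rateLog K a b (.inl q))
        / famNorm a ^ 2 := by ring
  rw [e7, div_le_iff₀ (pow_pos hn 2)]
  have h14 : 1 / Q ^ 7 * famNorm a ^ 2 ≤ 1 / Q ^ 7 * Q := by gcongr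
  have e8 : 1 / Q ^ 7 * Q = 1 / Q ^ 2 * (1 / Q ^ 4) := by field_simp
  have h15 : 1 / Q ^ 2 ≤ 1 / 2 := by
    rw [div_le_div_iff₀ (by positivity) (by norm_num)]
    nlinarith [P.hQ]
  have h16 := mul_le_mul_of_nonneg_right h15 (by positivity : 0 ≤ 1 / Q ^ 4)
  linarith

omit Sc hL in
/-- The norm of a noise does not increase. -/
lemma Near.rateLog_noise_nonpos (t : T) : rateLog K a b (.inr t) ≤ 0 := by
  have h1 := (abs_le.1 (h.abs_rateLog_sub_le' P hK (.inr t) (Or.inr rfl))).2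
  have h2 := h.logistic_le_meanWeight P hK hκ (.inr t)
  have h6 := P.pow_eps_le (k := 6) (by norm_num)
  have h8 : Q ^ 5 * ε ≤ logistic K (-1) := by
    have e : Q ^ 6 * ε = Q * (Q ^ 5 * ε) := by ring
    rw [e] at h6
    exact le_of_mul_le_mul_left (h6.trans hκ) P.pos
  have h7 := P.step 4 ε P.eps_nonneg
  have h9 := P.mono (k := 3) (l := 4) (by norm_num) P.eps_nonneg
  have h10 := logistic_pos hK (-1)
  simp only [Nat.reduceAdd] at h7
  simp only [weight, Sum.elim_inr, Pi.zero_apply] at h1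
  linarith

omit Sc hL in
lemma Near.le_rateLog_noise (t : T) : -5 ≤ rateLog K a b (.inr t) := by
  have h1 := (abs_le.1 (h.abs_rateLog_sub_le' P hK (.inr t) (Or.inr rfl))).1
  have h2 := h.meanWeight_le_four P hK hκ
  have h6 := P.pow_eps_le (k := 3) (by norm_num)
  simp only [weight, Sum.elim_inr, Pi.zero_apply] at h1
  linarith

/-- The norms of a noise in the two families decay at nearly the same rate. -/
lemma Near.abs_rate_noise_sub_le (t : T) :
    |σ (.inr t) / famNorm a ^ 2 * rateLog K a b (.inr t)
      - σ (.inr t) / famNorm b ^ 2 * rateLog K b a (.inr t)| ≤ Q ^ 5 * ε := by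
  have hε := P.eps_nonneg
  have hQ := P.pos
  have h1 := h.abs_rateLog_sub_le' P hK (.inr t) (Or.inr rfl)
  have h2 := h.symm.abs_rateLog_sub_le' P hK (.inr t) (Or.inr rfl)
  rw [weight_comm, meanWeight_comm] at h2
  simp only [weight, Sum.elim_inr, Pi.zero_apply, zero_sub, sub_neg_eq_add] at h1 h2
  have h3 := h.meanWeight_le_four P hK hκ
  have h3' := h.logistic_le_meanWeight P hK hκ (.inr t)
  have hκ0 := logistic_pos hK (-1)
  have hs := (Sc.div_sq_le (.inr t)).trans (by linarith : 4 * L ≤ 4 * Q)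
  have hs' := (Sc.symm.div_sq_le (.inr t)).trans (by linarith : 4 * L ≤ 4 * Q)
  have hs0 := (Sc.div_sq_pos (.inr t)).le
  have hs0' := (Sc.symm.div_sq_pos (.inr t)).le
  have hn := h.famNorm_pos (.inr t)
  have hN := h.symm.famNorm_pos (.inr t)
  have hd := h.symm.abs_famNorm_sub_le P (.inr t)
  have hd2 : |σ (.inr t) / famNorm a ^ 2 - σ (.inr t) / famNorm b ^ 2| ≤ 4 * Q * (18 * Q * ε) := by
    have e : σ (.inr t) / famNorm a ^ 2 - σ (.inr t) / famNorm b ^ 2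
        = σ (.inr t) / famNorm a ^ 2 * (((famNorm b - famNorm a) / famNorm b)
          * (1 + famNorm a / famNorm b)) := by
      field_simp; ring
    have h4 : |(famNorm b - famNorm a) / famNorm b| ≤ 6 * Q * ε := by
      rw [abs_div, abs_of_pos hN, div_le_iff₀ hN]; exact hd
    have h5 : famNorm a / famNorm b ≤ 2 := by
      rw [div_le_iff₀ hN]
      have h6 := (abs_le.1 hd).1
      have h7 : 6 * (Q * ε) ≤ 1 := by
        have := P.step 1 ε hε
        have := P.pow_eps_le (k := 2) (by norm_num)
        simp only [Nat.reduceAdd, pow_one] at *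
        linarith [mul_nonneg hQ.le hε]
      nlinarith
    rw [e, abs_mul, abs_mul, abs_of_nonneg hs0,
      abs_of_nonneg (by positivity : 0 ≤ 1 + famNorm a / famNorm b)]
    have h8 := mul_le_mul h4 (by linarith : 1 + famNorm a / famNorm b ≤ 3) (by positivity)
      (by positivity)
    refine (mul_le_mul hs h8 (by positivity) (by positivity)).trans (le_of_eq (by ring))
  set x := σ (.inr t) / famNorm a ^ 2
  set y := σ (.inr t) / famNorm b ^ 2
  set ra := rateLog K a b (.inr t)
  set rb := rateLog K b a (.inr t)
  set H := meanWeight K a b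
  have e : x * ra - y * rb = x * (ra + H) - y * (rb + H) - (x - y) * H := by ring
  rw [e]
  have t1 := abs_sub (x * (ra + H) - y * (rb + H)) ((x - y) * H)
  have t2 := abs_sub (x * (ra + H)) (y * (rb + H))
  rw [abs_mul, abs_mul, abs_of_nonneg hs0, abs_of_nonneg hs0'] at t2
  rw [abs_mul, abs_of_nonneg (by linarith : 0 ≤ H)] at t1
  have u1 := mul_le_mul hs h1 (abs_nonneg _) (by positivity)
  have u2 := mul_le_mul hs' h2 (abs_nonneg _) (by positivity)
  have u3 := mul_le_mul hd2 h3 (by linarith) (by positivity)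
  have e1 : 4 * Q * (Q ^ 3 * ε) = 4 * (Q ^ 4 * ε) := by ring
  have e2 : 4 * Q * (18 * Q * ε) * 4 = 288 * (Q ^ 2 * ε) := by ring
  have s4 := P.step 4 ε hε
  have s2 := P.step 2 ε hε
  have m3 := P.mono (k := 3) (l := 4) (by norm_num) hε
  have p2 : 0 ≤ Q ^ 2 * ε := by positivity
  have p4 : 0 ≤ Q ^ 4 * ε := by positivity
  simp only [Nat.reduceAdd] at s4 s2
  linarith

omit hκ in
/-- Two noises of equal strength decay at nearly the same rate. -/
lemma Near.abs_rate_noise_sub_le' {t t' : T} (hσ : σ (.inr t) = σ (.inr t')) :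
    |σ (.inr t) / famNorm a ^ 2 * rateLog K a b (.inr t)
      - σ (.inr t') / famNorm a ^ 2 * rateLog K a b (.inr t')| ≤ Q ^ 5 * ε := by
  have hε := P.eps_nonneg
  have hQ := P.pos
  have h1 := h.abs_rateLog_sub_le' P hK (.inr t) (Or.inr rfl)
  have h2 := h.abs_rateLog_sub_le' P hK (.inr t') (Or.inr rfl)
  simp only [weight, Sum.elim_inr, Pi.zero_apply, zero_sub, sub_neg_eq_add] at h1 h2
  have hs := (Sc.div_sq_le (.inr t)).trans (by linarith : 4 * L ≤ 4 * Q)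
  have hs0 := (Sc.div_sq_pos (.inr t)).le
  rw [← hσ, ← mul_sub, abs_mul, abs_of_nonneg hs0]
  have h3 : |rateLog K a b (.inr t) - rateLog K a b (.inr t')| ≤ 2 * (Q ^ 3 * ε) := by
    rw [abs_le] at *
    constructor <;> linarith
  have u1 := mul_le_mul hs h3 (abs_nonneg _) (by positivity)
  have e1 : 4 * Q * (2 * (Q ^ 3 * ε)) = 8 * (Q ^ 4 * ε) := by ring
  have s4 := P.step 4 ε hε
  have p4 : 0 ≤ Q ^ 4 * ε := by positivity
  simp only [Nat.reduceAdd] at s4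
  linarith

end State
end Contrastive

namespace Contrastive

/-! ### Barriers for finite families of functions -/

section Barrier
open Set Filter Topology

/-- If, whenever `f k` is the largest member of the family, its derivative is at most `c`, then the
family grows at most at the rate `c`. -/
lemma le_add_mul_of_deriv_le {κ : Type*} [Finite κ] {f f' : κ → ℝ → ℝ} {T m c : ℝ}
    (hf : ∀ k, ContinuousOn (f k) (Icc 0 T))
    (hf' : ∀ k, ∀ t ∈ Ico 0 T, HasDerivWithinAt (f k) (f' k t) (Ici t) t)
    (h0 : ∀ k, f k 0 ≤ m)
    (hd : ∀ t ∈ Ico 0 T, ∀ k, (∀ l, f l t ≤ f k t) → f' k t ≤ c) (k : κ) {t : ℝ}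
    (ht : t ∈ Icc 0 T) : f k t ≤ m + c * t := by
  suffices h : ∀ η > 0, f k t ≤ m + (c + η) * t by
    have hT : 0 ≤ t := ht.1
    refine le_of_forall_pos_le_add fun δ hδ => ?_
    have h1 := h (δ / (t + 1)) (by positivity)
    have h2 : δ / (t + 1) * t ≤ δ := by
      rw [div_mul_eq_mul_div, div_le_iff₀ (by positivity)]; nlinarith
    linarith
  intro η hη
  set B : ℝ → ℝ := fun t => m + (c + η) * t with hB
  have hBc : Continuous B := by fun_prop
  have key : Icc 0 T ⊆ {t | ∀ k, f k t ≤ B t} := by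
    refine IsClosed.Icc_subset_of_forall_exists_gt ?_ ?_ ?_
    · have e : {t | ∀ k, f k t ≤ B t} ∩ Icc 0 T
          = Icc 0 T ∩ ⋂ k, (Icc 0 T ∩ {t | f k t ≤ B t}) := by
        ext t; simp only [mem_inter_iff, mem_ofPred_eq, mem_iInter]
        exact ⟨fun h => ⟨h.2, fun k => ⟨h.2, h.1 k⟩⟩, fun h => ⟨fun k => (h.2 k).2, h.1⟩⟩
      rw [e]
      exact isClosed_Icc.inter (isClosed_iInter fun k =>
        isClosed_Icc.isClosed_le (hf k) hBc.continuousOn)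
    · intro k; simpa [hB] using h0 k
    · rintro x ⟨hx, hxT⟩ y hy
      have hev : ∀ k, ∀ᶠ z in 𝓝[>] x, f k z ≤ B z := by
        intro k
        rcases (hx k).lt_or_eq with hlt | heq
        · have h1 : ContinuousWithinAt (fun z => B z - f k z) (Ioi x) x :=
            hBc.continuousWithinAt.sub ((hf' k x hxT).continuousWithinAt.mono Ioi_subset_Ici_self)
          have h2 := h1.eventually (lt_mem_nhds (sub_pos.2 hlt))
          filter_upwards [h2] with z hz using (sub_pos.1 hz).le
        · have hmax : ∀ l, f l x ≤ f k x := fun l => (hx l).trans heq.ge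
          have h1 := hd x hxT k hmax
          have h2 : HasDerivWithinAt (fun z => f k z - B z) (f' k x - (c + η)) (Ici x) x := by
            refine (hf' k x hxT).sub ?_
            have := ((hasDerivAt_id x).const_mul (c + η)).const_add m
            simpa [hB] using this.hasDerivWithinAt
          rw [hasDerivWithinAt_iff_tendsto_slope, Ici_sdiff_left] at h2
          have h3 := h2.eventually (gt_mem_nhds (show f' k x - (c + η) < 0 by linarith))
          filter_upwards [h3, self_mem_nhdsWithin] with z hz hzx
          rw [slope_def_field, heq, sub_self, sub_zero] at hz
          by_contra hcon
          push Not at hcon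
          have : 0 ≤ (f k z - B z) / (z - x) :=
            div_nonneg (by linarith) (sub_nonneg.2 (le_of_lt hzx))
          linarith
      have h1 := (eventually_all.2 hev).and (Ioc_mem_nhdsGT hy)
      obtain ⟨z, hz, hz'⟩ := h1.exists
      exact ⟨z, hz, hz'⟩
  exact key ht k

/-- A family in which every member is damped or attracted by another member is bounded by its
initial values, up to the accumulated remainders. -/
lemma abs_le_add_mul_of_contracting {κ : Type*} [Finite κ] {f f' : κ → ℝ → ℝ} {T m R : ℝ}
    (hf : ∀ k, ContinuousOn (f k) (Icc 0 T))
    (hf' : ∀ k, ∀ t ∈ Ico 0 T, HasDerivWithinAt (f k) (f' k t) (Ici t) t)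
    (h0 : ∀ k, |f k 0| ≤ m)
    (hd : ∀ t ∈ Ico 0 T, ∀ k, ∃ c₁ c₂ : ℝ, ∃ l, 0 ≤ c₁ ∧ 0 ≤ c₂ ∧
      |f' k t + c₁ * f k t + c₂ * (f k t - f l t)| ≤ R) (k : κ) {t : ℝ}
    (ht : t ∈ Icc 0 T) : |f k t| ≤ m + R * t := by
  have main := le_add_mul_of_deriv_le (κ := κ × Bool)
    (f := fun p t => boolSign p.2 * f p.1 t) (f' := fun p t => boolSign p.2 * f' p.1 t)
    (T := T) (m := m) (c := R) (fun p => continuousOn_const.mul (hf p.1))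
    (fun p t ht => (hf' p.1 t ht).const_mul _) (fun p => ?_) (fun t ht p hp => ?_)
  · have h1 := main (k, true) ht
    have h2 := main (k, false) ht
    simp only [boolSign, if_true, Bool.false_eq_true, if_false] at h1 h2
    rw [abs_le]; constructor <;> linarith
  · have := abs_le.1 (h0 p.1)
    rcases p with ⟨k, _ | _⟩ <;> simp only [boolSign, if_true, Bool.false_eq_true, if_false] <;>
      linarith
  · obtain ⟨c₁, c₂, l, h1, h2, h3⟩ := hd t ht p.1
    have h4 := hp (l, p.2)
    have h5 := hp (p.1, !p.2)
    rw [abs_le] at h3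
    rcases p with ⟨k, _ | _⟩ <;>
      simp only [boolSign, if_true, Bool.false_eq_true, if_false, Bool.not_true,
        Bool.not_false] at h4 h5 ⊢
    · have h6 : 0 ≤ -f k t := by linarith
      have := mul_nonneg h1 h6
      have := mul_nonneg h2 (sub_nonneg.2 h4)
      linarith [h3.1]
    · have h6 : 0 ≤ f k t := by linarith
      have := mul_nonneg h1 h6
      have := mul_nonneg h2 (sub_nonneg.2 h4)
      linarith [h3.2]

/-- The mean value inequality for one function. -/
lemma abs_le_add_mul_of_abs_deriv_le {f f' : ℝ → ℝ} {T m R : ℝ}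
    (hf : ContinuousOn f (Icc 0 T))
    (hf' : ∀ t ∈ Ico 0 T, HasDerivWithinAt f (f' t) (Ici t) t)
    (h0 : |f 0| ≤ m) (hd : ∀ t ∈ Ico 0 T, |f' t| ≤ R) {t : ℝ} (ht : t ∈ Icc 0 T) :
    |f t| ≤ m + R * t :=
  abs_le_add_mul_of_contracting (κ := Unit) (f := fun _ => f) (f' := fun _ => f') (fun _ => hf)
    (fun _ => hf') (fun _ => h0) (fun t ht _ => ⟨0, 0, (), le_rfl, le_rfl, by simpa using hd t ht⟩)
    () ht

lemma le_add_mul_of_deriv_le_one {f f' : ℝ → ℝ} {T m c : ℝ}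
    (hf : ContinuousOn f (Icc 0 T))
    (hf' : ∀ t ∈ Ico 0 T, HasDerivWithinAt f (f' t) (Ici t) t)
    (h0 : f 0 ≤ m) (hd : ∀ t ∈ Ico 0 T, f' t ≤ c) {t : ℝ} (ht : t ∈ Icc 0 T) :
    f t ≤ m + c * t :=
  le_add_mul_of_deriv_le (κ := Unit) (f := fun _ => f) (f' := fun _ => f') (fun _ => hf)
    (fun _ => hf') (fun _ => h0) (fun t ht _ _ => hd t ht) () ht

end Barrier

/-! ### Polar coordinates along the flow -/

section Polar
variable {E : Type*} [NormedAddCommGroup E] [InnerProductSpace ℝ E]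

lemma hasDerivWithinAt_norm {v : ℝ → E} {s : Set ℝ} {t c r : ℝ} {d : E} (h0 : v t ≠ 0)
    (hd : inner ℝ d (dir (v t)) = 0)
    (hv : HasDerivWithinAt v ((c * ‖v t‖) • (r • dir (v t) + d)) s t) :
    HasDerivWithinAt (fun u => ‖v u‖) (‖v t‖ * (c * r)) s t := by
  have hn : ‖v t‖ ≠ 0 := norm_ne_zero_iff.2 h0
  have h1 := hv.norm_sq.sqrt (pow_ne_zero 2 hn)
  simp only [Real.sqrt_sq (norm_nonneg _)] at h1
  refine h1.congr_deriv ?_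
  have e : inner ℝ (v t) ((c * ‖v t‖) • (r • dir (v t) + d)) = ‖v t‖ ^ 2 * (c * r) := by
    have e1 : inner ℝ (v t) (dir (v t)) = ‖v t‖ := by
      have := real_inner_smul_left (dir (v t)) (dir (v t)) ‖v t‖
      rwa [norm_smul_dir, inner_dir_self h0, mul_one] at this
    have e2 : inner ℝ (v t) d = 0 := by
      have := real_inner_smul_left (dir (v t)) d ‖v t‖
      rwa [norm_smul_dir, real_inner_comm d (dir (v t)), hd, mul_zero] at this
    rw [real_inner_smul_right, inner_add_right, real_inner_smul_right, e1, e2]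
    ring
  rw [e]; field_simp

lemma hasDerivWithinAt_dir {v : ℝ → E} {s : Set ℝ} {t c r : ℝ} {d : E} (h0 : v t ≠ 0)
    (hd : inner ℝ d (dir (v t)) = 0)
    (hv : HasDerivWithinAt v ((c * ‖v t‖) • (r • dir (v t) + d)) s t) :
    HasDerivWithinAt (fun u => dir (v u)) (c • d) s t := by
  have hn : ‖v t‖ ≠ 0 := norm_ne_zero_iff.2 h0
  have h1 := ((hasDerivWithinAt_norm h0 hd hv).inv hn).smul hv
  refine h1.congr_deriv ?_
  have e : ∀ x : ℝ, x • v t = (x * ‖v t‖) • dir (v t) := fun x => by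
    rw [mul_smul, norm_smul_dir]
  rw [e]
  simp only [smul_add, smul_smul, Pi.inv_apply]
  rw [add_comm, ← add_assoc, ← add_smul, add_comm (_ / _ * _)]
  have e1 : ‖v t‖⁻¹ * (c * ‖v t‖) = c := by field_simp
  have e2 : ‖v t‖⁻¹ * (c * ‖v t‖ * r) + -(‖v t‖ * (c * r)) / ‖v t‖ ^ 2 * ‖v t‖ = 0 := by
    field_simp; ring
  rw [e1, e2, zero_smul, zero_add]

end Polar
end Contrastive

namespace Contrastive

/-! ### Derivatives along the flow -/

section Flow
open Set
variable {S T : Type*} [Fintype S] [Fintype T] [DecidableEq S] [DecidableEq T]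
variable {E : Type*} [NormedAddCommGroup E] [InnerProductSpace ℝ E]

lemma inner_rateDir_dir (K : ℝ) (a b : S ⊕ T → E) {i : S ⊕ T} (hi : a i ≠ 0) :
    inner ℝ (rateDir K a b i) (dir (a i)) = 0 := by
  rw [rateDir, inner_neg_left, sum_inner]
  refine neg_eq_zero.2 (Finset.sum_eq_zero fun j _ => ?_)
  rw [real_inner_smul_left, inner_sub_left, real_inner_smul_left, inner_dir_self hi]
  ring

/-- The logarithmic rates conserve the weighted mass of the family. -/
lemma sum_rel_sq_mul_rateLog (K : ℝ) {a b : S ⊕ T → E} (ha : ∀ i, a i ≠ 0) (hn : famNorm a ≠ 0) :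
    ∑ i, rel a i ^ 2 * rateLog K a b i = 0 := by
  have e : ∀ i, rel a i ^ 2 * rateLog K a b i = pairing K a b * rel a i ^ 2
      - ∑ j, grad K (overlap a b) i j * overlap a b i j := by
    intro i
    have hk : rel a i ≠ 0 := div_ne_zero (norm_ne_zero_iff.2 (ha i)) hn
    rw [rateLog, mul_sub, mul_comm, Finset.mul_sum]
    congr 1
    refine Finset.sum_congr rfl fun j _ => ?_
    rw [overlap_eq, couple, real_inner_comm]
    field_simp
  simp only [e, Finset.sum_sub_distrib, ← Finset.mul_sum]
  rw [sum_rel_sq hn, mul_one, pairing, sub_self]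

lemma IsFlow.symm {K : ℝ} {σ : S ⊕ T → ℝ} {a b : ℝ → S ⊕ T → E} (h : IsFlow K σ a b) :
    IsFlow K σ b a := fun t ht hb ha i => ⟨(h t ht ha hb i).2, (h t ht ha hb i).1⟩

section
variable {K : ℝ} {σ : S ⊕ T → ℝ} {a b : ℝ → S ⊕ T → E} (hF : IsFlow K σ a b) {t : ℝ} (ht : 0 ≤ t)
  {Q ε : ℝ} (h : Near (a t) (b t) Q ε)
include hF ht h

lemma IsFlow.hasDerivWithinAt_polar (i : S ⊕ T) :
    HasDerivWithinAt (fun u => a u i) ((σ i / famNorm (a t) ^ 2 * ‖a t i‖) •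
      (rateLog K (a t) (b t) i • dir (a t i) + rateDir K (a t) (b t) i)) (Ici t) t := by
  have hn := (h.famNorm_pos i).ne'
  have hN := (h.symm.famNorm_pos i).ne'
  refine ((hF t ht hn hN i).1.mono (Ici_subset_Ici.2 ht)).congr_deriv ?_
  rw [drift_eq K hn hN i (h.ne_left i), smul_smul]
  congr 1
  ring

lemma IsFlow.hasDerivWithinAt_norm (i : S ⊕ T) :
    HasDerivWithinAt (fun u => ‖a u i‖)
      (‖a t i‖ * (σ i / famNorm (a t) ^ 2 * rateLog K (a t) (b t) i)) (Ici t) t :=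
  Contrastive.hasDerivWithinAt_norm (h.ne_left i) (inner_rateDir_dir K _ _ (h.ne_left i))
    (hF.hasDerivWithinAt_polar ht h i)

lemma IsFlow.hasDerivWithinAt_log (i : S ⊕ T) :
    HasDerivWithinAt (fun u => Real.log ‖a u i‖)
      (σ i / famNorm (a t) ^ 2 * rateLog K (a t) (b t) i) (Ici t) t := by
  have h0 := (h.norm_pos i).ne'
  refine ((hF.hasDerivWithinAt_norm ht h i).log h0).congr_deriv ?_
  field_simp

lemma IsFlow.hasDerivWithinAt_dir (i : S ⊕ T) :
    HasDerivWithinAt (fun u => dir (a u i)) (velDir K σ (a t) (b t) i) (Ici t) t :=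
  Contrastive.hasDerivWithinAt_dir (h.ne_left i) (inner_rateDir_dir K _ _ (h.ne_left i))
    (hF.hasDerivWithinAt_polar ht h i)

lemma IsFlow.hasDerivWithinAt_comb (η : Bool) (i : S ⊕ T) :
    HasDerivWithinAt (fun u => comb (a u) (b u) η i) (velComb K σ (a t) (b t) η i) (Ici t) t :=
  (hF.hasDerivWithinAt_dir ht h i).add ((hF.symm.hasDerivWithinAt_dir ht h.symm i).const_smul _)

lemma IsFlow.hasDerivWithinAt_famNorm (i₀ : S ⊕ T) :
    HasDerivWithinAt (fun u => famNorm (a u))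
      (famNorm (a t) * ((∑ j, σ j * rel (a t) j ^ 2 * rateLog K (a t) (b t) j)
        / famNorm (a t) ^ 2)) (Ici t) t := by
  have hn := (h.famNorm_pos i₀).ne'
  have h1 : HasDerivWithinAt (fun u => ∑ i, ‖a u i‖ ^ 2) (∑ i, 2 * ‖a t i‖ *
      (‖a t i‖ * (σ i / famNorm (a t) ^ 2 * rateLog K (a t) (b t) i))) (Ici t) t := by
    refine HasDerivWithinAt.fun_sum fun i _ => ?_
    simpa using (hF.hasDerivWithinAt_norm ht h i).fun_pow 2
  have h2 := h1.sqrt (by rw [← famNorm_sq]; exact pow_ne_zero 2 hn)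
  refine h2.congr_deriv ?_
  change _ / (2 * famNorm (a t)) = _
  have e : ∀ i, 2 * ‖a t i‖ * (‖a t i‖ * (σ i / famNorm (a t) ^ 2 * rateLog K (a t) (b t) i))
      = 2 * (σ i * rel (a t) i ^ 2 * rateLog K (a t) (b t) i) := fun i => by
    rw [rel]; field_simp
  simp only [e, ← Finset.mul_sum]
  field_simp

lemma IsFlow.hasDerivWithinAt_rel (i : S ⊕ T) :
    HasDerivWithinAt (fun u => rel (a u) i)
      (rel (a t) i * ((σ i * rateLog K (a t) (b t) i
        - ∑ j, σ j * rel (a t) j ^ 2 * rateLog K (a t) (b t) j) / famNorm (a t) ^ 2))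
      (Ici t) t := by
  have hn := (h.famNorm_pos i).ne'
  refine ((hF.hasDerivWithinAt_norm ht h i).div (hF.hasDerivWithinAt_famNorm ht h i) hn).congr_deriv
    ?_
  rw [rel]
  set X := ∑ j, σ j * rel (a t) j ^ 2 * rateLog K (a t) (b t) j
  field_simp

lemma IsFlow.hasDerivWithinAt_mass (hσ : ∀ i, 0 < σ i) :
    HasDerivWithinAt (fun u => ∑ i, ‖a u i‖ ^ 2 / σ i) 0 (Ici t) t := by
  by_cases hne : Nonempty (S ⊕ T)
  · obtain ⟨i₀⟩ := hne
    have hn := (h.famNorm_pos i₀).ne'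
    have h1 : HasDerivWithinAt (fun u => ∑ i, ‖a u i‖ ^ 2 / σ i) (∑ i, 2 * ‖a t i‖ *
        (‖a t i‖ * (σ i / famNorm (a t) ^ 2 * rateLog K (a t) (b t) i)) / σ i) (Ici t) t := by
      refine HasDerivWithinAt.fun_sum fun i _ => ?_
      simpa using ((hF.hasDerivWithinAt_norm ht h i).fun_pow 2).div_const (σ i)
    refine h1.congr_deriv ?_
    have e : ∀ i, 2 * ‖a t i‖ *
        (‖a t i‖ * (σ i / famNorm (a t) ^ 2 * rateLog K (a t) (b t) i)) / σ i
        = 2 * (rel (a t) i ^ 2 * rateLog K (a t) (b t) i) := fun i => by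
      have := (hσ i).ne'
      rw [rel]; field_simp
    simp only [e, ← Finset.mul_sum]
    rw [sum_rel_sq_mul_rateLog K h.ne_left hn, mul_zero]
  · rw [not_nonempty_iff] at hne
    simpa using hasDerivWithinAt_const t (Ici t) (0 : ℝ)

lemma IsFlow.hasDerivWithinAt_energy (hσ : ∀ i, 0 < σ i) :
    HasDerivWithinAt (fun u => energy σ (a u) (b u))
      (∑ i, 2 * (‖a t i‖ - ‖b t i‖) * (‖a t i‖ / famNorm (a t) ^ 2 * rateLog K (a t) (b t) i
        - ‖b t i‖ / famNorm (b t) ^ 2 * rateLog K (b t) (a t) i)) (Ici t) t := by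
  refine HasDerivWithinAt.fun_sum fun i _ => ?_
  have h1 := (hF.hasDerivWithinAt_norm ht h i).fun_sub (hF.symm.hasDerivWithinAt_norm ht h.symm i)
  refine ((h1.fun_pow 2).div_const (σ i)).congr_deriv ?_
  have := (hσ i).ne'
  simp only [Nat.cast_ofNat, Nat.reduceSub, pow_one]
  field_simp

lemma IsFlow.hasDerivWithinAt_potential :
    HasDerivWithinAt (fun u => ∑ i, logCosh (rel (a u) i ^ 2))
      (∑ i, Real.tanh (rel (a t) i ^ 2) * (2 * rel (a t) i ^ 2 * (σ i * rateLog K (a t) (b t) i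
        - ∑ j, σ j * rel (a t) j ^ 2 * rateLog K (a t) (b t) j) / famNorm (a t) ^ 2)) (Ici t) t := by
  refine HasDerivWithinAt.fun_sum fun i _ => ?_
  have h1 := (hasDerivAt_logCosh (rel (a t) i ^ 2)).comp_hasDerivWithinAt t
    ((hF.hasDerivWithinAt_rel ht h i).fun_pow 2)
  refine h1.congr_deriv ?_
  simp only [Nat.cast_ofNat, Nat.reduceSub, pow_one]
  ring

end
end Flow
end Contrastive

namespace Contrastive

/-! ### Estimates along a trajectory with small errors -/

section Traj
open Set
variable {S T : Type*} [Fintype S] [Fintype T] [DecidableEq S] [DecidableEq T]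
variable {E : Type*} [NormedAddCommGroup E] [InnerProductSpace ℝ E]

/-- The relations between the constants: the strengths lie in `[1, L]`, and `Q` dominates the
constants that occur, including the exponential of `L` divided by a lower bound of the softmax
mass. The argument `-1` is a lower bound of `gapDiag`, see `NearDiag.gapDiag_ge`. -/
structure Regime (K : ℝ) (σ : S ⊕ T → ℝ) (L Q ε : ℝ) : Prop extends Params S T Q ε where
  hK : 0 < K
  one_le : ∀ i, 1 ≤ σ i
  le_L : ∀ i, σ i ≤ L
  hL : L ≤ Q
  hκ : 1 ≤ Q * logistic K (-1)
  exp_le : Real.exp (8 * L / logistic K (-1)) ≤ Q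

/-- A trajectory of the flow that starts with errors at most `ε₀` and whose errors stay below `ε`
before the time `τ`. The mass is normalized. -/
structure Traj (K : ℝ) (σ : S ⊕ T → ℝ) (a b : ℝ → S ⊕ T → E) (Q ε ε₀ τ : ℝ) : Prop where
  flow : IsFlow K σ a b
  cont_left : ∀ i, ContinuousOn (fun t => a t i) (Ici 0)
  cont_right : ∀ i, ContinuousOn (fun t => b t i) (Ici 0)
  mass : ∑ i, ‖a 0 i‖ ^ 2 / σ i = 1
  nonneg : 0 ≤ τ
  init : Near (a 0) (b 0) Q ε₀
  near : ∀ t ∈ Ico 0 τ, Near (a t) (b t) Q ε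

lemma HalfNear.mono {a b : S ⊕ T → E} {Q Q' ε ε' : ℝ} (h : HalfNear a b Q ε) (hQ : Q ≤ Q')
    (hε : ε ≤ ε') : HalfNear a b Q' ε' where
  low s := (h.low s).trans (mul_le_mul_of_nonneg_right hQ (norm_nonneg _))
  noise t := (h.noise t).trans (mul_le_mul_of_nonneg_right hε (famNorm_nonneg _))
  close s := (h.close s).trans (mul_le_mul_of_nonneg_right hε (norm_nonneg _))
  align s := (mul_le_mul_of_nonneg_right (by linarith)
    (mul_nonneg (norm_nonneg _) (norm_nonneg _))).trans (h.align s)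
  same i s hi := (h.same i s hi).trans (mul_le_mul_of_nonneg_right hε
    (mul_nonneg (norm_nonneg _) (norm_nonneg _)))
  cross i s hi := (h.cross i s hi).trans (mul_le_mul_of_nonneg_right hε
    (mul_nonneg (norm_nonneg _) (norm_nonneg _)))

lemma Near.mono {a b : S ⊕ T → E} {Q Q' ε ε' : ℝ} (h : Near a b Q ε) (hQ : Q ≤ Q')
    (hε : ε ≤ ε') : Near a b Q' ε' :=
  ⟨h.ne_left, h.ne_right, h.left.mono hQ hε, h.right.mono hQ hε⟩

/-- A non-strict inequality between continuous functions extends to the right end point. -/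
lemma le_on_Icc {f g : ℝ → ℝ} {τ : ℝ} (hf : ContinuousOn f (Icc 0 τ))
    (hg : ContinuousOn g (Icc 0 τ)) (h0 : f 0 ≤ g 0) (h : ∀ t ∈ Ico 0 τ, f t ≤ g t) :
    ∀ t ∈ Icc 0 τ, f t ≤ g t := by
  intro t ht
  rcases ht.1.eq_or_lt with rfl | h1
  · exact h0
  · have h2 : closure (Ico 0 τ) = Icc 0 τ := closure_Ico (h1.trans_le ht.2).ne
    refine ContinuousWithinAt.closure_le (s := Ico 0 τ) (by rw [h2]; exact ht)
      ((hf t ht).mono Ico_subset_Icc_self) ((hg t ht).mono Ico_subset_Icc_self) h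

section
variable {K : ℝ} {σ : S ⊕ T → ℝ} {a b : ℝ → S ⊕ T → E} {L Q ε ε₀ τ : ℝ}
  (G : Regime K σ L Q ε) (H : Traj K σ a b Q ε ε₀ τ) (hε₀ : ε₀ ≤ ε)
include G H hε₀

lemma Traj.continuousOn_norm (i : S ⊕ T) : ContinuousOn (fun t => ‖a t i‖) (Icc 0 τ) :=
  ((H.cont_left i).mono Icc_subset_Ici_self).norm

lemma Traj.continuousOn_norm' (i : S ⊕ T) : ContinuousOn (fun t => ‖b t i‖) (Icc 0 τ) :=
  ((H.cont_right i).mono Icc_subset_Ici_self).norm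

lemma Traj.continuousOn_famNorm : ContinuousOn (fun t => famNorm (a t)) (Icc 0 τ) :=
  Real.continuous_sqrt.comp_continuousOn
    (continuousOn_finsetSum _ fun i _ => (H.continuousOn_norm G hε₀ i).pow 2)

lemma Traj.continuousOn_famNorm' : ContinuousOn (fun t => famNorm (b t)) (Icc 0 τ) :=
  Real.continuous_sqrt.comp_continuousOn
    (continuousOn_finsetSum _ fun i _ => (H.continuousOn_norm' G hε₀ i).pow 2)

lemma Traj.mass_eq {t : ℝ} (ht : t ∈ Icc 0 τ) : ∑ i, ‖a t i‖ ^ 2 / σ i = 1 := by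
  rw [← H.mass]
  exact constant_of_has_deriv_right_zero (f := fun t => ∑ i, ‖a t i‖ ^ 2 / σ i)
    (continuousOn_finsetSum _ fun i _ => ((H.continuousOn_norm G hε₀ i).pow 2).div_const _)
    (fun t ht => H.flow.hasDerivWithinAt_mass ht.1 (H.near t ht)
      fun i => zero_lt_one.trans_le (G.one_le i)) t ht

lemma Traj.one_le_famNorm {t : ℝ} (ht : t ∈ Icc 0 τ) : 1 ≤ famNorm (a t) := by
  have h1 := H.mass_eq G hε₀ ht
  rw [← sq_le_sq₀ zero_le_one (famNorm_nonneg _), famNorm_sq, one_pow, ← h1]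
  exact Finset.sum_le_sum fun i _ => div_le_self (sq_nonneg _) (G.one_le i)

lemma Traj.sq_famNorm_le {t : ℝ} (ht : t ∈ Icc 0 τ) : famNorm (a t) ^ 2 ≤ L := by
  have h1 := H.mass_eq G hε₀ ht
  rw [famNorm_sq, ← mul_one L, ← h1, Finset.mul_sum]
  refine Finset.sum_le_sum fun i _ => ?_
  have h2 := zero_lt_one.trans_le (G.one_le i)
  rw [← mul_div_assoc, le_div_iff₀ h2, mul_comm]
  exact mul_le_mul_of_nonneg_right (G.le_L i) (sq_nonneg _)

lemma Traj.init_near : Near (a 0) (b 0) Q ε := H.init.mono le_rfl hε₀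

lemma Traj.false_of_isEmpty (h : IsEmpty (S ⊕ T)) : False := by
  have := H.mass
  simp at this

lemma Traj.famNorm_le_two_mul {t : ℝ} (ht : t ∈ Icc 0 τ) : famNorm (a t) ≤ 2 * famNorm (b t) := by
  have key : ∀ t, Near (a t) (b t) Q ε → famNorm (a t) ≤ 2 * famNorm (b t) := by
    intro t h
    by_cases hne : Nonempty (S ⊕ T)
    · obtain ⟨i⟩ := hne
      have h1 := (abs_le.1 (h.abs_famNorm_sub_le G.toParams i)).2
      have h2 := G.step 1 ε G.eps_nonneg
      have h3 := G.pow_eps_le (k := 2) (by norm_num)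
      have h4 := (h.famNorm_pos i).le
      simp only [Nat.reduceAdd, pow_one] at h2
      nlinarith
    · rw [not_nonempty_iff] at hne
      exact (H.false_of_isEmpty G hε₀ hne).elim
  exact le_on_Icc (H.continuousOn_famNorm G hε₀)
    (continuousOn_const.mul (H.continuousOn_famNorm' G hε₀)) (key 0 (H.init_near G hε₀))
    (fun t ht => key t (H.near t ht)) t ht

lemma Traj.famNorm_le_two_mul' {t : ℝ} (ht : t ∈ Icc 0 τ) :
    famNorm (b t) ≤ 2 * famNorm (a t) := by
  have key : ∀ t, Near (a t) (b t) Q ε → famNorm (b t) ≤ 2 * famNorm (a t) := by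
    intro t h
    by_cases hne : Nonempty (S ⊕ T)
    · obtain ⟨i⟩ := hne
      have h1 := (abs_le.1 (h.symm.abs_famNorm_sub_le G.toParams i)).2
      have h2 := G.step 1 ε G.eps_nonneg
      have h3 := G.pow_eps_le (k := 2) (by norm_num)
      have h4 := (h.symm.famNorm_pos i).le
      simp only [Nat.reduceAdd, pow_one] at h2
      nlinarith
    · rw [not_nonempty_iff] at hne
      exact (H.false_of_isEmpty G hε₀ hne).elim
  exact le_on_Icc (H.continuousOn_famNorm' G hε₀)
    (continuousOn_const.mul (H.continuousOn_famNorm G hε₀)) (key 0 (H.init_near G hε₀))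
    (fun t ht => key t (H.near t ht)) t ht

lemma Traj.scaled {t : ℝ} (ht : t ∈ Icc 0 τ) : Scaled σ (a t) (b t) L :=
  ⟨G.one_le, G.le_L, by linarith [H.one_le_famNorm G hε₀ ht],
    by linarith [H.one_le_famNorm G hε₀ ht, H.famNorm_le_two_mul G hε₀ ht]⟩

/-! ### Nonvanishing -/

lemma Traj.le_mul_norm_signal {t : ℝ} (ht : t ∈ Icc 0 τ) (s : S) :
    famNorm (a t) ≤ Q * ‖a t (.inl s)‖ :=
  le_on_Icc (H.continuousOn_famNorm G hε₀) (continuousOn_const.mul (H.continuousOn_norm G hε₀ _))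
    (H.init.left.low s) (fun t ht => (H.near t ht).left.low s) t ht

lemma Traj.le_mul_norm_signal' {t : ℝ} (ht : t ∈ Icc 0 τ) (s : S) :
    famNorm (b t) ≤ Q * ‖b t (.inl s)‖ :=
  le_on_Icc (H.continuousOn_famNorm' G hε₀) (continuousOn_const.mul (H.continuousOn_norm' G hε₀ _))
    (H.init.right.low s) (fun t ht => (H.near t ht).right.low s) t ht

omit G H hε₀ in
/-- A function that decays at most exponentially does not vanish. -/
lemma pos_of_deriv_ge {f f' : ℝ → ℝ} {c : ℝ} (hf : ContinuousOn f (Icc 0 τ))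
    (hf' : ∀ t ∈ Ico 0 τ, HasDerivWithinAt f (f' t) (Ici t) t) (h0 : 0 < f 0)
    (hd : ∀ t ∈ Ico 0 τ, -(c * f t) ≤ f' t) {t : ℝ} (ht : t ∈ Icc 0 τ) : 0 < f t := by
  have h1 := le_add_mul_of_deriv_le_one (f := fun t => -(f t * Real.exp (c * t)))
    (f' := fun t => -(f' t * Real.exp (c * t) + f t * (Real.exp (c * t) * c)))
    (T := τ) (m := -f 0) (c := 0) ((hf.mul (by fun_prop)).neg) (fun t ht => ?_) (by simp)
    (fun t ht => ?_) ht
  · have h2 : 0 < f t * Real.exp (c * t) := by linarith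
    exact pos_of_mul_pos_left h2 (Real.exp_pos _).le
  · have h2 : HasDerivAt (fun t => Real.exp (c * t)) (Real.exp (c * t) * c) t := by
      have := ((hasDerivAt_id t).const_mul c).exp
      simpa using this
    exact ((hf' t ht).fun_mul h2.hasDerivWithinAt).fun_neg
  · have := mul_nonneg (by linarith [hd t ht] : 0 ≤ f' t + c * f t) (Real.exp_pos (c * t)).le
    linarith

lemma Traj.noise_pos {t : ℝ} (ht : t ∈ Icc 0 τ) (q : T) : 0 < ‖a t (.inr q)‖ := by
  refine pos_of_deriv_ge (c := 20 * L) (H.continuousOn_norm G hε₀ _)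
    (fun t ht => H.flow.hasDerivWithinAt_norm ht.1 (H.near t ht) _) (H.init.norm_pos _)
    (fun t ht => ?_) ht
  have h := H.near t ht
  have Sc := H.scaled G hε₀ (Ico_subset_Icc_self ht)
  have h1 := h.le_rateLog_noise G.toParams G.hK G.hκ q
  have h2 := Sc.div_sq_le (.inr q)
  have h3 := (Sc.div_sq_pos (.inr q)).le
  have h4 : -(20 * L) ≤ σ (.inr q) / famNorm (a t) ^ 2 * rateLog K (a t) (b t) (.inr q) := by
    have := mul_le_mul_of_nonneg_left h1 h3
    linarith
  have := mul_le_mul_of_nonneg_left h4 (norm_nonneg (a t (.inr q)))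
  linarith

lemma Traj.noise_pos' {t : ℝ} (ht : t ∈ Icc 0 τ) (q : T) : 0 < ‖b t (.inr q)‖ := by
  refine pos_of_deriv_ge (c := 20 * L) (H.continuousOn_norm' G hε₀ _)
    (fun t ht => H.flow.symm.hasDerivWithinAt_norm ht.1 (H.near t ht).symm _)
    (H.init.symm.norm_pos _) (fun t ht => ?_) ht
  have h := (H.near t ht).symm
  have Sc := (H.scaled G hε₀ (Ico_subset_Icc_self ht)).symm
  have h1 := h.le_rateLog_noise G.toParams G.hK G.hκ q
  have h2 := Sc.div_sq_le (.inr q)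
  have h3 := (Sc.div_sq_pos (.inr q)).le
  have h4 : -(20 * L) ≤ σ (.inr q) / famNorm (b t) ^ 2 * rateLog K (b t) (a t) (.inr q) := by
    have := mul_le_mul_of_nonneg_left h1 h3
    linarith
  have := mul_le_mul_of_nonneg_left h4 (norm_nonneg (b t (.inr q)))
  linarith

lemma Traj.ne_left {t : ℝ} (ht : t ∈ Icc 0 τ) (i : S ⊕ T) : a t i ≠ 0 := by
  rcases i with s | q
  · have h1 := H.le_mul_norm_signal G hε₀ ht s
    have h2 := H.one_le_famNorm G hε₀ ht
    intro h0
    rw [h0, norm_zero, mul_zero] at h1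
    linarith
  · exact norm_pos_iff.1 (H.noise_pos G hε₀ ht q)

lemma Traj.ne_right {t : ℝ} (ht : t ∈ Icc 0 τ) (i : S ⊕ T) : b t i ≠ 0 := by
  rcases i with s | q
  · have h1 := H.le_mul_norm_signal' G hε₀ ht s
    have h2 := (H.scaled G hε₀ ht).right
    intro h0
    rw [h0, norm_zero, mul_zero] at h1
    linarith
  · exact norm_pos_iff.1 (H.noise_pos' G hε₀ ht q)

lemma Traj.continuousOn_dir (i : S ⊕ T) : ContinuousOn (fun t => dir (a t i)) (Icc 0 τ) := by
  unfold dir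
  exact ((H.continuousOn_norm G hε₀ i).inv₀ fun t ht =>
    norm_ne_zero_iff.2 (H.ne_left G hε₀ ht i)).smul ((H.cont_left i).mono Icc_subset_Ici_self)

lemma Traj.continuousOn_dir' (i : S ⊕ T) : ContinuousOn (fun t => dir (b t i)) (Icc 0 τ) := by
  unfold dir
  exact ((H.continuousOn_norm' G hε₀ i).inv₀ fun t ht =>
    norm_ne_zero_iff.2 (H.ne_right G hε₀ ht i)).smul ((H.cont_right i).mono Icc_subset_Ici_self)

lemma Traj.continuousOn_comb (η : Bool) (i : S ⊕ T) :
    ContinuousOn (fun t => comb (a t) (b t) η i) (Icc 0 τ) :=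
  (H.continuousOn_dir G hε₀ i).add ((H.continuousOn_dir' G hε₀ i).const_smul _)

lemma Traj.continuousOn_rel (i : S ⊕ T) : ContinuousOn (fun t => rel (a t) i) (Icc 0 τ) :=
  (H.continuousOn_norm G hε₀ i).div (H.continuousOn_famNorm G hε₀) fun t ht => by
    linarith [H.one_le_famNorm G hε₀ ht]

/-! ### Bounds for the correlations -/

omit G H hε₀ in
lemma abs_inner_comb_le {a b : S ⊕ T → E} {i j : S ⊕ T} {δ : ℝ} {η ζ : Bool}
    (h1 : |inner ℝ (dir (a i)) (dir (a j))| ≤ δ) (h2 : |inner ℝ (dir (a i)) (dir (b j))| ≤ δ)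
    (h3 : |inner ℝ (dir (b i)) (dir (a j))| ≤ δ) (h4 : |inner ℝ (dir (b i)) (dir (b j))| ≤ δ) :
    |inner ℝ (comb a b η i) (comb a b ζ j)| ≤ 4 * δ := by
  simp only [comb, inner_add_left, inner_add_right, real_inner_smul_left, real_inner_smul_right]
  rw [abs_le] at *
  cases η <;> cases ζ <;> simp only [boolSign, if_true, Bool.false_eq_true, if_false] <;>
    constructor <;> linarith

/-- The family of all correlations of sums and differences of two different signals contracts. -/
lemma Traj.abs_inner_comb_signal_le {s s' : S} (hs : s ≠ s') (η ζ : Bool) {t : ℝ}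
    (ht : t ∈ Icc 0 τ) :
    |inner ℝ (comb (a t) (b t) η (.inl s)) (comb (a t) (b t) ζ (.inl s'))|
      ≤ 4 * ε₀ + Q ^ 11 * ε ^ 2 * t := by
  refine abs_le_add_mul_of_contracting (κ := {p : S × S // p.1 ≠ p.2} × Bool × Bool)
    (f := fun k t => inner ℝ (comb (a t) (b t) k.2.1 (.inl k.1.1.1))
      (comb (a t) (b t) k.2.2 (.inl k.1.1.2)))
    (f' := fun k t => inner ℝ (comb (a t) (b t) k.2.1 (.inl k.1.1.1))
      (velComb K σ (a t) (b t) k.2.2 (.inl k.1.1.2))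
      + inner ℝ (velComb K σ (a t) (b t) k.2.1 (.inl k.1.1.1))
      (comb (a t) (b t) k.2.2 (.inl k.1.1.2)))
    (fun k => (H.continuousOn_comb G hε₀ _ _).inner (H.continuousOn_comb G hε₀ _ _))
    (fun k t ht => (H.flow.hasDerivWithinAt_comb ht.1 (H.near t ht) _ _).inner ℝ
      (H.flow.hasDerivWithinAt_comb ht.1 (H.near t ht) _ _)) (fun k => ?_) (fun t ht k => ?_)
    (⟨(s, s'), hs⟩, η, ζ) ht
  · obtain ⟨⟨⟨s, s'⟩, hs⟩, η, ζ⟩ := k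
    have hne : (Sum.inl s : S ⊕ T) ≠ .inl s' := by simpa using hs
    exact abs_inner_comb_le (H.init.abs_same_le hne) (H.init.abs_cross_le hne)
      (H.init.symm.abs_cross_le hne) (H.init.symm.abs_same_le hne)
  · obtain ⟨⟨⟨s, s'⟩, hs⟩, η, ζ⟩ := k
    obtain ⟨c₁, c₂, h1, h2, h3⟩ := (H.near t ht).exists_deriv_comb_signal G.toParams G.hK
      (H.scaled G hε₀ (Ico_subset_Icc_self ht)) G.hL G.hκ hs η ζ
    exact ⟨c₁, c₂, (⟨(s, s'), hs⟩, !η, !ζ), h1, h2, h3⟩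

/-- The correlations of a noise with the sum and the difference of the directions of a signal
contract. -/
lemma Traj.abs_inner_comb_noise_le (q : T) (s : S) (ζ : Bool) {t : ℝ} (ht : t ∈ Icc 0 τ) :
    |inner ℝ (dir (a t (.inr q))) (comb (a t) (b t) ζ (.inl s))|
      ≤ 2 * ε₀ + Q ^ 11 * ε ^ 2 * t := by
  refine abs_le_add_mul_of_contracting (κ := Bool)
    (f := fun ζ t => inner ℝ (dir (a t (.inr q))) (comb (a t) (b t) ζ (.inl s)))
    (f' := fun ζ t => inner ℝ (dir (a t (.inr q))) (velComb K σ (a t) (b t) ζ (.inl s))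
      + inner ℝ (velDir K σ (a t) (b t) (.inr q)) (comb (a t) (b t) ζ (.inl s)))
    (fun k => (H.continuousOn_dir G hε₀ _).inner (H.continuousOn_comb G hε₀ _ _))
    (fun k t ht => (H.flow.hasDerivWithinAt_dir ht.1 (H.near t ht) _).inner ℝ
      (H.flow.hasDerivWithinAt_comb ht.1 (H.near t ht) _ _)) (fun ζ => ?_) (fun t ht ζ => ?_) ζ ht
  · have hne : (Sum.inr q : S ⊕ T) ≠ .inl s := by simp
    have h1 := H.init.abs_same_le hne
    have h2 := H.init.abs_cross_le hne
    simp only [comb, inner_add_right, real_inner_smul_right]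
    rw [abs_le] at *
    cases ζ <;> simp only [boolSign, if_true, Bool.false_eq_true, if_false] <;>
      constructor <;> linarith
  · obtain ⟨c₁, c₂, h1, h2, h3⟩ := (H.near t ht).exists_deriv_comb_noise G.toParams G.hK
      (H.scaled G hε₀ (Ico_subset_Icc_self ht)) G.hL G.hκ q s ζ
    exact ⟨c₁, c₂, !ζ, h1, h2, h3⟩

lemma Traj.abs_inner_comb_noise_le' (q : T) (s : S) (ζ : Bool) {t : ℝ} (ht : t ∈ Icc 0 τ) :
    |inner ℝ (dir (b t (.inr q))) (comb (b t) (a t) ζ (.inl s))|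
      ≤ 2 * ε₀ + Q ^ 11 * ε ^ 2 * t := by
  have hc : ∀ ζ, ContinuousOn (fun t => comb (b t) (a t) ζ (.inl s)) (Icc 0 τ) := fun ζ =>
    (H.continuousOn_dir' G hε₀ _).add ((H.continuousOn_dir G hε₀ _).const_smul _)
  refine abs_le_add_mul_of_contracting (κ := Bool)
    (f := fun ζ t => inner ℝ (dir (b t (.inr q))) (comb (b t) (a t) ζ (.inl s)))
    (f' := fun ζ t => inner ℝ (dir (b t (.inr q))) (velComb K σ (b t) (a t) ζ (.inl s))
      + inner ℝ (velDir K σ (b t) (a t) (.inr q)) (comb (b t) (a t) ζ (.inl s)))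
    (fun k => (H.continuousOn_dir' G hε₀ _).inner (hc _))
    (fun k t ht => (H.flow.symm.hasDerivWithinAt_dir ht.1 (H.near t ht).symm _).inner ℝ
      (H.flow.symm.hasDerivWithinAt_comb ht.1 (H.near t ht).symm _ _)) (fun ζ => ?_)
    (fun t ht ζ => ?_) ζ ht
  · have hne : (Sum.inr q : S ⊕ T) ≠ .inl s := by simp
    have h1 := H.init.symm.abs_same_le hne
    have h2 := H.init.symm.abs_cross_le hne
    simp only [comb, inner_add_right, real_inner_smul_right]
    rw [abs_le] at *
    cases ζ <;> simp only [boolSign, if_true, Bool.false_eq_true, if_false] <;>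
      constructor <;> linarith
  · obtain ⟨c₁, c₂, h1, h2, h3⟩ := (H.near t ht).symm.exists_deriv_comb_noise G.toParams G.hK
      (H.scaled G hε₀ (Ico_subset_Icc_self ht)).symm G.hL G.hκ q s ζ
    exact ⟨c₁, c₂, !ζ, h1, h2, h3⟩

end
end Traj
end Contrastive

namespace Contrastive

section Traj
open Set
variable {S T : Type*} [Fintype S] [Fintype T] [DecidableEq S] [DecidableEq T]
variable {E : Type*} [NormedAddCommGroup E] [InnerProductSpace ℝ E]
variable {K : ℝ} {σ : S ⊕ T → ℝ} {a b : ℝ → S ⊕ T → E} {L Q ε ε₀ τ : ℝ}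
  (G : Regime K σ L Q ε) (H : Traj K σ a b Q ε ε₀ τ) (hε₀ : ε₀ ≤ ε)
include G H hε₀

/-- The correlations of the directions of a signal and another vector are recovered from those of
sums and differences. -/
lemma Traj.abs_inner_le {i : S ⊕ T} {s : S} (hi : i ≠ .inl s) (h0 : 0 ≤ ε₀) {t : ℝ}
    (ht : t ∈ Icc 0 τ) :
    (|inner ℝ (dir (a t i)) (dir (a t (.inl s)))| ≤ 4 * ε₀ + Q ^ 11 * ε ^ 2 * t ∧
      |inner ℝ (dir (a t i)) (dir (b t (.inl s)))| ≤ 4 * ε₀ + Q ^ 11 * ε ^ 2 * t) ∧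
    |inner ℝ (dir (b t i)) (dir (a t (.inl s)))| ≤ 4 * ε₀ + Q ^ 11 * ε ^ 2 * t ∧
      |inner ℝ (dir (b t i)) (dir (b t (.inl s)))| ≤ 4 * ε₀ + Q ^ 11 * ε ^ 2 * t := by
  rcases i with s' | q
  · have hs : s' ≠ s := by rintro rfl; exact hi rfl
    have h1 := H.abs_inner_comb_signal_le G hε₀ hs true true ht
    have h2 := H.abs_inner_comb_signal_le G hε₀ hs true false ht
    have h3 := H.abs_inner_comb_signal_le G hε₀ hs false true ht
    have h4 := H.abs_inner_comb_signal_le G hε₀ hs false false ht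
    simp only [comb, inner_add_left, inner_add_right, real_inner_smul_left, real_inner_smul_right,
      boolSign, if_true, Bool.false_eq_true, if_false] at h1 h2 h3 h4
    rw [abs_le] at *
    simp only [abs_le]
    refine ⟨⟨⟨?_, ?_⟩, ?_, ?_⟩, ⟨?_, ?_⟩, ?_, ?_⟩ <;> linarith
  · have h1 := H.abs_inner_comb_noise_le G hε₀ q s true ht
    have h2 := H.abs_inner_comb_noise_le G hε₀ q s false ht
    have h3 := H.abs_inner_comb_noise_le' G hε₀ q s true ht
    have h4 := H.abs_inner_comb_noise_le' G hε₀ q s false ht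
    simp only [comb, inner_add_right, real_inner_smul_right,
      boolSign, if_true, Bool.false_eq_true, if_false] at h1 h2 h3 h4
    rw [abs_le] at *
    simp only [abs_le]
    refine ⟨⟨⟨?_, ?_⟩, ?_, ?_⟩, ⟨?_, ?_⟩, ?_, ?_⟩ <;> linarith

lemma Traj.le_align (s : S) {t : ℝ} (ht : t ∈ Icc 0 τ) :
    1 - (ε₀ + Q ^ 8 * ε ^ 2 * t) ≤ inner ℝ (dir (a t (.inl s))) (dir (b t (.inl s))) := by
  have := le_add_mul_of_deriv_le_one (T := τ) (m := ε₀ - 1) (c := Q ^ 8 * ε ^ 2)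
    (f := fun t => -inner ℝ (dir (a t (.inl s))) (dir (b t (.inl s))))
    (f' := fun t => -(inner ℝ (dir (a t (.inl s))) (velDir K σ (b t) (a t) (.inl s))
      + inner ℝ (velDir K σ (a t) (b t) (.inl s)) (dir (b t (.inl s)))))
    ((H.continuousOn_dir G hε₀ _).inner (H.continuousOn_dir' G hε₀ _)).neg
    (fun t ht => ((H.flow.hasDerivWithinAt_dir ht.1 (H.near t ht) _).inner ℝ
      (H.flow.symm.hasDerivWithinAt_dir ht.1 (H.near t ht).symm _)).fun_neg)
    (by linarith [H.init.le_align s])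
    (fun t ht => by
      linarith [(H.near t ht).deriv_align_ge G.toParams G.hK
        (H.scaled G hε₀ (Ico_subset_Icc_self ht)) G.hL G.hκ s]) ht
  linarith

/-- Correlations between noises are not damped, but they move only to second order. -/
lemma Traj.abs_inner_noise_le (q q' : T) {m t : ℝ} (ht : t ∈ Icc 0 τ)
    (hm : |inner ℝ (dir (a 0 (.inr q))) (dir (b 0 (.inr q')))| ≤ m) :
    |inner ℝ (dir (a t (.inr q))) (dir (b t (.inr q')))| ≤ m + Q ^ 7 * ε ^ 2 * t :=
  abs_le_add_mul_of_abs_deriv_le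
    ((H.continuousOn_dir G hε₀ _).inner (H.continuousOn_dir' G hε₀ _))
    (fun t ht => (H.flow.hasDerivWithinAt_dir ht.1 (H.near t ht) _).inner ℝ
      (H.flow.symm.hasDerivWithinAt_dir ht.1 (H.near t ht).symm _)) hm
    (fun t ht => (H.near t ht).abs_deriv_noise_le G.toParams G.hK
        (H.scaled G hε₀ (Ico_subset_Icc_self ht)) G.hL q q') ht

/-! ### Bounds for the norms -/

lemma Traj.norm_noise_le (q : T) {t : ℝ} (ht : t ∈ Icc 0 τ) :
    ‖a t (.inr q)‖ ≤ ‖a 0 (.inr q)‖ := by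
  have := le_add_mul_of_deriv_le_one (c := 0) (H.continuousOn_norm G hε₀ (.inr q))
    (fun t ht => H.flow.hasDerivWithinAt_norm ht.1 (H.near t ht) _) le_rfl
    (fun t ht => mul_nonpos_of_nonneg_of_nonpos (norm_nonneg _)
      (mul_nonpos_of_nonneg_of_nonpos
        ((H.scaled G hε₀ (Ico_subset_Icc_self ht)).div_sq_pos _).le
        ((H.near t ht).rateLog_noise_nonpos G.toParams G.hK G.hκ q))) ht
  simpa using this

lemma Traj.norm_noise_le' (q : T) {t : ℝ} (ht : t ∈ Icc 0 τ) :
    ‖b t (.inr q)‖ ≤ ‖b 0 (.inr q)‖ := by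
  have := le_add_mul_of_deriv_le_one (c := 0) (H.continuousOn_norm' G hε₀ (.inr q))
    (fun t ht => H.flow.symm.hasDerivWithinAt_norm ht.1 (H.near t ht).symm _) le_rfl
    (fun t ht => mul_nonpos_of_nonneg_of_nonpos (norm_nonneg _)
      (mul_nonpos_of_nonneg_of_nonpos
        ((H.scaled G hε₀ (Ico_subset_Icc_self ht)).symm.div_sq_pos _).le
        ((H.near t ht).symm.rateLog_noise_nonpos G.toParams G.hK G.hκ q))) ht
  simpa using this

lemma Traj.continuousOn_log (i : S ⊕ T) : ContinuousOn (fun t => Real.log ‖a t i‖) (Icc 0 τ) :=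
  (H.continuousOn_norm G hε₀ i).log fun _ ht => norm_ne_zero_iff.2 (H.ne_left G hε₀ ht i)

lemma Traj.continuousOn_log' (i : S ⊕ T) : ContinuousOn (fun t => Real.log ‖b t i‖) (Icc 0 τ) :=
  (H.continuousOn_norm' G hε₀ i).log fun _ ht => norm_ne_zero_iff.2 (H.ne_right G hε₀ ht i)

lemma Traj.abs_log_noise_sub_le (q : T) {m t : ℝ} (ht : t ∈ Icc 0 τ)
    (hm : |Real.log ‖a 0 (.inr q)‖ - Real.log ‖b 0 (.inr q)‖| ≤ m) :
    |Real.log ‖a t (.inr q)‖ - Real.log ‖b t (.inr q)‖| ≤ m + Q ^ 5 * ε * t :=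
  abs_le_add_mul_of_abs_deriv_le ((H.continuousOn_log G hε₀ _).sub (H.continuousOn_log' G hε₀ _))
    (fun t ht => (H.flow.hasDerivWithinAt_log ht.1 (H.near t ht) _).fun_sub
      (H.flow.symm.hasDerivWithinAt_log ht.1 (H.near t ht).symm _)) hm
    (fun t ht => (H.near t ht).abs_rate_noise_sub_le G.toParams G.hK
        (H.scaled G hε₀ (Ico_subset_Icc_self ht)) G.hL G.hκ q) ht

lemma Traj.abs_log_noise_sub_le' {q q' : T} (hσ : σ (.inr q) = σ (.inr q')) {m t : ℝ}
    (ht : t ∈ Icc 0 τ) (hm : |Real.log ‖a 0 (.inr q)‖ - Real.log ‖a 0 (.inr q')‖| ≤ m) :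
    |Real.log ‖a t (.inr q)‖ - Real.log ‖a t (.inr q')‖| ≤ m + Q ^ 5 * ε * t :=
  abs_le_add_mul_of_abs_deriv_le ((H.continuousOn_log G hε₀ _).sub (H.continuousOn_log G hε₀ _))
    (fun t ht => (H.flow.hasDerivWithinAt_log ht.1 (H.near t ht) _).fun_sub
      (H.flow.hasDerivWithinAt_log ht.1 (H.near t ht) _)) hm
    (fun t ht => (H.near t ht).abs_rate_noise_sub_le' G.toParams G.hK
        (H.scaled G hε₀ (Ico_subset_Icc_self ht)) G.hL hσ) ht

/-- As long as some signals are unbalanced, all logarithmic ratios of the signals stay below a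
decreasing bound. -/
lemma Traj.log_ratio_le {cT m : ℝ} (hcT : cT ≤ Q * (cT - 1)) (hcT1 : 1 < cT)
    (hun : ∀ t ∈ Ico 0 τ, ∃ p q, cT * ‖a t (.inl q)‖ ^ 2 < ‖a t (.inl p)‖ ^ 2)
    (hm : ∀ p q, Real.log ‖a 0 (.inl p)‖ - Real.log ‖a 0 (.inl q)‖ ≤ m) (p q : S) {t : ℝ}
    (ht : t ∈ Icc 0 τ) :
    Real.log ‖a t (.inl p)‖ - Real.log ‖a t (.inl q)‖ ≤ m + -(1 / Q ^ 7) * t := by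
  refine le_add_mul_of_deriv_le (κ := S × S)
    (f := fun k t => Real.log ‖a t (.inl k.1)‖ - Real.log ‖a t (.inl k.2)‖)
    (fun k => (H.continuousOn_log G hε₀ _).sub (H.continuousOn_log G hε₀ _))
    (fun k t ht => (H.flow.hasDerivWithinAt_log ht.1 (H.near t ht) _).fun_sub
      (H.flow.hasDerivWithinAt_log ht.1 (H.near t ht) _)) (fun k => hm _ _)
    (fun t ht k hk => ?_) (p, q) ht
  have h := H.near t ht
  have ht' := Ico_subset_Icc_self ht
  have hp : ∀ s, ‖a t (.inl s)‖ ≤ ‖a t (.inl k.1)‖ := fun s => by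
    have := hk (s, k.2)
    rw [← Real.log_le_log_iff (h.norm_pos _) (h.norm_pos _)]
    linarith
  have hq : ∀ s, ‖a t (.inl k.2)‖ ≤ ‖a t (.inl s)‖ := fun s => by
    have := hk (k.1, s)
    rw [← Real.log_le_log_iff (h.norm_pos _) (h.norm_pos _)]
    linarith
  obtain ⟨p, q, hpq⟩ := hun t ht
  refine h.ratio_rate_le G.toParams G.hK (H.scaled G hε₀ ht') G.hL G.hκ hcT hcT1 hp hq ?_
    ((H.sq_famNorm_le G hε₀ ht').trans G.hL)
  have h1 := pow_le_pow_left₀ (norm_nonneg _) (hq q) 2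
  have h2 := pow_le_pow_left₀ (norm_nonneg _) (hp p) 2
  nlinarith

omit G H hε₀ in
lemma Near.energy_le {a b : S ⊕ T → E} (P : Params S T Q ε) (h : Near a b Q ε)
    (hσ : ∀ i, 1 ≤ σ i) (hn : famNorm a ^ 2 ≤ Q) : energy σ a b ≤ Q ^ 3 * ε ^ 2 := by
  have hQ := P.pos
  have hε := P.eps_nonneg
  unfold energy
  refine (Finset.sum_le_card_nsmul _ _ (4 * (Q * ε ^ 2)) fun i _ => ?_).trans ?_
  · have h1 := h.abs_norm_sub_le P i
    refine (div_le_self (sq_nonneg _) (hσ i)).trans ?_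
    rw [← sq_abs]
    refine (pow_le_pow_left₀ (abs_nonneg _) h1 2).trans ?_
    have : (2 * ε * famNorm a) ^ 2 = 4 * (famNorm a ^ 2 * ε ^ 2) := by ring
    rw [this]
    gcongr
  · rw [Finset.card_univ, nsmul_eq_mul]
    have h2 := P.step 2 (ε ^ 2) (sq_nonneg _)
    have h3 : 0 ≤ Q ^ 2 * ε ^ 2 := by positivity
    have h4 := P.card_le
    simp only [Nat.reduceAdd] at h2
    calc _ ≤ Q * (4 * (Q * ε ^ 2)) := by gcongr
      _ ≤ _ := by linarith

lemma Traj.energy_zero_le (h0 : 0 ≤ ε₀) : energy σ (a 0) (b 0) ≤ Q ^ 3 * ε₀ ^ 2 := by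
  have P₀ : Params S T Q ε₀ := ⟨G.hQ, G.card_le, h0,
    (mul_le_mul_of_nonneg_left hε₀ (pow_nonneg G.pos.le _)).trans G.eps_le⟩
  exact H.init.energy_le P₀ G.one_le ((H.sq_famNorm_le G hε₀ ⟨le_rfl, H.nonneg⟩).trans G.hL)

/-- The energy of the norm differences stays small: its growth is compensated by the dissipation
of the potential. -/
lemma Traj.energy_le (h0 : 0 ≤ ε₀) {t : ℝ} (ht : t ∈ Icc 0 τ) :
    energy σ (a t) (b t) ≤ Q ^ 4 * ε₀ ^ 2 + Q ^ 16 * ε ^ 3 * t := by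
  have hε := G.eps_nonneg
  have hQ := G.pos
  have hκ0 := logistic_pos G.hK (-1)
  have hσ : ∀ i, 0 < σ i := fun i => zero_lt_one.trans_le (G.one_le i)
  by_cases hne : Nonempty (S ⊕ T)
  swap
  · rw [not_nonempty_iff] at hne
    exact (H.false_of_isEmpty G hε₀ hne).elim
  obtain ⟨i₀⟩ := hne
  have hL0 : 0 < L := zero_lt_one.trans_le ((G.one_le i₀).trans (G.le_L i₀))
  -- `Γ` times the decay of the potential cancels the growth rate of the energy
  set Γ := 8 * L / logistic K (-1) with hΓ
  have hΓ0 : 0 < Γ := by positivity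
  have hΓQ : Γ ≤ Q := by
    have := Real.add_one_le_exp Γ
    linarith [G.exp_le]
  set Φ : ℝ → ℝ := fun t => ∑ i, logCosh (rel (a t) i ^ 2) with hΦ
  have hΦ0 : ∀ t, 0 ≤ Φ t := fun t => Finset.sum_nonneg fun i _ => logCosh_nonneg _
  have hΦ1 : ∀ t ∈ Icc 0 τ, Φ t ≤ 1 := by
    intro t ht
    rw [← sum_rel_sq (a := a t) (by linarith [H.one_le_famNorm G hε₀ ht])]
    refine Finset.sum_le_sum fun i _ => (logCosh_le _).trans ?_
    have h1 := pow_le_one₀ (n := 2) (rel_nonneg (a t) i) (rel_le_one (a t) i)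
    have h2 := sq_nonneg (rel (a t) i)
    nlinarith
  have hE0 : ∀ t, 0 ≤ energy σ (a t) (b t) := fun t =>
    Finset.sum_nonneg fun i _ => div_nonneg (sq_nonneg _) (hσ i).le
  have main := le_add_mul_of_deriv_le_one (T := τ) (m := Q ^ 4 * ε₀ ^ 2) (c := Q ^ 16 * ε ^ 3)
    (f := fun t => energy σ (a t) (b t) * Real.exp (Γ * Φ t)) (t := t) ?_
    (fun t ht => (H.flow.hasDerivWithinAt_energy ht.1 (H.near t ht) hσ).fun_mul
      ((H.flow.hasDerivWithinAt_potential ht.1 (H.near t ht)).const_mul Γ).exp) ?_ ?_ ht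
  · have h1 : 1 ≤ Real.exp (Γ * Φ t) := Real.one_le_exp (mul_nonneg hΓ0.le (hΦ0 t))
    exact (le_mul_of_one_le_right (hE0 t) h1).trans main
  · refine ContinuousOn.mul (continuousOn_finsetSum _ fun i _ =>
      (((H.continuousOn_norm G hε₀ i).sub (H.continuousOn_norm' G hε₀ i)).pow 2).div_const _) ?_
    refine Real.continuous_exp.comp_continuousOn (continuousOn_const.mul
      (continuousOn_finsetSum _ fun i _ => ?_))
    have hc : Continuous logCosh :=
      continuous_iff_continuousAt.2 fun x => (hasDerivAt_logCosh x).continuousAt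
    exact hc.comp_continuousOn ((H.continuousOn_rel G hε₀ i).pow 2)
  · have h1 : Real.exp (Γ * Φ 0) ≤ Q := by
      refine le_trans (Real.exp_le_exp.2 ?_) G.exp_le
      exact mul_le_of_le_one_right hΓ0.le (hΦ1 0 ⟨le_rfl, H.nonneg⟩)
    have h2 := H.energy_zero_le G hε₀ h0
    calc _ ≤ (Q ^ 3 * ε₀ ^ 2) * Q := mul_le_mul h2 h1 (Real.exp_pos _).le (by positivity)
      _ = _ := by ring
  · intro t ht
    have h := H.near t ht
    have ht' := Ico_subset_Icc_self ht
    have Sc := H.scaled G hε₀ ht'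
    have h1 := h.energy_rate_le G.toParams G.hK Sc G.hκ i₀
    have h2 := h.potential_rate_le G.toParams G.hK Sc G.hL G.hκ i₀
    set E₁ := ∑ i, 2 * (‖a t i‖ - ‖b t i‖) * (‖a t i‖ / famNorm (a t) ^ 2 * rateLog K (a t) (b t) i
        - ‖b t i‖ / famNorm (b t) ^ 2 * rateLog K (b t) (a t) i)
    set Φ₁ := ∑ i, Real.tanh (rel (a t) i ^ 2) * (2 * rel (a t) i ^ 2
      * (σ i * rateLog K (a t) (b t) i - ∑ j, σ j * rel (a t) j ^ 2 * rateLog K (a t) (b t) j)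
      / famNorm (a t) ^ 2)
    set V := weightVar K (a t) (b t) / famNorm (a t) ^ 2
    have h3 : energy σ (a t) (b t) ≤ Q ^ 3 * ε ^ 2 :=
      h.energy_le G.toParams G.one_le ((H.sq_famNorm_le G hε₀ ht').trans G.hL)
    have hX : Real.exp (Γ * Φ t) ≤ Q := by
      refine le_trans (Real.exp_le_exp.2 ?_) G.exp_le
      exact mul_le_of_le_one_right hΓ0.le (hΦ1 t ht')
    have hX0 := (Real.exp_pos (Γ * Φ t)).le
    have h4 : E₁ + Γ * energy σ (a t) (b t) * Φ₁ ≤ 2 * (Q ^ 14 * ε ^ 3) := by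
      have h5 := mul_le_mul_of_nonneg_left h2 (mul_nonneg hΓ0.le (hE0 t))
      have h6 : Γ * energy σ (a t) (b t) * (Q ^ 10 * ε) ≤ Q * (Q ^ 3 * ε ^ 2) * (Q ^ 10 * ε) := by
        have := hE0 t
        gcongr
      have e6 : Q * (Q ^ 3 * ε ^ 2) * (Q ^ 10 * ε) = Q ^ 14 * ε ^ 3 := by ring
      have m := G.mono (k := 7) (l := 14) (by norm_num) (by positivity : 0 ≤ ε ^ 3)
      linarith
    have h7 := mul_le_mul_of_nonneg_right h4 hX0
    have h8 := mul_le_mul_of_nonneg_left hX (by positivity : 0 ≤ 2 * (Q ^ 14 * ε ^ 3))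
    have s := G.step 15 (ε ^ 3) (by positivity)
    have : 0 ≤ Q ^ 15 * ε ^ 3 := by positivity
    simp only [Nat.reduceAdd] at s
    have e8 : 2 * (Q ^ 14 * ε ^ 3) * Q = 2 * (Q ^ 15 * ε ^ 3) := by ring
    simp only [hΦ] at *
    linarith

end Traj
end Contrastive

namespace Contrastive

/-! ### Continuation until the signals are balanced -/

section Bootstrap
open Set Filter Topology
variable {S T : Type*} [Fintype S] [Fintype T] [DecidableEq S] [DecidableEq T]
variable {E : Type*} [NormedAddCommGroup E] [InnerProductSpace ℝ E]
variable {K : ℝ} {σ : S ⊕ T → ℝ} {a b : ℝ → S ⊕ T → E} {L Q ε ε₀ τ cT ρ : ℝ}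

/-- Half of `Near` is an open condition: it persists for a short time with doubled constants. -/
lemma HalfNear.eventually {t : ℝ} (ht : 0 ≤ t) (hca : ∀ i, ContinuousOn (fun t => a t i) (Ici 0))
    (hcb : ∀ i, ContinuousOn (fun t => b t i) (Ici 0)) (ha : ∀ i, a t i ≠ 0) (hb : ∀ i, b t i ≠ 0)
    (hQ : 0 < Q) (hε : 0 < ε) (h : HalfNear (a t) (b t) (Q / 2) (ε / 2)) :
    ∀ᶠ u in 𝓝[≥] t, HalfNear (a u) (b u) Q ε := by
  have ca : ∀ i, ContinuousWithinAt (fun t => a t i) (Ici t) t := fun i =>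
    (hca i t ht).mono (Ici_subset_Ici.2 ht)
  have cb : ∀ i, ContinuousWithinAt (fun t => b t i) (Ici t) t := fun i =>
    (hcb i t ht).mono (Ici_subset_Ici.2 ht)
  have cn : ContinuousWithinAt (fun t => famNorm (a t)) (Ici t) t :=
    Real.continuous_sqrt.continuousAt.comp_continuousWithinAt
      (tendsto_finsetSum _ fun i _ => (ca i).norm.pow 2)
  have na : ∀ i, 0 < ‖a t i‖ := fun i => norm_pos_iff.2 (ha i)
  have nb : ∀ i, 0 < ‖b t i‖ := fun i => norm_pos_iff.2 (hb i)
  have key : ∀ f g : ℝ → ℝ, ContinuousWithinAt f (Ici t) t → ContinuousWithinAt g (Ici t) t →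
      f t < g t → ∀ᶠ u in 𝓝[≥] t, f u ≤ g u := fun f g hf hg hlt =>
    (hf.eventually_lt hg hlt).mono fun _ => le_of_lt
  have e1 : ∀ᶠ u in 𝓝[≥] t, ∀ s, famNorm (a u) ≤ Q * ‖a u (.inl s)‖ :=
    eventually_all.2 fun s => key _ _ cn (continuousWithinAt_const.mul (ca _).norm) (by
      have := mul_pos hQ (na (.inl s))
      linarith [h.low s])
  have e2 : ∀ᶠ u in 𝓝[≥] t, ∀ q, ‖a u (.inr q)‖ ≤ ε * famNorm (a u) :=
    eventually_all.2 fun q => key _ _ (ca _).norm (continuousWithinAt_const.mul cn) (by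
      have := mul_pos hε ((na (.inr q)).trans_le (norm_le_famNorm (a t) (.inr q)))
      linarith [h.noise q])
  have e3 : ∀ᶠ u in 𝓝[≥] t, ∀ s, |‖a u (.inl s)‖ - ‖b u (.inl s)‖| ≤ ε * ‖a u (.inl s)‖ :=
    eventually_all.2 fun s => key _ _ ((ca _).norm.sub (cb _).norm).abs
      (continuousWithinAt_const.mul (ca _).norm) (by
      have := mul_pos hε (na (.inl s))
      linarith [h.close s])
  have e4 : ∀ᶠ u in 𝓝[≥] t, ∀ s, (1 - ε) * (‖a u (.inl s)‖ * ‖b u (.inl s)‖)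
      ≤ inner ℝ (a u (.inl s)) (b u (.inl s)) :=
    eventually_all.2 fun s => key _ _ (continuousWithinAt_const.mul ((ca _).norm.mul (cb _).norm))
      ((ca _).inner (cb _)) (by
      have := mul_pos hε (mul_pos (na (.inl s)) (nb (.inl s)))
      linarith [h.align s])
  have e5 : ∀ᶠ u in 𝓝[≥] t, ∀ i s, i ≠ .inl s →
      |inner ℝ (a u i) (a u (.inl s))| ≤ ε * (‖a u i‖ * ‖a u (.inl s)‖) :=
    eventually_all.2 fun i => eventually_all.2 fun s => by
      by_cases hi : i = .inl s
      · exact Eventually.of_forall fun u h => absurd hi h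
      · refine (key (fun u => |inner ℝ (a u i) (a u (.inl s))|)
          (fun u => ε * (‖a u i‖ * ‖a u (.inl s)‖)) ((ca _).inner (ca _)).abs
          (continuousWithinAt_const.mul ((ca i).norm.mul (ca (.inl s)).norm)) ?_).mono
          fun u hu _ => hu
        have := mul_pos hε (mul_pos (na i) (na (.inl s)))
        linarith [h.same i s hi]
  have e6 : ∀ᶠ u in 𝓝[≥] t, ∀ i s, i ≠ .inl s →
      |inner ℝ (a u i) (b u (.inl s))| ≤ ε * (‖a u i‖ * ‖b u (.inl s)‖) :=
    eventually_all.2 fun i => eventually_all.2 fun s => by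
      by_cases hi : i = .inl s
      · exact Eventually.of_forall fun u h => absurd hi h
      · refine (key (fun u => |inner ℝ (a u i) (b u (.inl s))|)
          (fun u => ε * (‖a u i‖ * ‖b u (.inl s)‖)) ((ca _).inner (cb _)).abs
          (continuousWithinAt_const.mul ((ca i).norm.mul (cb (.inl s)).norm)) ?_).mono
          fun u hu _ => hu
        have := mul_pos hε (mul_pos (na i) (nb (.inl s)))
        linarith [h.cross i s hi]
  filter_upwards [e1, e2, e3, e4, e5, e6] with u h1 h2 h3 h4 h5 h6 using ⟨h1, h2, h3, h4, h5, h6⟩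

lemma Near.eventually {t : ℝ} (ht : 0 ≤ t) (hca : ∀ i, ContinuousOn (fun t => a t i) (Ici 0))
    (hcb : ∀ i, ContinuousOn (fun t => b t i) (Ici 0)) (hQ : 0 < Q) (hε : 0 < ε)
    (h : Near (a t) (b t) (Q / 2) (ε / 2)) : ∀ᶠ u in 𝓝[≥] t, Near (a u) (b u) Q ε := by
  have e1 : ∀ᶠ u in 𝓝[≥] t, ∀ i, a u i ≠ 0 := eventually_all.2 fun i =>
    ((hca i t ht).mono (Ici_subset_Ici.2 ht)).eventually_ne (h.ne_left i)
  have e2 : ∀ᶠ u in 𝓝[≥] t, ∀ i, b u i ≠ 0 := eventually_all.2 fun i =>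
    ((hcb i t ht).mono (Ici_subset_Ici.2 ht)).eventually_ne (h.ne_right i)
  filter_upwards [e1, e2, h.left.eventually ht hca hcb h.ne_left h.ne_right hQ hε,
    h.right.eventually ht hcb hca h.ne_right h.ne_left hQ hε] with u h1 h2 h3 h4
    using ⟨h1, h2, h3, h4⟩

/-- What is assumed at the initial time, beyond `Traj`: the signals of the first family differ by at
most a factor `ρ`, and the initial errors are much smaller than the errors `ε` allowed later. -/
structure Start (a : ℝ → S ⊕ T → E) (Q ε ε₀ cT ρ : ℝ) : Prop where
  nonneg : 0 ≤ ε₀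
  le : Q ^ 8 * ε₀ ≤ ε
  one_lt : 1 < cT
  target_le : cT ≤ Q * (cT - 1)
  one_le : 1 ≤ ρ
  ratio : ∀ p q, ‖a 0 (.inl p)‖ ≤ ρ * ‖a 0 (.inl q)‖
  ratio_le : 8 * (Fintype.card (S ⊕ T) * ρ) ≤ Q

section
variable (G : Regime K σ L Q ε) (I : Start a Q ε ε₀ cT ρ)
include G I

lemma Start.le_eps : ε₀ ≤ ε := by
  have h1 := G.mono (k := 0) (l := 8) (by norm_num) I.nonneg
  rw [pow_zero, one_mul] at h1
  exact h1.trans I.le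

lemma Start.hundred_le {k : ℕ} (hk : k ≤ 7) : 100 * (Q ^ k * ε₀) ≤ ε :=
  (G.step k ε₀ I.nonneg).trans ((G.mono (by omega) I.nonneg).trans I.le)

variable (H : Traj K σ a b Q ε ε₀ τ)
  (hun : ∀ t ∈ Ico 0 τ, ∃ p q, cT * ‖a t (.inl q)‖ ^ 2 < ‖a t (.inl p)‖ ^ 2)
include H hun

lemma Traj.log_ratio_le' (p q : S) {t : ℝ} (ht : t ∈ Icc 0 τ) :
    Real.log ‖a t (.inl p)‖ - Real.log ‖a t (.inl q)‖ ≤ Real.log ρ + -(1 / Q ^ 7) * t := by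
  refine H.log_ratio_le G (I.le_eps G) I.target_le I.one_lt hun (fun p q => ?_) p q ht
  rw [sub_le_iff_le_add, ← Real.log_mul (by linarith [I.one_le]) (H.init.norm_pos _).ne']
  exact Real.log_le_log (H.init.norm_pos _) (I.ratio p q)

lemma Traj.ratio_le {t : ℝ} (ht : t ∈ Icc 0 τ) (p q : S) :
    ‖a t (.inl p)‖ ≤ ρ * ‖a t (.inl q)‖ := by
  have h1 := H.log_ratio_le' G I hun p q ht
  have hp := norm_pos_iff.2 (H.ne_left G (I.le_eps G) ht (.inl p))
  have hq := norm_pos_iff.2 (H.ne_left G (I.le_eps G) ht (.inl q))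
  have hρ : 0 < ρ := by linarith [I.one_le]
  rw [← Real.log_le_log_iff hp (mul_pos hρ hq), Real.log_mul hρ.ne' hq.ne']
  have := mul_nonneg (by have := G.pos; positivity : 0 ≤ 1 / Q ^ 7) ht.1
  linarith

lemma Traj.time_le [Nonempty S] : τ ≤ Q ^ 8 := by
  obtain ⟨s⟩ := ‹Nonempty S›
  have h1 := H.log_ratio_le' G I hun s s ⟨H.nonneg, le_rfl⟩
  have hQ := G.pos
  have hρ : ρ ≤ Q := by
    have h2 := I.ratio_le
    have h3 : (1 : ℝ) ≤ Fintype.card (S ⊕ T) := by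
      have : 0 < Fintype.card (S ⊕ T) := Fintype.card_pos_iff.2 ⟨.inl s⟩
      exact_mod_cast this
    have h4 := I.one_le
    nlinarith
  have h5 : Real.log ρ ≤ Q :=
    ((Real.log_le_sub_one_of_pos (by linarith [I.one_le])).trans (by linarith)).trans hρ
  rw [sub_self] at h1
  have h6 : 1 / Q ^ 7 * τ ≤ Q := by linarith
  rw [div_mul_eq_mul_div, one_mul, div_le_iff₀ (by positivity)] at h6
  calc τ ≤ Q * Q ^ 7 := h6
    _ = Q ^ 8 := by ring

/-- As long as the signals are unbalanced, the bounds defining a trajectory improve by factors. -/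
lemma Traj.near_half [Nonempty S] {t : ℝ} (ht : t ∈ Icc 0 τ) :
    Near (a t) (b t) (Q / 2) (ε / 2) := by
  have hε₀ := I.le_eps G
  have hε := G.eps_nonneg
  have hQ := G.pos
  have hQ100 := G.hQ
  have h0 := I.nonneg
  have htQ : t ≤ Q ^ 8 := ht.2.trans (H.time_le G I hun)
  have hn1 := H.one_le_famNorm G hε₀ ht
  have hN1 := (H.scaled G hε₀ ht).right
  have hnL : famNorm (a 0) ≤ Q := by
    have h1 := (H.sq_famNorm_le G hε₀ ⟨le_rfl, H.nonneg⟩).trans G.hL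
    have h2 := H.one_le_famNorm G hε₀ ⟨le_rfl, H.nonneg⟩
    nlinarith
  have hNL := H.famNorm_le_two_mul' G hε₀ ⟨le_rfl, H.nonneg⟩
  have hsmall : ∀ k, k ≤ 31 → 100 * (Q ^ k * ε ^ 2) * Q ^ 8 ≤ ε := fun k hk => by
    have h1 := G.absorb (k := k + 8 + 1) (by omega)
    have h2 := G.step (k + 8) (ε ^ 2) (sq_nonneg ε)
    have e : 100 * (Q ^ k * ε ^ 2) * Q ^ 8 = 100 * (Q ^ (k + 8) * ε ^ 2) := by ring
    linarith
  have hpow : ∀ k, k ≤ 31 → 100 * (Q ^ k * ε ^ 2 * t) ≤ ε := fun k hk => by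
    have h1 := mul_le_mul_of_nonneg_left htQ (by positivity : 0 ≤ 100 * (Q ^ k * ε ^ 2))
    linarith [hsmall k hk]
  have hδ : 4 * ε₀ + Q ^ 11 * ε ^ 2 * t ≤ ε / 2 := by
    have h1 := I.hundred_le G (k := 0) (by norm_num)
    have h2 := hpow 11 (by norm_num)
    simp only [pow_zero, one_mul] at h1
    linarith
  have hal : ε₀ + Q ^ 8 * ε ^ 2 * t ≤ ε / 2 := by
    have h1 := I.hundred_le G (k := 0) (by norm_num)
    have h2 := hpow 8 (by norm_num)
    simp only [pow_zero, one_mul] at h1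
    linarith
  have na : ∀ i, 0 < ‖a t i‖ := fun i => norm_pos_iff.2 (H.ne_left G hε₀ ht i)
  have nb : ∀ i, 0 < ‖b t i‖ := fun i => norm_pos_iff.2 (H.ne_right G hε₀ ht i)
  have hu : ∀ s, 1 ≤ Q * ‖a t (.inl s)‖ := fun s => hn1.trans (H.le_mul_norm_signal G hε₀ ht s)
  -- the norms of the two families are close
  have hE := H.energy_le G hε₀ h0 ht
  have hclose : ∀ s, |‖a t (.inl s)‖ - ‖b t (.inl s)‖| ≤ ε / 4 * ‖a t (.inl s)‖ := by
    intro s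
    refine abs_le_of_sq_le_sq ?_ (by positivity)
    have h1 : (‖a t (.inl s)‖ - ‖b t (.inl s)‖) ^ 2 ≤ Q * energy σ (a t) (b t) := by
      have hσ : 0 < σ (.inl s) := zero_lt_one.trans_le (G.one_le _)
      have h2 : (‖a t (.inl s)‖ - ‖b t (.inl s)‖) ^ 2 / σ (.inl s) ≤ energy σ (a t) (b t) :=
        Finset.single_le_sum (f := fun i => (‖a t i‖ - ‖b t i‖) ^ 2 / σ i)
          (fun i _ => div_nonneg (sq_nonneg _) (zero_le_one.trans (G.one_le i)))
          (Finset.mem_univ _)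
      have h3 : 0 ≤ energy σ (a t) (b t) := le_trans (by positivity) h2
      rw [div_le_iff₀ hσ] at h2
      have h4 := (G.le_L (.inl s)).trans G.hL
      nlinarith
    have h2 : Q * (Q ^ 4 * ε₀ ^ 2 + Q ^ 16 * ε ^ 3 * t) * Q ^ 2 ≤ ε ^ 2 / 16 := by
      have h3 := I.hundred_le G (k := 7) le_rfl
      have h4 := hpow 20 (by norm_num)
      have h5 : (100 * (Q ^ 7 * ε₀)) ^ 2 ≤ ε ^ 2 := pow_le_pow_left₀ (by positivity) h3 2
      have h6 : Q ^ 7 * ε₀ ^ 2 ≤ Q ^ 14 * ε₀ ^ 2 := G.mono (by norm_num) (sq_nonneg _)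
      have h7 := mul_le_mul_of_nonneg_right h4 hε
      have h8 : Q ^ 19 * (ε ^ 3 * t) ≤ Q ^ 20 * (ε ^ 3 * t) :=
        G.mono (by norm_num) (mul_nonneg (by positivity) ht.1)
      nlinarith
    have h3 : 1 ≤ (Q * ‖a t (.inl s)‖) ^ 2 := one_le_pow₀ (hu s)
    have h4 : 0 ≤ Q * energy σ (a t) (b t) := (sq_nonneg _).trans h1
    calc (‖a t (.inl s)‖ - ‖b t (.inl s)‖) ^ 2
        ≤ Q * energy σ (a t) (b t) := h1
      _ ≤ Q * energy σ (a t) (b t) * (Q * ‖a t (.inl s)‖) ^ 2 := le_mul_of_one_le_right h4 h3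
      _ ≤ Q * (Q ^ 4 * ε₀ ^ 2 + Q ^ 16 * ε ^ 3 * t) * (Q * ‖a t (.inl s)‖) ^ 2 := by gcongr
      _ = Q * (Q ^ 4 * ε₀ ^ 2 + Q ^ 16 * ε ^ 3 * t) * Q ^ 2 * ‖a t (.inl s)‖ ^ 2 := by ring
      _ ≤ ε ^ 2 / 16 * ‖a t (.inl s)‖ ^ 2 := by gcongr
      _ = (ε / 4 * ‖a t (.inl s)‖) ^ 2 := by ring
  have hclose' : ∀ s, ‖a t (.inl s)‖ ≤ 2 * ‖b t (.inl s)‖ := fun s => by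
    have h1 := (abs_le.1 (hclose s)).2
    have h2 := G.eps_le_one
    have := na (.inl s)
    nlinarith
  -- the noises
  have hna : ∀ q, ‖a t (.inr q)‖ ≤ Q * ε₀ := fun q => by
    refine (H.norm_noise_le G hε₀ q ht).trans ((H.init.left.noise q).trans ?_)
    rw [mul_comm]
    exact mul_le_mul_of_nonneg_right hnL h0
  have hnb : ∀ q, ‖b t (.inr q)‖ ≤ 2 * (Q * ε₀) := fun q => by
    refine (H.norm_noise_le' G hε₀ q ht).trans ((H.init.right.noise q).trans ?_)
    have := mul_le_mul_of_nonneg_left (hNL.trans (by linarith : _ ≤ 2 * Q)) h0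
    linarith
  have hq1 := I.hundred_le G (k := 1) (by norm_num)
  rw [pow_one] at hq1
  -- the signals stay comparable
  have hlow : ∀ s, famNorm (a t) ≤ Q / 8 * ‖a t (.inl s)‖ := by
    intro s
    have hcard : (1 : ℝ) ≤ Fintype.card (S ⊕ T) := by
      have : 0 < Fintype.card (S ⊕ T) := Fintype.card_pos_iff.2 ⟨.inl s⟩
      exact_mod_cast this
    have hρ := I.one_le
    have h1 : ∀ i, ‖a t i‖ ^ 2 ≤ (ρ * ‖a t (.inl s)‖) ^ 2 := by
      intro i
      refine pow_le_pow_left₀ (norm_nonneg _) ?_ 2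
      rcases i with s' | q
      · exact H.ratio_le G I hun ht s' s
      · have h2 := hna q
        have h3 := hu s
        have h4 := I.hundred_le G (k := 2) (by norm_num)
        have h5 := G.eps_le_one
        have h6 : Q * (Q * ε₀) ≤ Q * ‖a t (.inl s)‖ := by
          have e : Q * (Q * ε₀) = Q ^ 2 * ε₀ := by ring
          have : 0 ≤ Q ^ 2 * ε₀ := by positivity
          linarith
        have h7 := le_of_mul_le_mul_left h6 hQ
        have h8 := le_mul_of_one_le_left (na (.inl s)).le hρ
        linarith
    have h2 : famNorm (a t) ^ 2 ≤ Fintype.card (S ⊕ T) * (ρ * ‖a t (.inl s)‖) ^ 2 := by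
      rw [famNorm_sq]
      refine (Finset.sum_le_card_nsmul _ _ _ fun i _ => h1 i).trans ?_
      rw [Finset.card_univ, nsmul_eq_mul]
    have h3 : famNorm (a t) ≤ Fintype.card (S ⊕ T) * (ρ * ‖a t (.inl s)‖) := by
      have h4 : 0 ≤ ρ * ‖a t (.inl s)‖ := mul_nonneg (by linarith) (norm_nonneg _)
      refine (sq_le_sq₀ (famNorm_nonneg _) (mul_nonneg (by linarith) h4)).1 (h2.trans ?_)
      rw [mul_pow _ (ρ * ‖a t (.inl s)‖)]
      refine mul_le_mul_of_nonneg_right ?_ (sq_nonneg _)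
      nlinarith
    have h5 := mul_le_mul_of_nonneg_right I.ratio_le (na (.inl s)).le
    linarith
  have prod : ∀ (u v : E) (δ : ℝ), |inner ℝ (dir u) (dir v)| ≤ δ →
      |inner ℝ u v| ≤ δ * (‖u‖ * ‖v‖) := fun u v δ h => by
    rw [inner_eq_mul_inner_dir, abs_mul, abs_of_nonneg (by positivity : 0 ≤ ‖u‖ * ‖v‖), mul_comm]
    exact mul_le_mul_of_nonneg_right h (by positivity)
  have hψ : ∀ s, (1 - ε / 2) * (‖a t (.inl s)‖ * ‖b t (.inl s)‖)
      ≤ inner ℝ (a t (.inl s)) (b t (.inl s)) := fun s => by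
    rw [inner_eq_mul_inner_dir, mul_comm]
    exact mul_le_mul_of_nonneg_left (by linarith [H.le_align G hε₀ s ht]) (by positivity)
  refine ⟨H.ne_left G hε₀ ht, H.ne_right G hε₀ ht, ⟨fun s => ?_, fun q => ?_, fun s => ?_, hψ,
    fun i s hi => ?_, fun i s hi => ?_⟩, ⟨fun s => ?_, fun q => ?_, fun s => ?_, fun s => ?_,
    fun i s hi => ?_, fun i s hi => ?_⟩⟩
  · have := mul_pos hQ (na (.inl s))
    linarith [hlow s]
  · have := mul_le_mul_of_nonneg_left hn1 hε
    have := mul_nonneg hQ.le h0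
    linarith [hna q]
  · have := mul_nonneg hε (na (.inl s)).le
    linarith [hclose s]
  · exact prod _ _ _ ((H.abs_inner_le G hε₀ hi h0 ht).1.1.trans hδ)
  · exact prod _ _ _ ((H.abs_inner_le G hε₀ hi h0 ht).1.2.trans hδ)
  · have h1 := H.famNorm_le_two_mul' G hε₀ ht
    have h2 := mul_le_mul_of_nonneg_left (hclose' s) hQ.le
    linarith [hlow s]
  · have := mul_le_mul_of_nonneg_left hN1 hε
    have := mul_nonneg hQ.le h0
    linarith [hnb q]
  · rw [abs_sub_comm]
    have := mul_le_mul_of_nonneg_left (hclose' s) hε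
    linarith [hclose s]
  · rw [real_inner_comm, mul_comm ‖b t (.inl s)‖]
    exact hψ s
  · exact prod _ _ _ ((H.abs_inner_le G hε₀ hi h0 ht).2.2.trans hδ)
  · exact prod _ _ _ ((H.abs_inner_le G hε₀ hi h0 ht).2.1.trans hδ)

end

variable (G : Regime K σ L Q ε) (I : Start a Q ε ε₀ cT ρ) (hε : 0 < ε)
include G I hε

/-- The bounds of a trajectory hold as long as the signals are unbalanced. -/
lemma Traj.extend [Nonempty S] (H : Traj K σ a b Q ε ε₀ 0) (hτ : 0 ≤ τ)
    (hun : ∀ t ∈ Ico 0 τ, ∃ p q, cT * ‖a t (.inl q)‖ ^ 2 < ‖a t (.inl p)‖ ^ 2) :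
    Traj K σ a b Q ε ε₀ τ := by
  have hQ := G.pos
  have relax : ∀ t, Near (a t) (b t) (Q / 2) (ε / 2) → Near (a t) (b t) Q ε := fun t h =>
    h.mono (by linarith) (by linarith)
  have make : ∀ x, 0 ≤ x → (∀ t ∈ Ico 0 x, Near (a t) (b t) Q ε) → Traj K σ a b Q ε ε₀ x :=
    fun x hx h => ⟨H.flow, H.cont_left, H.cont_right, H.mass, hx, H.init, h⟩
  refine make τ hτ fun t ht => ?_
  by_contra hbad
  -- the first time at which the improved bounds fail
  set U : Set ℝ := {x | x ∈ Icc 0 τ ∧ ¬ Near (a x) (b x) (Q / 2) (ε / 2)} with hU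
  have htU : t ∈ U := ⟨Ico_subset_Icc_self ht, fun h => hbad (relax t h)⟩
  have hbdd : BddBelow U := ⟨0, fun x hx => hx.1.1⟩
  set x := sInf U with hx
  have hx0 : 0 ≤ x := le_csInf ⟨t, htU⟩ fun y hy => hy.1.1
  have hxt : x ≤ t := csInf_le hbdd htU
  have hbelow : ∀ y ∈ Ico 0 x, Near (a y) (b y) Q ε := fun y hy => by
    by_contra h
    exact not_le.2 hy.2 (csInf_le hbdd ⟨⟨hy.1, (hy.2.le.trans hxt).trans ht.2.le⟩,
      fun h' => h (relax y h')⟩)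
  have Hx := make x hx0 hbelow
  have hnear := Hx.near_half G I (fun y hy => hun y ⟨hy.1, hy.2.trans_le (hxt.trans ht.2.le)⟩)
    (t := x) ⟨hx0, le_rfl⟩
  have hev := hnear.eventually hx0 H.cont_left H.cont_right hQ hε
  obtain ⟨y, hy, hsub⟩ := mem_nhdsGE_iff_exists_Ico_subset.1 hev
  have hmin : x < min y τ := lt_min hy (hxt.trans_lt ht.2)
  have Hy := make (min y τ) (hx0.trans hmin.le) fun u hu => by
    rcases lt_or_ge u x with h1 | h1
    · exact hbelow u ⟨hu.1, h1⟩
    · exact hsub ⟨h1, hu.2.trans_le (min_le_left _ _)⟩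
  have hle : min y τ ≤ x := le_csInf ⟨t, htU⟩ fun u hu => by
    by_contra hcon
    push Not at hcon
    exact hu.2 (Hy.near_half G I (fun v hv => hun v ⟨hv.1, hv.2.trans_le (min_le_right _ _)⟩)
      ⟨hu.1.1, hcon.le⟩)
  exact not_le.2 hmin hle

/-- There is a first time at which the signals are balanced, and the bounds hold up to that time. -/
lemma Traj.exists_first_balanced [Nonempty S] (H : Traj K σ a b Q ε ε₀ 0) :
    ∃ T₁, IsLeast {t | 0 ≤ t ∧ ∀ p q, ‖a t (.inl p)‖ ^ 2 ≤ cT * ‖a t (.inl q)‖ ^ 2} T₁ ∧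
      T₁ ≤ Q ^ 8 ∧ Traj K σ a b Q ε ε₀ T₁ ∧
      ∀ t ∈ Icc 0 T₁, Near (a t) (b t) (Q / 2) (ε / 2) := by
  set A : Set ℝ := {t | 0 ≤ t ∧ ∀ p q, ‖a t (.inl p)‖ ^ 2 ≤ cT * ‖a t (.inl q)‖ ^ 2} with hA
  have hQ := G.pos
  have hne : A.Nonempty := by
    by_contra hcon
    have hun : ∀ t ∈ Ico 0 (Q ^ 8 + 1), ∃ p q,
        cT * ‖a t (.inl q)‖ ^ 2 < ‖a t (.inl p)‖ ^ 2 := by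
      intro t ht
      by_contra h
      push Not at h
      exact hcon ⟨t, ht.1, h⟩
    have := (H.extend G I hε (by positivity) hun).time_le G I hun
    linarith
  have hclosed : IsClosed A := by
    have e : A = Ici 0 ∩ ⋂ p, ⋂ q, (Ici 0 ∩ {t | ‖a t (.inl p)‖ ^ 2 ≤ cT * ‖a t (.inl q)‖ ^ 2}) := by
      ext t
      simp only [hA, mem_inter_iff, mem_ofPred_eq, mem_iInter, mem_Ici]
      exact ⟨fun h => ⟨h.1, fun p q => ⟨h.1, h.2 p q⟩⟩, fun h => ⟨h.1, fun p q => (h.2 p q).2⟩⟩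
    rw [e]
    exact isClosed_Ici.inter (isClosed_iInter fun p => isClosed_iInter fun q =>
      isClosed_Ici.isClosed_le ((H.cont_left _).norm.pow 2)
        (continuousOn_const.mul ((H.cont_left _).norm.pow 2)))
  have hbdd : BddBelow A := ⟨0, fun x hx => hx.1⟩
  have hmem := hclosed.csInf_mem hne hbdd
  set T₁ := sInf A
  have hun : ∀ t ∈ Ico 0 T₁, ∃ p q, cT * ‖a t (.inl q)‖ ^ 2 < ‖a t (.inl p)‖ ^ 2 := by
    intro t ht
    by_contra h
    push Not at h
    exact not_le.2 ht.2 (csInf_le hbdd ⟨ht.1, h⟩)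
  have HT := H.extend G I hε hmem.1 hun
  exact ⟨T₁, ⟨hmem, fun x hx => csInf_le hbdd hx⟩, HT.time_le G I hun, HT,
    fun t ht => HT.near_half G I hun ht⟩

end Bootstrap
end Contrastive

namespace Contrastive

/-! ### Rescaling space and time -/

section Rescale
open Set
variable {S T : Type*} [Fintype S] [Fintype T] [DecidableEq S] [DecidableEq T]
variable {E : Type*} [NormedAddCommGroup E] [InnerProductSpace ℝ E]

lemma famNorm_smul {ι : Type*} [Fintype ι] {l : ℝ} (hl : 0 < l) (a : ι → E) :
    famNorm (fun i => l • a i) = l * famNorm a := by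
  unfold famNorm
  simp only [norm_smul, mul_pow, ← Finset.mul_sum, Real.norm_eq_abs, sq_abs]
  rw [Real.sqrt_mul (sq_nonneg l), Real.sqrt_sq hl.le]

lemma overlap_smul {ι : Type*} [Fintype ι] {l : ℝ} (hl : 0 < l) (a b : ι → E) :
    overlap (fun i => l • a i) (fun i => l • b i) = overlap a b := by
  ext i j
  unfold overlap
  rw [famNorm_smul hl, famNorm_smul hl, real_inner_smul_left, real_inner_smul_right]
  have := hl.ne'
  field_simp

lemma drift_smul (K : ℝ) {l : ℝ} (hl : 0 < l) (a b : S ⊕ T → E) (i : S ⊕ T) :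
    drift K (fun i => l • a i) (fun i => l • b i) i = l⁻¹ • drift K a b i := by
  have := hl.ne'
  unfold drift pairing
  rw [overlap_smul hl, famNorm_smul hl, famNorm_smul hl, smul_sub, Finset.smul_sum, smul_smul,
    smul_smul]
  congr 1
  · congr 1
    field_simp
  · refine Finset.sum_congr rfl fun j _ => ?_
    rw [smul_smul, smul_smul]
    congr 1
    field_simp

/-- `drift` is homogeneous of degree `-1`, so scaling the vectors by `l` and time by `μ` multiplies
the mobilities by `l ^ 2 * μ`. -/
lemma IsFlow.rescale {K : ℝ} {σ σ' : S ⊕ T → ℝ} {a b : ℝ → S ⊕ T → E} (h : IsFlow K σ a b)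
    {l μ : ℝ} (hl : 0 < l) (hμ : 0 ≤ μ) (hσ : ∀ i, σ' i = l ^ 2 * μ * σ i) :
    IsFlow K σ' (fun t i => l • a (μ * t) i) fun t i => l • b (μ * t) i := by
  intro t ht ha hb i
  rw [famNorm_smul hl] at ha hb
  obtain ⟨h1, h2⟩ := h (μ * t) (mul_nonneg hμ ht) (right_ne_zero_of_mul ha)
    (right_ne_zero_of_mul hb) i
  have hm : HasDerivWithinAt (fun u : ℝ => μ * u) μ (Ici 0) t := by
    simpa using (hasDerivWithinAt_id t (Ici 0)).const_mul μ
  have hmaps : MapsTo (fun u : ℝ => μ * u) (Ici 0) (Ici 0) := fun u hu => mul_nonneg hμ hu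
  have e : ∀ v : E, l • (μ • (σ i • v)) = σ' i • (l⁻¹ • v) := fun v => by
    rw [hσ, smul_smul, smul_smul, smul_smul]
    congr 1
    field_simp
  refine ⟨?_, ?_⟩
  · rw [drift_smul K hl, ← e]
    exact (HasDerivWithinAt.scomp t h1 hm hmaps).const_smul l
  · rw [drift_smul K hl, ← e]
    exact (HasDerivWithinAt.scomp t h2 hm hmaps).const_smul l

end Rescale

section Model
open Set DataModel
variable {d r m : ℕ} (D : DataModel d r)

lemma weightCol_smul (c : Modality) (l : ℝ) (V : Weights d m) (i : Fin r ⊕ Fin (d - r)) :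
    weightCol D c (l • V) i = l • weightCol D c V i := embed_smul _ _ _

lemma continuousOn_weightCol {s : Set ℝ} {w : ℝ → Weights d m} (hw : ContinuousOn w s)
    (c : Modality) (i : Fin r ⊕ Fin (d - r)) : ContinuousOn (fun t => weightCol D c (w t) i) s :=
  (embedLin (modelCol D c i)).continuous.comp_continuousOn hw

lemma sq_norm_weightCol_le (c : Modality) (V : Weights d m) (i : Fin r ⊕ Fin (d - r)) :
    ‖weightCol D c V i‖ ^ 2 ≤ strength D i * ‖V‖ ^ 2 := by
  have h1 : ∑ x, modelCol D c i x ^ 2 = strength D i := by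
    have := modelCol_gram D c i i
    rw [if_pos rfl] at this
    rw [← this]
    exact Finset.sum_congr rfl fun x _ => sq _
  rw [weightCol, embed, EuclideanSpace.norm_sq_eq, EuclideanSpace.norm_sq_eq,
    Fintype.sum_prod_type_right, Finset.mul_sum]
  refine Finset.sum_le_sum fun k _ => ?_
  simp only [Real.norm_eq_abs, sq_abs]
  rw [← h1, mul_comm]
  exact Finset.sum_mul_sq_le_sq_mul_sq _ _ _

lemma varMin_le (i : Fin r ⊕ Fin (d - r)) : D.varMin ≤ strength D i := by
  unfold DataModel.varMin
  rcases i with p | q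
  · exact ciInf_le (Set.finite_range _).bddBelow (some p)
  · exact ciInf_le (Set.finite_range _).bddBelow none

lemma le_varMax (i : Fin r ⊕ Fin (d - r)) : strength D i ≤ D.varMax := by
  unfold DataModel.varMax
  rcases i with p | q
  · exact le_ciSup (f := fun i : Option (Fin r) => (i.elim D.σξ D.σ) ^ 2)
      (Set.finite_range _).bddAbove (some p)
  · exact le_ciSup (f := fun i : Option (Fin r) => (i.elim D.σξ D.σ) ^ 2)
      (Set.finite_range _).bddAbove none

lemma varMin_pos : 0 < D.varMin := by
  obtain ⟨i, hi⟩ := exists_eq_ciInf_of_finite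
    (f := fun i : Option (Fin r) => (i.elim D.σξ D.σ) ^ 2)
  unfold DataModel.varMin
  rw [← hi]
  rcases i with _ | p
  · exact pow_pos D.σξ_pos 2
  · exact pow_pos (D.σ_pos p) 2

end Model

/-! ### The error conditions of the model -/

section Errors
open DataModel
variable {d r m : ℕ} {D : DataModel d r} {W : Modality → Weights d m}
  {δ η δm δNS δAB δξ δm' δNS' δAB' δξ' Q ε ρ : ℝ}

lemma _root_.DataModel.ErrorsWithin.mono (h : D.ErrorsWithin W δm δNS δAB δξ) (h1 : δm ≤ δm')
    (h2 : δNS ≤ δNS') (h3 : δAB ≤ δAB') (h4 : δξ ≤ δξ') : D.ErrorsWithin W δm' δNS' δAB' δξ' where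
  align p := (h.align p).trans h1
  sig_norm p := (h.sig_norm p).trans h1
  noise_norm q := (h.noise_norm q).trans h1
  noise_balance q s := (h.noise_balance q s).trans h1
  noise_signal c c' p q := (h.noise_signal c c' p q).trans h2
  sig_orth c c' p q hpq := (h.sig_orth c c' p q hpq).trans h3
  sig_noise_orth c c' p q := (h.sig_noise_orth c c' p q).trans h4
  noise_orth q s := (h.noise_orth q s).trans h4

lemma dir_smul {E : Type*} [NormedAddCommGroup E] [InnerProductSpace ℝ E] {l : ℝ} (hl : 0 < l)
    (v : E) : dir (l • v) = dir v := by
  unfold dir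
  rw [norm_smul, Real.norm_of_nonneg hl.le, smul_smul]
  congr 1
  have := hl.ne'
  field_simp

/-- The error conditions do not depend on the scale of the weights. -/
lemma errorsWithin_smul_iff {l : ℝ} (hl : 0 < l) :
    D.ErrorsWithin (fun c => l • W c) δm δNS δAB δξ ↔ D.ErrorsWithin W δm δNS δAB δξ := by
  have key : ∀ (V : Modality → Weights d m) {l : ℝ}, 0 < l → D.ErrorsWithin V δm δNS δAB δξ →
      D.ErrorsWithin (fun c => l • V c) δm δNS δAB δξ := by
    intro V l hl h
    have hs : ∀ c p, D.sigCol (fun c => l • V c) c p = l • D.sigCol V c p := fun c p =>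
      embed_smul _ _ _
    have hn : ∀ c p, D.noiseCol (fun c => l • V c) c p = l • D.noiseCol V c p := fun c p =>
      embed_smul _ _ _
    have hu : ∀ v : EuclideanSpace ℝ (Fin m), unitVec (l • v) = unitVec v := dir_smul hl
    have h2 : ∀ u v : EuclideanSpace ℝ (Fin m), ‖l • u‖ ^ 2 / ‖l • v‖ ^ 2 = ‖u‖ ^ 2 / ‖v‖ ^ 2 :=
      fun u v => by
        rw [norm_smul, norm_smul, mul_pow, mul_pow, mul_div_mul_left]
        exact pow_ne_zero 2 (norm_ne_zero_iff.2 hl.ne')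
    have h1 : ∀ u v : EuclideanSpace ℝ (Fin m), ‖l • u‖ / ‖l • v‖ = ‖u‖ / ‖v‖ := fun u v => by
      rw [norm_smul, norm_smul, mul_div_mul_left]
      exact norm_ne_zero_iff.2 hl.ne'
    constructor <;> simp only [hs, hn, hu, h2, h1]
    exacts [h.align, h.sig_norm, h.noise_norm, h.noise_balance, h.noise_signal, h.sig_orth,
      h.sig_noise_orth, h.noise_orth]
  refine ⟨fun h => ?_, key W hl⟩
  have := key _ (inv_pos.2 hl) h
  simpa only [smul_smul, inv_mul_cancel₀ hl.ne', one_smul] using this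

end Errors
end Contrastive

namespace Contrastive

/-! ### Ratios close to one -/

section Ratio
variable {x y δ : ℝ}

lemma abs_sub_le_of_sq_ratio (hx : 0 < x) (hy : 0 < y) (h : |1 - x ^ 2 / y ^ 2| ≤ δ) :
    |x - y| ≤ δ * y := by
  have h0 : 1 - x ^ 2 / y ^ 2 = (y - x) * (x + y) / y ^ 2 := by field_simp; ring
  rw [h0, abs_div, abs_of_pos (pow_pos hy 2), div_le_iff₀ (pow_pos hy 2), abs_mul,
    abs_of_pos (add_pos hx hy)] at h
  rw [abs_sub_comm]
  have h1 : |y - x| * y ≤ δ * y * y := by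
    have := mul_nonneg (abs_nonneg (y - x)) hx.le
    nlinarith
  exact le_of_mul_le_mul_right h1 hy

lemma abs_sub_le_two_mul (h : |x - y| ≤ δ * y) (hδ : 0 ≤ δ) (hδ2 : δ ≤ 1 / 2) (hy : 0 < y) :
    y ≤ 2 * x ∧ |x - y| ≤ 2 * δ * x := by
  have h1 := (abs_le.1 h).1
  have h2 : y ≤ 2 * x := by nlinarith
  exact ⟨h2, h.trans (by nlinarith)⟩

lemma abs_one_sub_sq_ratio_le (hx : 0 < x) (hy : 0 < y) (h : |x - y| ≤ δ * y) (hδ : δ ≤ 1) :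
    |1 - x ^ 2 / y ^ 2| ≤ 3 * δ := by
  have h0 : 1 - x ^ 2 / y ^ 2 = (y - x) * (x + y) / y ^ 2 := by field_simp; ring
  rw [abs_sub_comm] at h
  rw [h0, abs_div, abs_of_pos (pow_pos hy 2), div_le_iff₀ (pow_pos hy 2), abs_mul,
    abs_of_pos (add_pos hx hy)]
  have h1 := (abs_le.1 h).1
  have h2 := (abs_nonneg _).trans h
  calc |y - x| * (x + y) ≤ δ * y * (3 * y) :=
        mul_le_mul h (by nlinarith) (by positivity) h2
    _ = 3 * δ * y ^ 2 := by ring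

lemma abs_log_sub_le (hx : 0 < x) (hy : 0 < y) (h : |1 - x ^ 2 / y ^ 2| ≤ δ) (hδ : δ ≤ 1 / 2) :
    |Real.log x - Real.log y| ≤ 2 * δ := by
  have h1 := abs_sub_le_of_sq_ratio hx hy h
  have h0 := (abs_nonneg _).trans h
  obtain ⟨h2, h3⟩ := abs_sub_le_two_mul h1 h0 hδ hy
  rw [← Real.log_div hx.ne' hy.ne', abs_le]
  constructor
  · have h4 := Real.one_sub_inv_le_log_of_pos (div_pos hx hy)
    have h5 : -(2 * δ) ≤ 1 - (x / y)⁻¹ := by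
      have e : 1 - (x / y)⁻¹ = (x - y) / x := by field_simp
      rw [e, le_div_iff₀ hx]
      linarith [(abs_le.1 h3).1]
    exact h5.trans h4
  · have h4 := Real.log_le_sub_one_of_pos (div_pos hx hy)
    have h5 : x / y - 1 ≤ δ := by
      have e : x / y - 1 = (x - y) / y := by field_simp
      rw [e, div_le_iff₀ hy]
      exact (abs_le.1 h1).2
    linarith

lemma abs_one_sub_sq_ratio_le_of_log (hx : 0 < x) (hy : 0 < y)
    (h : |Real.log x - Real.log y| ≤ δ) (hδ : δ ≤ 1 / 2) : |1 - x ^ 2 / y ^ 2| ≤ 4 * δ := by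
  have e : x ^ 2 / y ^ 2 = Real.exp (2 * (Real.log x - Real.log y)) := by
    rw [← div_pow, two_mul, Real.exp_add, Real.exp_sub, Real.exp_log hx, Real.exp_log hy, sq]
  have h1 : |2 * (Real.log x - Real.log y)| ≤ 2 * δ := by
    rw [abs_mul, abs_two]; linarith
  rw [e, abs_sub_comm]
  have := Real.abs_exp_sub_one_le (h1.trans (by linarith))
  linarith

end Ratio

/-! ### Comparison of the error conditions -/

section Errors
open DataModel
variable {d r m : ℕ} {D : DataModel d r} {W : Modality → Weights d m} {δ Q ε ρ : ℝ}

/-- Errors below one exclude zero columns, because of the conventions `unitVec 0 = 0` and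
`x / 0 = 0`. -/
lemma _root_.DataModel.ErrorsWithin.ne_zero (h : D.ErrorsWithin W δ δ δ δ) (hδ : δ < 1)
    (i : Fin r ⊕ Fin (d - r)) :
    weightCol D .A (W .A) i ≠ 0 ∧ weightCol D .B (W .B) i ≠ 0 := by
  rcases i with p | q
  · have h1 := h.align p
    constructor <;> intro h0
    · have h0' : D.sigCol W .A p = 0 := h0
      rw [h0', unitVec, smul_zero, inner_zero_left] at h1
      linarith
    · have h0' : D.sigCol W .B p = 0 := h0
      rw [h0', unitVec, unitVec, smul_zero, inner_zero_right] at h1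
      linarith
  · have h1 := h.noise_norm q
    constructor <;> intro h0
    · have h0' : D.noiseCol W .A q = 0 := h0
      rw [h0'] at h1
      norm_num at h1
      linarith
    · have h0' : D.noiseCol W .B q = 0 := h0
      rw [h0'] at h1
      norm_num at h1
      linarith

lemma _root_.DataModel.ErrorsWithin.halfNear [Nonempty (Fin r)] (h : D.ErrorsWithin W δ δ δ δ)
    (hδ : 0 ≤ δ) (hδ1 : δ ≤ 1) {c c' : Modality}
    (hn : ∀ p, 0 < ‖weightCol D c (W c) (.inl p)‖)
    (hclose : ∀ p, |‖weightCol D c (W c) (.inl p)‖ - ‖weightCol D c' (W c') (.inl p)‖|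
      ≤ 2 * δ * ‖weightCol D c (W c) (.inl p)‖)
    (halign : ∀ p, (1 - 2 * δ) *
      (‖weightCol D c (W c) (.inl p)‖ * ‖weightCol D c' (W c') (.inl p)‖)
      ≤ inner ℝ (weightCol D c (W c) (.inl p)) (weightCol D c' (W c') (.inl p)))
    (hρ : ∀ p q, ‖weightCol D c (W c) (.inl p)‖ ≤ ρ * ‖weightCol D c (W c) (.inl q)‖)
    (hρ1 : 1 ≤ ρ) (hQ : Fintype.card (Fin r ⊕ Fin (d - r)) * ρ ≤ Q) :
    HalfNear (weightCol D c (W c)) (weightCol D c' (W c')) Q (2 * δ) := by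
  have hns : ∀ q p, ‖weightCol D c (W c) (.inr q)‖ ≤ δ * ‖weightCol D c (W c) (.inl p)‖ :=
    fun q p =>
      (div_le_iff₀ (hn p)).1 (h.noise_signal c c p q)
  have hort : ∀ c₁ c₂ i s, i ≠ Sum.inl s →
      |inner ℝ (weightCol D c₁ (W c₁) i) (weightCol D c₂ (W c₂) (.inl s))|
        ≤ 2 * δ * (‖weightCol D c₁ (W c₁) i‖ * ‖weightCol D c₂ (W c₂) (.inl s)‖) := by
    intro c₁ c₂ i s hi
    rw [inner_eq_mul_inner_dir, abs_mul, abs_of_nonneg (by positivity), mul_comm]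
    refine mul_le_mul_of_nonneg_right ?_ (by positivity)
    rcases i with p | q
    · exact (h.sig_orth c₁ c₂ p s fun hp => hi (by rw [hp])).trans (by linarith)
    · rw [real_inner_comm]
      exact (h.sig_noise_orth c₂ c₁ s q).trans (by linarith)
  refine ⟨fun s => ?_, fun q => ?_, hclose, halign, fun i s hi => hort _ _ i s hi,
    fun i s hi => hort _ _ i s hi⟩
  · have hs := norm_nonneg (weightCol D c (W c) (.inl s))
    have h1 : ∀ i, ‖weightCol D c (W c) i‖ ^ 2 ≤ (ρ * ‖weightCol D c (W c) (.inl s)‖) ^ 2 := by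
      intro i
      refine pow_le_pow_left₀ (norm_nonneg _) ?_ 2
      rcases i with p | q
      · exact hρ p s
      · exact (hns q s).trans (mul_le_mul_of_nonneg_right (hδ1.trans hρ1) hs)
    have hcard : (1 : ℝ) ≤ Fintype.card (Fin r ⊕ Fin (d - r)) := by
      have : 0 < Fintype.card (Fin r ⊕ Fin (d - r)) :=
        Fintype.card_pos_iff.2 ⟨.inl (Classical.arbitrary _)⟩
      exact_mod_cast this
    have h4 : 0 ≤ ρ * ‖weightCol D c (W c) (.inl s)‖ := mul_nonneg (by linarith) hs
    have h2 : famNorm (weightCol D c (W c)) ^ 2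
        ≤ (Fintype.card (Fin r ⊕ Fin (d - r)) * (ρ * ‖weightCol D c (W c) (.inl s)‖)) ^ 2 := by
      rw [famNorm_sq]
      refine (Finset.sum_le_card_nsmul _ _ _ fun i _ => h1 i).trans ?_
      rw [Finset.card_univ, nsmul_eq_mul, mul_pow _ (ρ * ‖weightCol D c (W c) (.inl s)‖)]
      refine mul_le_mul_of_nonneg_right ?_ (sq_nonneg _)
      nlinarith
    have h3 := (sq_le_sq₀ (famNorm_nonneg _) (mul_nonneg (by linarith) h4)).1 h2
    refine h3.trans ?_
    rw [← mul_assoc]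
    exact mul_le_mul_of_nonneg_right hQ hs
  · have p : Fin r := Classical.arbitrary _
    refine (hns q p).trans ?_
    have h1 := mul_le_mul_of_nonneg_left (norm_le_famNorm (weightCol D c (W c)) (.inl p)) hδ
    have h2 := mul_nonneg hδ (famNorm_nonneg (weightCol D c (W c)))
    linarith

/-- The error conditions of the model imply those used along the flow. -/
lemma _root_.DataModel.ErrorsWithin.near [Nonempty (Fin r)] (h : D.ErrorsWithin W δ δ δ δ)
    (hδ : 0 ≤ δ) (hδ2 : δ ≤ 1 / 4)
    (hρ : ∀ p q, ‖weightCol D .A (W .A) (.inl p)‖ ≤ ρ * ‖weightCol D .A (W .A) (.inl q)‖)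
    (hρ1 : 1 ≤ ρ) (hQ : 8 * (Fintype.card (Fin r ⊕ Fin (d - r)) * ρ) ≤ Q) :
    Near (weightCol D .A (W .A)) (weightCol D .B (W .B)) Q (2 * δ) := by
  have hne := fun i => h.ne_zero (by linarith) i
  have na : ∀ i, 0 < ‖weightCol D .A (W .A) i‖ := fun i => norm_pos_iff.2 (hne i).1
  have nb : ∀ i, 0 < ‖weightCol D .B (W .B) i‖ := fun i => norm_pos_iff.2 (hne i).2
  have hc : ∀ p, |‖weightCol D .A (W .A) (.inl p)‖ - ‖weightCol D .B (W .B) (.inl p)‖|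
      ≤ δ * ‖weightCol D .B (W .B) (.inl p)‖ := fun p =>
    abs_sub_le_of_sq_ratio (na _) (nb _) (h.sig_norm p)
  have hal : ∀ p, (1 - 2 * δ) *
      (‖weightCol D .A (W .A) (.inl p)‖ * ‖weightCol D .B (W .B) (.inl p)‖)
      ≤ inner ℝ (weightCol D .A (W .A) (.inl p)) (weightCol D .B (W .B) (.inl p)) := fun p => by
    rw [inner_eq_mul_inner_dir, mul_comm]
    refine mul_le_mul_of_nonneg_left ?_ (by positivity)
    have h1 : 1 - inner ℝ (dir (weightCol D .A (W .A) (.inl p)))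
      (dir (weightCol D .B (W .B) (.inl p))) ≤ δ := h.align p
    linarith
  have hc0 : (0 : ℝ) ≤ Fintype.card (Fin r ⊕ Fin (d - r)) * ρ :=
    mul_nonneg (Nat.cast_nonneg _) (by linarith)
  have h2 := fun p => abs_sub_le_two_mul (hc p) hδ (by linarith) (nb _)
  refine ⟨fun i => (hne i).1, fun i => (hne i).2, h.halfNear hδ (by linarith)
    (fun p => na _) (fun p => (h2 p).2) hal hρ hρ1 (by linarith),
    h.halfNear (ρ := 4 * ρ) hδ (by linarith) (fun p => nb _)
    (fun p => ?_) (fun p => ?_) (fun p q => ?_) (by linarith) (by linarith)⟩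
  · rw [abs_sub_comm]
    have := mul_nonneg hδ (nb (.inl p)).le
    linarith [hc p]
  · rw [real_inner_comm, mul_comm ‖weightCol D .B (W .B) (.inl p)‖]
    exact hal p
  · have h3 := (abs_le.1 (hc q)).2
    have h4 : ‖weightCol D .A (W .A) (.inl q)‖ ≤ 2 * ‖weightCol D .B (W .B) (.inl q)‖ := by
      have := nb (.inl q)
      nlinarith
    have h5 := mul_le_mul_of_nonneg_left h4 (by linarith : 0 ≤ ρ)
    linarith [(h2 p).1, hρ p q]

/-- Conversely, the error conditions used along the flow give those of the model, except for those
that concern the noises alone. -/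
lemma Near.errorsWithin (hQ : 1 ≤ Q) (hε : 0 ≤ ε) (hε2 : ε ≤ 1 / 2)
    (h : Near (weightCol D .A (W .A)) (weightCol D .B (W .B)) Q ε)
    (hδ : 4 * (Q * ε) ≤ δ)
    (hnorm : ∀ q, 4 * |Real.log ‖weightCol D .A (W .A) (.inr q)‖
      - Real.log ‖weightCol D .B (W .B) (.inr q)‖| ≤ δ)
    (hbal : ∀ q s, 4 * |Real.log ‖weightCol D .A (W .A) (.inr q)‖
      - Real.log ‖weightCol D .A (W .A) (.inr s)‖| ≤ δ)
    (hort : ∀ q s, |inner ℝ (dir (weightCol D .A (W .A) (.inr s)))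
      (dir (weightCol D .B (W .B) (.inr q)))| ≤ δ) (hδ1 : δ ≤ 1) :
    D.ErrorsWithin W δ δ δ δ := by
  have na : ∀ i, 0 < ‖weightCol D .A (W .A) i‖ := fun i => norm_pos_iff.2 (h.ne_left i)
  have nb : ∀ i, 0 < ‖weightCol D .B (W .B) i‖ := fun i => norm_pos_iff.2 (h.ne_right i)
  have hεδ : 4 * ε ≤ δ := by nlinarith
  have hdir : ∀ u v : EuclideanSpace ℝ (Fin m), 0 < ‖u‖ → 0 < ‖v‖ →
      |inner ℝ u v| ≤ ε * (‖u‖ * ‖v‖) → |inner ℝ (dir u) (dir v)| ≤ δ := by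
    intro u v hu hv huv
    rw [inner_dir_dir, abs_div, abs_of_pos (mul_pos hu hv), div_le_iff₀ (mul_pos hu hv)]
    exact huv.trans (mul_le_mul_of_nonneg_right (by linarith) (mul_pos hu hv).le)
  have hdirs : ∀ c c' i s, i ≠ Sum.inl s →
      |inner ℝ (dir (weightCol D c (W c) i)) (dir (weightCol D c' (W c') (.inl s)))| ≤ δ := by
    intro c c' i s hi
    rcases c with _ | _ <;> rcases c' with _ | _
    · exact hdir _ _ (na _) (na _) (h.left.same i s hi)
    · exact hdir _ _ (na _) (nb _) (h.left.cross i s hi)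
    · exact hdir _ _ (nb _) (na _) (h.right.cross i s hi)
    · exact hdir _ _ (nb _) (nb _) (h.right.same i s hi)
  have hfam : ∀ (u v : Fin r ⊕ Fin (d - r) → EuclideanSpace ℝ (Fin m)), HalfNear u v Q ε →
      ∀ q p, ‖u (.inr q)‖ ≤ Q * ε * ‖u (.inl p)‖ := fun u v huv q p => by
    have := mul_le_mul_of_nonneg_left (huv.low p) hε
    linarith [huv.noise q]
  have hab : ∀ p, ‖weightCol D .A (W .A) (.inl p)‖ ≤ 2 * ‖weightCol D .B (W .B) (.inl p)‖ :=
    fun p => by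
      have h1 := (abs_le.1 (h.left.close p)).2
      have := na (.inl p)
      nlinarith
  have hba : ∀ p, ‖weightCol D .B (W .B) (.inl p)‖ ≤ 2 * ‖weightCol D .A (W .A) (.inl p)‖ :=
    fun p => by
      have h1 := (abs_le.1 (h.right.close p)).2
      have := nb (.inl p)
      nlinarith
  have hQε : 0 ≤ Q * ε := mul_nonneg (by linarith) hε
  constructor
  · intro p
    have h1 := h.left.align p
    change 1 - inner ℝ (dir (weightCol D .A (W .A) (.inl p)))
      (dir (weightCol D .B (W .B) (.inl p))) ≤ δ
    have h2 := mul_pos (na (.inl p)) (nb (.inl p))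
    have h3 : 1 - ε ≤ inner ℝ (dir (weightCol D .A (W .A) (.inl p)))
        (dir (weightCol D .B (W .B) (.inl p))) := by
      rwa [inner_dir_dir, le_div_iff₀ h2]
    linarith
  · intro p
    refine (abs_one_sub_sq_ratio_le (na (.inl p)) (nb (.inl p)) (δ := ε) ?_ (by linarith)).trans
      (by linarith)
    rw [abs_sub_comm]
    exact h.right.close p
  · intro q
    exact (abs_one_sub_sq_ratio_le_of_log (na (.inr q)) (nb (.inr q)) le_rfl
      (by linarith [hnorm q])).trans (hnorm q)
  · intro q s
    exact (abs_one_sub_sq_ratio_le_of_log (na (.inr q)) (na (.inr s)) le_rfl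
      (by linarith [hbal q s])).trans (hbal q s)
  · intro c c' p q
    change ‖weightCol D c (W c) (.inr q)‖ / ‖weightCol D c' (W c') (.inl p)‖ ≤ δ
    have hA := hfam _ _ h.left q p
    have hB := hfam _ _ h.right q p
    have h1 := mul_le_mul_of_nonneg_left (hab p) hQε
    have h2 := mul_le_mul_of_nonneg_left (hba p) hQε
    have h3 := mul_le_mul_of_nonneg_right hδ (na (.inl p)).le
    have h4 := mul_le_mul_of_nonneg_right hδ (nb (.inl p)).le
    have h5 := mul_nonneg hQε (na (.inl p)).le
    have h6 := mul_nonneg hQε (nb (.inl p)).le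
    rcases c with _ | _ <;> rcases c' with _ | _
    · rw [div_le_iff₀ (na _)]; linarith
    · rw [div_le_iff₀ (nb _)]; linarith
    · rw [div_le_iff₀ (na _)]; linarith
    · rw [div_le_iff₀ (nb _)]; linarith
  · exact fun c c' p q hpq => hdirs c c' (.inl p) q fun hp => hpq (Sum.inl_injective hp)
  · intro c c' p q
    rw [real_inner_comm]
    exact hdirs c' c (.inr q) p (by simp)
  · exact hort

end Errors
end Contrastive

namespace Contrastive

/-! ### The flow of the model -/

section Final
open Set DataModel
variable {d r m : ℕ} {D : DataModel d r} {W : Modality → ℝ → Weights d m} {K L Q ε δ η cT ρ : ℝ}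

/-- The mass of the columns is at most `d` times the squared norm of the weights. -/
lemma sum_sq_weightCol_div_le (hr : r ≤ d) (c : Modality) (V : Weights d m) :
    ∑ i, ‖weightCol D c V i‖ ^ 2 / strength D i ≤ d * ‖V‖ ^ 2 := by
  refine (Finset.sum_le_card_nsmul _ _ (‖V‖ ^ 2) fun i _ => ?_).trans ?_
  · rw [div_le_iff₀ (strength_pos D i), mul_comm]
    exact sq_norm_weightCol_le D c V i
  · rw [Finset.card_univ, Fintype.card_sum, Fintype.card_fin, Fintype.card_fin, nsmul_eq_mul,
      Nat.add_sub_cancel' hr]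

/-- The signals of the model become balanced at a first time, and its error conditions hold up to
that time. -/
lemma exists_first_balanced (hr1 : 1 ≤ r) (hr : r ≤ d) (hW : D.IsGradientFlow K 1 W)
    (G : Regime K (fun i => strength D i / D.varMin) L Q ε) (hε : 0 < ε) (hT : 1 < cT)
    (hcT : cT ≤ Q * (cT - 1)) (hδ : 0 ≤ δ) (hδ4 : δ ≤ 1 / 4) (hδε : Q ^ 8 * (2 * δ) ≤ ε)
    (hρ : 1 ≤ ρ) (hρQ : 8 * (Fintype.card (Fin r ⊕ Fin (d - r)) * ρ) ≤ Q)
    (hratio : ∀ p q, ‖D.sigCol (fun c => W c 0) .A p‖ / ‖D.sigCol (fun c => W c 0) .A q‖ ≤ ρ)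
    (hη : Q ^ 14 * ε ≤ η) (hη1 : η ≤ 1) (herr : D.ErrorsWithin (fun c => W c 0) δ δ δ δ) :
    ∃ T₁ : ℝ, IsLeast {t : ℝ | 0 ≤ t ∧ ∀ p q,
        ‖D.sigCol (fun c => W c t) .A p‖ ^ 2 / ‖D.sigCol (fun c => W c t) .A q‖ ^ 2 ≤ cT} T₁ ∧
      T₁ ≤ d * ‖W .A 0‖ ^ 2 * Q ^ 8 ∧
      ∀ t ∈ Icc 0 T₁, D.ErrorsWithin (fun c => W c t) η η η η := by
  have : Nonempty (Fin r) := ⟨⟨0, hr1⟩⟩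
  have hvm := varMin_pos D
  have hs := strength_pos D
  have hne0 := fun i => (herr.ne_zero (by linarith) i).1
  -- the units of time and length in which `varMin` and the mass equal one
  set μ : ℝ := ∑ i, ‖weightCol D .A (W .A 0) i‖ ^ 2 / strength D i with hμ
  have hμ0 : 0 < μ := Finset.sum_pos
    (fun i _ => div_pos (pow_pos (norm_pos_iff.2 (hne0 i)) 2) (hs i))
    ⟨.inl (Classical.arbitrary _), Finset.mem_univ _⟩
  set l : ℝ := (√(D.varMin * μ))⁻¹ with hl
  have hl0 : 0 < l := inv_pos.2 (Real.sqrt_pos.2 (mul_pos hvm hμ0))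
  have hl2 : l ^ 2 = (D.varMin * μ)⁻¹ := by
    rw [hl, inv_pow, Real.sq_sqrt (mul_pos hvm hμ0).le]
  set V : Modality → ℝ → Weights d m := fun c t => l • W c (μ * t) with hV
  have hVt : ∀ t, (fun c => V c t) = fun c => l • W c (μ * t) := fun t => rfl
  have hflow : IsFlow K (fun i => strength D i / D.varMin)
      (fun t => weightCol D .A (V .A t)) fun t => weightCol D .B (V .B t) := by
    have h := (isFlow_of_isGradientFlow D (by omega) G.hK hW).rescale
      (σ' := fun i => strength D i / D.varMin) hl0 hμ0.le fun i => by
        rw [hl2]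
        have := hμ0.ne'
        have := hvm.ne'
        field_simp
    have e : ∀ c, (fun t i => l • weightCol D c (W c (μ * t)) i)
        = fun t => weightCol D c (V c t) := fun c => by
      funext t i
      exact (weightCol_smul D c l (W c (μ * t)) i).symm
    rwa [e, e] at h
  have hcont : ∀ c, ContinuousOn (W c) (Ici 0) := fun c t ht => by
    cases c
    · exact (hW t ht).1.continuousWithinAt
    · exact (hW t ht).2.continuousWithinAt
  have hcontV : ∀ c, ContinuousOn (V c) (Ici 0) := fun c =>
    ((hcont c).comp (continuous_const_mul μ).continuousOn
      fun t ht => mul_nonneg hμ0.le ht).const_smul l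
  have hinit : D.ErrorsWithin (fun c => V c 0) δ δ δ δ := by
    rw [hVt, errorsWithin_smul_iff hl0, mul_zero]
    exact herr
  have hnorm : ∀ t i, ‖weightCol D .A (V .A t) i‖ = l * ‖weightCol D .A (W .A (μ * t)) i‖ :=
    fun t i => by rw [hV, weightCol_smul, norm_smul, Real.norm_of_nonneg hl0.le]
  have hρ0 : ∀ p q, ‖weightCol D .A (V .A 0) (.inl p)‖
      ≤ ρ * ‖weightCol D .A (V .A 0) (.inl q)‖ := fun p q => by
    have h1 : ‖weightCol D .A (W .A 0) (.inl p)‖ ≤ ρ * ‖weightCol D .A (W .A 0) (.inl q)‖ :=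
      (div_le_iff₀ (norm_pos_iff.2 (hne0 (.inl q)))).1 (hratio p q)
    rw [hnorm, hnorm, mul_zero]
    have := mul_le_mul_of_nonneg_left h1 hl0.le
    linarith
  have H : Traj K (fun i => strength D i / D.varMin) (fun t => weightCol D .A (V .A t))
      (fun t => weightCol D .B (V .B t)) Q ε (2 * δ) 0 := by
    refine ⟨hflow, continuousOn_weightCol D (hcontV .A) _, continuousOn_weightCol D (hcontV .B) _,
      ?_, le_rfl, hinit.near hδ hδ4 hρ0 hρ hρQ, fun t ht => absurd ht (by simp)⟩
    have h1 : ∀ i, ‖weightCol D .A (V .A 0) i‖ ^ 2 / (strength D i / D.varMin)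
        = l ^ 2 * D.varMin * (‖weightCol D .A (W .A 0) i‖ ^ 2 / strength D i) := fun i => by
      rw [hnorm, mul_zero]
      have := (hs i).ne'
      field_simp
    simp only [h1]
    rw [← Finset.mul_sum, ← hμ, hl2]
    have := hμ0.ne'
    have := hvm.ne'
    field_simp
  have I : Start (fun t => weightCol D .A (V .A t)) Q ε (2 * δ) cT ρ :=
    ⟨by linarith, hδε, hT, hcT, hρ, hρ0, hρQ⟩
  obtain ⟨T, ⟨⟨hT0, hTmem⟩, hTle⟩, hTQ, HT, hnear⟩ := H.exists_first_balanced G I hε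
  have hε₀ := I.le_eps G
  have hQ := G.pos
  have hε13 : ε ≤ Q ^ 13 * ε := by
    simpa using G.mono (k := 0) (l := 13) (by norm_num) hε.le
  have hQ14 : 100 * (Q ^ 13 * ε) ≤ Q ^ 14 * ε := G.step 13 ε hε.le
  have hpos : ∀ t ∈ Icc 0 T, ∀ p, 0 < ‖D.sigCol (fun c => W c (μ * t)) .A p‖ := fun t ht p => by
    have h1 := norm_pos_iff.2 ((hnear t ht).ne_left (.inl p))
    rw [hnorm] at h1
    exact pos_of_mul_pos_right h1 hl0.le
  have hsq : ∀ t p, ‖weightCol D .A (V .A t) (.inl p)‖ ^ 2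
      = l ^ 2 * ‖D.sigCol (fun c => W c (μ * t)) .A p‖ ^ 2 := fun t p => by
    rw [hnorm, mul_pow]; rfl
  have hiff : ∀ t ∈ Icc 0 T, ∀ p q,
      (‖weightCol D .A (V .A t) (.inl p)‖ ^ 2 ≤ cT * ‖weightCol D .A (V .A t) (.inl q)‖ ^ 2 ↔
      ‖D.sigCol (fun c => W c (μ * t)) .A p‖ ^ 2 / ‖D.sigCol (fun c => W c (μ * t)) .A q‖ ^ 2
        ≤ cT) := fun t ht p q => by
    rw [hsq, hsq, div_le_iff₀ (pow_pos (hpos t ht q) 2), mul_left_comm,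
      mul_le_mul_iff_right₀ (pow_pos hl0 2)]
  refine ⟨μ * T, ⟨⟨mul_nonneg hμ0.le hT0, fun p q => ?_⟩, ?_⟩, ?_, ?_⟩
  · exact (hiff T ⟨hT0, le_rfl⟩ p q).1 (hTmem p q)
  · rintro t ⟨ht0, ht⟩
    by_contra hcon
    push Not at hcon
    have e : μ * (t / μ) = t := mul_div_cancel₀ t hμ0.ne'
    have h1 : t / μ < T := by rwa [div_lt_iff₀ hμ0, mul_comm]
    have h2 : t / μ ∈ Icc 0 T := ⟨div_nonneg ht0 hμ0.le, h1.le⟩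
    refine not_le.2 h1 (hTle ⟨h2.1, fun p q => ?_⟩)
    rw [hiff _ h2, e]
    exact ht p q
  · exact mul_le_mul (sum_sq_weightCol_div_le hr _ _) hTQ hT0 (by positivity)
  · intro t ht
    have e : μ * (t / μ) = t := mul_div_cancel₀ t hμ0.ne'
    have ht' : t / μ ∈ Icc 0 T := ⟨div_nonneg ht.1 hμ0.le, by
      rw [div_le_iff₀ hμ0, mul_comm]; exact ht.2⟩
    have htQ : t / μ ≤ Q ^ 8 := ht'.2.trans hTQ
    rw [← e, ← errorsWithin_smul_iff hl0]
    have hn0 := fun i => norm_pos_iff.2 (hinit.ne_zero (by linarith) i).1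
    have hn0' := fun i => norm_pos_iff.2 (hinit.ne_zero (by linarith) i).2
    have h5 : Q ^ 5 * ε * (t / μ) ≤ Q ^ 13 * ε := by
      have := mul_le_mul_of_nonneg_left htQ (by positivity : 0 ≤ Q ^ 5 * ε)
      linarith [show Q ^ 5 * ε * Q ^ 8 = Q ^ 13 * ε by ring]
    have h7 : Q ^ 7 * ε ^ 2 * (t / μ) ≤ Q ^ 13 * ε := by
      have h1 := mul_le_mul_of_nonneg_left htQ (by positivity : 0 ≤ Q ^ 7 * ε ^ 2)
      have h2 : Q ^ 2 * ε ≤ 1 := (G.mono (by norm_num) hε.le).trans G.eps_le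
      have h3 := mul_le_mul_of_nonneg_left h2 (by positivity : 0 ≤ Q ^ 13 * ε)
      linarith [show Q ^ 7 * ε ^ 2 * Q ^ 8 = Q ^ 13 * ε * (Q ^ 2 * ε) by ring]
    have hδ' : 2 * δ ≤ Q ^ 13 * ε := hε₀.trans hε13
    refine Near.errorsWithin (W := fun c => V c (t / μ)) (Q := Q) (by linarith [G.hQ]) hε.le ?_
      ((hnear _ ht').mono (by linarith) (by linarith)) ?_ (fun q => ?_) (fun q s => ?_)
      (fun q s => ?_) hη1
    · have := G.mono (k := 0) (l := 39) (by norm_num) hε.le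
      have h1 := G.step 39 ε hε.le
      have h2 := G.eps_le
      simp only [pow_zero, one_mul] at this
      linarith
    · have h1 : Q ^ 1 * ε ≤ Q ^ 13 * ε := G.mono (by norm_num) hε.le
      rw [pow_one] at h1
      have : 0 ≤ Q ^ 13 * ε := by positivity
      linarith
    · have := HT.abs_log_noise_sub_le G hε₀ q ht'
        (abs_log_sub_le (hn0 _) (hn0' _) (hinit.noise_norm q) (by linarith))
      linarith
    · have := HT.abs_log_noise_sub_le' G hε₀ (q := q) (q' := s) rfl ht'
        (abs_log_sub_le (hn0 _) (hn0 _) (hinit.noise_balance q s) (by linarith))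
      linarith
    · have := HT.abs_inner_noise_le G hε₀ s q ht' (hinit.noise_orth q s)
      linarith

/-- All constants that enter the estimates are bounded by a fixed power of the dimension. -/
lemma exists_exponent (c cT : ℝ) {κ : ℝ} (hc : 0 < c) (hκ : 0 < κ) (hT : 1 < cT) :
    ∃ k : ℕ, ∀ d : ℕ, 2 ≤ d → 100 ≤ (d : ℝ) ^ k ∧ (d : ℝ) ≤ (d : ℝ) ^ k ∧
      c * Real.log d ≤ (d : ℝ) ^ k ∧ 1 ≤ (d : ℝ) ^ k * κ ∧
      Real.exp (8 * (c * Real.log d) / κ) ≤ (d : ℝ) ^ k ∧ cT ≤ (d : ℝ) ^ k * (cT - 1) ∧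
      8 * (d * √(d : ℝ)) ≤ (d : ℝ) ^ k := by
  obtain ⟨n, hn⟩ := pow_unbounded_of_one_lt (c + κ⁻¹ + cT / (cT - 1)) (one_lt_two (α := ℝ))
  obtain ⟨N, hN⟩ := exists_nat_ge (8 * c / κ)
  refine ⟨7 + (n + N), fun d hd => ?_⟩
  have hd2 : (2 : ℝ) ≤ d := by exact_mod_cast hd
  have hd1 : (1 : ℝ) ≤ d := by linarith
  have hd0 : (0 : ℝ) < d := by linarith
  have h7 : (d : ℝ) * 64 ≤ (d : ℝ) ^ 7 := by
    have := pow_le_pow_left₀ zero_le_two hd2 6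
    have e : (d : ℝ) ^ 7 = d * (d : ℝ) ^ 6 := by ring
    rw [e]
    exact mul_le_mul_of_nonneg_left (by linarith) hd0.le
  have hn2 : c + κ⁻¹ + cT / (cT - 1) ≤ (d : ℝ) ^ n :=
    hn.le.trans (pow_le_pow_left₀ zero_le_two hd2 n)
  have hn1 : (1 : ℝ) ≤ (d : ℝ) ^ n := one_le_pow₀ hd1
  have hN1 : (1 : ℝ) ≤ (d : ℝ) ^ N := one_le_pow₀ hd1
  have hκ' := inv_pos.2 hκ
  have hT' : 0 < cT / (cT - 1) := div_pos (by linarith) (by linarith)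
  have e : (d : ℝ) ^ (7 + (n + N)) = (d : ℝ) ^ 7 * ((d : ℝ) ^ n * (d : ℝ) ^ N) := by
    rw [pow_add, pow_add]
  have hnN1 : (1 : ℝ) ≤ (d : ℝ) ^ n * (d : ℝ) ^ N := by nlinarith
  have hle7 : (d : ℝ) ^ 7 ≤ (d : ℝ) ^ (7 + (n + N)) := by
    rw [e]; exact le_mul_of_one_le_right (by positivity) hnN1
  have hlen : (d : ℝ) * (d : ℝ) ^ n ≤ (d : ℝ) ^ (7 + (n + N)) := by
    rw [e]
    exact mul_le_mul (by linarith) (le_mul_of_one_le_right (by positivity) hN1) (by positivity)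
      (by positivity)
  have hlen' : (d : ℝ) ^ n ≤ (d : ℝ) ^ (7 + (n + N)) :=
    (le_mul_of_one_le_left (by positivity) hd1).trans hlen
  have hlog : Real.log d ≤ d := (Real.log_le_sub_one_of_pos hd0).trans (by linarith)
  have hlog0 : 0 ≤ Real.log d := Real.log_nonneg hd1
  refine ⟨by linarith, by linarith, ?_, ?_, ?_, ?_, ?_⟩
  · refine le_trans ?_ hlen
    rw [mul_comm]
    exact mul_le_mul hlog (by linarith) hc.le hd0.le
  · rw [← div_le_iff₀ hκ, one_div]
    linarith
  · have h1 : Real.exp (8 * (c * Real.log d) / κ) ≤ (d : ℝ) ^ N := by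
      rw [← Real.rpow_natCast, Real.rpow_def_of_pos hd0]
      refine Real.exp_le_exp.2 ?_
      have := mul_le_mul_of_nonneg_left hN hlog0
      calc 8 * (c * Real.log d) / κ = Real.log d * (8 * c / κ) := by ring
        _ ≤ _ := this
    refine h1.trans (pow_le_pow_right₀ hd1 (by omega))
  · rw [← div_le_iff₀ (by linarith)]
    linarith
  · refine le_trans ?_ hle7
    have h1 : √(d : ℝ) ≤ d := Real.sqrt_le_iff.2 ⟨hd0.le, by nlinarith⟩
    have h2 := pow_le_pow_left₀ zero_le_two hd2 5
    have e7 : (d : ℝ) ^ 7 = (d : ℝ) ^ 5 * (d * d) := by ring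
    rw [e7]
    exact mul_le_mul (by linarith) (mul_le_mul_of_nonneg_left h1 hd0.le) (by positivity)
      (by positivity)

end Final
end Contrastive

open Contrastive in
theorem mainTheorem3 (c K cTarget b : ℝ) (hc : 0 < c) (hK : 0 < K) (hT : 1 < cTarget) :
    ∃ C : ℝ, ∀ am aNS aAB aξ : ℝ, ∃ a₀ : ℝ, 0 < a₀ ∧
      ∀ (d r m : ℕ), 1 ≤ r → r ≤ d → ∀ D : DataModel d r,
        D.varMax / D.varMin * max 1 (((d : ℝ) - r) * D.σξ ^ 2 / (r * D.varMin))
          ≤ c * Real.log d →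
        ∀ W : Modality → ℝ → Weights d m,
          D.IsGradientFlow K 1 W →
          (∀ i, ‖W i 0‖ ≤ (d : ℝ) ^ b) →
          (∀ p q, ‖D.sigCol (fun i => W i 0) .A p‖ / ‖D.sigCol (fun i => W i 0) .A q‖
            ≤ √(d : ℝ)) →
          D.ErrorsWithin (fun i => W i 0)
            ((d : ℝ) ^ (-a₀)) ((d : ℝ) ^ (-a₀)) ((d : ℝ) ^ (-a₀)) ((d : ℝ) ^ (-a₀)) →
          ∃ T₁ : ℝ,
            IsLeast {t : ℝ | 0 ≤ t ∧ ∀ p q,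
              ‖D.sigCol (fun i => W i t) .A p‖ ^ 2 / ‖D.sigCol (fun i => W i t) .A q‖ ^ 2
                ≤ cTarget} T₁ ∧
            T₁ ≤ (d : ℝ) ^ C ∧
            ∀ t ∈ Set.Icc 0 T₁,
              D.ErrorsWithin (fun i => W i t)
                ((d : ℝ) ^ (-am)) ((d : ℝ) ^ (-aNS)) ((d : ℝ) ^ (-aAB)) ((d : ℝ) ^ (-aξ)) := by
  obtain ⟨k, hk⟩ := exists_exponent c cTarget hc (logistic_pos hK (-1)) hT
  refine ⟨2 * b + (8 * k + 1 : ℕ), fun am aNS aAB aξ => ?_⟩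
  obtain ⟨n, hn⟩ := exists_nat_ge (max (max am aNS) (max aAB aξ))
  -- `ε = d ^ (-(40 * k + n))` is the error allowed along the flow
  refine ⟨(8 * k + 2 + (40 * k + n) : ℕ), by positivity, ?_⟩
  intro d r m hr1 hr D hcond W hW hb hratio herr
  obtain ⟨hmin, hrest⟩ : 0 < D.varMin ∧ D.varMax / D.varMin ≤ c * Real.log d := by
    have hvm := varMin_pos D
    have h1 : D.varMin ≤ D.varMax :=
      (varMin_le D (.inl ⟨0, hr1⟩)).trans (le_varMax D (.inl ⟨0, hr1⟩))
    exact ⟨hvm, (le_mul_of_one_le_right (div_nonneg (hvm.le.trans h1) hvm.le)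
      (le_max_left _ _)).trans hcond⟩
  have hd : 2 ≤ d := by
    by_contra hlt
    obtain rfl : d = 1 := by omega
    have h1 : D.varMin ≤ D.varMax :=
      (varMin_le D (.inl ⟨0, hr1⟩)).trans (le_varMax D (.inl ⟨0, hr1⟩))
    have h2 := div_pos (hmin.trans_le h1) hmin
    rw [Nat.cast_one, Real.log_one, mul_zero] at hrest
    linarith
  obtain ⟨h100, hdQ, hLQ, hκ, hexp, hcT, hρQ⟩ := hk d hd
  have hd2 : (2 : ℝ) ≤ d := by exact_mod_cast hd
  have hd1 : (1 : ℝ) ≤ d := by linarith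
  have hd0 : (0 : ℝ) < d := by linarith
  have hcard : Fintype.card (Fin r ⊕ Fin (d - r)) = d := by
    rw [Fintype.card_sum, Fintype.card_fin, Fintype.card_fin, Nat.add_sub_cancel' hr]
  have hQ : ∀ j : ℕ, ((d : ℝ) ^ k) ^ j = (d : ℝ) ^ (j * k) := fun j => by rw [← pow_mul, mul_comm]
  have hε : (0 : ℝ) < ((d : ℝ) ^ (40 * k + n))⁻¹ := by positivity
  have hinv : ∀ i j : ℕ, i ≤ j → (d : ℝ) ^ i * ((d : ℝ) ^ j)⁻¹ ≤ 1 := fun i j hij => by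
    rw [← div_eq_mul_inv]
    exact div_le_one_of_le₀ (pow_le_pow_right₀ hd1 hij) (by positivity)
  have hδ : (d : ℝ) ^ (-((8 * k + 2 + (40 * k + n) : ℕ) : ℝ))
      = ((d : ℝ) ^ (8 * k) * (d : ℝ) ^ 2 * (d : ℝ) ^ (40 * k + n))⁻¹ := by
    rw [Real.rpow_neg hd0.le, Real.rpow_natCast, pow_add, pow_add]
  have h4 : (4 : ℝ) ≤ (d : ℝ) ^ 2 := by nlinarith
  have G : Regime K (fun i => strength D i / D.varMin) (c * Real.log d) ((d : ℝ) ^ k)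
      ((d : ℝ) ^ (40 * k + n))⁻¹ := by
    refine ⟨⟨h100, by rw [hcard]; exact hdQ, hε.le, ?_⟩, hK, fun i => ?_, fun i => ?_, hLQ, hκ,
      hexp⟩
    · rw [hQ]
      exact hinv _ _ (by omega)
    · rw [one_le_div hmin]
      exact varMin_le D i
    · exact (div_le_div_of_nonneg_right (le_varMax D i) hmin.le).trans hrest
  have hA1 : (1 : ℝ) ≤ (d : ℝ) ^ (8 * k) := one_le_pow₀ hd1
  have hB1 : (1 : ℝ) ≤ (d : ℝ) ^ (40 * k + n) := one_le_pow₀ hd1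
  obtain ⟨T₁, hleast, hle, herrs⟩ := exists_first_balanced (cT := cTarget) (ρ := √(d : ℝ))
    (η := ((d : ℝ) ^ n)⁻¹) hr1 hr hW G hε hT hcT
    (Real.rpow_nonneg hd0.le _) (by
      rw [hδ, one_div]
      refine inv_anti₀ (by norm_num) ?_
      have h1 : (4 : ℝ) ≤ (d : ℝ) ^ (8 * k) * (d : ℝ) ^ 2 := by nlinarith
      nlinarith) (by
      rw [hδ, hQ, mul_inv, mul_inv]
      have h1 : (2 : ℝ) * ((d : ℝ) ^ 2)⁻¹ ≤ 1 := by
        rw [← div_eq_mul_inv]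
        exact div_le_one_of_le₀ (by linarith) (by positivity)
      calc (d : ℝ) ^ (8 * k) * (2 * (((d : ℝ) ^ (8 * k))⁻¹ * ((d : ℝ) ^ 2)⁻¹
            * ((d : ℝ) ^ (40 * k + n))⁻¹))
          = (d : ℝ) ^ (8 * k) * ((d : ℝ) ^ (8 * k))⁻¹ * (2 * ((d : ℝ) ^ 2)⁻¹)
            * ((d : ℝ) ^ (40 * k + n))⁻¹ := by ring
        _ = 2 * ((d : ℝ) ^ 2)⁻¹ * ((d : ℝ) ^ (40 * k + n))⁻¹ := by
            rw [mul_inv_cancel₀ (by positivity), one_mul]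
        _ ≤ _ := mul_le_of_le_one_left hε.le h1)
    (Real.one_le_sqrt.2 hd1) (by rw [hcard]; exact hρQ) hratio (by
      rw [hQ, pow_add _ (40 * k) n, mul_inv, ← mul_assoc]
      exact mul_le_of_le_one_left (by positivity) (hinv _ _ (by omega)))
    (inv_le_one_of_one_le₀ (one_le_pow₀ hd1)) herr
  refine ⟨T₁, hleast, hle.trans ?_, fun t ht => ?_⟩
  · have h1 : ‖W .A 0‖ ^ 2 ≤ (d : ℝ) ^ (2 * b) := by
      have := pow_le_pow_left₀ (norm_nonneg _) (hb .A) 2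
      rwa [← Real.rpow_natCast ((d : ℝ) ^ b), ← Real.rpow_mul hd0.le, Nat.cast_ofNat,
        mul_comm b] at this
    rw [Real.rpow_add hd0, Real.rpow_natCast, hQ, pow_succ]
    calc (d : ℝ) * ‖W .A 0‖ ^ 2 * (d : ℝ) ^ (8 * k)
        ≤ d * (d : ℝ) ^ (2 * b) * (d : ℝ) ^ (8 * k) := by gcongr
      _ = _ := by ring
  · have hη : ∀ a : ℝ, a ≤ n → ((d : ℝ) ^ n)⁻¹ ≤ (d : ℝ) ^ (-a) := fun a ha => by
      rw [← Real.rpow_natCast, ← Real.rpow_neg hd0.le]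
      exact Real.rpow_le_rpow_of_exponent_le hd1 (by linarith)
    simp only [max_le_iff] at hn
    exact (herrs t ht).mono (hη _ hn.1.1) (hη _ hn.1.2) (hη _ hn.2.1) (hη _ hn.2.2)
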